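/- **Theorem (Simulation of sparse diagonally dominant Hamiltonians).** Set $n=\lceil\log_2 N\rceil$ and let $u>0$. Let $H=A+B\in\mathbb C^{N\times N}$ be Hermitian and $d$-sparse (at most $d$ non-zero entries in every row), with $A$ diagonal and $B_{kk}=0$ for all $k$. $H$ is accessed through two unitary oracles. Both act on index registers of $n$ qubits. * $O_H|x,y,z\rangle=|x,y,z\oplus H_{xy}\rangle$, where $H_{xy}$ is stored exactly in fixed point with $n_p$ bits of precision: its real and imaginary parts are $u$ times $n_p$-bit two's complement integers. * $O_f|x,j\rangle=|x,f(x,j)\rangle$, where for each row $x$ the map $f(x,\cdot)$ is a permutation of the indices $\{0,\dots,N-1\}$ such that every non-zero entry of row $x$ lies in one of the columns $f(x,0),\dots,f(x,d-1)$ (when row $x$ has fewer than $d$ non-zero entries, the remaining ones among these columns hold zero entries). Both oracles act as the identity on basis states whose index registers do not hold valid indices. A circuit consists of primitive gates (arbitrary unitaries on at most two qubits) and of queries to $O_H$, $O_f$ or their inverses, where a controlled query also counts as one query. A circuit $V$ on the $n$ system qubits and some ancilla qubits *approximates $e^{-iHt}$ with error $\epsilon$* if $\|W-e^{-iHt}\|\le\epsilon$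 in spectral norm for the operation $W=(\langle 0|_a\otimes 1_s)V(|0\rangle_a\otimes 1_s)$ restricted to $\mathbb C^N$; the failure probability of the ancilla projection is then at most $2\epsilon$. Write $\|B\|_{\max}=\max_{x,y}|B_{xy}|$, $\|A\|$ for the spectral norm, and $$\Lambda(y)=\frac{\log \max(y,e^e)}{\log\log \max(y,e^e)},\qquad \ell(y)=\log\max(y,e).$$ There are an absolute constant $C>0$ and an exponent $c\in\mathbb N$ such that the following holds for all $N,d,n_p\in\mathbb N$, all $u>0$, all bounds $a,b\ge 0$, all $t\ge 0$ and all $\epsilon>0$. With $\alpha_B=d\,b$, there is one circuit, which depends only on these parameters and not on the contents of the oracles, that approximates $e^{-iHt}$ with error $\epsilon$ for every $H=A+B$ as above with $\|A\|\le a$ and $\|B\|_{\max}\le b$ (in particular for $a=\|A\|$, $b=\|B\|_{\max}$, so that $\alpha_B=d\|B\|_{\max}$), for every choice of oracles encoding $H$. This circuit uses 1. at most $C\,\max(1,\alpha_B t)\,\Lambda(\alpha_B t/\epsilon)$ queries to $O_H$ and $O_f$ in total, a bound independent of $a$; 2. at most $C\left(n_p+\log N+\ell\!\left(\tfrac t\epsilon(a+\alpha_B)\right)\right)$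 qubits; 3. at most $C\,\max(1,\alpha_B t)\left(\log N+n_p^{\,c}\;\ell\!\left(\tfrac t\epsilon(a+\alpha_B)\right)\right)\Lambda(\alpha_B t/\epsilon)$ primitive gates. (Convention: $\log 0:=0$ when $N=0$.) For $\alpha_B t\ge1$, $\alpha_B t/\epsilon\ge e^e$ and $\tfrac t\epsilon(a+\alpha_B)\ge e$ these are literally $O\!\left(\alpha_B t\frac{\log(\alpha_B t/\epsilon)}{\log\log(\alpha_B t/\epsilon)}\right)$ queries, $O\!\left(n_p+\log N+\log\left(\tfrac t\epsilon(a+\alpha_B)\right)\right)$ qubits and $O\!\left(\alpha_B t\left(\log N+\operatorname{poly}(n_p)\log\left(\tfrac t\epsilon(a+\alpha_B)\right)\right)\frac{\log(\alpha_B t/\epsilon)}{\log\log(\alpha_B t/\epsilon)}\right)$ primitive gates. -/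

import Mathlib

open scoped Matrix.Norms.L2Operator

noncomputable section

namespace SparseSim

/-! ### Registers, gates and circuits -/

/-- A basis state of the qubits labelled by `Q`; operators on these qubits are complex matrices
indexed by basis states. -/
abbrev BasisState (Q : Type) : Type := Q → Bool

/-- Number of qubits of a register that holds an index in `{0, …, N - 1}`, i.e. `⌈log₂ N⌉`. -/
abbrev indexQubits (N : ℕ) : ℕ := Nat.clog 2 N

/-- The basis state `|x⟩` of an index register (binary expansion, bit `0` least significant). -/
def indexState {N : ℕ} (x : Fin N) : BasisState (Fin (indexQubits N)) :=
  fun i => (x : ℕ).testBit i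

open Classical in
/-- `embed e U` applies the operator `U` on the register `S` to the wires `e s`, `s : S`, and the
identity to all other wires. -/
def embed {S Q : Type} (e : S ↪ Q) (U : Matrix (BasisState S) (BasisState S) ℂ) :
    Matrix (BasisState Q) (BasisState Q) ℂ :=
  Matrix.of fun r s => if ∀ q, q ∉ Set.range e → r q = s q then U (r ∘ e) (s ∘ e) else 0

open Classical in
/-- The controlled version of `U`; the new wire `none` is the control qubit. -/
def controlled {S : Type} (U : Matrix (BasisState S) (BasisState S) ℂ) :
    Matrix (BasisState (Option S)) (BasisState (Option S)) ℂ :=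
  Matrix.of fun r s =>
    if r none = s none then
      (if s none then U (r ∘ some) (s ∘ some) else if r ∘ some = s ∘ some then 1 else 0)
    else 0

/-- The operator that maps each basis state `|s⟩` to `|f s⟩`. -/
def basisMap {S : Type} [Fintype S] (f : BasisState S → BasisState S) :
    Matrix (BasisState S) (BasisState S) ℂ :=
  Matrix.of fun r s => if r = f s then 1 else 0

/-! ### Sparse-access oracles -/

/-- Wires of a value register: real part (`false`) and imaginary part (`true`), `np` bits each. -/
abbrev ValueWires (np : ℕ) : Type := Bool × Fin np

/-- The wires on which `O_f` acts: row index `x`, column index `j`. -/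
abbrev PositionWires (N : ℕ) : Type := Fin (indexQubits N) ⊕ Fin (indexQubits N)

/-- The wires on which `O_H` acts: row index `x`, column index `y`, value register. -/
abbrev EntryWires (N np : ℕ) : Type := PositionWires N ⊕ ValueWires np

/-- The complex number stored in a value register: fixed point with unit `u`, real and imaginary
part in two's complement. -/
def decode {np : ℕ} (u : ℝ) (z : BasisState (ValueWires np)) : ℂ :=
  (u : ℂ) * ((Int.ofBits (fun k : Fin np => z (false, k)) : ℂ)
    + Complex.I * (Int.ofBits (fun k : Fin np => z (true, k)) : ℂ))

/-- The classical data behind the oracles: `value x y` is the bit string of the entry `H x y`, and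
`column x j` is the column of the `j`-th listed entry of row `x`. -/
structure SparseData (N np : ℕ) where
  value : Fin N → Fin N → BasisState (ValueWires np)
  column : Fin N → Equiv.Perm (Fin N)

/-- `D` encodes the `d`-sparse matrix `H`: the value bits decode exactly to the entries, and in each
row `x` the columns `column x 0, …, column x (d - 1)` contain the positions of all non-zero entries
(the remaining ones among them point to zero entries). -/
def SparseData.Encodes {N np : ℕ} (D : SparseData N np) (u : ℝ) (d : ℕ)
    (H : Matrix (Fin N) (Fin N) ℂ) : Prop :=
  (∀ x y, decode u (D.value x y) = H x y) ∧
  ∀ x y, H x y ≠ 0 → ∃ j : Fin N, (j : ℕ) < d ∧ D.column x j = y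

/-- `|x, y, z⟩ ↦ |x, y, z ⊕ H_{xy}⟩` (bitwise XOR; identity if `x` or `y` is not a valid index). -/
def entryMap {N np : ℕ} (D : SparseData N np) (s : BasisState (EntryWires N np)) :
    BasisState (EntryWires N np) :=
  let x := Nat.ofBits fun i => s (.inl (.inl i))
  let y := Nat.ofBits fun i => s (.inl (.inr i))
  if h : x < N ∧ y < N then
    Sum.elim (fun w => s (.inl w)) (fun k => (s (.inr k)).xor (D.value ⟨x, h.1⟩ ⟨y, h.2⟩ k))
  else s

/-- `|x, j⟩ ↦ |x, f(x, j)⟩` (identity if `x` or `j` is not a valid index). -/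
def positionMap {N np : ℕ} (D : SparseData N np) (s : BasisState (PositionWires N)) :
    BasisState (PositionWires N) :=
  let x := Nat.ofBits fun i => s (.inl i)
  let j := Nat.ofBits fun i => s (.inr i)
  if h : x < N ∧ j < N then
    Sum.elim (fun i => s (.inl i)) (indexState (D.column ⟨x, h.1⟩ ⟨j, h.2⟩))
  else s

/-- The oracle `O_H`. -/
def entryOracle {N np : ℕ} (D : SparseData N np) :
    Matrix (BasisState (EntryWires N np)) (BasisState (EntryWires N np)) ℂ :=
  basisMap (entryMap D)

/-- The oracle `O_f`. -/
def positionOracle {N np : ℕ} (D : SparseData N np) :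
    Matrix (BasisState (PositionWires N)) (BasisState (PositionWires N)) ℂ :=
  basisMap (positionMap D)

/-- One step of a query circuit on the qubits `Q`: a primitive gate, which is an arbitrary unitary on
at most two qubits, or a query to an oracle or (if `inv`) its inverse, possibly controlled by one
further qubit. -/
inductive Step (N np : ℕ) (Q : Type) : Type
  | gate (k : ℕ) (hk : k ≤ 2) (U : Matrix.unitaryGroup (BasisState (Fin k)) ℂ) (e : Fin k ↪ Q)
  | queryEntry (inv : Bool) (e : EntryWires N np ↪ Q)
  | queryPosition (inv : Bool) (e : PositionWires N ↪ Q)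
  | ctrlQueryEntry (inv : Bool) (e : Option (EntryWires N np) ↪ Q)
  | ctrlQueryPosition (inv : Bool) (e : Option (PositionWires N) ↪ Q)

/-- `U`, or `U†` if `inv`. -/
def adjointIf {S : Type} (inv : Bool) (U : Matrix (BasisState S) (BasisState S) ℂ) :
    Matrix (BasisState S) (BasisState S) ℂ :=
  if inv then U.conjTranspose else U

namespace Step

variable {N np : ℕ} {Q : Type}

/-- The operator performed by a step when the oracles are those of `D`. -/
def eval (D : SparseData N np) : Step N np Q → Matrix (BasisState Q) (BasisState Q) ℂ
  | gate _ _ U e => embed e U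
  | queryEntry inv e => embed e (adjointIf inv (entryOracle D))
  | queryPosition inv e => embed e (adjointIf inv (positionOracle D))
  | ctrlQueryEntry inv e => embed e (controlled (adjointIf inv (entryOracle D)))
  | ctrlQueryPosition inv e => embed e (controlled (adjointIf inv (positionOracle D)))

/-- Whether a step is a primitive gate; all other steps are oracle queries. -/
def isGate : Step N np Q → Bool
  | gate _ _ _ _ => true
  | _ => false

end Step

/-- The wires of a circuit: a system register holding an index, and `m` ancilla qubits. -/
abbrev Wires (N m : ℕ) : Type := Fin (indexQubits N) ⊕ Fin m

/-- A query circuit with `m` ancilla qubits: the list of its steps, first step first. It is a syntactic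
object that does not depend on the contents of the oracles. -/
abbrev Circuit (N np m : ℕ) : Type := List (Step N np (Wires N m))

namespace Circuit

variable {N np m : ℕ}

/-- The operator performed by the whole circuit when the oracles are those of `D`. -/
def eval (V : Circuit N np m) (D : SparseData N np) :
    Matrix (BasisState (Wires N m)) (BasisState (Wires N m)) ℂ :=
  V.foldl (fun M s => s.eval D * M) 1

/-- Total number of queries to `O_H` and `O_f`. -/
def queryCount (V : Circuit N np m) : ℕ := V.countP fun s => !s.isGate

/-- Number of primitive gates. -/
def gateCount (V : Circuit N np m) : ℕ := V.countP Step.isGate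

/-- Total number of qubits. -/
def qubitCount (_V : Circuit N np m) : ℕ := indexQubits N + m

/-- The operation `W = (⟨0|_a ⊗ 1_s) V (|0⟩_a ⊗ 1_s)` on `ℂ^N` that the circuit applies to the system
when the ancillas start in `|0⟩` and are projected onto `|0⟩` at the end. -/
def block (V : Circuit N np m) (D : SparseData N np) : Matrix (Fin N) (Fin N) ℂ :=
  Matrix.of fun x y =>
    V.eval D (Sum.elim (indexState x) fun _ => false) (Sum.elim (indexState y) fun _ => false)

end Circuit

/-! ### Matrices and cost functions -/

/-- Every row of `H` has at most `d` non-zero entries. -/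
def IsSparse {N : ℕ} (d : ℕ) (H : Matrix (Fin N) (Fin N) ℂ) : Prop :=
  ∀ x, {y | H x y ≠ 0}.ncard ≤ d

/-- The max-norm, the largest absolute value of an entry (`0` for the empty matrix). -/
def maxNorm {N : ℕ} (B : Matrix (Fin N) (Fin N) ℂ) : ℝ := ⨆ x, ⨆ y, ‖B x y‖

/-- `log y`, cut off from below at `1`. -/
def logCut (y : ℝ) : ℝ := Real.log (max y (Real.exp 1))

/-- `log y / log log y`, with `y` cut off from below at `e ^ e`, from which point on the quotient is
increasing. -/
def logRatio (y : ℝ) : ℝ :=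
  Real.log (max y (Real.exp (Real.exp 1))) / Real.log (Real.log (max y (Real.exp (Real.exp 1))))

end SparseSim

end

/-! The motion under `A` is removed by passing to the interaction picture, so that queries are spent
on `B` only. The time is cut into r segments of length τ, with r of order max(1, α_B t). On one
segment e^{-iτH} = e^{-iτA} (e^{iτA} e^{-iτH}). The first factor is diagonal and is performed
exactly from the entries `H x x`. For the second, put M = 2^w, δ = τ/M, Y = -iδA, Z = -iδB. Up to a
discretization error of order (τ(‖A‖ + β))²/M, where β ≥ ‖B‖ is the normalization `scale`, it equals
e^{-MY} (e^Y (1 + Z))^M. This is exactly the time-ordered product of the operators 1 + e^{-jY} Z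
e^{jY} (`orderedProd_conj`). Expanding that product gives the discrete Dyson series `dyson`, whose
tail is factorially small because τβ ≤ 1/2 (`norm_dyson_tail_le`, `dyson_error`). The size of `A`
enters only through the number w of time bits, hence logarithmically and never through the number of
queries.

The operator `B` is block encoded with four queries and no arithmetic (`offDiag_isBlock`,
`offEntry_eq`): a uniform superposition of positions in a row is turned into columns, and each entry
is compared with a uniformly distributed number R. The average of the resulting signs is linear in
the entry. Auxiliary qubits make the diagonal cancel by interference and set the overall scale.
Being a corner of a unitary, the encoding also yields ‖B‖ ≤ β (`norm_offPart_le`), and β ≤ 6 d b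
(`scale_le`).

The truncated series is evaluated in Horner form: `levelMat` averages the identity with (next level)
· (interaction at the current time) · (jump to a later time). A chain of controlled Hadamard gates
does the averaging (`condGate_had_ctl`). Each level halves, and each interaction block carries a
compensating factor 2, so that all orders get the common weight 1/2 except the last one, which gets
weight 1. After every block a fresh flag records whether its scratch wires returned to zero;
projecting all flags onto zero at the end acts like projections in between (`flag_proj`,
`levels_proj`). On stacks of operators indexed by time, these levels reproduce the recursion of
`dyson` (`sumTimes_levelMat_one`).

Hence twice the block T of the series circuit is nearly unitary. One round of oblivious amplitude
amplification produces 3T - 4TT†T (`amplify_block`), which is then close to that unitary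
(`norm_amplify_sub_le`). A unitary circuit whose corner is ε-close to a unitary leaks at most √(2ε)
into non-zero ancilla states (`isometry_dist`). The segments can therefore be concatenated on the
same ancillas without reset, with errors that add (`pow_dist`). The square root demands accuracy of
order (ε/r)² per segment; this affects only factorials and logarithms.

It remains to choose the order K with (K + 1)! of order (α_B t/ε)² (`exists_order`), which gives the
quotient log / log log, and w with 2^w of order ((a + α_B) t/ε)² (`exists_timeBits`). Cases with ε ≥
2, without value bits or with vanishing off-diagonal part are handled by direct circuits. All
operators live on all 2^n states of the index register; the encoded matrix vanishes at invalid
indices, so its exponential restricts to that of `H` (`exp_encodedMat`). -/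

noncomputable section
set_option linter.unusedSectionVars false

namespace SparseSim

/-! ### Operators on some of the wires -/

section Embed

variable {S T Q : Type}

/-- `s` with the wires `e` overwritten by `v`. -/
abbrev overwrite (e : S ↪ Q) (v : BasisState S) (s : BasisState Q) : BasisState Q :=
  Function.extend e v s

/-- `r` and `s` coincide on all wires outside the range of `e`. -/
def AgreeOff (e : S ↪ Q) (r s : BasisState Q) : Prop := ∀ q, q ∉ Set.range e → r q = s q

theorem overwrite_apply (e : S ↪ Q) (v : BasisState S) (s : BasisState Q) (i : S) :
    overwrite e v s (e i) = v i := e.injective.extend_apply _ _ _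

@[simp] theorem overwrite_comp (e : S ↪ Q) (v : BasisState S) (s : BasisState Q) :
    overwrite e v s ∘ e = v := funext fun i => overwrite_apply e v s i

theorem overwrite_of_notMem (e : S ↪ Q) (v : BasisState S) (s : BasisState Q) {q : Q}
    (hq : q ∉ Set.range e) : overwrite e v s q = s q :=
  Function.extend_apply' _ _ _ (by simpa using hq)

theorem AgreeOff.refl (e : S ↪ Q) (s : BasisState Q) : AgreeOff e s s := fun _ _ => rfl

theorem agreeOff_overwrite (e : S ↪ Q) (v : BasisState S) (s : BasisState Q) :
    AgreeOff e (overwrite e v s) s := fun _ hq => overwrite_of_notMem e v s hq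

theorem AgreeOff.symm {e : S ↪ Q} {r s : BasisState Q} (h : AgreeOff e r s) : AgreeOff e s r :=
  fun q hq => (h q hq).symm

theorem AgreeOff.trans {e : S ↪ Q} {r s t : BasisState Q} (h : AgreeOff e r s)
    (h' : AgreeOff e s t) : AgreeOff e r t := fun q hq => (h q hq).trans (h' q hq)

theorem eq_overwrite_iff (e : S ↪ Q) (v : BasisState S) (r s : BasisState Q) :
    r = overwrite e v s ↔ AgreeOff e r s ∧ r ∘ e = v := by
  constructor
  · rintro rfl
    exact ⟨agreeOff_overwrite e v s, overwrite_comp e v s⟩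
  · rintro ⟨h, rfl⟩
    funext q
    by_cases hq : q ∈ Set.range e
    · obtain ⟨i, rfl⟩ := hq
      rw [overwrite_apply]; rfl
    · rw [overwrite_of_notMem e _ s hq, h q hq]

theorem overwrite_self (e : S ↪ Q) (s : BasisState Q) : overwrite e (s ∘ e) s = s :=
  ((eq_overwrite_iff e _ s s).2 ⟨AgreeOff.refl e s, rfl⟩).symm

theorem overwrite_injective (e : S ↪ Q) (s : BasisState Q) :
    Function.Injective fun v : BasisState S => overwrite e v s := fun v w h => by
  have := congrArg (· ∘ e) h
  simpa using this

open Classical in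
theorem embed_apply (e : S ↪ Q) (U : Matrix (BasisState S) (BasisState S) ℂ)
    (r s : BasisState Q) :
    embed e U r s = if AgreeOff e r s then U (r ∘ e) (s ∘ e) else 0 := by
  simp only [embed, Matrix.of_apply, AgreeOff]
  congr

theorem embed_apply_of_agreeOff {e : S ↪ Q} (U : Matrix (BasisState S) (BasisState S) ℂ)
    {r s : BasisState Q} (h : AgreeOff e r s) : embed e U r s = U (r ∘ e) (s ∘ e) := by
  classical rw [embed_apply, if_pos h]

theorem embed_apply_of_not {e : S ↪ Q} (U : Matrix (BasisState S) (BasisState S) ℂ)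
    {r s : BasisState Q} (h : ¬ AgreeOff e r s) : embed e U r s = 0 := by
  classical rw [embed_apply, if_neg h]

theorem embed_conjTranspose (e : S ↪ Q) (U : Matrix (BasisState S) (BasisState S) ℂ) :
    embed e U.conjTranspose = (embed e U).conjTranspose := by
  ext r s
  rw [Matrix.conjTranspose_apply]
  by_cases h : AgreeOff e r s
  · rw [embed_apply_of_agreeOff _ h, embed_apply_of_agreeOff _ h.symm, Matrix.conjTranspose_apply]
  · rw [embed_apply_of_not _ h, embed_apply_of_not _ fun h' => h h'.symm, star_zero]

theorem agreeOff_trans_iff (e : S ↪ T) (e' : T ↪ Q) (r s : BasisState Q) :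
    AgreeOff (e.trans e') r s ↔ AgreeOff e' r s ∧ AgreeOff e (r ∘ e') (s ∘ e') := by
  constructor
  · intro h
    refine ⟨fun q hq => h q ?_, fun i hi => h _ ?_⟩
    · rintro ⟨i, rfl⟩
      exact hq ⟨e i, rfl⟩
    · rintro ⟨j, hj⟩
      exact hi ⟨j, e'.injective hj⟩
  · rintro ⟨h1, h2⟩ q hq
    by_cases h : q ∈ Set.range e'
    · obtain ⟨i, rfl⟩ := h
      refine h2 i ?_
      rintro ⟨j, rfl⟩
      exact hq ⟨j, rfl⟩
    · exact h1 q h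

theorem embed_embed (e : S ↪ T) (e' : T ↪ Q) (U : Matrix (BasisState S) (BasisState S) ℂ) :
    embed e' (embed e U) = embed (e.trans e') U := by
  ext r s
  by_cases h : AgreeOff e' r s
  · rw [embed_apply_of_agreeOff _ h]
    by_cases h' : AgreeOff e (r ∘ e') (s ∘ e')
    · rw [embed_apply_of_agreeOff _ h',
        embed_apply_of_agreeOff _ ((agreeOff_trans_iff e e' r s).2 ⟨h, h'⟩)]
      rfl
    · rw [embed_apply_of_not _ h',
        embed_apply_of_not _ fun h'' => h' ((agreeOff_trans_iff e e' r s).1 h'').2]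
  · rw [embed_apply_of_not _ h,
      embed_apply_of_not _ fun h'' => h ((agreeOff_trans_iff e e' r s).1 h'').1]

variable [Fintype S] [DecidableEq S] [Fintype Q] [DecidableEq Q]

/-- Only states that agree with `r` off the register contribute, and these are parametrized by the
contents `v` of the register. -/
theorem sum_embed_mul (e : S ↪ Q) (U : Matrix (BasisState S) (BasisState S) ℂ)
    (r : BasisState Q) (X : BasisState Q → ℂ) :
    ∑ k, embed e U r k * X k = ∑ v, U (r ∘ e) v * X (overwrite e v r) := by
  symm
  refine Fintype.sum_of_injective (fun v => overwrite e v r) (overwrite_injective e r) _ _ ?_ ?_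
  · intro k hk
    rw [embed_apply_of_not, zero_mul]
    intro h
    exact hk ⟨k ∘ e, ((eq_overwrite_iff e _ k r).2 ⟨h.symm, rfl⟩).symm⟩
  · intro v
    rw [embed_apply_of_agreeOff U (agreeOff_overwrite e v r).symm, overwrite_comp]

theorem embed_mul_apply (e : S ↪ Q) (U : Matrix (BasisState S) (BasisState S) ℂ)
    (X : Matrix (BasisState Q) (BasisState Q) ℂ) (r s : BasisState Q) :
    (embed e U * X) r s = ∑ v, U (r ∘ e) v * X (overwrite e v r) s := by
  rw [Matrix.mul_apply, sum_embed_mul e U r fun k => X k s]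

theorem embed_mul (e : S ↪ Q) (U V : Matrix (BasisState S) (BasisState S) ℂ) :
    embed e (U * V) = embed e U * embed e V := by
  ext r s
  rw [embed_mul_apply]
  by_cases h : AgreeOff e r s
  · rw [embed_apply_of_agreeOff _ h, Matrix.mul_apply]
    refine Finset.sum_congr rfl fun v _ => ?_
    rw [embed_apply_of_agreeOff V ((agreeOff_overwrite e v r).trans h), overwrite_comp]
  · rw [embed_apply_of_not _ h]
    refine (Finset.sum_eq_zero fun v _ => ?_).symm
    rw [embed_apply_of_not, mul_zero]
    exact fun h' => h ((agreeOff_overwrite e v r).symm.trans h')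

theorem embed_diagonal (e : S ↪ Q) (φ : BasisState S → ℂ) :
    embed e (Matrix.diagonal φ) = Matrix.diagonal fun s => φ (s ∘ e) := by
  ext r s
  rw [Matrix.diagonal_apply]
  by_cases h : AgreeOff e r s
  · rw [embed_apply_of_agreeOff _ h, Matrix.diagonal_apply]
    have : r ∘ e = s ∘ e ↔ r = s := by
      constructor
      · intro h'
        rw [(eq_overwrite_iff e _ r s).2 ⟨h, h'⟩, overwrite_self]
      · rintro rfl; rfl
    simp only [this]
  · rw [embed_apply_of_not _ h, if_neg]
    rintro rfl
    exact h (AgreeOff.refl e r)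

theorem embed_one (e : S ↪ Q) :
    embed e (1 : Matrix (BasisState S) (BasisState S) ℂ) = 1 := by
  rw [← Matrix.diagonal_one, embed_diagonal, ← Matrix.diagonal_one]

/-- `embed e` as a homomorphism of star algebras. -/
def embedHom (e : S ↪ Q) : Matrix (BasisState S) (BasisState S) ℂ →⋆ₐ[ℂ]
    Matrix (BasisState Q) (BasisState Q) ℂ where
  toFun := embed e
  map_one' := embed_one e
  map_mul' := embed_mul e
  map_zero' := by
    ext r s
    classical rw [embed_apply]; simp
  map_add' U V := by
    ext r s
    classical simp only [embed_apply, Matrix.add_apply]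
    split_ifs <;> simp
  commutes' c := by
    rw [Matrix.algebraMap_eq_diagonal, embed_diagonal, Matrix.algebraMap_eq_diagonal]
    rfl
  map_star' := embed_conjTranspose e

@[simp] theorem embedHom_apply (e : S ↪ Q) (U : Matrix (BasisState S) (BasisState S) ℂ) :
    embedHom e U = embed e U := rfl

theorem embed_commute [Fintype T] [DecidableEq T] (e : S ↪ Q) (f : T ↪ Q)
    (hd : ∀ i j, e i ≠ f j) (U : Matrix (BasisState S) (BasisState S) ℂ)
    (V : Matrix (BasisState T) (BasisState T) ℂ) : Commute (embed e U) (embed f V) := by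
  -- The formula for the product is symmetric in the two operators, so one computation applied in
  -- both orders gives commutation.
  have key : ∀ {S T : Type} [Fintype S] [DecidableEq S] [Fintype T] [DecidableEq T]
      (e : S ↪ Q) (f : T ↪ Q) (_ : ∀ i j, e i ≠ f j)
      (U : Matrix (BasisState S) (BasisState S) ℂ) (V : Matrix (BasisState T) (BasisState T) ℂ)
      (r s : BasisState Q),
      (embed e U * embed f V) r s =
        open Classical in
        if ∀ q, q ∉ Set.range e → q ∉ Set.range f → r q = s q then
          U (r ∘ e) (s ∘ e) * V (r ∘ f) (s ∘ f) else 0 := by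
    intro S T _ _ _ _ e f hd U V r s
    rw [embed_mul_apply]
    have hf : ∀ v : BasisState S, overwrite e v r ∘ f = r ∘ f := fun v => funext fun j =>
      overwrite_of_notMem e v r (by rintro ⟨i, hi⟩; exact hd i j hi)
    have hr : ∀ v : BasisState S, AgreeOff f (overwrite e v r) s →
        v = s ∘ e ∧ ∀ q, q ∉ Set.range e → q ∉ Set.range f → r q = s q := by
      intro v h
      refine ⟨funext fun i => ?_, fun q hq hq' => ?_⟩
      · have := h (e i) (by rintro ⟨j, hj⟩; exact hd i j hj.symm)
        rwa [overwrite_apply] at this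
      · have := h q hq'
        rwa [overwrite_of_notMem e v r hq] at this
    split_ifs with h
    · rw [Finset.sum_eq_single (s ∘ e)]
      · rw [embed_apply_of_agreeOff, hf]
        intro q hq
        by_cases hqe : q ∈ Set.range e
        · obtain ⟨i, rfl⟩ := hqe
          rw [overwrite_apply]; rfl
        · rw [overwrite_of_notMem e _ r hqe]
          exact h q hqe hq
      · intro v _ hv
        rw [embed_apply_of_not _ fun h' => hv (hr v h').1, mul_zero]
      · simp
    · refine Finset.sum_eq_zero fun v _ => ?_
      rw [embed_apply_of_not _ fun h' => h (hr v h').2, mul_zero]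
  ext r s
  rw [key e f hd U V, key f e (fun j i => (hd i j).symm) V U]
  congr 1
  · exact propext ⟨fun h q a b => h q b a, fun h q a b => h q b a⟩
  · rw [mul_comm]

theorem diagonal_commute_embed (e : S ↪ Q) (U : Matrix (BasisState S) (BasisState S) ℂ)
    (φ : BasisState Q → ℂ) (h : ∀ r s, AgreeOff e r s → φ r = φ s) :
    Commute (Matrix.diagonal φ) (embed e U) := by
  ext r s
  rw [Matrix.diagonal_mul, Matrix.mul_diagonal]
  by_cases hrs : AgreeOff e r s
  · rw [h r s hrs, mul_comm]
  · rw [embed_apply_of_not _ hrs]; simp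

end Embed

/-! ### Monomial operators -/

section Mono

variable {S Q : Type} [Fintype S] [DecidableEq S] [Fintype Q] [DecidableEq Q]

/-- The operator that maps each basis state `|s⟩` to `φ s |π s⟩`. -/
def mono (φ : BasisState Q → ℂ) (π : BasisState Q → BasisState Q) :
    Matrix (BasisState Q) (BasisState Q) ℂ :=
  Matrix.of fun r s => if r = π s then φ s else 0

theorem mono_apply (φ : BasisState Q → ℂ) (π : BasisState Q → BasisState Q)
    (r s : BasisState Q) : mono φ π r s = if r = π s then φ s else 0 := rfl

theorem basisMap_eq_mono (f : BasisState Q → BasisState Q) : basisMap f = mono 1 f := by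
  ext r s
  simp only [basisMap, mono, Matrix.of_apply, Pi.one_apply]

theorem diagonal_eq_mono (φ : BasisState Q → ℂ) : Matrix.diagonal φ = mono φ id := by
  ext r s
  rw [Matrix.diagonal_apply, mono_apply]
  simp only [id]
  split_ifs with h
  · rw [h]
  · rfl

theorem mono_one_id : mono (1 : BasisState Q → ℂ) id = 1 := by
  rw [← diagonal_eq_mono, ← Matrix.diagonal_one]; rfl

theorem mul_mono_apply (X : Matrix (BasisState Q) (BasisState Q) ℂ) (φ : BasisState Q → ℂ)
    (π : BasisState Q → BasisState Q) (r s : BasisState Q) :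
    (X * mono φ π) r s = X r (π s) * φ s := by
  rw [Matrix.mul_apply, Finset.sum_eq_single (π s)]
  · simp [mono_apply]
  · intro k _ hk
    simp [mono_apply, hk]
  · simp

/-- Reversible classical gates and diagonal phases are both monomial. Composition therefore reduces
to composing functions on bit strings, and no matrix product has to be expanded for classical
subcircuits. -/
theorem mono_mul_mono (φ ψ : BasisState Q → ℂ) (π σ : BasisState Q → BasisState Q) :
    mono φ π * mono ψ σ = mono (fun s => φ (σ s) * ψ s) (π ∘ σ) := by
  ext r s
  rw [mul_mono_apply, mono_apply, mono_apply]
  simp only [Function.comp, ite_mul, zero_mul]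

theorem embed_mono (e : S ↪ Q) (φ : BasisState S → ℂ) (f : BasisState S → BasisState S) :
    embed e (mono φ f) = mono (fun s => φ (s ∘ e)) fun s => overwrite e (f (s ∘ e)) s := by
  ext r s
  rw [mono_apply]
  by_cases h : AgreeOff e r s
  · rw [embed_apply_of_agreeOff _ h, mono_apply]
    simp [eq_overwrite_iff, h]
  · rw [embed_apply_of_not _ h, if_neg]
    rw [eq_overwrite_iff]
    exact fun h' => h h'.1

theorem mono_conjTranspose_mul (φ : BasisState Q → ℂ) (π : BasisState Q → BasisState Q)
    (hπ : Function.Injective π) (hφ : ∀ s, ‖φ s‖ = 1) :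
    (mono φ π).conjTranspose * mono φ π = 1 := by
  ext r s
  rw [mul_mono_apply, Matrix.conjTranspose_apply, mono_apply, Matrix.one_apply]
  by_cases h : r = s
  · subst h
    simp [Complex.conj_mul', hφ]
  · rw [if_neg h, if_neg fun h' => h (hπ h').symm]
    simp

theorem mono_mem_unitaryGroup (φ : BasisState Q → ℂ) (π : BasisState Q → BasisState Q)
    (hπ : Function.Injective π) (hφ : ∀ s, ‖φ s‖ = 1) :
    mono φ π ∈ Matrix.unitaryGroup (BasisState Q) ℂ :=
  Matrix.mem_unitaryGroup_iff'.2 (mono_conjTranspose_mul φ π hπ hφ)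

/-- Conjugation of a monomial operator by a monomial unitary. -/
theorem mono_conj (φ ψ χ : BasisState Q → ℂ) (π σ τ : BasisState Q → BasisState Q)
    (hπ : Function.Injective π) (hφ : ∀ s, ‖φ s‖ = 1) (hτ : ∀ s, π (τ s) = σ (π s))
    (hχ : ∀ s, φ (τ s) * χ s = ψ (π s) * φ s) :
    (mono φ π).conjTranspose * (mono ψ σ * mono φ π) = mono χ τ := by
  have : mono ψ σ * mono φ π = mono φ π * mono χ τ := by
    rw [mono_mul_mono, mono_mul_mono]
    congr 1
    · funext s; rw [hχ]
    · funext s; exact (hτ s).symm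
  rw [this, ← mul_assoc, mono_conjTranspose_mul φ π hπ hφ, one_mul]

end Mono

/-! ### Circuits on arbitrary wires -/

section Prog

variable {N np : ℕ} {Q R : Type}

/-- The value of an index register. -/
abbrev bitsVal {n : ℕ} (v : BasisState (Fin n)) : ℕ := Nat.ofBits v

theorem bitsVal_indexState {N : ℕ} (x : Fin N) : bitsVal (indexState x) = x := by
  unfold bitsVal indexState
  rw [Nat.ofBits_testBit, Nat.mod_eq_of_lt]
  exact lt_of_lt_of_le x.2 (Nat.le_pow_clog (by norm_num) N)

theorem bitsVal_injective {n : ℕ} : Function.Injective (bitsVal : BasisState (Fin n) → ℕ) := by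
  intro v w h
  funext i
  rw [← Nat.testBit_ofBits_lt v i i.2, ← Nat.testBit_ofBits_lt w i i.2]
  exact congrArg (fun k => Nat.testBit k i) h

theorem indexState_bitsVal {N : ℕ} (v : BasisState (Fin (indexQubits N))) (h : bitsVal v < N) :
    indexState (⟨bitsVal v, h⟩ : Fin N) = v := bitsVal_injective (bitsVal_indexState _)

theorem indexState_injective {N : ℕ} : Function.Injective (indexState : Fin N → _) := by
  intro x y h
  exact Fin.ext (by rw [← bitsVal_indexState x, ← bitsVal_indexState y, h])

/-- The entry bits for a pair of index registers (zero for invalid indices). -/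
def entryBits (D : SparseData N np) (x y : BasisState (Fin (indexQubits N))) :
    BasisState (ValueWires np) :=
  if h : bitsVal x < N ∧ bitsVal y < N then D.value ⟨bitsVal x, h.1⟩ ⟨bitsVal y, h.2⟩
  else fun _ => false

/-- The column register after a position query (unchanged for invalid indices). -/
def columnBits (D : SparseData N np) (x j : BasisState (Fin (indexQubits N))) :
    BasisState (Fin (indexQubits N)) :=
  if h : bitsVal x < N ∧ bitsVal j < N then
    indexState (D.column ⟨bitsVal x, h.1⟩ ⟨bitsVal j, h.2⟩)
  else j

/-- The oracle data with all column permutations inverted. -/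
def SparseData.inv (D : SparseData N np) : SparseData N np where
  value := D.value
  column x := (D.column x).symm

/-- An inverse position query is the position query for the inverted permutations. Invalid registers
are fixed by both, and valid ones stay valid. -/
theorem columnBits_inv (D : SparseData N np) (x j : BasisState (Fin (indexQubits N))) :
    columnBits D.inv x (columnBits D x j) = j := by
  unfold columnBits
  by_cases h : bitsVal x < N ∧ bitsVal j < N
  · rw [dif_pos h]
    have h2 : bitsVal x < N ∧ bitsVal (indexState (D.column ⟨bitsVal x, h.1⟩ ⟨bitsVal j, h.2⟩)) < N := by
      refine ⟨h.1, ?_⟩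
      rw [bitsVal_indexState]
      exact Fin.is_lt _
    rw [dif_pos h2]
    simp only [bitsVal_indexState, SparseData.inv, Fin.eta, Equiv.symm_apply_apply]
    exact indexState_bitsVal j h.2
  · rw [dif_neg h, dif_neg h]

theorem entryMap_eq (D : SparseData N np) (s : BasisState (EntryWires N np)) :
    entryMap D s = Sum.elim (fun w => s (.inl w)) fun k =>
      (s (.inr k)).xor (entryBits D (fun i => s (.inl (.inl i))) (fun i => s (.inl (.inr i))) k) := by
  unfold entryMap entryBits
  simp only [bitsVal]
  split_ifs with h
  · rfl
  · funext k
    rcases k with k | k <;> simp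

theorem positionMap_eq (D : SparseData N np) (s : BasisState (PositionWires N)) :
    positionMap D s = Sum.elim (fun i => s (.inl i))
      (columnBits D (fun i => s (.inl i)) fun i => s (.inr i)) := by
  unfold positionMap columnBits
  simp only [bitsVal]
  split_ifs with h
  · rfl
  · funext k
    rcases k with k | k <;> simp

theorem entryMap_entryMap (D : SparseData N np) (s : BasisState (EntryWires N np)) :
    entryMap D (entryMap D s) = s := by
  rw [entryMap_eq, entryMap_eq]
  funext k
  rcases k with k | k <;> simp

theorem positionMap_inv (D : SparseData N np) (s : BasisState (PositionWires N)) :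
    positionMap D.inv (positionMap D s) = s := by
  rw [positionMap_eq, positionMap_eq]
  funext k
  rcases k with k | k <;> simp [columnBits_inv]

theorem entryMap_injective (D : SparseData N np) : Function.Injective (entryMap D) :=
  Function.LeftInverse.injective (entryMap_entryMap D)

theorem positionMap_injective (D : SparseData N np) : Function.Injective (positionMap D) :=
  Function.LeftInverse.injective (positionMap_inv D)

theorem basisMap_conjTranspose_mul {S : Type} [Fintype S] [DecidableEq S]
    (f : BasisState S → BasisState S) (hf : Function.Injective f) :
    (basisMap f).conjTranspose * basisMap f = 1 := by
  rw [basisMap_eq_mono]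
  exact mono_conjTranspose_mul _ _ hf (by simp)

/-- A map with a left inverse on a finite set gives a permutation matrix, whose adjoint is its
unique inverse. -/
theorem basisMap_conjTranspose {S : Type} [Fintype S] [DecidableEq S]
    (f g : BasisState S → BasisState S) (h : ∀ s, g (f s) = s) :
    (basisMap f).conjTranspose = basisMap g := by
  have hf : Function.Injective f := Function.LeftInverse.injective h
  have h1 := basisMap_conjTranspose_mul f hf
  have h2 : basisMap g * basisMap f = 1 := by
    rw [basisMap_eq_mono, basisMap_eq_mono, mono_mul_mono, ← mono_one_id]
    congr 1
    · funext s; simp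
    · funext s; exact h s
  have h3 := mul_eq_one_comm.1 h1
  calc _ = basisMap g * basisMap f * (basisMap f).conjTranspose := by rw [h2, one_mul]
    _ = basisMap g := by rw [mul_assoc, h3, mul_one]

theorem adjointIf_conjTranspose {S : Type} (inv : Bool)
    (U : Matrix (BasisState S) (BasisState S) ℂ) :
    (adjointIf inv U).conjTranspose = adjointIf (!inv) U := by
  cases inv <;> simp [adjointIf]

theorem controlled_conjTranspose {S : Type} (U : Matrix (BasisState S) (BasisState S) ℂ) :
    (controlled U).conjTranspose = controlled U.conjTranspose := by
  classical
  ext r s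
  simp only [Matrix.conjTranspose_apply, controlled, Matrix.of_apply]
  by_cases h : r none = s none
  · by_cases h2 : s none = true
    · simp [h, h2]
    · by_cases h3 : r ∘ some = s ∘ some
      · simp [h, h2, h3]
      · have : ¬ s ∘ some = r ∘ some := fun h' => h3 h'.symm
        simp [h, h2, h3, this]
  · rw [if_neg h, if_neg fun h' => h h'.symm, star_zero]

theorem controlled_mul {S : Type} [Fintype S] [DecidableEq S]
    (U V : Matrix (BasisState S) (BasisState S) ℂ) :
    controlled U * controlled V = controlled (U * V) := by
  classical
  have key : ∀ (U : Matrix (BasisState S) (BasisState S) ℂ) (r s : BasisState (Option S)),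
      controlled U r s = if r none = s none then
        (if s none then U (r ∘ some) (s ∘ some) else if r ∘ some = s ∘ some then 1 else 0)
        else 0 := by
    intro U r s
    simp only [controlled, Matrix.of_apply]
    congr
  let up : Bool → BasisState S → BasisState (Option S) := fun b v o => o.elim b v
  ext r s
  rw [Matrix.mul_apply]
  have : ∑ k, controlled U r k * controlled V k s =
      ∑ v, controlled U r (up (r none) v) * controlled V (up (r none) v) s := by
    symm
    refine Fintype.sum_of_injective (up (r none)) ?_ _ _ ?_ fun _ => rfl
    · intro v w h
      funext i
      exact congrFun h (some i)
    · intro k hk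
      rw [key, if_neg, zero_mul]
      intro h
      refine hk ⟨k ∘ some, ?_⟩
      funext o
      cases o with
      | none => exact h
      | some i => rfl
  rw [this]
  have hs : ∀ b v, up b v ∘ some = v := fun _ _ => rfl
  have hn : ∀ b v, up b v none = b := fun _ _ => rfl
  simp only [key, hs, hn]
  by_cases h : r none = s none
  · by_cases h2 : s none = true
    · simp [h, h2, Matrix.mul_apply]
    · simp [h, h2]
  · simp [h]

theorem controlled_one {S : Type} [Fintype S] [DecidableEq S] :
    controlled (1 : Matrix (BasisState S) (BasisState S) ℂ) = 1 := by
  classical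
  ext r s
  simp only [controlled, Matrix.of_apply, Matrix.one_apply]
  have : r = s ↔ r none = s none ∧ r ∘ some = s ∘ some := by
    constructor
    · rintro rfl; simp
    · rintro ⟨h1, h2⟩
      funext o
      cases o with
      | none => exact h1
      | some i => exact congrFun h2 i
  by_cases h : r none = s none
  · by_cases h2 : r ∘ some = s ∘ some
    · simp [this, h, h2]
    · simp [this, h, h2]
  · simp [this, h]

namespace Step

/-- The inverse step. -/
def inverse : Step N np Q → Step N np Q
  | gate k hk U e => gate k hk (star U) e
  | queryEntry i e => queryEntry (!i) e
  | queryPosition i e => queryPosition (!i) e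
  | ctrlQueryEntry i e => ctrlQueryEntry (!i) e
  | ctrlQueryPosition i e => ctrlQueryPosition (!i) e

/-- The same step on other wires. -/
def map (ι : Q ↪ R) : Step N np Q → Step N np R
  | gate k hk U e => gate k hk U (e.trans ι)
  | queryEntry i e => queryEntry i (e.trans ι)
  | queryPosition i e => queryPosition i (e.trans ι)
  | ctrlQueryEntry i e => ctrlQueryEntry i (e.trans ι)
  | ctrlQueryPosition i e => ctrlQueryPosition i (e.trans ι)

theorem isGate_inverse (st : Step N np Q) : st.inverse.isGate = st.isGate := by
  cases st <;> rfl

theorem isGate_map (ι : Q ↪ R) (st : Step N np Q) : (st.map ι).isGate = st.isGate := by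
  cases st <;> rfl

theorem eval_map (D : SparseData N np) (ι : Q ↪ R) (st : Step N np Q) :
    (st.map ι).eval D = embed ι (st.eval D) := by
  cases st <;> simp only [map, eval, embed_embed]

theorem eval_inverse (D : SparseData N np) (st : Step N np Q) :
    st.inverse.eval D = (st.eval D).conjTranspose := by
  cases st <;> simp only [inverse, eval, ← embed_conjTranspose, controlled_conjTranspose,
    adjointIf_conjTranspose, Unitary.coe_star, Matrix.star_eq_conjTranspose]

variable [Fintype Q] [DecidableEq Q]

theorem adjointIf_unitary {S : Type} [Fintype S] [DecidableEq S] (inv : Bool)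
    (U : Matrix (BasisState S) (BasisState S) ℂ) (h : U.conjTranspose * U = 1) :
    (adjointIf inv U).conjTranspose * adjointIf inv U = 1 := by
  cases inv
  · simpa [adjointIf] using h
  · simpa [adjointIf] using mul_eq_one_comm.1 h

theorem eval_unitary (D : SparseData N np) (st : Step N np Q) :
    (st.eval D).conjTranspose * st.eval D = 1 := by
  have hE (i) := adjointIf_unitary i (entryOracle D)
    (basisMap_conjTranspose_mul _ (entryMap_injective D))
  have hP (i) := adjointIf_unitary i (positionOracle D)
    (basisMap_conjTranspose_mul _ (positionMap_injective D))
  cases st with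
  | gate k hk U e =>
    simp only [eval, ← embed_conjTranspose, ← embed_mul]
    have := Matrix.mem_unitaryGroup_iff'.1 U.2
    rw [Matrix.star_eq_conjTranspose] at this
    rw [this, embed_one]
  | queryEntry i e => simp only [eval, ← embed_conjTranspose, ← embed_mul, hE, embed_one]
  | queryPosition i e => simp only [eval, ← embed_conjTranspose, ← embed_mul, hP, embed_one]
  | ctrlQueryEntry i e =>
    simp only [eval, ← embed_conjTranspose, ← embed_mul, controlled_conjTranspose,
      controlled_mul, hE, controlled_one, embed_one]
  | ctrlQueryPosition i e =>
    simp only [eval, ← embed_conjTranspose, ← embed_mul, controlled_conjTranspose,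
      controlled_mul, hP, controlled_one, embed_one]

end Step

/-- A list of steps on the wires `Q`. -/
abbrev Prog (N np : ℕ) (Q : Type) : Type := List (Step N np Q)

namespace Prog

/-- The inverse of a list of steps. -/
def inverse (V : Prog N np Q) : Prog N np Q := (List.map Step.inverse V).reverse

/-- The same steps on other wires. -/
def map (ι : Q ↪ R) (V : Prog N np Q) : Prog N np R := List.map (Step.map ι) V

/-- Number of primitive gates. -/
def gates (V : Prog N np Q) : ℕ := V.countP Step.isGate

/-- Number of queries. -/
def queries (V : Prog N np Q) : ℕ := V.countP fun s => !s.isGate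

@[simp] theorem gates_nil : gates ([] : Prog N np Q) = 0 := rfl
@[simp] theorem queries_nil : queries ([] : Prog N np Q) = 0 := rfl
@[simp] theorem gates_append (V W : Prog N np Q) : gates (V ++ W) = gates V + gates W :=
  List.countP_append
@[simp] theorem queries_append (V W : Prog N np Q) : queries (V ++ W) = queries V + queries W :=
  List.countP_append

@[simp] theorem gates_cons (s : Step N np Q) (W : Prog N np Q) :
    gates (s :: W) = gates W + if s.isGate then 1 else 0 := by
  simp [gates, List.countP_cons]
@[simp] theorem queries_cons (s : Step N np Q) (W : Prog N np Q) :
    queries (s :: W) = queries W + if s.isGate then 0 else 1 := by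
  cases h : s.isGate <;> simp [queries, h]

@[simp] theorem gates_map (ι : Q ↪ R) (V : Prog N np Q) : gates (V.map ι) = gates V := by
  simp [gates, map, List.countP_map, Function.comp_def, Step.isGate_map]
@[simp] theorem queries_map (ι : Q ↪ R) (V : Prog N np Q) : queries (V.map ι) = queries V := by
  simp [queries, map, List.countP_map, Function.comp_def, Step.isGate_map]
@[simp] theorem gates_inverse (V : Prog N np Q) : gates V.inverse = gates V := by
  simp [gates, inverse, List.countP_map, Function.comp_def, Step.isGate_inverse]
@[simp] theorem queries_inverse (V : Prog N np Q) : queries V.inverse = queries V := by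
  simp [queries, inverse, List.countP_map, Function.comp_def, Step.isGate_inverse]

theorem gates_flatMap_le {α : Type} (l : List α) (f : α → Prog N np Q) (c : ℕ)
    (h : ∀ a, gates (f a) ≤ c) : gates (l.flatMap f) ≤ l.length * c := by
  induction l with
  | nil => simp
  | cons a l ih =>
    rw [List.flatMap_cons, gates_append, List.length_cons]
    have := h a
    linarith

theorem queries_flatMap_le {α : Type} (l : List α) (f : α → Prog N np Q) (c : ℕ)
    (h : ∀ a, queries (f a) ≤ c) : queries (l.flatMap f) ≤ l.length * c := by
  induction l with
  | nil => simp
  | cons a l ih =>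
    rw [List.flatMap_cons, queries_append, List.length_cons]
    have := h a
    linarith

variable [Fintype Q] [DecidableEq Q] [Fintype R] [DecidableEq R]

/-- The operator performed by a list of steps. -/
def eval (V : Prog N np Q) (D : SparseData N np) : Matrix (BasisState Q) (BasisState Q) ℂ :=
  V.foldl (fun M s => s.eval D * M) 1

theorem foldl_eval (V : Prog N np Q) (D : SparseData N np)
    (A : Matrix (BasisState Q) (BasisState Q) ℂ) :
    V.foldl (fun M s => s.eval D * M) A = eval V D * A := by
  unfold eval
  induction V generalizing A with
  | nil => simp
  | cons s V ih =>
    rw [List.foldl_cons, ih, List.foldl_cons, ih (s.eval D * 1), mul_one, mul_assoc]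

@[simp] theorem eval_nil (D : SparseData N np) : eval ([] : Prog N np Q) D = 1 := rfl

@[simp] theorem eval_cons (s : Step N np Q) (V : Prog N np Q) (D : SparseData N np) :
    eval (s :: V) D = eval V D * s.eval D := by
  rw [eval, List.foldl_cons, foldl_eval, mul_one]

@[simp] theorem eval_append (V W : Prog N np Q) (D : SparseData N np) :
    eval (V ++ W) D = eval W D * eval V D := by
  rw [eval, List.foldl_append, foldl_eval]; rfl

theorem eval_map (ι : Q ↪ R) (V : Prog N np Q) (D : SparseData N np) :
    eval (V.map ι) D = embed ι (eval V D) := by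
  induction V with
  | nil => simp [map, embed_one]
  | cons s V ih =>
    rw [eval_cons, embed_mul, ← ih, ← Step.eval_map, ← eval_cons]; rfl

theorem eval_inverse (V : Prog N np Q) (D : SparseData N np) :
    eval V.inverse D = (eval V D).conjTranspose := by
  induction V with
  | nil => simp [inverse]
  | cons s V ih =>
    have : inverse (s :: V) = inverse V ++ [s.inverse] := by simp [inverse]
    rw [this, eval_append, ih, eval_cons, eval_cons, eval_nil, one_mul, Step.eval_inverse,
      Matrix.conjTranspose_mul]

/-- Unitarity of arbitrary step lists makes every corner of a circuit a contraction. The norm bound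
for the off-diagonal part, the amplification and the leakage estimate all rest on this. -/
theorem eval_unitary (V : Prog N np Q) (D : SparseData N np) :
    (eval V D).conjTranspose * eval V D = 1 := by
  induction V with
  | nil => simp
  | cons s V ih =>
    rw [eval_cons, Matrix.conjTranspose_mul, mul_assoc, ← mul_assoc _ (eval V D), ih, one_mul,
      Step.eval_unitary]

theorem eval_unitary' (V : Prog N np Q) (D : SparseData N np) :
    eval V D * (eval V D).conjTranspose = 1 := mul_eq_one_comm.1 (eval_unitary V D)

/-- The circuit performs the permutation `π` of the basis states. -/
def Performs (V : Prog N np Q) (D : SparseData N np) (π : BasisState Q → BasisState Q) : Prop :=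
  eval V D = mono 1 π

theorem Performs.append {V W : Prog N np Q} {D : SparseData N np} {π σ : BasisState Q → BasisState Q}
    (hV : V.Performs D π) (hW : W.Performs D σ) : Performs (V ++ W) D (σ ∘ π) := by
  unfold Performs at *
  rw [eval_append, hV, hW, mono_mul_mono]
  congr 1
  funext s
  simp

theorem Performs.nil (D : SparseData N np) : Performs ([] : Prog N np Q) D id := mono_one_id.symm

theorem Performs.congr {V : Prog N np Q} {D : SparseData N np} {π σ : BasisState Q → BasisState Q}
    (hV : V.Performs D π) (h : ∀ s q, σ s q = π s q) : V.Performs D σ := by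
  have : σ = π := funext fun s => funext (h s)
  rwa [this]

/-- Reversibility is inherited from the unitarity of the circuit, so it never has to be checked for
the function itself. -/
theorem Performs.injective {V : Prog N np Q} {D : SparseData N np} {π : BasisState Q → BasisState Q}
    (hV : V.Performs D π) : Function.Injective π := by
  intro s s' h
  have h1 := eval_unitary V D
  rw [hV] at h1
  have h2 := congrFun (congrFun h1 s) s'
  rw [mul_mono_apply, Matrix.conjTranspose_apply, mono_apply, if_pos h.symm] at h2
  by_contra hne
  rw [Matrix.one_apply_ne hne] at h2
  simp at h2

/-- Compute, act, uncompute. -/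
theorem Performs.conj {V W : Prog N np Q} {D : SparseData N np}
    {π σ τ : BasisState Q → BasisState Q} (hV : V.Performs D π) (hW : W.Performs D σ)
    (h : ∀ s, π (τ s) = σ (π s)) : Performs (V ++ W ++ V.inverse) D τ := by
  unfold Performs at *
  rw [eval_append, eval_append, eval_inverse, hV, hW]
  exact mono_conj 1 1 1 π σ τ (Performs.injective (show Performs V D π from hV)) (by simp) h
    (by simp)

/-- Compute, apply phases, uncompute. -/
theorem eval_conj_diagonal {V W : Prog N np Q} {D : SparseData N np}
    {π : BasisState Q → BasisState Q} {φ : BasisState Q → ℂ} (hV : V.Performs D π)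
    (hW : W.eval D = Matrix.diagonal φ) :
    eval (V ++ W ++ V.inverse) D = Matrix.diagonal fun s => φ (π s) := by
  have hinj := hV.injective
  unfold Performs at hV
  rw [eval_append, eval_append, eval_inverse, hV, hW, diagonal_eq_mono, diagonal_eq_mono]
  exact mono_conj 1 φ _ π id id hinj (by simp) (by simp) (by simp)

end Prog

end Prog

/-! ### Primitive gates -/

section Gates

variable {N np : ℕ} {Q : Type}

/-- An ordered pair of distinct wires. -/
def pairEmb (a b : Q) (h : a ≠ b) : Fin 2 ↪ Q :=
  ⟨![a, b], by
    intro i j hij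
    fin_cases i <;> fin_cases j <;> simp_all [Ne.symm h]⟩

/-- A single wire. -/
def wireEmb {S : Type} [Unique S] (a : Q) : S ↪ Q := ⟨fun _ => a, fun _ _ _ => Subsingleton.elim _ _⟩

@[simp] theorem pairEmb_zero (a b : Q) (h : a ≠ b) : pairEmb a b h 0 = a := rfl

@[simp] theorem pairEmb_one (a b : Q) (h : a ≠ b) : pairEmb a b h 1 = b := rfl

@[simp] theorem wireEmb_apply {S : Type} [Unique S] (a : Q) (i : S) : wireEmb a i = a := rfl

theorem notMem_range_pairEmb {a b : Q} (h : a ≠ b) {q : Q} :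
    q ∉ Set.range (pairEmb a b h) ↔ q ≠ a ∧ q ≠ b := by
  simp only [Set.mem_range, not_exists, Fin.forall_fin_two]
  simp [eq_comm]

theorem notMem_range_wireEmb {S : Type} [Unique S] {a q : Q} :
    q ∉ Set.range (wireEmb a : S ↪ Q) ↔ q ≠ a := by
  simp [eq_comm]

variable [Fintype Q] [DecidableEq Q]

theorem overwrite_pairEmb {a b : Q} (h : a ≠ b) (v : BasisState (Fin 2)) (s : BasisState Q) :
    overwrite (pairEmb a b h) v s = Function.update (Function.update s a (v 0)) b (v 1) := by
  symm
  rw [eq_overwrite_iff]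
  constructor
  · intro q hq
    rw [notMem_range_pairEmb] at hq
    rw [Function.update_of_ne hq.2, Function.update_of_ne hq.1]
  · funext i
    fin_cases i
    · simp [h]
    · simp

theorem overwrite_wireEmb {S : Type} [Unique S] (a : Q) (v : BasisState S) (s : BasisState Q) :
    overwrite (wireEmb a) v s = Function.update s a (v default) := by
  symm
  rw [eq_overwrite_iff]
  constructor
  · intro q hq
    rw [notMem_range_wireEmb] at hq
    rw [Function.update_of_ne hq]
  · funext i
    rw [Unique.eq_default i]
    simp

/-- Operator on the wire `a` that depends on the state of the other wires. -/
def condOp (a : Q) (f : BasisState Q → Matrix Bool Bool ℂ) :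
    Matrix (BasisState Q) (BasisState Q) ℂ :=
  Matrix.of fun r s => if r = Function.update s a (r a) then f s (r a) (s a) else 0

theorem condOp_apply (a : Q) (f : BasisState Q → Matrix Bool Bool ℂ) (r s : BasisState Q) :
    condOp a f r s = if r = Function.update s a (r a) then f s (r a) (s a) else 0 := rfl

theorem mul_condOp_apply (a : Q) (f : BasisState Q → Matrix Bool Bool ℂ)
    (X : Matrix (BasisState Q) (BasisState Q) ℂ) (r s : BasisState Q) :
    (X * condOp a f) r s = ∑ b, X r (Function.update s a b) * f s b (s a) := by
  rw [Matrix.mul_apply]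
  symm
  refine Fintype.sum_of_injective (fun b => Function.update s a b)
    (Function.update_injective s a) _ _ ?_ ?_
  · intro k hk
    rw [condOp_apply, if_neg, mul_zero]
    intro h
    exact hk ⟨k a, h.symm⟩
  · intro b
    rw [condOp_apply, if_pos (by simp)]
    simp

/-- The left factor sees a state in which wire `a` may already have changed; this is harmless
because `f` ignores that wire. -/
theorem condOp_mul_condOp (a : Q) (f g : BasisState Q → Matrix Bool Bool ℂ)
    (hf : ∀ s b, f (Function.update s a b) = f s) :
    condOp a f * condOp a g = condOp a fun s => f s * g s := by
  ext r s
  rw [mul_condOp_apply, condOp_apply, Matrix.mul_apply]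
  by_cases h : r = Function.update s a (r a)
  · rw [if_pos h]
    refine Finset.sum_congr rfl fun b _ => ?_
    rw [condOp_apply, if_pos, hf]
    · simp
    · simpa using h
  · rw [if_neg h]
    refine Finset.sum_eq_zero fun b _ => ?_
    rw [condOp_apply, if_neg, zero_mul]
    simpa using h

theorem mono_condOp_mono (a : Q) (f : BasisState Q → Matrix Bool Bool ℂ)
    (π : BasisState Q → BasisState Q) (hπ : ∀ s, π (π s) = s)
    (ha : ∀ s b, π (Function.update s a b) = Function.update (π s) a b) :
    mono 1 π * condOp a f * mono 1 π = condOp a fun s => f (π s) := by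
  have hpa : ∀ s, π s a = s a := by
    intro s
    have := congrFun (ha s (s a)) a
    rwa [Function.update_eq_self, Function.update_self] at this
  ext r s
  rw [mul_mono_apply, mul_condOp_apply, condOp_apply]
  simp only [mono_apply, Pi.one_apply, mul_one, ha, hπ]
  by_cases h : r = Function.update s a (r a)
  · rw [if_pos h, Finset.sum_eq_single (r a)]
    · rw [if_pos h, one_mul, hpa]
    · intro b _ hb
      rw [if_neg, zero_mul]
      intro h'
      exact hb (by rw [h']; simp)
    · simp
  · rw [if_neg h]
    refine Finset.sum_eq_zero fun b _ => ?_
    rw [if_neg, zero_mul]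
    intro h'
    exact h (by rw [h']; simp)

/-- The matrix of the bit flip. -/
def notMat : Matrix Bool Bool ℂ := Matrix.of fun r s => if r = !s then 1 else 0

theorem condOp_not (t : Q) (c : BasisState Q → Bool) :
    (condOp t fun s => if c s then notMat else 1) =
      mono 1 fun s => Function.update s t ((s t).xor (c s)) := by
  ext r s
  rw [condOp_apply, mono_apply]
  by_cases h : r = Function.update s t (r t)
  · rw [if_pos h]
    have h2 : (r = Function.update s t ((s t).xor (c s))) ↔ r t = (s t).xor (c s) := by
      constructor
      · intro h'
        rw [h']; simp
      · intro h'
        rw [← h']; exact h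
    simp only [h2, Pi.one_apply]
    cases c s
    · simp [Matrix.one_apply]
    · simp [notMat]
  · rw [if_neg h, if_neg]
    intro h'
    exact h (by rw [h']; simp)

/-! #### Classical gates -/

/-- The target `b` is flipped if the wire `a` holds `p`. -/
def cx (p : Bool) (a b : Q) : Prog N np Q :=
  if h : a ≠ b then
    [.gate 2 le_rfl ⟨mono 1 fun v => Function.update v 1 ((v 1).xor (v 0 == p)),
      mono_mem_unitaryGroup _ _ (by
        refine Function.LeftInverse.injective
          (g := fun v => Function.update v 1 ((v 1).xor (v 0 == p))) fun v => ?_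
        funext i
        fin_cases i <;> simp) (by simp)⟩ (pairEmb a b h)]
  else []

/-- Controlled NOT. -/
abbrev cnot (a b : Q) : Prog N np Q := cx true a b

theorem cx_performs (D : SparseData N np) (p : Bool) {a b : Q} (h : a ≠ b) :
    (cx p a b : Prog N np Q).Performs D fun s => Function.update s b ((s b).xor (s a == p)) := by
  rw [Prog.Performs, cx, dif_pos h, Prog.eval_cons, Prog.eval_nil, one_mul, Step.eval,
    embed_mono]
  congr 1
  funext s
  rw [overwrite_pairEmb]
  simp

theorem cnot_performs (D : SparseData N np) {a b : Q} (h : a ≠ b) :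
    (cnot a b : Prog N np Q).Performs D fun s => Function.update s b ((s b).xor (s a)) := by
  have := cx_performs (Q := Q) D true h
  simpa using this

/-- Bit flip. -/
def notGate (a : Q) : Prog N np Q :=
  [.gate 1 (by norm_num) ⟨mono 1 fun v => fun i => !v i,
      mono_mem_unitaryGroup _ _ (by
        refine Function.LeftInverse.injective (g := fun v => fun i => !v i) fun v => ?_
        funext i
        simp) (by simp)⟩ (wireEmb a)]

theorem notGate_performs (D : SparseData N np) (a : Q) :
    (notGate a : Prog N np Q).Performs D fun s => Function.update s a (!s a) := by
  rw [Prog.Performs, notGate, Prog.eval_cons, Prog.eval_nil, one_mul, Step.eval, embed_mono]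
  congr 1
  funext s
  rw [overwrite_wireEmb]
  rfl

/-- The gate on a control and a target wire that applies `M b` to the target if the control holds
`b`. -/
def condMat (M : Bool → Matrix Bool Bool ℂ) :
    Matrix (BasisState (Fin 2)) (BasisState (Fin 2)) ℂ :=
  condOp 1 fun s => M (s 0)

theorem condOp_conjTranspose [Fintype Q] (a : Q) (f : BasisState Q → Matrix Bool Bool ℂ)
    (hf : ∀ s b, f (Function.update s a b) = f s) :
    (condOp a f).conjTranspose = condOp a fun s => (f s).conjTranspose := by
  ext r s
  rw [Matrix.conjTranspose_apply, condOp_apply, condOp_apply]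
  by_cases h : r = Function.update s a (r a)
  · have h' : s = Function.update r a (s a) := by rw [h]; simp
    rw [if_pos h, if_pos h', Matrix.conjTranspose_apply]
    rw [show f r = f s by rw [h, hf]]
  · have h' : ¬ s = Function.update r a (s a) := fun h' => h (by rw [h']; simp)
    rw [if_neg h, if_neg h', star_zero]

theorem condOp_one (a : Q) : (condOp a fun _ => 1) = (1 : Matrix (BasisState Q) _ ℂ) := by
  ext r s
  rw [condOp_apply]
  by_cases h : r = s
  · subst h; simp
  · rw [Matrix.one_apply_ne h]
    split_ifs with h'
    · rw [Matrix.one_apply_ne]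
      intro h''
      rw [h''] at h'
      exact h (by simpa using h')
    · rfl

theorem condMat_mem (M : Bool → Matrix Bool Bool ℂ) (hM : ∀ b, M b ∈ Matrix.unitaryGroup Bool ℂ) :
    condMat M ∈ Matrix.unitaryGroup (BasisState (Fin 2)) ℂ := by
  rw [Matrix.mem_unitaryGroup_iff, Matrix.star_eq_conjTranspose, condMat,
    condOp_conjTranspose _ _ (by simp), condOp_mul_condOp _ _ _ (by simp)]
  simp only [← Matrix.star_eq_conjTranspose, Matrix.mem_unitaryGroup_iff.1 (hM _)]
  exact condOp_one 1

open Classical in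
/-- Controlled one-qubit gate: `M b` is applied to the wire `a` if the wire `c` holds `b`. -/
def condGate (M : Bool → Matrix Bool Bool ℂ) (c a : Q) : Prog N np Q :=
  if h : (c ≠ a) ∧ ∀ b, M b ∈ Matrix.unitaryGroup Bool ℂ then
    [.gate 2 le_rfl ⟨condMat M, condMat_mem M h.2⟩ (pairEmb c a h.1)]
  else []

theorem embed_condOp {S : Type} [Fintype S] [DecidableEq S] (e : S ↪ Q) (a : S)
    (f : BasisState S → Matrix Bool Bool ℂ) :
    embed e (condOp a f) = condOp (e a) fun s => f (s ∘ e) := by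
  ext r s
  have hu : ∀ b, Function.update s (e a) b ∘ e = Function.update (s ∘ e) a b := by
    intro b
    funext i
    by_cases hi : i = a
    · subst hi; simp
    · rw [Function.comp, Function.update_of_ne (fun h => hi (e.injective h)),
        Function.update_of_ne hi]
      rfl
  by_cases h : r = Function.update s (e a) (r (e a))
  · have hag : AgreeOff e r s := by
      intro q hq
      rw [h, Function.update_of_ne]
      rintro rfl
      exact hq ⟨a, rfl⟩
    rw [embed_apply_of_agreeOff _ hag, condOp_apply, condOp_apply, if_pos h, if_pos]
    · rfl
    · conv_lhs => rw [h]
      rw [hu]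
      rfl
  · rw [condOp_apply, if_neg h]
    by_cases hag : AgreeOff e r s
    · rw [embed_apply_of_agreeOff _ hag, condOp_apply, if_neg]
      intro h'
      apply h
      have hr := (eq_overwrite_iff e _ r s).2 ⟨hag, h'⟩
      conv_lhs => rw [hr]
      symm
      rw [eq_overwrite_iff]
      refine ⟨?_, hu _⟩
      intro q hq
      rw [Function.update_of_ne]
      rintro rfl
      exact hq ⟨a, rfl⟩
    · rw [embed_apply_of_not _ hag]

theorem condGate_eval (D : SparseData N np) (M : Bool → Matrix Bool Bool ℂ)
    (hM : ∀ b, M b ∈ Matrix.unitaryGroup Bool ℂ) {c a : Q} (h : c ≠ a) :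
    (condGate M c a : Prog N np Q).eval D = condOp a fun s => M (s c) := by
  rw [condGate, dif_pos ⟨h, hM⟩, Prog.eval_cons, Prog.eval_nil, one_mul, Step.eval]
  exact embed_condOp _ _ _

open Classical in
/-- One-qubit gate. -/
def rot (M : Matrix Bool Bool ℂ) (a : Q) : Prog N np Q :=
  if h : M ∈ Matrix.unitaryGroup Bool ℂ then
    [.gate 1 (by norm_num) ⟨condOp 0 fun _ => M, by
      rw [Matrix.mem_unitaryGroup_iff, Matrix.star_eq_conjTranspose,
        condOp_conjTranspose _ _ (by simp), condOp_mul_condOp _ _ _ (by simp)]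
      simp only [← Matrix.star_eq_conjTranspose, Matrix.mem_unitaryGroup_iff.1 h]
      exact condOp_one 0⟩ (wireEmb a)]
  else []

theorem rot_eval (D : SparseData N np) (M : Matrix Bool Bool ℂ)
    (hM : M ∈ Matrix.unitaryGroup Bool ℂ) (a : Q) :
    (rot M a : Prog N np Q).eval D = condOp a fun _ => M := by
  rw [rot, dif_pos hM, Prog.eval_cons, Prog.eval_nil, one_mul, Step.eval, embed_condOp]
  rfl

open Classical in
/-- Phase depending on two wires. -/
def phase (φ : Bool → Bool → ℂ) (a b : Q) : Prog N np Q :=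
  if h : (a ≠ b) ∧ ∀ i j, ‖φ i j‖ = 1 then
    [.gate 2 le_rfl ⟨mono (fun v => φ (v 0) (v 1)) id,
      mono_mem_unitaryGroup _ _ Function.injective_id fun _ => h.2 _ _⟩ (pairEmb a b h.1)]
  else []

theorem phase_eval (D : SparseData N np) (φ : Bool → Bool → ℂ) (hφ : ∀ i j, ‖φ i j‖ = 1)
    {a b : Q} (h : a ≠ b) :
    (phase φ a b : Prog N np Q).eval D = Matrix.diagonal fun s => φ (s a) (s b) := by
  rw [phase, dif_pos ⟨h, hφ⟩, Prog.eval_cons, Prog.eval_nil, one_mul, Step.eval, embed_mono,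
    diagonal_eq_mono]
  congr 1
  funext s
  simp [overwrite_self]

open Classical in
/-- Phase depending on one wire. -/
def phase₁ (φ : Bool → ℂ) (a : Q) : Prog N np Q :=
  if h : ∀ i, ‖φ i‖ = 1 then
    [.gate 1 (by norm_num) ⟨mono (fun v => φ (v 0)) id,
      mono_mem_unitaryGroup _ _ Function.injective_id fun _ => h _⟩ (wireEmb a)]
  else []

theorem phase₁_eval (D : SparseData N np) (φ : Bool → ℂ) (hφ : ∀ i, ‖φ i‖ = 1) (a : Q) :
    (phase₁ φ a : Prog N np Q).eval D = Matrix.diagonal fun s => φ (s a) := by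
  rw [phase₁, dif_pos hφ, Prog.eval_cons, Prog.eval_nil, one_mul, Step.eval, embed_mono,
    diagonal_eq_mono]
  congr 1
  funext s
  simp [overwrite_self]

/-! #### Toffoli gate -/

/-- A square root of the bit flip. -/
def sqrtNot : Matrix Bool Bool ℂ :=
  Matrix.of fun r s => if r = s then (1 + Complex.I) / 2 else (1 - Complex.I) / 2

theorem sqrtNot_mul_self : sqrtNot * sqrtNot = notMat := by
  ext r s
  rw [Matrix.mul_apply, Fintype.sum_bool]
  cases r <;> cases s <;> simp [sqrtNot, notMat] <;> ring_nf <;> simp [Complex.I_sq] <;> ring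

theorem sqrtNot_mul_star : sqrtNot * sqrtNot.conjTranspose = 1 := by
  ext r s
  rw [Matrix.mul_apply, Fintype.sum_bool]
  cases r <;> cases s <;> simp [sqrtNot, Matrix.conjTranspose_apply] <;> ring_nf <;>
    simp [Complex.I_sq] <;> ring

theorem sqrtNot_mem : sqrtNot ∈ Matrix.unitaryGroup Bool ℂ :=
  Matrix.mem_unitaryGroup_iff.2 sqrtNot_mul_star

/-- The wire `t` is flipped if `a` holds `p` and `b` holds `q`. -/
def tof (p q : Bool) (a b t : Q) : Prog N np Q :=
  condGate (fun x => if x == q then sqrtNot else 1) b t ++ cx p a b ++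
    condGate (fun x => if x == q then sqrtNot.conjTranspose else 1) b t ++ cx p a b ++
    condGate (fun x => if x == p then sqrtNot else 1) a t

/-- With α and β the truth values of `s a == p` and `s b == q`, the target receives the power β - (α
xor β) + α = 2αβ of the square root of NOT. -/
theorem tof_performs (D : SparseData N np) (p q : Bool) {a b t : Q} (hab : a ≠ b) (hat : a ≠ t)
    (hbt : b ≠ t) : (tof p q a b t : Prog N np Q).Performs D fun s =>
      Function.update s t ((s t).xor ((s a == p) && (s b == q))) := by
  have h1 : ∀ q b : Bool, (if b == q then sqrtNot else 1) ∈ Matrix.unitaryGroup Bool ℂ := by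
    intro q b
    split_ifs
    exacts [sqrtNot_mem, one_mem _]
  have h2 : ∀ b : Bool, (if b == q then sqrtNot.conjTranspose else 1) ∈
      Matrix.unitaryGroup Bool ℂ := by
    intro b
    split_ifs
    exacts [Unitary.star_mem sqrtNot_mem, one_mem _]
  rw [Prog.Performs, tof, Prog.eval_append, Prog.eval_append, Prog.eval_append, Prog.eval_append,
    condGate_eval D _ (h1 q) hbt, condGate_eval D _ h2 hbt, condGate_eval D _ (h1 p) hat,
    cx_performs D p hab, ← mul_assoc (condOp t _) (mono 1 _) (condOp t _),
    ← mul_assoc (mono 1 _) (condOp t _ * _) (condOp t _), ← mul_assoc (mono 1 _) (condOp t _) _,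
    mono_condOp_mono, condOp_mul_condOp, condOp_mul_condOp, ← condOp_not]
  · congr 1
    funext s
    simp only [Function.update_self]
    have hm := sqrtNot_mul_star
    have hm' := mul_eq_one_comm.1 hm
    have hs := sqrtNot_mul_self
    generalize s a = x
    generalize s b = y
    cases x <;> cases y <;> cases p <;> cases q <;> simp [hm, hm', hs]
  · intro s x
    simp [hat]
  · intro s x
    simp [hat, hbt]
  · intro s
    simp [hab]
  · intro s x
    rw [Function.update_of_ne hat, Function.update_of_ne hbt, Function.update_comm hbt]

theorem gates_cx_le (p : Bool) (a b : Q) : (cx p a b : Prog N np Q).gates ≤ 1 := by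
  unfold cx; split_ifs <;> simp [Step.isGate]

theorem gates_condGate_le (M : Bool → Matrix Bool Bool ℂ) (a b : Q) :
    (condGate M a b : Prog N np Q).gates ≤ 1 := by
  unfold condGate; split_ifs <;> simp [Step.isGate]

theorem gates_phase_le (φ : Bool → Bool → ℂ) (a b : Q) :
    (phase φ a b : Prog N np Q).gates ≤ 1 := by
  unfold phase; split_ifs <;> simp [Step.isGate]

theorem gates_phase₁_le (φ : Bool → ℂ) (a : Q) : (phase₁ φ a : Prog N np Q).gates ≤ 1 := by
  unfold phase₁; split_ifs <;> simp [Step.isGate]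

theorem gates_rot_le (M : Matrix Bool Bool ℂ) (a : Q) : (rot M a : Prog N np Q).gates ≤ 1 := by
  unfold rot; split_ifs <;> simp [Step.isGate]

@[simp] theorem gates_notGate (a : Q) : (notGate a : Prog N np Q).gates = 1 := by
  simp [notGate, Step.isGate]

theorem gates_tof_le (p q : Bool) (a b t : Q) : (tof p q a b t : Prog N np Q).gates ≤ 5 := by
  simp only [tof, Prog.gates_append]
  have h1 := gates_cx_le (N := N) (np := np) p a b
  have h2 := fun M => gates_condGate_le (N := N) (np := np) M b t
  have h3 := fun M => gates_condGate_le (N := N) (np := np) M a t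
  have := h2 (fun x => if x == q then sqrtNot else 1)
  have := h2 (fun x => if x == q then sqrtNot.conjTranspose else 1)
  have := h3 (fun x => if x == p then sqrtNot else 1)
  omega

@[simp] theorem queries_cx (p : Bool) (a b : Q) : (cx p a b : Prog N np Q).queries = 0 := by
  unfold cx; split_ifs <;> simp [Step.isGate]

@[simp] theorem queries_condGate (M : Bool → Matrix Bool Bool ℂ) (a b : Q) :
    (condGate M a b : Prog N np Q).queries = 0 := by
  unfold condGate; split_ifs <;> simp [Step.isGate]

@[simp] theorem queries_phase (φ : Bool → Bool → ℂ) (a b : Q) :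
    (phase φ a b : Prog N np Q).queries = 0 := by
  unfold phase; split_ifs <;> simp [Step.isGate]

@[simp] theorem queries_phase₁ (φ : Bool → ℂ) (a : Q) :
    (phase₁ φ a : Prog N np Q).queries = 0 := by
  unfold phase₁; split_ifs <;> simp [Step.isGate]

@[simp] theorem queries_rot (M : Matrix Bool Bool ℂ) (a : Q) :
    (rot M a : Prog N np Q).queries = 0 := by
  unfold rot; split_ifs <;> simp [Step.isGate]

@[simp] theorem queries_notGate (a : Q) : (notGate a : Prog N np Q).queries = 0 := by
  simp [notGate, Step.isGate]

@[simp] theorem queries_tof (p q : Bool) (a b t : Q) :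
    (tof p q a b t : Prog N np Q).queries = 0 := by
  simp [tof]

end Gates

/-! ### Reversible classical circuits -/

section Classical

variable {N np : ℕ} {Q : Type} [Fintype Q] [DecidableEq Q]

/-- Carry of the addition of `x` and the complement of `y` (least significant bits first), with
carry-in `c`. -/
def carry : Bool → List (Bool × Bool) → Bool
  | c, [] => c
  | c, (x, y) :: l => carry (x.xor ((c.xor x) && !(y.xor x))) l

/-- The sum of f, the complement 2^n - 1 - g and c overflows n bits precisely when g < f + c. The
carry chain of an adder is thus a comparator. -/
theorem carry_ofFn {n : ℕ} (c : Bool) (f g : Fin n → Bool) :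
    carry c (List.ofFn fun i => (f i, g i)) = decide (bitsVal g < bitsVal f + c.toNat) := by
  induction n generalizing c with
  | zero => cases c <;> simp [carry]
  | succ n ih =>
    rw [List.ofFn_succ, carry, ih, bitsVal, bitsVal, bitsVal, bitsVal, Nat.ofBits_succ,
      Nat.ofBits_succ]
    simp only [Function.comp_def]
    rw [decide_eq_decide]
    cases f 0 <;> cases g 0 <;> cases c <;> simp <;> omega

/-- Compared with the zero register, the carry is the disjunction of all bits, so the same circuit
serves as a zero test. -/
theorem carry_false_right {α : Type} (l : List α) (f : α → Bool) (c : Bool) :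
    carry c (l.map fun a => (f a, false)) = (c || l.any f) := by
  induction l generalizing c with
  | nil => simp [carry]
  | cons a l ih =>
    rw [List.map_cons, carry, ih, List.any_cons]
    cases f a <;> cases c <;> simp

/-- The carry chain on pairs of wires, computed in place. -/
def carryChain : Q → List (Q × Q) → Prog N np Q
  | _, [] => []
  | c, (a, b) :: l => cnot a b ++ cnot a c ++ tof true false c b a ++ carryChain a l

/-- The wire that holds the result of `carryChain`. -/
def carryWire : Q → List (Q × Q) → Q
  | c, [] => c
  | _, (a, _) :: l => carryWire a l

/-- The wires of a carry chain. -/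
def pairWires (l : List (Q × Q)) : List Q := l.flatMap fun p => [p.1, p.2]

theorem pairWires_cons (a b : Q) (l : List (Q × Q)) :
    pairWires ((a, b) :: l) = a :: b :: pairWires l := by simp [pairWires]

theorem mem_pairWires {l : List (Q × Q)} {p : Q × Q} (h : p ∈ l) :
    p.1 ∈ pairWires l ∧ p.2 ∈ pairWires l := by
  simp only [pairWires, List.mem_flatMap]
  exact ⟨⟨p, h, by simp⟩, ⟨p, h, by simp⟩⟩

theorem carryWire_mem (c : Q) (l : List (Q × Q)) : carryWire c l ∈ c :: pairWires l := by
  induction l generalizing c with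
  | nil => simp [carryWire]
  | cons p l ih =>
    obtain ⟨a, b⟩ := p
    rw [carryWire, pairWires_cons]
    have := ih a
    simp only [List.mem_cons] at this ⊢
    tauto

/-- The running carry is stored in place, on the first wire of the pair just processed. The
remaining clauses say that foreign wires are neither changed nor read, which is what uncomputation
after writing to a foreign wire requires. -/
theorem carryChain_performs (D : SparseData N np) (c : Q) (l : List (Q × Q))
    (hl : (c :: pairWires l).Nodup) :
    ∃ π : BasisState Q → BasisState Q, (carryChain c l : Prog N np Q).Performs D π ∧
      (∀ s, π s (carryWire c l) = carry (s c) (l.map fun p => (s p.1, s p.2))) ∧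
      (∀ s q, q ∉ c :: pairWires l → π s q = s q) ∧
      ∀ s q v, q ∉ c :: pairWires l →
        π (Function.update s q v) = Function.update (π s) q v := by
  induction l generalizing c with
  | nil => exact ⟨id, Prog.Performs.nil D, by simp [carryWire, carry], by simp, by simp⟩
  | cons p l ih =>
    obtain ⟨a, b⟩ := p
    rw [pairWires_cons] at hl ⊢
    simp only [List.nodup_cons, List.mem_cons, not_or] at hl
    obtain ⟨⟨hca, hcb, hcl⟩, ⟨hab, hal⟩, hbl, hl⟩ := hl
    obtain ⟨π, hπ, hc, hk, hu⟩ := ih a (List.nodup_cons.2 ⟨hal, hl⟩)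
    refine ⟨_, ((((cnot_performs D hab).append (cnot_performs D (Ne.symm hca))).append
      (tof_performs D true false hcb hca (Ne.symm hab))).append hπ), ?_, ?_, ?_⟩
    · intro s
      simp only [Function.comp]
      rw [carryWire, hc, List.map_cons, carry]
      congr 1
      · simp [hab, hcb, Ne.symm hca, Ne.symm hcb]
      · refine List.map_congr_left fun p hp => ?_
        have hp' := mem_pairWires hp
        have h1 : ∀ q ∈ pairWires l, q ≠ a ∧ q ≠ b ∧ q ≠ c := fun q hq =>
          ⟨fun h => hal (h ▸ hq), fun h => hbl (h ▸ hq), fun h => hcl (h ▸ hq)⟩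
        obtain ⟨h2, h3, h4⟩ := h1 _ hp'.1
        obtain ⟨h5, h6, h7⟩ := h1 _ hp'.2
        simp [h2, h3, h4, h5, h6, h7]
    · intro s q hq
      simp only [List.mem_cons, not_or] at hq
      obtain ⟨h1, h2, h3, h4⟩ := hq
      simp only [Function.comp]
      rw [hk _ _ (by simp [h2, h4])]
      simp [h1, h2, h3]
    · intro s q v hq
      simp only [List.mem_cons, not_or] at hq
      obtain ⟨h1, h2, h3, h4⟩ := hq
      simp only [Function.comp]
      rw [← hu _ _ _ (by simp [h2, h4])]
      congr 1
      simp only [Function.update_of_ne (Ne.symm h1), Function.update_of_ne (Ne.symm h2),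
        Function.update_of_ne (Ne.symm h3), Function.update_of_ne hcb, Function.update_self,
        Function.update_comm h1, Function.update_comm h2, Function.update_comm h3]

/-- The wire `g` is flipped if `k` is set and the carry is set. -/
def ctrlCompare (k c : Q) (l : List (Q × Q)) (g : Q) : Prog N np Q :=
  carryChain c l ++ tof true true k (carryWire c l) g ++ (carryChain c l).inverse

/-- The wire `g` is flipped if the carry is set. -/
def compare (c : Q) (l : List (Q × Q)) (g : Q) : Prog N np Q :=
  carryChain c l ++ cnot (carryWire c l) g ++ (carryChain c l).inverse

/-- The chain runs regardless of the control and is undone afterwards; only the single flip between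
the two runs is controlled. -/
theorem ctrlCompare_performs (D : SparseData N np) (k c : Q) (l : List (Q × Q)) (g : Q)
    (hl : (k :: g :: c :: pairWires l).Nodup) :
    (ctrlCompare k c l g : Prog N np Q).Performs D fun s =>
      Function.update s g ((s g).xor (s k && carry (s c) (l.map fun p => (s p.1, s p.2)))) := by
  rw [List.nodup_cons, List.nodup_cons, List.mem_cons, not_or] at hl
  obtain ⟨⟨hkg, hk⟩, hg, hl⟩ := hl
  obtain ⟨π, hπ, hc, hkeep, hu⟩ := carryChain_performs D c l hl
  have hw := carryWire_mem c l
  refine Prog.Performs.conj hπ (tof_performs D true true (fun h => hk (h ▸ hw)) hkg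
    (fun h => hg (h ▸ hw))) fun s => ?_
  rw [hu _ _ _ hg, hc, hkeep _ _ hg, hkeep _ _ hk]
  simp

theorem compare_performs (D : SparseData N np) (c : Q) (l : List (Q × Q)) (g : Q)
    (hl : (g :: c :: pairWires l).Nodup) :
    (compare c l g : Prog N np Q).Performs D fun s =>
      Function.update s g ((s g).xor (carry (s c) (l.map fun p => (s p.1, s p.2)))) := by
  rw [List.nodup_cons] at hl
  obtain ⟨hg, hl⟩ := hl
  obtain ⟨π, hπ, hc, hkeep, hu⟩ := carryChain_performs D c l hl
  have hw := carryWire_mem c l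
  refine Prog.Performs.conj hπ (cnot_performs D (fun h => hg (h ▸ hw))) fun s => ?_
  rw [hu _ _ _ hg, hc, hkeep _ _ hg]

theorem gates_carryChain_le (c : Q) (l : List (Q × Q)) :
    (carryChain c l : Prog N np Q).gates ≤ 7 * l.length := by
  induction l generalizing c with
  | nil => simp [carryChain]
  | cons p l ih =>
    obtain ⟨a, b⟩ := p
    simp only [carryChain, cnot, Prog.gates_append, List.length_cons]
    have h1 := gates_cx_le (N := N) (np := np) true a b
    have h2 := gates_cx_le (N := N) (np := np) true a c
    have h3 := gates_tof_le (N := N) (np := np) true false c b a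
    have := ih a
    omega

@[simp] theorem queries_carryChain (c : Q) (l : List (Q × Q)) :
    (carryChain c l : Prog N np Q).queries = 0 := by
  induction l generalizing c with
  | nil => simp [carryChain]
  | cons p l ih =>
    obtain ⟨a, b⟩ := p
    simp [carryChain, ih]

theorem gates_ctrlCompare_le (k c : Q) (l : List (Q × Q)) (g : Q) :
    (ctrlCompare k c l g : Prog N np Q).gates ≤ 14 * l.length + 5 := by
  simp only [ctrlCompare, Prog.gates_append, Prog.gates_inverse]
  have := gates_carryChain_le (N := N) (np := np) c l
  have := gates_tof_le (N := N) (np := np) true true k (carryWire c l) g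
  omega

theorem gates_compare_le (c : Q) (l : List (Q × Q)) (g : Q) :
    (compare c l g : Prog N np Q).gates ≤ 14 * l.length + 1 := by
  simp only [compare, cnot, Prog.gates_append, Prog.gates_inverse]
  have := gates_carryChain_le (N := N) (np := np) c l
  have := gates_cx_le (N := N) (np := np) true (carryWire c l) g
  omega

@[simp] theorem queries_ctrlCompare (k c : Q) (l : List (Q × Q)) (g : Q) :
    (ctrlCompare k c l g : Prog N np Q).queries = 0 := by simp [ctrlCompare]

@[simp] theorem queries_compare (c : Q) (l : List (Q × Q)) (g : Q) :
    (compare c l g : Prog N np Q).queries = 0 := by simp [compare]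

/-- Controlled swap of two wires. -/
def cswap (k a b : Q) : Prog N np Q := cnot b a ++ tof true true k a b ++ cnot b a

theorem cswap_performs (D : SparseData N np) {k a b : Q} (hka : k ≠ a) (hkb : k ≠ b)
    (hab : a ≠ b) : (cswap k a b : Prog N np Q).Performs D fun s q =>
      if s k then s (Equiv.swap a b q) else s q := by
  have := ((cnot_performs (N := N) (np := np) D (Ne.symm hab)).append
    (tof_performs D true true hka hkb hab)).append (cnot_performs D (Ne.symm hab))
  unfold cswap
  convert this using 1
  funext s q
  simp only [Function.comp]
  by_cases hqa : q = a
  · subst hqa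
    simp [hab, hka, Ne.symm hab]
    cases s k <;> cases s q <;> cases s b <;> rfl
  · by_cases hqb : q = b
    · subst hqb
      simp [hab, hka, Ne.symm hab]
      cases s k <;> cases s q <;> cases s a <;> rfl
    · rw [Equiv.swap_apply_of_ne_of_ne hqa hqb]
      simp [hqa, hqb]

/-- Controlled swap of the two wires of each pair. -/
def cswaps (k : Q) (l : List (Q × Q)) : Prog N np Q := l.flatMap fun p => cswap k p.1 p.2

/-- The permutation of the wires that swaps the two wires of each pair. -/
def swapPerm : List (Q × Q) → Q → Q
  | [], q => q
  | (a, b) :: l, q => Equiv.swap a b (swapPerm l q)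

theorem cswaps_performs (D : SparseData N np) (k : Q) (l : List (Q × Q))
    (hl : (k :: pairWires l).Nodup) :
    (cswaps k l : Prog N np Q).Performs D fun s q => if s k then s (swapPerm l q) else s q := by
  induction l with
  | nil =>
    exact (Prog.Performs.nil (Q := Q) D).congr fun s q => by simp [swapPerm]
  | cons p l ih =>
    obtain ⟨a, b⟩ := p
    rw [pairWires_cons] at hl
    simp only [List.nodup_cons, List.mem_cons, not_or] at hl
    obtain ⟨⟨hka, hkb, hkl⟩, ⟨hab, hal⟩, hbl, hl⟩ := hl
    refine ((cswap_performs D hka hkb hab).append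
      (ih (List.nodup_cons.2 ⟨hkl, hl⟩))).congr fun s q => ?_
    simp only [Function.comp, swapPerm]
    rw [Equiv.swap_apply_of_ne_of_ne hka hkb]
    cases s k <;> simp

theorem swapPerm_of_notMem (l : List (Q × Q)) {q : Q} (h : q ∉ pairWires l) :
    swapPerm l q = q := by
  induction l with
  | nil => rfl
  | cons p l ih =>
    obtain ⟨a, b⟩ := p
    rw [pairWires_cons] at h
    simp only [List.mem_cons, not_or] at h
    rw [swapPerm, ih h.2.2, Equiv.swap_apply_of_ne_of_ne h.1 h.2.1]

theorem swapPerm_of_mem (l : List (Q × Q)) (hl : (pairWires l).Nodup) {a b : Q}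
    (h : (a, b) ∈ l) : swapPerm l a = b ∧ swapPerm l b = a := by
  induction l with
  | nil => simp at h
  | cons p l ih =>
    obtain ⟨x, y⟩ := p
    rw [pairWires_cons] at hl
    simp only [List.nodup_cons, List.mem_cons, not_or] at hl
    obtain ⟨⟨hab, hal⟩, hbl, hl⟩ := hl
    rw [swapPerm, swapPerm]
    rcases List.mem_cons.1 h with h | h
    · obtain ⟨rfl, rfl⟩ := Prod.mk.inj h
      rw [swapPerm_of_notMem l hal, swapPerm_of_notMem l hbl]
      simp
    · obtain ⟨h1, h2⟩ := ih hl h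
      have hm := mem_pairWires h
      rw [h1, h2, Equiv.swap_apply_of_ne_of_ne, Equiv.swap_apply_of_ne_of_ne]
      · exact ⟨rfl, rfl⟩
      · rintro rfl; exact hal hm.1
      · rintro rfl; exact hbl hm.1
      · rintro rfl; exact hal hm.2
      · rintro rfl; exact hbl hm.2

theorem gates_cswaps_le (k : Q) (l : List (Q × Q)) :
    (cswaps k l : Prog N np Q).gates ≤ l.length * 7 := by
  refine Prog.gates_flatMap_le _ _ _ fun p => ?_
  simp only [cswap, cnot, Prog.gates_append]
  have := gates_cx_le (N := N) (np := np) true p.2 p.1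
  have := gates_tof_le (N := N) (np := np) true true k p.1 p.2
  omega

@[simp] theorem queries_cswaps (k : Q) (l : List (Q × Q)) :
    (cswaps k l : Prog N np Q).queries = 0 := by
  have := Prog.queries_flatMap_le l (fun p => (cswap k p.1 p.2 : Prog N np Q)) 0
    (by simp [cswap])
  simpa [cswaps] using this

/-- Copies wires onto other wires by controlled NOT gates. -/
def copies {α : Type} (f g : α → Q) (l : List α) : Prog N np Q := l.flatMap fun a => cnot (f a) (g a)

theorem copies_performs {α : Type} (D : SparseData N np) (f : α → Q) (g : α ↪ Q)
    (hfg : ∀ i j, f i ≠ g j) (l : List α) (hl : l.Nodup) :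
    (copies f g l : Prog N np Q).Performs D fun s =>
      overwrite g (open Classical in
        fun i => if i ∈ l then (s (g i)).xor (s (f i)) else s (g i)) s := by
  classical
  induction l with
  | nil =>
    refine (Prog.Performs.nil (Q := Q) D).congr fun s q => ?_
    simp only [List.not_mem_nil, if_false, id]
    exact congrFun (overwrite_self g s) q
  | cons a l ih =>
    rw [List.nodup_cons] at hl
    refine ((cnot_performs D (hfg a a)).append (ih hl.2)).congr fun s q => ?_
    revert q
    rw [← funext_iff]
    simp only [Function.comp]
    symm
    rw [eq_overwrite_iff]
    constructor
    · intro q hq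
      rw [overwrite_of_notMem _ _ _ hq, Function.update_of_ne]
      rintro rfl
      exact hq ⟨a, rfl⟩
    · rw [overwrite_comp]
      funext i
      rw [Function.update_of_ne (hfg i a)]
      by_cases hi : i = a
      · subst hi
        simp [hl.1]
      · rw [Function.update_of_ne fun h => hi (g.injective h)]
        simp [hi]

theorem gates_copies_le {α : Type} (f g : α → Q) (l : List α) :
    (copies f g l : Prog N np Q).gates ≤ l.length := by
  have := Prog.gates_flatMap_le l (fun a => (cnot (f a) (g a) : Prog N np Q)) 1
    fun a => gates_cx_le _ _ _
  simpa [copies] using this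

@[simp] theorem queries_copies {α : Type} (f g : α → Q) (l : List α) :
    (copies f g l : Prog N np Q).queries = 0 := by
  have := Prog.queries_flatMap_le l (fun a => (cnot (f a) (g a) : Prog N np Q)) 0 (by simp)
  simpa [copies] using this

theorem queryEntry_performs (D : SparseData N np) (e : EntryWires N np ↪ Q) :
    Prog.Performs ([.queryEntry false e] : Prog N np Q) D fun s => overwrite e (entryMap D (s ∘ e)) s := by
  rw [Prog.Performs, Prog.eval_cons, Prog.eval_nil, one_mul, Step.eval, entryOracle, adjointIf,
    basisMap_eq_mono]
  simp only [Bool.false_eq_true, if_false]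
  rw [embed_mono]
  rfl

theorem queryPosition_performs (D : SparseData N np) (e : PositionWires N ↪ Q) :
    Prog.Performs ([.queryPosition false e] : Prog N np Q) D
      fun s => overwrite e (positionMap D (s ∘ e)) s := by
  rw [Prog.Performs, Prog.eval_cons, Prog.eval_nil, one_mul, Step.eval, positionOracle, adjointIf,
    basisMap_eq_mono]
  simp only [Bool.false_eq_true, if_false]
  rw [embed_mono]
  rfl

theorem queryPosition_inv_performs (D : SparseData N np) (e : PositionWires N ↪ Q) :
    Prog.Performs ([.queryPosition true e] : Prog N np Q) D
      fun s => overwrite e (positionMap D.inv (s ∘ e)) s := by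
  rw [Prog.Performs, Prog.eval_cons, Prog.eval_nil, one_mul, Step.eval, positionOracle, adjointIf]
  simp only [if_true]
  rw [basisMap_conjTranspose _ (positionMap D.inv) (positionMap_inv D), basisMap_eq_mono,
    embed_mono]
  rfl

/-! ### Products of one-qubit gates -/

/-- Tensor product of one-qubit operators. -/
def tensor {S : Type} [Fintype S] (M : S → Matrix Bool Bool ℂ) :
    Matrix (BasisState S) (BasisState S) ℂ := Matrix.of fun r s => ∏ i, M i (r i) (s i)

/-- One-qubit gates on the wires of a register. -/
def rots {S : Type} [Fintype S] (e : S ↪ Q) (M : S → Matrix Bool Bool ℂ) : Prog N np Q :=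
  Prog.map e ((Finset.univ : Finset S).toList.flatMap fun i => rot (M i) i)

theorem rots_eval {S : Type} [Fintype S] [DecidableEq S] (D : SparseData N np) (e : S ↪ Q)
    (M : S → Matrix Bool Bool ℂ) (hM : ∀ i, M i ∈ Matrix.unitaryGroup Bool ℂ) :
    (rots e M : Prog N np Q).eval D = embed e (tensor M) := by
  rw [rots, Prog.eval_map]
  congr 1
  -- The induction is over the wires already treated; an untreated wire contributes a Kronecker
  -- delta.
  have key : ∀ l : List S, l.Nodup →
      Prog.eval (l.flatMap fun i => (rot (M i) i : Prog N np S)) D =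
        Matrix.of fun r s => ∏ i, if i ∈ l then M i (r i) (s i) else if r i = s i then 1 else 0 := by
    intro l hl
    induction l with
    | nil =>
      ext r s
      simp only [List.flatMap_nil, Prog.eval_nil, Matrix.of_apply, List.not_mem_nil, if_false]
      rw [Finset.prod_ite_zero, Matrix.one_apply]
      simp [funext_iff]
    | cons a l ih =>
      rw [List.nodup_cons] at hl
      rw [List.flatMap_cons, Prog.eval_append, ih hl.2, rot_eval D _ (hM a)]
      ext r s
      rw [mul_condOp_apply]
      simp only [Matrix.of_apply]
      rw [← Finset.mul_prod_erase _ _ (Finset.mem_univ a)]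
      have h1 : ∀ b : Bool, (∏ i, if i ∈ l then M i (r i) (Function.update s a b i)
          else if r i = Function.update s a b i then (1 : ℂ) else 0) =
          (if r a = b then 1 else 0) * ∏ i ∈ Finset.univ.erase a,
            if i ∈ a :: l then M i (r i) (s i) else if r i = s i then 1 else 0 := by
        intro b
        rw [← Finset.mul_prod_erase _ _ (Finset.mem_univ a)]
        congr 1
        · simp [hl.1]
        · refine Finset.prod_congr rfl fun i hi => ?_
          have : i ≠ a := (Finset.mem_erase.1 hi).1
          simp [this]
      simp only [h1]
      rw [Finset.sum_eq_single (r a)]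
      · simp [mul_comm]
      · intro b _ hb
        rw [if_neg (Ne.symm hb)]; simp
      · simp
  rw [key _ (Finset.nodup_toList _)]
  ext r s
  simp [tensor]

theorem gates_rots_le {S : Type} [Fintype S] (e : S ↪ Q) (M : S → Matrix Bool Bool ℂ) :
    (rots e M : Prog N np Q).gates ≤ Fintype.card S := by
  rw [rots, Prog.gates_map]
  classical
  have := Prog.gates_flatMap_le (Finset.univ : Finset S).toList
    (fun i => (rot (M i) i : Prog N np S)) 1 fun a => gates_rot_le _ _
  simpa using this

@[simp] theorem queries_rots {S : Type} [Fintype S] (e : S ↪ Q) (M : S → Matrix Bool Bool ℂ) :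
    (rots e M : Prog N np Q).queries = 0 := by
  rw [rots, Prog.queries_map]
  classical
  have := Prog.queries_flatMap_le (Finset.univ : Finset S).toList
    (fun i => (rot (M i) i : Prog N np S)) 0 (by simp)
  simpa using this

end Classical

/-! ### Registers and path sums -/

section Registers

variable {N np : ℕ} {S Q : Type} [Fintype S] [DecidableEq S] [Fintype Q] [DecidableEq Q]

theorem mem_pairWires_map {α : Type} (l : List α) (a b : α → Q) (q : Q) :
    q ∈ pairWires (l.map fun i => (a i, b i)) ↔ ∃ i ∈ l, q = a i ∨ q = b i := by
  simp [pairWires, List.mem_flatMap]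

theorem nodup_pairWires_map {α : Type} (l : List α) (hl : l.Nodup) (a b : α → Q)
    (ha : Function.Injective a) (hb : Function.Injective b) (hab : ∀ i j, a i ≠ b j) :
    (pairWires (l.map fun i => (a i, b i))).Nodup := by
  induction l with
  | nil => simp [pairWires]
  | cons i l ih =>
    rw [List.nodup_cons] at hl
    rw [List.map_cons, pairWires_cons, List.nodup_cons, List.nodup_cons, List.mem_cons,
      mem_pairWires_map, mem_pairWires_map]
    refine ⟨?_, ?_, ih hl.2⟩
    · rintro (h | ⟨j, hj, h | h⟩)
      · exact hab i i h
      · exact hl.1 (ha h ▸ hj)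
      · exact hab i j h
    · rintro ⟨j, hj, h | h⟩
      · exact hab j i h.symm
      · exact hl.1 (hb h ▸ hj)

/-- The pairs of corresponding wires of two registers. -/
abbrev regPairs {n : ℕ} (a b : Fin n → Q) : List (Q × Q) :=
  (List.finRange n).map fun i => (a i, b i)

theorem carry_regPairs {n : ℕ} (c : Bool) (a b : Fin n → Q) (s : BasisState Q) :
    carry c ((regPairs a b).map fun p => (s p.1, s p.2)) =
      decide (bitsVal (fun i => s (b i)) < bitsVal (fun i => s (a i)) + c.toNat) := by
  rw [← carry_ofFn, List.map_map, List.ofFn_eq_map]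
  rfl

theorem swapPerm_regPairs {n : ℕ} (a b : Fin n → Q) (ha : Function.Injective a)
    (hb : Function.Injective b) (hab : ∀ i j, a i ≠ b j) (i : Fin n) :
    swapPerm (regPairs a b) (a i) = b i ∧ swapPerm (regPairs a b) (b i) = a i :=
  swapPerm_of_mem _ (nodup_pairWires_map _ (List.nodup_finRange n) a b ha hb hab)
    (List.mem_map.2 ⟨i, List.mem_finRange i, rfl⟩)

/-- A sum over paths: prepare a superposition on some wires, act by a phased classical map, undo the
preparation. The time step and the off-diagonal block both have this shape, and their entries are
read off from this sum. -/
theorem sandwich_apply (e : S ↪ Q) (A B : Matrix (BasisState S) (BasisState S) ℂ)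
    (φ : BasisState Q → ℂ) (π : BasisState Q → BasisState Q) (r s : BasisState Q) :
    (embed e A * (mono φ π * embed e B)) r s =
      ∑ v, embed e A r (π (overwrite e v s)) * φ (overwrite e v s) * B v (s ∘ e) := by
  rw [← mul_assoc, Matrix.mul_apply]
  symm
  refine Fintype.sum_of_injective (fun v => overwrite e v s) (overwrite_injective e s) _ _ ?_ ?_
  · intro k hk
    rw [embed_apply_of_not, mul_zero]
    intro h
    exact hk ⟨k ∘ e, ((eq_overwrite_iff e _ k s).2 ⟨h, rfl⟩).symm⟩
  · intro v
    rw [embed_apply_of_agreeOff B (agreeOff_overwrite e v s), overwrite_comp, mul_mono_apply]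

/-- The Hadamard gate. -/
def had : Matrix Bool Bool ℂ :=
  Matrix.of fun r s => if r && s then -(1 / (Real.sqrt 2 : ℝ) : ℂ) else (1 / (Real.sqrt 2 : ℝ) : ℂ)

/-- Reflection with real first column `(c, √(1 - c²))`. -/
def refl (c : ℝ) : Matrix Bool Bool ℂ :=
  Matrix.of fun r s => if r then (if s then -(c : ℂ) else (Real.sqrt (1 - c ^ 2) : ℂ))
    else (if s then (Real.sqrt (1 - c ^ 2) : ℂ) else (c : ℂ))

theorem sqrt_two_inv_sq : (1 / (Real.sqrt 2 : ℝ) : ℂ) * (1 / (Real.sqrt 2 : ℝ) : ℂ) = 1 / 2 := by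
  rw [div_mul_div_comm, one_mul, ← Complex.ofReal_mul, Real.mul_self_sqrt (by norm_num)]
  norm_num

theorem had_mem : had ∈ Matrix.unitaryGroup Bool ℂ := by
  rw [Matrix.mem_unitaryGroup_iff]
  ext r s
  rw [Matrix.mul_apply, Fintype.sum_bool]
  have h := sqrt_two_inv_sq
  have h2 : (starRingEnd ℂ) (1 / (Real.sqrt 2 : ℝ) : ℂ) = 1 / (Real.sqrt 2 : ℝ) := by
    rw [map_div₀, Complex.conj_ofReal, map_one]
  simp only [Matrix.star_apply, had, Matrix.of_apply, RCLike.star_def]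
  generalize (1 / (Real.sqrt 2 : ℝ) : ℂ) = x at *
  cases r <;> cases s <;> simp [h2, h] <;> norm_num

theorem refl_mem (c : ℝ) (hc : c ^ 2 ≤ 1) : refl c ∈ Matrix.unitaryGroup Bool ℂ := by
  rw [Matrix.mem_unitaryGroup_iff]
  ext r s
  rw [Matrix.mul_apply, Fintype.sum_bool]
  have h : ((Real.sqrt (1 - c ^ 2) : ℝ) : ℂ) * (Real.sqrt (1 - c ^ 2) : ℝ) = 1 - (c : ℂ) ^ 2 := by
    rw [← Complex.ofReal_mul, Real.mul_self_sqrt (by linarith)]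
    push_cast; ring
  simp only [Matrix.star_apply, refl, Matrix.of_apply, RCLike.star_def]
  generalize ((Real.sqrt (1 - c ^ 2) : ℝ)) = x at *
  cases r <;> cases s <;> simp [h] <;> ring

theorem had_false (b : Bool) : had false b = 1 / (Real.sqrt 2 : ℝ) := by simp [had]
theorem had_false' (b : Bool) : had b false = 1 / (Real.sqrt 2 : ℝ) := by simp [had]

/-- The sign `(-1)^b`. -/
def sgn (b : Bool) : ℂ := if b then -1 else 1

/-- The phase of the controlled `Z` gate. -/
def cz (a b : Bool) : ℂ := sgn (a && b)

theorem norm_sgn (b : Bool) : ‖sgn b‖ = 1 := by cases b <;> simp [sgn]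

theorem norm_cz (a b : Bool) : ‖cz a b‖ = 1 := norm_sgn _

end Registers

/-! ### The wires of an elementary block -/

/-- Scratch wires: column register `y`, value register `z`, comparison register `r`, new time
register `t`, and single qubits. -/
inductive Scratch (N np p w : ℕ) : Type
  | y (i : Fin (indexQubits N))
  | z (k : ValueWires np)
  | r (i : Fin p)
  | t (i : Fin w)
  | b
  | rho
  | gre
  | gim
  | g
  | c
  deriving DecidableEq, Fintype

/-- The wires of an elementary block: system register, time register, control, scratch. -/
inductive Core (N np p w : ℕ) : Type
  | x (i : Fin (indexQubits N))
  | tm (i : Fin w)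
  | k
  | s (a : Scratch N np p w)
  deriving DecidableEq, Fintype

namespace Core

variable {N np p w : ℕ}

/-- All scratch wires hold `0`. -/
def Clean (s : BasisState (Core N np p w)) : Prop := ∀ a, s (.s a) = false

/-- The system and time registers. -/
def st : Fin (indexQubits N) ⊕ Fin w ↪ Core N np p w :=
  ⟨Sum.elim .x .tm, by rintro (i | i) (j | j) h <;> simp_all⟩

@[simp] theorem st_inl (i : Fin (indexQubits N)) : (st (.inl i) : Core N np p w) = .x i := rfl

@[simp] theorem st_inr (i : Fin w) : (st (.inr i) : Core N np p w) = .tm i := rfl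

theorem clean_eq_iff {r s : BasisState (Core N np p w)} (hr : Clean r) (hs : Clean s) :
    r = s ↔ r .k = s .k ∧ r ∘ st = s ∘ st := by
  constructor
  · rintro rfl; simp
  · rintro ⟨h1, h2⟩
    funext q
    rcases q with i | i | _ | a
    · exact congrFun h2 (.inl i)
    · exact congrFun h2 (.inr i)
    · exact h1
    · rw [hr a, hs a]

theorem clean_agreeOff_iff {r s : BasisState (Core N np p w)} (hr : Clean r) (hs : Clean s) :
    AgreeOff st r s ↔ r .k = s .k := by
  constructor
  · intro h
    exact h .k (by rintro ⟨i | i, h⟩ <;> simp at h)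
  · intro h q hq
    rcases q with i | i | _ | a
    · exact absurd ⟨.inl i, rfl⟩ hq
    · exact absurd ⟨.inr i, rfl⟩ hq
    · exact h
    · rw [hr a, hs a]

/-- With clean scratch wires before and after, `U` acts on the system and time registers as `Y` if
the control is set, and as the identity otherwise. -/
def IsBlock (U : Matrix (BasisState (Core N np p w)) (BasisState (Core N np p w)) ℂ)
    (Y : Matrix (BasisState (Fin (indexQubits N) ⊕ Fin w))
      (BasisState (Fin (indexQubits N) ⊕ Fin w)) ℂ) : Prop :=
  ∀ r s, Clean r → Clean s → U r s =
    if r .k = s .k then (if s .k then Y (r ∘ st) (s ∘ st) else (1 : Matrix _ _ ℂ) (r ∘ st) (s ∘ st))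
    else 0

/-! #### The time step block -/

/-- Wires in superposition in the time step block. -/
def eL : Fin w ⊕ Unit ↪ Core N np p w :=
  ⟨Sum.elim (fun i => .s (.t i)) fun _ => .s .b, by
    rintro (i | i) (j | j) h <;> simp_all⟩

/-- The time step block: uniform superposition of times, restricted to times later than the current
one, which they replace. -/
def timeStep : Prog N np (Core N np p w) :=
  rots eL (fun _ => had) ++
  (ctrlCompare .k (.s .c) (regPairs (fun i => .s (.t i)) .tm) (.s .g) ++
    (phase cz (.s .b) .k ++ phase cz (.s .b) (.s .g)) ++
    (ctrlCompare .k (.s .c) (regPairs (fun i => .s (.t i)) .tm) (.s .g)).inverse) ++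
  cswaps .k (regPairs (fun i => .s (.t i)) .tm) ++
  rots eL (fun _ => had)

/-- Strictly lower triangular summation over times. -/
def timeMat (N w : ℕ) : Matrix (BasisState (Fin (indexQubits N) ⊕ Fin w))
    (BasisState (Fin (indexQubits N) ⊕ Fin w)) ℂ :=
  Matrix.of fun r s => if r ∘ Sum.inl = s ∘ Sum.inl ∧ bitsVal (s ∘ Sum.inr) < bitsVal (r ∘ Sum.inr)
    then 1 / 2 ^ w else 0

/-- The state with the superposed wires of the time step block set. -/
def setL (t : Fin w → Bool) (b : Bool) (s : BasisState (Core N np p w)) :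
    BasisState (Core N np p w) := fun q =>
  match q with
  | .s (.t i) => t i
  | .s .b => b
  | q => s q

theorem overwrite_eL (t : Fin w → Bool) (b : Bool) (s : BasisState (Core N np p w)) :
    overwrite eL (Sum.elim t fun _ => b) s = setL t b s := by
  symm
  rw [eq_overwrite_iff]
  constructor
  · intro q hq
    rcases q with i | i | _ | (_ | _ | _ | i | _ | _ | _ | _ | _ | _) <;> try rfl
    · exact absurd ⟨.inl i, rfl⟩ hq
    · exact absurd ⟨.inr (), rfl⟩ hq
  · funext i
    rcases i with i | i <;> rfl

theorem tensor_had_left {S : Type} [Fintype S] {r v : BasisState S} (hr : ∀ i, r i = false) :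
    tensor (fun _ => had) r v = (1 / (Real.sqrt 2 : ℝ) : ℂ) ^ Fintype.card S := by
  simp [tensor, hr, had_false, Finset.prod_const]

theorem tensor_had_right {S : Type} [Fintype S] {r v : BasisState S} (hr : ∀ i, r i = false) :
    tensor (fun _ => had) v r = (1 / (Real.sqrt 2 : ℝ) : ℂ) ^ Fintype.card S := by
  simp [tensor, hr, had_false', Finset.prod_const]

theorem sqrt_two_inv_pow (n : ℕ) : (1 / (Real.sqrt 2 : ℝ) : ℂ) ^ n * (1 / (Real.sqrt 2 : ℝ) : ℂ) ^ n
    = 1 / 2 ^ n := by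
  rw [← mul_pow, sqrt_two_inv_sq, div_pow, one_pow]

end Core

namespace Core

variable {N np p w : ℕ}

/-- Exchange of the two time registers if the control is set. -/
def swapTime (s : BasisState (Core N np p w)) : BasisState (Core N np p w) := fun q =>
  match q with
  | .tm i => if s .k then s (.s (.t i)) else s (.tm i)
  | .s (.t i) => if s .k then s (.tm i) else s (.s (.t i))
  | q => s q

theorem swapTime_performs (D : SparseData N np) :
    (cswaps .k (regPairs (fun i => .s (.t i)) .tm) : Prog N np (Core N np p w)).Performs D
      swapTime := by
  have hinj1 : Function.Injective fun i : Fin w => (Core.s (.t i) : Core N np p w) :=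
    fun i j h => by simpa using h
  have hinj2 : Function.Injective (Core.tm : Fin w → Core N np p w) := fun i j h => by simpa using h
  have hgt : ∀ i j : Fin w, (Core.s (.t i) : Core N np p w) ≠ .tm j := fun i j => by simp
  have hnd := nodup_pairWires_map (List.finRange w) (List.nodup_finRange w) _ _ hinj1 hinj2 hgt
  have hsp1 := swapPerm_regPairs _ _ hinj1 hinj2 hgt
  have hsp2 : ∀ q : Core N np p w, (∀ i, q ≠ .s (.t i)) → (∀ i, q ≠ .tm i) →
      swapPerm (regPairs (fun i : Fin w => (Core.s (.t i) : Core N np p w)) .tm) q = q := by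
    intro q h1 h2
    refine swapPerm_of_notMem _ ?_
    rw [mem_pairWires_map]
    rintro ⟨i, -, h | h⟩
    exacts [h1 i h, h2 i h]
  refine (cswaps_performs (Q := Core N np p w) D .k (regPairs (fun i => .s (.t i)) .tm) (by
      simp only [List.nodup_cons, mem_pairWires_map]
      exact ⟨by simp, hnd⟩)).congr fun s q => ?_
  rcases q with i | i | _ | (_ | _ | _ | i | _ | _ | _ | _ | _ | _)
  case tm => rw [(hsp1 i).2]; rfl
  case s.t => rw [(hsp1 i).1]; rfl
  all_goals
    rw [hsp2 _ (by simp) (by simp), ite_self]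
    rfl

theorem timeStep_eval (D : SparseData N np) :
    (timeStep : Prog N np (Core N np p w)).eval D =
      embed eL (tensor fun _ => had) *
        (mono (fun s => cz (s (.s .b)) (s .k) * cz (s (.s .b)) ((s (.s .g)).xor (s .k &&
            decide (bitsVal (fun i => s (.tm i)) <
              bitsVal (fun i => s (.s (.t i))) + (s (.s .c)).toNat))))
          swapTime * embed eL (tensor fun _ => had)) := by
  have hnd := nodup_pairWires_map (List.finRange w) (List.nodup_finRange w)
    (fun i : Fin w => (Core.s (.t i) : Core N np p w)) .tm (fun i j h => by simpa using h)
    (fun i j h => by simpa using h) (fun i j => by simp)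
  have hcmp := ctrlCompare_performs (Q := Core N np p w) D .k (.s .c)
    (regPairs (fun i => .s (.t i)) .tm) (.s .g) (by
      simp only [List.nodup_cons, List.mem_cons, not_or, mem_pairWires_map]
      exact ⟨⟨by simp, by simp, by simp⟩, ⟨by simp, by simp⟩, by simp, hnd⟩)
  have hph : Prog.eval (phase cz (.s .b) .k ++ phase cz (.s .b) (.s .g) :
      Prog N np (Core N np p w)) D = Matrix.diagonal fun s =>
        cz (s (.s .b)) (s (.s .g)) * cz (s (.s .b)) (s .k) := by
    rw [Prog.eval_append, phase_eval D _ norm_cz (by simp), phase_eval D _ norm_cz (by simp),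
      Matrix.diagonal_mul_diagonal]
  rw [timeStep, Prog.eval_append, Prog.eval_append, Prog.eval_append,
    Prog.eval_conj_diagonal hcmp hph, rots_eval D eL _ fun _ => had_mem, swapTime_performs,
    diagonal_eq_mono, ← mul_assoc (mono 1 _), mono_mul_mono]
  congr 2
  congr 1
  funext s
  rw [carry_regPairs]
  simp [mul_comm]

/-- This is how unwanted paths are deleted without measurement: a qubit in uniform superposition
picks up a sign on them, and its two values cancel. -/
theorem sum_sgn_and (b : Bool) : ∑ x : Bool, sgn (x && b) = if b then 0 else 2 := by
  rw [Fintype.sum_bool]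
  cases b <;> simp [sgn] <;> norm_num

theorem comp_st_eq_iff (r s : BasisState (Core N np p w)) :
    r ∘ st = s ∘ st ↔ (r ∘ st) ∘ Sum.inl = (s ∘ st) ∘ Sum.inl ∧
      (r ∘ st) ∘ Sum.inr = (s ∘ st) ∘ Sum.inr := by
  constructor
  · intro h
    rw [h]; simp
  · rintro ⟨h1, h2⟩
    funext i
    rcases i with i | i
    exacts [congrFun h1 i, congrFun h2 i]

/-- With the control set, each path picks a time t; those with t not after the current time cancel
through qubit `b`. The swap puts t into the time register, and the final Hadamard layer forgets the
old time. With the control off there is neither phase nor swap, and the sum over t gives 1. -/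
theorem timeStep_isBlock (D : SparseData N np) :
    IsBlock ((timeStep : Prog N np (Core N np p w)).eval D) (timeMat N w) := by
  intro r s hr hs
  rw [timeStep_eval, sandwich_apply]
  have hsum : ∀ F : BasisState (Fin w ⊕ Unit) → ℂ,
      ∑ v, F v = ∑ t : Fin w → Bool, ∑ b : Bool, F (Sum.elim t fun _ => b) := by
    intro F
    rw [← (Equiv.sumArrowEquivProdArrow (Fin w) Unit Bool).symm.sum_comp, Fintype.sum_prod_type]
    refine Finset.sum_congr rfl fun t _ => ?_
    rw [← (Equiv.funUnique Unit Bool).symm.sum_comp]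
    rfl
  rw [hsum]
  have hsL : ∀ i, (s ∘ eL) i = false := by
    rintro (i | i)
    all_goals exact hs _
  have hrL : ∀ i, (r ∘ eL) i = false := by
    rintro (i | i)
    all_goals exact hr _
  have hc : s (.s .c) = false := hs _
  have hg : s (.s .g) = false := hs _
  have key : ∀ (t : Fin w → Bool) (b : Bool), AgreeOff eL r (swapTime (setL t b s)) ↔
      r .k = s .k ∧ (r ∘ st) ∘ Sum.inl = (s ∘ st) ∘ Sum.inl ∧
        ((r ∘ st) ∘ Sum.inr = if s .k then t else (s ∘ st) ∘ Sum.inr) := by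
    intro t b
    have hk : setL t b s .k = s .k := rfl
    have htm : ∀ i, swapTime (setL t b s) (.tm i) =
        (if s .k then t else (s ∘ st) ∘ Sum.inr) i := by
      intro i
      simp only [swapTime, hk]
      split_ifs <;> rfl
    constructor
    · intro h
      refine ⟨?_, ?_, ?_⟩
      · exact h .k (by rintro ⟨i | i, h⟩ <;> cases h)
      · funext i
        exact h (.x i) (by rintro ⟨i | i, h⟩ <;> cases h)
      · funext i
        rw [← htm]
        exact h (.tm i) (by rintro ⟨i | i, h⟩ <;> cases h)
    · rintro ⟨h1, h2, h3⟩ q hq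
      rcases q with i | i | _ | (_ | _ | _ | i | _ | _ | _ | _ | _ | _)
      case x => exact congrFun h2 i
      case tm => rw [htm]; exact congrFun h3 i
      case k => exact h1
      case s.t => exact absurd ⟨.inl i, rfl⟩ hq
      case s.b => exact absurd ⟨.inr (), rfl⟩ hq
      all_goals
        rw [hr]
        exact (hs _).symm
  have hE : ∀ (t : Fin w → Bool) (b : Bool), embed eL (tensor fun _ => had) r
      (swapTime (setL t b s)) =
      if r .k = s .k ∧ (r ∘ st) ∘ Sum.inl = (s ∘ st) ∘ Sum.inl ∧
        ((r ∘ st) ∘ Sum.inr = if s .k then t else (s ∘ st) ∘ Sum.inr)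
      then (1 / (Real.sqrt 2 : ℝ) : ℂ) ^ (w + 1) else 0 := by
    intro t b
    by_cases h : AgreeOff eL r (swapTime (setL t b s))
    · rw [embed_apply_of_agreeOff _ h, tensor_had_left hrL, if_pos ((key t b).1 h)]
      simp
    · rw [embed_apply_of_not _ h, if_neg fun h' => h ((key t b).2 h')]
  have hphase : ∀ (t : Fin w → Bool) (b : Bool),
      cz (setL t b s (.s .b)) (setL t b s .k) * cz (setL t b s (.s .b)) ((setL t b s (.s .g)).xor
        (setL t b s .k && decide (bitsVal (fun i => setL t b s (.tm i)) <
          bitsVal (fun i => setL t b s (.s (.t i))) + (setL t b s (.s .c)).toNat))) =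
      sgn (b && (s .k && !decide (bitsVal ((s ∘ st) ∘ Sum.inr) < bitsVal t))) := by
    intro t b
    have e1 : setL t b s (.s .b) = b := rfl
    have e2 : setL t b s .k = s .k := rfl
    have e3 : setL t b s (.s .g) = false := hg
    have e4 : setL t b s (.s .c) = false := hc
    have e5 : (fun i => setL t b s (.tm i)) = (s ∘ st) ∘ Sum.inr := rfl
    have e6 : (fun i => setL t b s (.s (.t i))) = t := rfl
    rw [e1, e2, e3, e4, e5, e6]
    simp only [Bool.toNat_false, add_zero]
    generalize decide (bitsVal ((s ∘ st) ∘ Sum.inr) < bitsVal t) = d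
    cases b <;> cases s .k <;> cases d <;> simp [cz, sgn]
  simp only [overwrite_eL, hE, tensor_had_right hsL, hphase]
  have hcard : Fintype.card (Fin w ⊕ Unit) = w + 1 := by simp
  have hpow := sqrt_two_inv_pow (w + 1)
  -- The two Hadamard layers on w + 1 wires give 2^{-(w+1)}, and the sum over `b` is 2 on surviving
  -- paths, which leaves 2^{-w}.
  have hinner : ∀ (c : Prop) [Decidable c] (d : Bool), ∑ b : Bool,
      (if c then (1 / (Real.sqrt 2 : ℝ) : ℂ) ^ (w + 1) else 0) * sgn (b && d) *
        (1 / (Real.sqrt 2 : ℝ) : ℂ) ^ Fintype.card (Fin w ⊕ Unit) =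
      if c then (if d then 0 else 1 / 2 ^ w) else 0 := by
    intro c _ d
    rw [hcard, ← Finset.sum_mul, ← Finset.mul_sum, sum_sgn_and, mul_right_comm]
    split_ifs <;> simp only [hpow, mul_zero, zero_mul]
    rw [pow_succ]
    field_simp
  simp only [hinner]
  by_cases h1 : r .k = s .k
  swap
  · simp [h1]
  by_cases h2 : (r ∘ st) ∘ Sum.inl = (s ∘ st) ∘ Sum.inl
  swap
  · have : ¬ r ∘ st = s ∘ st := fun h => h2 (by rw [h])
    simp [h2, timeMat, this]
  by_cases hk : s .k = true
  · simp only [hk, h1, h2, if_true, timeMat, Matrix.of_apply, true_and, Bool.true_and]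
    rw [Finset.sum_eq_single ((r ∘ st) ∘ Sum.inr)]
    · by_cases h3 : bitsVal ((s ∘ st) ∘ Sum.inr) < bitsVal ((r ∘ st) ∘ Sum.inr) <;> simp [h3]
    · intro t _ ht
      rw [if_neg (Ne.symm ht)]
    · simp
  · simp only [hk, h1, h2, Matrix.one_apply, comp_st_eq_iff r s, true_and, if_true,
      Bool.false_and, if_false, Bool.false_eq_true]
    by_cases h3 : (r ∘ st) ∘ Sum.inr = (s ∘ st) ∘ Sum.inr <;> simp [h3]

end Core

/-! ### Comparison and exchange of whole registers, and products of tensor operators -/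

theorem ctrlCompare_regs {N np n : ℕ} {Q : Type} [Fintype Q] [DecidableEq Q]
    (D : SparseData N np) (k c g : Q) (a b : Fin n → Q) (ha : Function.Injective a)
    (hb : Function.Injective b) (hab : ∀ i j, a i ≠ b j) (hkg : k ≠ g) (hkc : k ≠ c) (hgc : g ≠ c)
    (hk : ∀ i, k ≠ a i ∧ k ≠ b i) (hg : ∀ i, g ≠ a i ∧ g ≠ b i) (hc : ∀ i, c ≠ a i ∧ c ≠ b i) :
    (ctrlCompare k c (regPairs a b) g : Prog N np Q).Performs D fun s =>
      Function.update s g ((s g).xor (s k && decide (bitsVal (fun i => s (b i)) <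
        bitsVal (fun i => s (a i)) + (s c).toNat))) := by
  have hnd := nodup_pairWires_map (List.finRange n) (List.nodup_finRange n) a b ha hb hab
  have h : ∀ q, (∀ i, q ≠ a i ∧ q ≠ b i) → q ∉ pairWires (regPairs a b) := by
    intro q hq hm
    rw [mem_pairWires_map] at hm
    obtain ⟨i, -, h | h⟩ := hm
    exacts [(hq i).1 h, (hq i).2 h]
  refine (ctrlCompare_performs D k c (regPairs a b) g ?_).congr fun s q => ?_
  · simp only [List.nodup_cons, List.mem_cons, not_or]
    exact ⟨⟨hkg, hkc, h k hk⟩, ⟨hgc, h g hg⟩, h c hc, hnd⟩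
  · rw [carry_regPairs]

theorem cswaps_regs {N np n : ℕ} {Q : Type} [Fintype Q] [DecidableEq Q]
    (D : SparseData N np) (k : Q) (a b : Fin n → Q) (ha : Function.Injective a)
    (hb : Function.Injective b) (hab : ∀ i j, a i ≠ b j) (hk : ∀ i, k ≠ a i ∧ k ≠ b i)
    (π : BasisState Q → BasisState Q) (h1 : ∀ s i, π s (a i) = if s k then s (b i) else s (a i))
    (h2 : ∀ s i, π s (b i) = if s k then s (a i) else s (b i))
    (h3 : ∀ s q, (∀ i, q ≠ a i ∧ q ≠ b i) → π s q = s q) :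
    (cswaps k (regPairs a b) : Prog N np Q).Performs D π := by
  have hnd := nodup_pairWires_map (List.finRange n) (List.nodup_finRange n) a b ha hb hab
  have h : ∀ q, (∀ i, q ≠ a i ∧ q ≠ b i) → q ∉ pairWires (regPairs a b) := by
    intro q hq hm
    rw [mem_pairWires_map] at hm
    obtain ⟨i, -, h | h⟩ := hm
    exacts [(hq i).1 h, (hq i).2 h]
  have hsp1 := swapPerm_regPairs _ _ ha hb hab
  refine (cswaps_performs (Q := Q) D k (regPairs a b) (List.nodup_cons.2 ⟨h k hk, hnd⟩)).congr
    fun s q => ?_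
  by_cases hqa : ∃ i, q = a i
  · obtain ⟨i, rfl⟩ := hqa
    rw [(hsp1 i).1, h1]
  · by_cases hqb : ∃ i, q = b i
    · obtain ⟨i, rfl⟩ := hqb
      rw [(hsp1 i).2, h2]
    · have hq : ∀ i, q ≠ a i ∧ q ≠ b i := fun i => ⟨fun h => hqa ⟨i, h⟩, fun h => hqb ⟨i, h⟩⟩
      rw [h3 s q hq, swapPerm_of_notMem _ (h q hq), ite_self]

theorem tensor_mul {S : Type} [Fintype S] [DecidableEq S] (M M' : S → Matrix Bool Bool ℂ) :
    tensor M * tensor M' = tensor fun i => M i * M' i := by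
  ext r s
  rw [Matrix.mul_apply]
  simp only [tensor, Matrix.of_apply, Matrix.mul_apply]
  rw [Finset.prod_univ_sum]
  simp only [Fintype.piFinset_univ, Finset.prod_mul_distrib]

theorem had_mul_had : had * had = 1 := by
  have h := Matrix.mem_unitaryGroup_iff.1 had_mem
  have : star had = had := by
    ext r s
    simp only [Matrix.star_apply, had, Matrix.of_apply, RCLike.star_def]
    cases r <;> cases s <;> simp
  rwa [this] at h

theorem refl_mul_refl (c : ℝ) (hc : c ^ 2 ≤ 1) : refl c * refl c = 1 := by
  have h := Matrix.mem_unitaryGroup_iff.1 (refl_mem c hc)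
  have : star (refl c) = refl c := by
    ext r s
    simp only [Matrix.star_apply, refl, Matrix.of_apply, RCLike.star_def]
    cases r <;> cases s <;> simp
  rwa [this] at h

theorem tensor_one {S : Type} [Fintype S] [DecidableEq S] :
    tensor (fun _ : S => (1 : Matrix Bool Bool ℂ)) = 1 := by
  ext r s
  simp only [tensor, Matrix.of_apply, Matrix.one_apply]
  rw [Finset.prod_ite_zero]
  simp [funext_iff]

namespace Core

variable {N np p w : ℕ}

/-! #### The block of the off-diagonal part -/

/-- The wires of a position query. -/
def eF : PositionWires N ↪ Core N np p w :=
  ⟨Sum.elim .x fun i => .s (.y i), by rintro (i | i) (j | j) h <;> simp_all⟩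

/-- The wires of an entry query. -/
def eH : EntryWires N np ↪ Core N np p w :=
  ⟨Sum.elim (Sum.elim .x fun i => .s (.y i)) fun v => .s (.z v), by
    rintro ((i | i) | v) ((j | j) | l) h <;> simp_all⟩

/-- Wires in superposition. -/
def eB : Fin (indexQubits N) ⊕ (Fin p ⊕ Bool) ↪ Core N np p w :=
  ⟨Sum.elim (fun i => .s (.y i)) (Sum.elim (fun i => .s (.r i)) fun i => .s (cond i .rho .b)), by
    rintro (i | i | i) (j | j | j) h
    all_goals try cases i
    all_goals try cases j
    all_goals simp_all⟩

/-- The system register. -/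
abbrev xr (s : BasisState (Core N np p w)) : BasisState (Fin (indexQubits N)) := fun i => s (.x i)

/-- The column register. -/
abbrev yr (s : BasisState (Core N np p w)) : BasisState (Fin (indexQubits N)) :=
  fun i => s (.s (.y i))

/-- Effect of a position query. -/
def colMap (D : SparseData N np) (s : BasisState (Core N np p w)) : BasisState (Core N np p w) :=
  fun q => match q with
  | .s (.y i) => columnBits D (xr s) (yr s) i
  | q => s q

/-- Effect of an entry query. -/
def entMap (D : SparseData N np) (s : BasisState (Core N np p w)) : BasisState (Core N np p w) :=
  fun q => match q with
  | .s (.z v) => (s (.s (.z v))).xor (entryBits D (xr s) (yr s) v)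
  | q => s q

/-- Exchange of system and column register if the control is set. -/
def swapXY (s : BasisState (Core N np p w)) : BasisState (Core N np p w) := fun q =>
  match q with
  | .x i => if s .k then s (.s (.y i)) else s (.x i)
  | .s (.y i) => if s .k then s (.x i) else s (.s (.y i))
  | q => s q

theorem colMap_performs (D : SparseData N np) :
    Prog.Performs ([.queryPosition false eF] : Prog N np (Core N np p w)) D (colMap D) := by
  refine (queryPosition_performs D eF).congr fun s q => ?_
  revert q
  rw [← funext_iff, eq_overwrite_iff, positionMap_eq]
  constructor
  · intro q hq
    rcases q with i | i | _ | (i | _ | _ | _ | _ | _ | _ | _ | _ | _) <;> try rfl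
    exact absurd ⟨.inr i, rfl⟩ hq
  · funext i
    rcases i with i | i <;> rfl

theorem colMap_inv_performs (D : SparseData N np) :
    Prog.Performs ([.queryPosition true eF] : Prog N np (Core N np p w)) D (colMap D.inv) := by
  refine (queryPosition_inv_performs D eF).congr fun s q => ?_
  revert q
  rw [← funext_iff, eq_overwrite_iff, positionMap_eq]
  constructor
  · intro q hq
    rcases q with i | i | _ | (i | _ | _ | _ | _ | _ | _ | _ | _ | _) <;> try rfl
    exact absurd ⟨.inr i, rfl⟩ hq
  · funext i
    rcases i with i | i <;> rfl

theorem entMap_performs (D : SparseData N np) :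
    Prog.Performs ([.queryEntry false eH] : Prog N np (Core N np p w)) D (entMap D) := by
  refine (queryEntry_performs D eH).congr fun s q => ?_
  revert q
  rw [← funext_iff, eq_overwrite_iff, entryMap_eq]
  constructor
  · intro q hq
    rcases q with i | i | _ | (_ | v | _ | _ | _ | _ | _ | _ | _ | _) <;> try rfl
    exact absurd ⟨.inr v, rfl⟩ hq
  · funext i
    rcases i with (i | i) | i <;> rfl

theorem swapXY_performs (D : SparseData N np) :
    (cswaps .k (regPairs .x fun i => .s (.y i)) : Prog N np (Core N np p w)).Performs D swapXY := by
  refine cswaps_regs D _ _ _ (fun i j h => by simpa using h) (fun i j h => by simpa using h)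
    (fun i j => by simp) (fun i => by simp) _ (fun _ _ => rfl) (fun _ _ => rfl) ?_
  intro s q hq
  rcases q with i | i | _ | (i | _ | _ | _ | _ | _ | _ | _ | _ | _) <;> try rfl
  · exact absurd rfl (hq i).1
  · exact absurd rfl (hq i).2

section Off

variable (hp : p + 1 ≤ np)

/-- The low wires of the real part (`false`) or imaginary part (`true`) of the value register. -/
abbrev zlow (i : Bool) (j : Fin (p + 1)) : Core N np (p + 1) w := .s (.z (i, Fin.castLE hp j))

/-- Compares the entry of the matrix with a uniformly distributed number, and the indices with each
other. -/
def judge : Prog N np (Core N np (p + 1) w) :=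
  [.queryEntry false eH] ++ notGate (zlow hp false (Fin.last p)) ++
    notGate (zlow hp true (Fin.last p)) ++
    ctrlCompare .k (.s .c) (regPairs (zlow hp false) fun i => .s (.r i)) (.s .gre) ++
    ctrlCompare .k (.s .c) (regPairs (zlow hp true) fun i => .s (.r i)) (.s .gim) ++
    ctrlCompare .k (.s .c) (regPairs .x fun i => .s (.y i)) (.s .g) ++
    ctrlCompare .k (.s .c) (regPairs (fun i => .s (.y i)) .x) (.s .g)

/-- Phase of the comparison bits of real and imaginary part. -/
def bitPhase (a b : Bool) : ℂ := (-sgn a - Complex.I * sgn b) / (-1 - Complex.I)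

/-- Phase of the control. -/
def ctrlPhase (k : Bool) : ℂ := if k then (Complex.I - 1) / (Real.sqrt 2 : ℝ) else 1

/-- The phases of the block of the off-diagonal part. -/
def judgePhases : Prog N np (Core N np (p + 1) w) :=
  phase bitPhase (.s .gre) (.s .gim) ++ phase₁ ctrlPhase .k ++ phase cz (.s .b) .k ++
    phase cz (.s .b) (.s .g) ++ phase cz .k (.s .rho)

/-- The low bits of an entry, as an unsigned number in offset binary. -/
def offsetVal (D : SparseData N np) (x y : BasisState (Fin (indexQubits N))) (i : Bool) : ℕ :=
  bitsVal fun j : Fin (p + 1) =>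
    (entryBits D x y (i, Fin.castLE hp j)).xor (decide (j = Fin.last p))

theorem norm_one_add_I : ‖(-1 - Complex.I : ℂ)‖ = Real.sqrt 2 := by
  rw [Complex.norm_def]; congr 1; simp [Complex.normSq]; norm_num

/-- Up to a fixed phase this is (±1 ± i)/√2: one phase gate carries the signs for real and imaginary
part together. This is the origin of the √2 in `scale`. -/
theorem norm_bitPhase (a b : Bool) : ‖bitPhase a b‖ = 1 := by
  rw [bitPhase, norm_div, norm_one_add_I]
  have : ‖-sgn a - Complex.I * sgn b‖ = Real.sqrt 2 := by
    rw [Complex.norm_def]; congr 1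
    cases a <;> cases b <;> simp [Complex.normSq, sgn] <;> norm_num
  rw [this, div_self (by positivity)]

theorem norm_ctrlPhase (k : Bool) : ‖ctrlPhase k‖ = 1 := by
  cases k
  · simp [ctrlPhase]
  · have : ‖(Complex.I - 1 : ℂ)‖ = Real.sqrt 2 := by
      rw [Complex.norm_def]; congr 1; simp [Complex.normSq]; norm_num
    simp only [ctrlPhase, if_true, norm_div, this, Complex.norm_real, Real.norm_eq_abs]
    rw [abs_of_nonneg (Real.sqrt_nonneg 2), div_self (by positivity)]

/-- The diagonal of the phases that `judge` and `judgePhases` produce. -/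
theorem judge_eval (D : SparseData N np) :
    ∃ φ : BasisState (Core N np (p + 1) w) → ℂ,
      Prog.eval (judge hp ++ judgePhases ++ (judge hp).inverse) D = Matrix.diagonal φ ∧
      ∀ s, (∀ v, s (.s (.z v)) = false) → s (.s .gre) = false → s (.s .gim) = false →
        s (.s .g) = false → s (.s .c) = false →
        φ s = if s .k then
          (-Complex.I / (Real.sqrt 2 : ℝ) *
            (sgn (!decide (bitsVal (fun i => s (.s (.r i))) < offsetVal hp D (xr s) (yr s) false)) +
            Complex.I * sgn (!decide (bitsVal (fun i => s (.s (.r i))) <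
              offsetVal hp D (xr s) (yr s) true)))) *
          sgn (s (.s .b) && decide (xr s = yr s)) * sgn (s (.s .rho)) else 1 := by
  have hz : ∀ i, Function.Injective (zlow (N := N) (w := w) hp i) := by
    intro i j j' h
    simpa using h
  have hr : Function.Injective fun i => (Core.s (.r i) : Core N np (p + 1) w) :=
    fun i j h => by simpa using h
  have hx : Function.Injective (Core.x : _ → Core N np (p + 1) w) := fun i j h => by simpa using h
  have hy : Function.Injective fun i => (Core.s (.y i) : Core N np (p + 1) w) :=
    fun i j h => by simpa using h
  have P := ((((((entMap_performs (p := p + 1) (w := w) D).append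
    (notGate_performs D (zlow hp false (Fin.last p)))).append
    (notGate_performs D (zlow hp true (Fin.last p)))).append
    (ctrlCompare_regs D .k (.s .c) (.s .gre) (zlow hp false) (fun i => .s (.r i)) (hz _) hr
      (by simp) (by simp) (by simp) (by simp) (by simp) (by simp) (by simp))).append
    (ctrlCompare_regs D .k (.s .c) (.s .gim) (zlow hp true) (fun i => .s (.r i)) (hz _) hr
      (by simp) (by simp) (by simp) (by simp) (by simp) (by simp) (by simp))).append
    (ctrlCompare_regs D .k (.s .c) (.s .g) .x (fun i => .s (.y i)) hx hy
      (by simp) (by simp) (by simp) (by simp) (by simp) (by simp) (by simp))).append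
    (ctrlCompare_regs D .k (.s .c) (.s .g) (fun i => .s (.y i)) .x hy hx
      (by simp) (by simp) (by simp) (by simp) (by simp) (by simp) (by simp))
  have hW : Prog.eval (judgePhases : Prog N np (Core N np (p + 1) w)) D =
      Matrix.diagonal fun s => cz (s .k) (s (.s .rho)) * (cz (s (.s .b)) (s (.s .g)) *
        (cz (s (.s .b)) (s .k) * (ctrlPhase (s .k) * bitPhase (s (.s .gre)) (s (.s .gim))))) := by
    rw [judgePhases, Prog.eval_append, Prog.eval_append, Prog.eval_append, Prog.eval_append,
      phase_eval D _ norm_cz (by simp), phase_eval D _ norm_cz (by simp),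
      phase_eval D _ norm_cz (by simp), phase₁_eval D _ norm_ctrlPhase,
      phase_eval D _ norm_bitPhase (by simp)]
    simp only [Matrix.diagonal_mul_diagonal]
  refine ⟨_, Prog.eval_conj_diagonal P hW, ?_⟩
  intro s h1 h2 h3 h4 h5
  have hoff : ∀ i, bitsVal (fun j : Fin (p + 1) => (entryBits D (xr s) (yr s)
      (i, Fin.castLE hp j)).xor (decide (j = Fin.last p))) = offsetVal hp D (xr s) (yr s) i :=
    fun _ => rfl
  have hz0 : ∀ v, entMap D s (.s (.z v)) = entryBits D (xr s) (yr s) v := by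
    intro v
    simp [entMap, h1]
  have e1 : ∀ i, entMap D s (.x i) = s (.x i) := fun _ => rfl
  have e2 : ∀ i, entMap D s (.s (.y i)) = s (.s (.y i)) := fun _ => rfl
  have e3 : ∀ i, entMap D s (.s (.r i)) = s (.s (.r i)) := fun _ => rfl
  have e4 : entMap D s .k = s .k := rfl
  have e5 : entMap D s (.s .b) = s (.s .b) := rfl
  have e6 : entMap D s (.s .rho) = s (.s .rho) := rfl
  have e7 : entMap D s (.s .gre) = false := h2
  have e8 : entMap D s (.s .gim) = false := h3
  have e9 : entMap D s (.s .g) = false := h4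
  have e10 : entMap D s (.s .c) = false := h5
  simp only [Function.comp]
  simp [Function.update_apply, hz0, e1, e2, e3, e4, e5, e6, e7, e8, e9, e10]
  have hite : ∀ i, (bitsVal fun j : Fin (p + 1) =>
      if j = Fin.last p then !entryBits D (xr s) (yr s) (i, Fin.castLE hp (Fin.last p))
      else entryBits D (xr s) (yr s) (i, Fin.castLE hp j)) = offsetVal hp D (xr s) (yr s) i := by
    intro i
    rw [← hoff]
    congr 1
    funext j
    by_cases hj : j = Fin.last p <;> simp [hj]
  -- Two strict comparisons written to the same wire decide inequality of the registers.
  have hxy : (decide (bitsVal (yr s) < bitsVal (xr s)) ^^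
      decide (bitsVal (xr s) < bitsVal (yr s))) = !decide (xr s = yr s) := by
    have hd : decide (xr s = yr s) = decide (bitsVal (xr s) = bitsVal (yr s)) :=
      decide_eq_decide.2 bitsVal_injective.eq_iff.symm
    rw [hd]
    rcases lt_trichotomy (bitsVal (xr s)) (bitsVal (yr s)) with h | h | h
    · simp [h, h.ne, h.le]
    · simp [h]
    · simp [h, h.ne', h.le]
  have hph : ∀ a b : Bool, ctrlPhase true * bitPhase a b =
      -Complex.I / (Real.sqrt 2 : ℝ) * (sgn (!a) + Complex.I * sgn (!b)) := by
    intro a b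
    have h0 : (-1 - Complex.I : ℂ) ≠ 0 := by
      intro h
      simpa using congrArg Complex.re h
    have h2 : ((Real.sqrt 2 : ℝ) : ℂ) ≠ 0 := by norm_num
    have hn : ∀ a, sgn (!a) = -sgn a := by intro a; cases a <;> simp [sgn]
    rw [ctrlPhase, if_pos rfl, bitPhase, hn, hn]
    field_simp
    linear_combination (sgn a + Complex.I * sgn b) * Complex.I_sq
  rw [hite, hite]
  -- With the control off every comparison bit stays 0, and `bitPhase` and `ctrlPhase` are
  -- normalized to be 1 there. Hence the oracle queries themselves need no control.
  cases hk : s .k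
  · have h0 : (-1 - Complex.I : ℂ) ≠ 0 := by
      intro h
      simpa using congrArg Complex.re h
    simp [cz, sgn, ctrlPhase, bitPhase, h0]
  · simp only [Bool.true_and, if_true, hph, hxy]
    generalize -Complex.I / (Real.sqrt 2 : ℝ) * _ = X
    generalize decide (xr s = yr s) = d
    cases s (.s .b) <;> cases s (.s .rho) <;> cases d <;> simp [cz, sgn]

end Off

end Core

/-! ### Path sum for the off-diagonal block -/

namespace Core

variable {N np p w : ℕ}

/-- The gates that prepare the superposition in the off-diagonal block. -/
def prepB (N p σ : ℕ) (c : ℝ) : Fin (indexQubits N) ⊕ (Fin p ⊕ Bool) → Matrix Bool Bool ℂ :=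
  Sum.elim (fun i => if (i : ℕ) < σ then had else 1)
    (Sum.elim (fun _ => had) fun i => if i then refl c else had)

theorem prepB_mem (σ : ℕ) (c : ℝ) (hc : c ^ 2 ≤ 1) (i : Fin (indexQubits N) ⊕ (Fin p ⊕ Bool)) :
    prepB N p σ c i ∈ Matrix.unitaryGroup Bool ℂ := by
  rcases i with i | i | i
  · simp only [prepB, Sum.elim_inl]
    split_ifs
    exacts [had_mem, one_mem _]
  · exact had_mem
  · cases i
    exacts [had_mem, refl_mem c hc]

/-- All preparation gates are involutions, so the same gates serve to prepare and to unprepare, and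
they cancel when the control is off. -/
theorem prepB_mul_self (σ : ℕ) (c : ℝ) (hc : c ^ 2 ≤ 1) :
    tensor (prepB N p σ c) * tensor (prepB N p σ c) = 1 := by
  rw [tensor_mul, ← tensor_one]
  congr 1
  funext i
  rcases i with i | i | i
  · simp only [prepB, Sum.elim_inl]
    split_ifs
    exacts [had_mul_had, one_mul _]
  · exact had_mul_had
  · cases i
    exacts [had_mul_had, refl_mul_refl c hc]

/-- Amplitude of the state `j` of the column register. -/
def amp (N σ : ℕ) (j : BasisState (Fin (indexQubits N))) : ℂ :=
  ∏ i : Fin (indexQubits N), (if (i : ℕ) < σ then had else 1 : Matrix Bool Bool ℂ) (j i) false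

theorem tensor_prepB_right (σ : ℕ) (c : ℝ) (v r : BasisState (Fin (indexQubits N) ⊕ (Fin p ⊕ Bool)))
    (hr : ∀ i, r i = false) :
    tensor (prepB N p σ c) v r = amp N σ (fun i => v (.inl i)) *
      ((1 / (Real.sqrt 2 : ℝ) : ℂ) ^ p * (refl c (v (.inr (.inr true))) false *
        (1 / (Real.sqrt 2 : ℝ) : ℂ))) := by
  simp [tensor, amp, prepB, hr, had_false', Fintype.prod_sum_type]

theorem tensor_prepB_symm (σ : ℕ) (c : ℝ) (v r : BasisState (Fin (indexQubits N) ⊕ (Fin p ⊕ Bool))) :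
    tensor (prepB N p σ c) v r = tensor (prepB N p σ c) r v := by
  simp only [tensor, Matrix.of_apply]
  refine Finset.prod_congr rfl fun i _ => ?_
  have h1 : ∀ a b, had a b = had b a := by
    intro a b; cases a <;> cases b <;> simp [had]
  have h2 : ∀ a b, refl c a b = refl c b a := by
    intro a b; cases a <;> cases b <;> simp [refl]
  rcases i with i | i | i
  · simp only [prepB, Sum.elim_inl]
    split_ifs
    · exact h1 _ _
    · rw [Matrix.one_apply, Matrix.one_apply]
      simp only [eq_comm]
  · exact h1 _ _
  · cases i
    exacts [h1 _ _, h2 _ _]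

/-- The state with the superposed wires of the off-diagonal block set. -/
def setB (v : BasisState (Fin (indexQubits N) ⊕ (Fin p ⊕ Bool))) (s : BasisState (Core N np p w)) :
    BasisState (Core N np p w) := fun q =>
  match q with
  | .s (.y i) => v (.inl i)
  | .s (.r i) => v (.inr (.inl i))
  | .s .b => v (.inr (.inr false))
  | .s .rho => v (.inr (.inr true))
  | q => s q

theorem overwrite_eB (v : BasisState (Fin (indexQubits N) ⊕ (Fin p ⊕ Bool)))
    (s : BasisState (Core N np p w)) : overwrite eB v s = setB v s := by
  symm
  rw [eq_overwrite_iff]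
  constructor
  · intro q hq
    rcases q with i | i | _ | (i | _ | i | _ | _ | _ | _ | _ | _ | _) <;> try rfl
    · exact absurd ⟨.inl i, rfl⟩ hq
    · exact absurd ⟨.inr (.inl i), rfl⟩ hq
    · exact absurd ⟨.inr (.inr false), rfl⟩ hq
    · exact absurd ⟨.inr (.inr true), rfl⟩ hq
  · funext i
    rcases i with i | i | (_ | _) <;> rfl

variable (hp : p + 1 ≤ np)

/-- The block of the off-diagonal part, in the frame of the system. -/
def offDiag (σ : ℕ) (c : ℝ) : Prog N np (Core N np (p + 1) w) :=
  rots eB (prepB N (p + 1) σ c) ++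
    ([.queryPosition false eF] ++ (cswaps .k (regPairs .x fun i => .s (.y i)) ++
      ((judge hp ++ judgePhases ++ (judge hp).inverse) ++ [.queryPosition true eF]))) ++
    rots eB (prepB N (p + 1) σ c)

/-- Entries of the operator performed by the block of the off-diagonal part. -/
def offEntry (D : SparseData N np) (σ : ℕ) (c : ℝ) (x' x : BasisState (Fin (indexQubits N))) : ℂ :=
  if x' = x then 0 else
    amp N σ (columnBits D.inv x x') * amp N σ (columnBits D.inv x' x) * (2 * c ^ 2 - 1) *
    (-Complex.I / (Real.sqrt 2 : ℝ)) * ((∑ R : BasisState (Fin (p + 1)),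
      (sgn (!decide (bitsVal R < offsetVal hp D x' x false)) +
        Complex.I * sgn (!decide (bitsVal R < offsetVal hp D x' x true)))) / 2 ^ (p + 1))

/-- The operator performed by the block of the off-diagonal part on system and time. -/
def offMat (D : SparseData N np) (σ : ℕ) (c : ℝ) (w : ℕ) :
    Matrix (BasisState (Fin (indexQubits N) ⊕ Fin w))
      (BasisState (Fin (indexQubits N) ⊕ Fin w)) ℂ :=
  Matrix.of fun r s => if r ∘ Sum.inr = s ∘ Sum.inr then
    offEntry hp D σ c (r ∘ Sum.inl) (s ∘ Sum.inl) else 0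

theorem columnBits_inv' (D : SparseData N np) (x j : BasisState (Fin (indexQubits N))) :
    columnBits D x (columnBits D.inv x j) = j := columnBits_inv D.inv x j

/-- Starting from x, position j becomes the column x' = f(x, j). After the exchange of x and x', the
inverse query turns x into its position in row x'. Thus exactly one j leads to x', and the amplitude
is the symmetric product over the two positions, times the average of the comparison signs. -/
theorem offDiag_isBlock (D : SparseData N np) (σ : ℕ) (c : ℝ) (hc : c ^ 2 ≤ 1) :
    IsBlock ((offDiag hp σ c : Prog N np (Core N np (p + 1) w)).eval D) (offMat hp D σ c w) := by
  intro r s hr hs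
  obtain ⟨φ, hφ, hφs⟩ := judge_eval (w := w) hp D
  have hev : (offDiag hp σ c : Prog N np (Core N np (p + 1) w)).eval D =
      embed eB (tensor (prepB N (p + 1) σ c)) * (mono (fun s => φ (swapXY (colMap D s)))
        (colMap D.inv ∘ swapXY ∘ colMap D) * embed eB (tensor (prepB N (p + 1) σ c))) := by
    rw [offDiag, Prog.eval_append, Prog.eval_append, Prog.eval_append, Prog.eval_append,
      Prog.eval_append, hφ,
      rots_eval D eB _ (prepB_mem σ c hc), colMap_performs, colMap_inv_performs, swapXY_performs,
      diagonal_eq_mono, mono_mul_mono, mono_mul_mono, mono_mul_mono]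
    congr 2
    congr 1
    funext s
    simp
  rw [hev, sandwich_apply]
  simp only [overwrite_eB]
  have hsB : ∀ i, (s ∘ eB) i = false := by
    rintro (i | i | (i | i))
    all_goals exact hs _
  have hrB : ∀ i, (r ∘ eB) i = false := by
    rintro (i | i | (i | i))
    all_goals exact hr _
  -- The control-off case is the second goal: the position query and its inverse cancel, and so do
  -- the two preparations.
  by_cases hk : s .k = true
  swap
  · have hk' : s .k = false := by simpa using hk
    have hph : ∀ v, φ (swapXY (colMap D (setB v s))) = 1 := by
      intro v
      rw [hφs (swapXY (colMap D (setB v s))) (fun _ => hs _) (hs _) (hs _) (hs _) (hs _)]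
      have : swapXY (colMap D (setB v s)) .k = false := hk'
      rw [this]
      rfl
    have hst : ∀ v, (colMap D.inv ∘ swapXY ∘ colMap D) (setB v s) = setB v s := by
      intro v
      have h1 : swapXY (colMap D (setB v s)) = colMap D (setB v s) := by
        have : colMap D (setB v s) .k = false := hk'
        funext q
        rcases q with i | i | _ | (i | _ | _ | _ | _ | _ | _ | _ | _ | _) <;>
          simp [swapXY, this]
      simp only [Function.comp, h1]
      funext q
      rcases q with i | i | _ | (i | _ | _ | _ | _ | _ | _ | _ | _ | _) <;> try rfl
      exact congrFun (columnBits_inv D (xr s) fun i => v (.inl i)) i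
    have hag : ∀ v, AgreeOff eB r (setB v s) ↔ r .k = s .k ∧ r ∘ st = s ∘ st := by
      intro v
      rw [← clean_eq_iff hr hs]
      have h2 := agreeOff_overwrite eB v s
      rw [overwrite_eB] at h2
      constructor
      · intro h
        have h3 := h.trans h2
        funext q
        by_cases hq : q ∈ Set.range eB
        · obtain ⟨i, rfl⟩ := hq
          exact (hrB i).trans (hsB i).symm
        · exact h3 q hq
      · rintro rfl
        exact h2.symm
    simp only [hst, hph, mul_one]
    simp only [hk', Bool.false_eq_true, if_false]
    by_cases hrs : r .k = s .k ∧ r ∘ st = s ∘ st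
    · have : ∀ v, embed eB (tensor (prepB N (p + 1) σ c)) r (setB v s) =
          tensor (prepB N (p + 1) σ c) (s ∘ eB) v := by
        intro v
        rw [embed_apply_of_agreeOff _ ((hag v).2 hrs), ← overwrite_eB, overwrite_comp]
        congr 1
        funext i
        rw [hrB, hsB]
      simp only [this]
      rw [← Matrix.mul_apply, prepB_mul_self σ c hc, hrs.1, hrs.2, hk', if_pos rfl,
        Matrix.one_apply_eq, Matrix.one_apply_eq]
    · have : ∀ v, embed eB (tensor (prepB N (p + 1) σ c)) r (setB v s) = 0 := by
        intro v
        rw [embed_apply_of_not _ (fun h => hrs ((hag v).1 h))]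
      simp only [this, zero_mul, Finset.sum_const_zero]
      rw [not_and] at hrs
      rw [hk'] at hrs
      split_ifs with h
      · rw [Matrix.one_apply, if_neg (hrs h)]
      · rfl
  have hx : ∀ v i, (colMap D.inv ∘ swapXY ∘ colMap D) (setB v s) (.x i) =
      columnBits D (xr s) (fun i => v (.inl i)) i := by
    intro v i
    have : (colMap D.inv ∘ swapXY ∘ colMap D) (setB v s) (.x i) =
        if s .k then columnBits D (xr s) (fun i => v (.inl i)) i else s (.x i) := rfl
    rw [this, if_pos hk]
  have hy : ∀ v i, (colMap D.inv ∘ swapXY ∘ colMap D) (setB v s) (.s (.y i)) =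
      columnBits D.inv (columnBits D (xr s) (fun i => v (.inl i))) (xr s) i := by
    intro v i
    have : (colMap D.inv ∘ swapXY ∘ colMap D) (setB v s) (.s (.y i)) =
      columnBits D.inv (fun i => if s .k then columnBits D (xr s) (fun i => v (.inl i)) i
          else s (.x i))
        (fun i => if s .k then s (.x i) else columnBits D (xr s) (fun i => v (.inl i)) i) i := rfl
    rw [this]
    simp only [hk, if_true]
  -- The final system register determines the initial position j, because each row map is a
  -- permutation.
  have hag : ∀ v, AgreeOff eB r ((colMap D.inv ∘ swapXY ∘ colMap D) (setB v s)) ↔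
      r .k = s .k ∧ (r ∘ st) ∘ Sum.inr = (s ∘ st) ∘ Sum.inr ∧
        (fun i => v (.inl i)) = columnBits D.inv (xr s) (xr r) := by
    intro v
    constructor
    · intro h
      refine ⟨h .k (by rintro ⟨i | i | (_ | _), h⟩ <;> cases h), ?_, ?_⟩
      · funext i
        exact h (.tm i) (by rintro ⟨i | i | (_ | _), h⟩ <;> cases h)
      · rw [← columnBits_inv D (xr s) fun i => v (.inl i)]
        congr 1
        funext i
        rw [← hx]
        exact (h (.x i) (by rintro ⟨i | i | (_ | _), h⟩ <;> cases h)).symm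
    · rintro ⟨h1, h2, h3⟩ q hq
      rcases q with i | i | _ | (i | _ | i | _ | _ | _ | _ | _ | _ | _)
      case x =>
        rw [hx, h3, columnBits_inv']
      case tm => exact congrFun h2 i
      case k => exact h1
      case s.y => exact absurd ⟨.inl i, rfl⟩ hq
      case s.r => exact absurd ⟨.inr (.inl i), rfl⟩ hq
      case s.b => exact absurd ⟨.inr (.inr false), rfl⟩ hq
      case s.rho => exact absurd ⟨.inr (.inr true), rfl⟩ hq
      all_goals
        rw [hr]
        exact (hs _).symm
  have hsum : ∀ F : BasisState (Fin (indexQubits N) ⊕ (Fin (p + 1) ⊕ Bool)) → ℂ,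
      ∑ v, F v = ∑ j : BasisState (Fin (indexQubits N)), ∑ R : BasisState (Fin (p + 1)),
        ∑ b : Bool, ∑ ρ : Bool, F (Sum.elim j (Sum.elim R fun i => cond i ρ b)) := by
    intro F
    rw [← (Equiv.sumArrowEquivProdArrow _ _ Bool).symm.sum_comp, Fintype.sum_prod_type]
    refine Finset.sum_congr rfl fun t _ => ?_
    rw [← (Equiv.sumArrowEquivProdArrow _ _ Bool).symm.sum_comp, Fintype.sum_prod_type]
    refine Finset.sum_congr rfl fun t _ => ?_
    rw [← (Equiv.boolArrowEquivProd Bool).symm.sum_comp, Fintype.sum_prod_type]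
    refine Finset.sum_congr rfl fun t _ => Finset.sum_congr rfl fun t _ => ?_
    congr 1
    funext i
    rcases i with i | i | (_ | _) <;> rfl
  rw [hsum]
  by_cases hrs : r .k = s .k ∧ (r ∘ st) ∘ Sum.inr = (s ∘ st) ∘ Sum.inr
  swap
  · have : ∀ v, embed eB (tensor (prepB N (p + 1) σ c)) r
        ((colMap D.inv ∘ swapXY ∘ colMap D) (setB v s)) = 0 := by
      intro v
      rw [embed_apply_of_not _ fun h => hrs ⟨((hag v).1 h).1, ((hag v).1 h).2.1⟩]
    simp only [this, zero_mul, Finset.sum_const_zero]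
    rw [not_and] at hrs
    split_ifs with h
    · rw [offMat, Matrix.of_apply, if_neg (hrs h)]
    · rfl
  have hyr : ∀ v : BasisState (Fin (indexQubits N) ⊕ (Fin (p + 1) ⊕ Bool)), (fun i => v (.inl i)) = columnBits D.inv (xr s) (xr r) →
      columnBits D (xr s) (fun i => v (.inl i)) = xr r := by
    intro v hv
    rw [hv, columnBits_inv']
  obtain ⟨F, hF⟩ : ∃ F : BasisState (Fin (p + 1)) → ℂ, ∀ R, F R =
      sgn (!decide (bitsVal R < offsetVal hp D (xr r) (xr s) false)) +
        Complex.I * sgn (!decide (bitsVal R < offsetVal hp D (xr r) (xr s) true)) :=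
    ⟨_, fun _ => rfl⟩
  have hph : ∀ v : BasisState (Fin (indexQubits N) ⊕ (Fin (p + 1) ⊕ Bool)), (fun i => v (.inl i)) = columnBits D.inv (xr s) (xr r) →
      φ (swapXY (colMap D (setB v s))) = (-Complex.I / (Real.sqrt 2 : ℝ) *
        F fun i => v (.inr (.inl i))) *
        sgn (v (.inr (.inr false)) && decide (xr r = xr s)) * sgn (v (.inr (.inr true))) := by
    intro v hv
    rw [hφs (swapXY (colMap D (setB v s))) (fun _ => hs _) (hs _) (hs _) (hs _) (hs _)]
    have e0 : swapXY (colMap D (setB v s)) .k = true := hk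
    have e1 : xr (swapXY (colMap D (setB v s))) = xr r := by
      rw [← hyr v hv]
      funext i
      have : swapXY (colMap D (setB v s)) (.x i) =
        if s .k then columnBits D (xr s) (fun i => v (.inl i)) i else s (.x i) := rfl
      simp only [this, hk, if_true]
    have e2 : yr (swapXY (colMap D (setB v s))) = xr s := by
      funext i
      have : swapXY (colMap D (setB v s)) (.s (.y i)) =
        if s .k then s (.x i) else columnBits D (xr s) (fun i => v (.inl i)) i := rfl
      simp only [yr, this, hk, if_true]
    rw [e0, if_pos rfl, e1, e2, hF]
    rfl
  have hE : ∀ v, embed eB (tensor (prepB N (p + 1) σ c)) r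
        ((colMap D.inv ∘ swapXY ∘ colMap D) (setB v s)) =
      if (fun i => v (.inl i)) = columnBits D.inv (xr s) (xr r) then
        amp N σ (columnBits D.inv (xr r) (xr s)) *
        ((1 / (Real.sqrt 2 : ℝ) : ℂ) ^ (p + 1) * (refl c (v (.inr (.inr true))) false *
          (1 / (Real.sqrt 2 : ℝ) : ℂ))) else 0 := by
    intro v
    split_ifs with h
    · rw [embed_apply_of_agreeOff _ ((hag v).2 ⟨hrs.1, hrs.2, h⟩), tensor_prepB_symm,
        tensor_prepB_right _ _ _ _ hrB]
      congr 2
      funext i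
      refine (hy v i).trans ?_
      rw [hyr v h]
    · rw [embed_apply_of_not _ fun h' => h ((hag v).1 h').2.2]
  have hsummand : ∀ j R b ρ,
      embed eB (tensor (prepB N (p + 1) σ c)) r ((colMap D.inv ∘ swapXY ∘ colMap D)
        (setB (Sum.elim j (Sum.elim R fun i => cond i ρ b)) s)) *
      φ (swapXY (colMap D (setB (Sum.elim j (Sum.elim R fun i => cond i ρ b)) s))) *
      tensor (prepB N (p + 1) σ c) (Sum.elim j (Sum.elim R fun i => cond i ρ b)) (s ∘ eB) =
      if j = columnBits D.inv (xr s) (xr r) then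
        amp N σ (columnBits D.inv (xr s) (xr r)) * amp N σ (columnBits D.inv (xr r) (xr s)) *
        (-Complex.I / (Real.sqrt 2 : ℝ)) / 2 ^ (p + 1) * F R *
        (sgn (b && decide (xr r = xr s)) / 2) * (refl c ρ false ^ 2 * sgn ρ) else 0 := by
    intro j R b ρ
    rw [hE, tensor_prepB_right _ _ _ _ hsB]
    split_ifs with h h' h'
    · rw [hph _ h]
      simp only [Sum.elim_inl, Sum.elim_inr, cond_true, cond_false]
      generalize decide (xr r = xr s) = d
      have h' : j = columnBits D.inv (xr s) (xr r) := h
      have hpow := sqrt_two_inv_pow (p + 1)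
      have hsq := sqrt_two_inv_sq
      rw [← h']
      generalize (1 / (Real.sqrt 2 : ℝ) : ℂ) ^ (p + 1) = X at *
      generalize (1 / (Real.sqrt 2 : ℝ) : ℂ) = Y at *
      rw [div_eq_mul_one_div _ ((2 : ℂ) ^ (p + 1)), ← hpow, div_eq_mul_one_div _ (2 : ℂ), ← hsq]
      ring
    · exact absurd h h'
    · exact absurd h' h
    · simp
  simp only [hsummand, Finset.sum_ite_irrel]
  simp only [← Finset.mul_sum, ← Finset.sum_mul, Finset.sum_const_zero]
  rw [Finset.sum_ite_eq' Finset.univ, if_pos (Finset.mem_univ _), if_pos hrs.1, if_pos hk, offMat,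
    Matrix.of_apply, if_pos hrs.2, offEntry]
  -- Interference of the two values of `b` removes the diagonal of the encoded matrix.
  have hb : ∑ b : Bool, sgn (b && decide (xr r = xr s)) / 2 = if xr r = xr s then 0 else 1 := by
    rw [← Finset.sum_div, sum_sgn_and]
    by_cases h : xr r = xr s <;> simp [h]
  -- Weight c² comes with sign + and weight 1 - c² with sign -, so `c` tunes the encoded matrix by a
  -- real factor in [-1, 1].
  have hρ : ∑ ρ : Bool, refl c ρ false ^ 2 * sgn ρ = 2 * (c : ℂ) ^ 2 - 1 := by
    have h2 : (((Real.sqrt (1 - c ^ 2) : ℝ) : ℂ)) ^ 2 = 1 - (c : ℂ) ^ 2 := by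
      rw [← Complex.ofReal_pow, Real.sq_sqrt (by linarith)]
      push_cast; ring
    rw [Fintype.sum_bool]
    simp only [refl, Matrix.of_apply, sgn, if_true, Bool.false_eq_true, if_false, h2]
    ring
  rw [hb, hρ]
  by_cases h : xr r = xr s
  · rw [if_pos h, if_pos (show (r ∘ st) ∘ Sum.inl = (s ∘ st) ∘ Sum.inl from h)]
    ring
  · rw [if_neg h, if_neg (show ¬ (r ∘ st) ∘ Sum.inl = (s ∘ st) ∘ Sum.inl from h)]
    have e : ∀ q : BasisState (Core N np (p + 1) w), (q ∘ st) ∘ Sum.inl = xr q := fun _ => rfl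
    rw [e, e]
    simp only [← hF]
    ring

end Core

/-! ### Matrix entries from bits -/

theorem bitsVal_lt {n : ℕ} (f : BasisState (Fin n)) : bitsVal f < 2 ^ n := Nat.ofBits_lt_two_pow f

theorem bitsVal_eq_sum {n : ℕ} (f : BasisState (Fin n)) :
    bitsVal f = ∑ j : Fin n, 2 ^ (j : ℕ) * (f j).toNat := by
  induction n with
  | zero => simp [bitsVal]
  | succ n ih =>
    rw [bitsVal, Nat.ofBits_succ, Fin.sum_univ_succ, show Nat.ofBits (f ∘ Fin.succ) = _ from ih _,
      Finset.mul_sum]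
    simp only [Fin.val_zero, pow_zero, one_mul, Fin.val_succ, Function.comp, pow_succ']
    rw [add_comm]
    congr 1
    exact Finset.sum_congr rfl fun i _ => by ring

theorem bitsVal_castLE {p n : ℕ} (h : p ≤ n) (f : BasisState (Fin n)) :
    bitsVal (fun j : Fin p => f (Fin.castLE h j)) = bitsVal f % 2 ^ p := by
  apply Nat.eq_of_testBit_eq
  intro i
  rw [Nat.testBit_mod_two_pow, Nat.testBit_ofBits, Nat.testBit_ofBits]
  by_cases hi : i < p
  · simp [hi, hi.trans_le h, Fin.castLE]
  · simp [hi]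

/-- Flipping the top bit shifts by half the range modulo 2^{p+1}; this converts two's complement to
offset binary. -/
theorem bitsVal_flip_last {p : ℕ} (f : BasisState (Fin (p + 1))) :
    (bitsVal (fun j => (f j).xor (decide (j = Fin.last p))) : ℤ) =
      if bitsVal f < 2 ^ p then (bitsVal f : ℤ) + 2 ^ p else (bitsVal f : ℤ) - 2 ^ p := by
  have h1 : ∀ g : BasisState (Fin (p + 1)), bitsVal g =
      bitsVal (fun j : Fin p => g j.castSucc) + 2 ^ p * (g (Fin.last p)).toNat := by
    intro g
    rw [bitsVal_eq_sum, bitsVal_eq_sum, Fin.sum_univ_castSucc]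
    rfl
  have h2 : (fun j : Fin p => (f j.castSucc).xor (decide (j.castSucc = Fin.last p))) =
      fun j : Fin p => f j.castSucc := by
    funext j
    have : j.castSucc ≠ Fin.last p := (Fin.castSucc_lt_last j).ne
    simp [this]
  have h3 := bitsVal_lt fun j : Fin p => f j.castSucc
  rw [h1, h1 f, h2]
  generalize bitsVal (fun j : Fin p => f j.castSucc) = L at *
  cases f (Fin.last p)
  · simp [h3]
  · simp

theorem ofBits_eq_ite {n : ℕ} (f : Fin n → Bool) : Int.ofBits f =
    if 2 * bitsVal f < 2 ^ n then (bitsVal f : ℤ) else (bitsVal f : ℤ) - 2 ^ n := by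
  rw [Int.ofBits]
  split_ifs
  · rfl
  · rw [Int.subNatNat_eq_coe]
    push_cast
    rfl

theorem ofBits_eq_sum {n : ℕ} (f : Fin n → Bool) : (Int.ofBits f : ℤ) =
    ∑ k : Fin n, (if (k : ℕ) + 1 = n then -2 ^ (k : ℕ) else 2 ^ (k : ℕ)) * ((f k).toNat : ℤ) := by
  rw [ofBits_eq_ite]
  cases n with
  | zero => simp [bitsVal]
  | succ n =>
    have h1 : bitsVal f =
        bitsVal (fun j : Fin n => f j.castSucc) + 2 ^ n * (f (Fin.last n)).toNat := by
      rw [bitsVal_eq_sum, bitsVal_eq_sum, Fin.sum_univ_castSucc]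
      rfl
    have h2 := bitsVal_lt fun j : Fin n => f j.castSucc
    have h3 : (∑ k : Fin n, (if ((k.castSucc : Fin (n + 1)) : ℕ) + 1 = n + 1 then -2 ^ (k : ℕ)
        else 2 ^ (k : ℕ)) * ((f k.castSucc).toNat : ℤ)) =
        (bitsVal (fun j : Fin n => f j.castSucc) : ℤ) := by
      rw [bitsVal_eq_sum]
      push_cast
      refine Finset.sum_congr rfl fun k _ => ?_
      have := k.2
      rw [if_neg (by simp only [Fin.val_castSucc]; omega)]
    rw [Fin.sum_univ_castSucc]
    simp only [Fin.val_castSucc, Fin.val_last, if_true] at h3 ⊢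
    rw [h3, h1]
    generalize bitsVal (fun j : Fin n => f j.castSucc) = L at *
    have e : (2 : ℤ) ^ (n + 1) = 2 ^ n + 2 ^ n := by ring
    cases f (Fin.last n)
    · rw [if_pos (by simp only [Bool.toNat_false]; rw [pow_succ]; omega)]
      simp
    · rw [if_neg (by simp only [Bool.toNat_true]; rw [pow_succ]; omega)]
      simp only [Bool.toNat_true]
      push_cast
      rw [e]
      ring

theorem sum_bitsVal {M : Type*} [AddCommMonoid M] (p : ℕ) (F : ℕ → M) :
    ∑ R : BasisState (Fin p), F (bitsVal R) = ∑ m ∈ Finset.range (2 ^ p), F m := by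
  refine Finset.sum_nbij bitsVal ?_ (fun a _ b _ h => bitsVal_injective h) ?_ fun _ _ => rfl
  · intro R _
    exact Finset.mem_range.2 (Nat.ofBits_lt_two_pow R)
  · intro m hm
    refine ⟨fun i => m.testBit i, Finset.mem_coe.2 (Finset.mem_univ _), ?_⟩
    rw [bitsVal, Nat.ofBits_testBit]
    exact Nat.mod_eq_of_lt (by simpa using hm)

/-- V signs are + and 2^p - V are -. The average sign is affine in V, so a stored number becomes an
amplitude by comparison alone. -/
theorem sum_sgn_lt (p V : ℕ) (hV : V ≤ 2 ^ p) :
    ∑ R : BasisState (Fin p), sgn (!decide (bitsVal R < V)) = 2 * (V : ℂ) - 2 ^ p := by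
  rw [sum_bitsVal p fun m => sgn (!decide (m < V)),
    ← Finset.sum_range_add_sum_Ico _ hV]
  have h1 : ∑ m ∈ Finset.range V, sgn (!decide (m < V)) = V := by
    rw [Finset.sum_congr rfl fun m hm => by
      rw [show sgn (!decide (m < V)) = 1 by simp [sgn, Finset.mem_range.1 hm]]]
    simp
  have h2 : ∑ m ∈ Finset.Ico V (2 ^ p), sgn (!decide (m < V)) = (V : ℂ) - 2 ^ p := by
    rw [Finset.sum_congr rfl fun m hm => by
      rw [show sgn (!decide (m < V)) = -1 by simp [sgn, (Finset.mem_Ico.1 hm).1]]]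
    simp [Nat.cast_sub hV]
  rw [h1, h2]
  ring

namespace Core

variable {N np p : ℕ}

/-- Hadamard gates act on the σ low wires only, so the superposition is uniform on the positions
below 2^σ. -/
theorem amp_eq (σ : ℕ) (hσ : σ ≤ indexQubits N) (j : BasisState (Fin (indexQubits N))) :
    amp N σ j = if bitsVal j < 2 ^ σ then (1 / (Real.sqrt 2 : ℝ) : ℂ) ^ σ else 0 := by
  have hiff : bitsVal j < 2 ^ σ ↔ ∀ i : Fin (indexQubits N), σ ≤ i → j i = false := by
    constructor
    · intro h i hi
      rw [← Nat.testBit_ofBits_lt j i i.2]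
      exact Nat.testBit_lt_two_pow (h.trans_le (Nat.pow_le_pow_right (by norm_num) hi))
    · intro h
      apply Nat.lt_pow_two_of_testBit
      intro i hi
      rw [Nat.testBit_ofBits]
      split_ifs with h'
      exacts [h ⟨i, h'⟩ hi, rfl]
  rw [amp]
  split_ifs with h
  · rw [hiff] at h
    have : ∀ i : Fin (indexQubits N), (if (i : ℕ) < σ then had else 1 : Matrix Bool Bool ℂ) (j i)
        false = if (i : ℕ) < σ then (1 / (Real.sqrt 2 : ℝ) : ℂ) else 1 := by
      intro i
      split_ifs with hi
      · exact had_false' _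
      · rw [h i (not_lt.1 hi), Matrix.one_apply_eq]
    simp only [this]
    rw [Finset.prod_ite, Finset.prod_const, Finset.prod_const_one, mul_one]
    congr 1
    rw [Fin.card_filter_val_lt]
    omega
  · rw [hiff] at h
    push Not at h
    obtain ⟨i, hi, hji⟩ := h
    refine Finset.prod_eq_zero (Finset.mem_univ i) ?_
    rw [if_neg (not_lt.2 hi), Matrix.one_apply, if_neg hji]

end Core

/-! ### The encoded matrix and its block encoding -/

section Parts

variable {N np : ℕ}

/-- The real part (`false`) or imaginary part (`true`) of an entry in units of the precision. -/
def entryInt (D : SparseData N np) (x y : BasisState (Fin (indexQubits N))) (i : Bool) : ℤ :=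
  Int.ofBits fun k : Fin np => entryBits D x y (i, k)

/-- The off-diagonal part of the encoded matrix. -/
def offPart (D : SparseData N np) (u : ℝ) : Matrix (BasisState (Fin (indexQubits N)))
    (BasisState (Fin (indexQubits N))) ℂ :=
  Matrix.of fun x y => if x = y then 0 else decode u (entryBits D x y)

/-- The diagonal part of the encoded matrix. -/
def diagPart (D : SparseData N np) (u : ℝ) (x : BasisState (Fin (indexQubits N))) : ℝ :=
  u * entryInt D x x false

/-- The conditions on the oracles that the block of the off-diagonal part relies on. -/
structure SparseData.Fits (D : SparseData N np) (u : ℝ) (p σ : ℕ) : Prop where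
  range : ∀ x y, x ≠ y → ∀ i, -2 ^ p ≤ entryInt D x y i ∧ entryInt D x y i < 2 ^ p
  symm : ∀ x y, decode u (entryBits D x y) = star (decode u (entryBits D y x))
  column : ∀ x y, x ≠ y → decode u (entryBits D x y) ≠ 0 → bitsVal (columnBits D.inv x y) < 2 ^ σ

/-- A number in [-2^p, 2^p) is determined by its residue modulo 2^{p+1}, hence by its low p + 1
bits. Flipping the top one of these adds 2^p. -/
theorem offsetVal_eq {p : ℕ} (hp : p + 1 ≤ np) (D : SparseData N np)
    (x y : BasisState (Fin (indexQubits N))) (i : Bool)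
    (h : -2 ^ p ≤ entryInt D x y i ∧ entryInt D x y i < 2 ^ p) :
    (Core.offsetVal hp D x y i : ℤ) = entryInt D x y i + 2 ^ p := by
  rw [Core.offsetVal, bitsVal_flip_last]
  rw [show bitsVal (fun j : Fin (p + 1) => entryBits D x y (i, Fin.castLE hp j)) = _ from
    bitsVal_castLE hp fun k => entryBits D x y (i, k)]
  have hlt := bitsVal_lt fun k : Fin np => entryBits D x y (i, k)
  have hv : entryInt D x y i = _ := ofBits_eq_ite fun k : Fin np => entryBits D x y (i, k)
  obtain ⟨q, hq⟩ : 2 ^ (p + 1) ∣ 2 ^ np := pow_dvd_pow 2 hp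
  have hpp : 2 ^ (p + 1) = 2 * 2 ^ p := pow_succ' 2 p
  generalize entryInt D x y i = v at *
  generalize bitsVal (fun k : Fin np => entryBits D x y (i, k)) = L at *
  have hmod := Nat.div_add_mod L (2 ^ (p + 1))
  have hml := Nat.mod_lt L (show 0 < 2 ^ (p + 1) by positivity)
  split_ifs at hv with h1
  · have hL : L < 2 ^ p := by
      have := h.2; rw [hv] at this; exact_mod_cast this
    rw [Nat.mod_eq_of_lt (by omega), if_pos hL, hv]
  · have hL : 2 ^ np ≤ L + 2 ^ p := by
      have h2 := h.1
      rw [hv] at h2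
      have : (2 : ℤ) ^ np ≤ L + 2 ^ p := by linarith
      exact_mod_cast this
    -- For a negative number the unsigned value lies in the last residue block of length 2^{p+1}
    -- below 2^np.
    have h4 : L % 2 ^ (p + 1) + 2 ^ np = L + 2 ^ (p + 1) := by
      have hq1 : 1 ≤ q := by
        rcases Nat.eq_zero_or_pos q with rfl | h'
        · simp at hq
        · exact h'
      obtain ⟨q', rfl⟩ : ∃ q', q = q' + 1 := ⟨q - 1, by omega⟩
      have e : L = 2 ^ (p + 1) * q' + (L - 2 ^ (p + 1) * q') := by
        rw [mul_add, mul_one] at hq; omega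
      have e2 : L - 2 ^ (p + 1) * q' < 2 ^ (p + 1) := by
        rw [mul_add, mul_one] at hq; omega
      rw [e, Nat.mul_add_mod, Nat.mod_eq_of_lt e2, hq]
      ring
    rw [if_neg (by omega), hv]
    have h4' : ((L % 2 ^ (p + 1) : ℕ) : ℤ) + 2 ^ np = L + 2 ^ (p + 1) := by exact_mod_cast h4
    have e : (2 : ℤ) ^ (p + 1) = 2 * 2 ^ p := pow_succ' 2 p
    linarith

/-- The sign sums equal twice the integer parts and are divided by 2^{p+1}; the two position
amplitudes multiply to 2^{-σ}. The offset 2^p drops out exactly, so no rounding occurs. -/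
theorem offEntry_eq {p : ℕ} (hp : p + 1 ≤ np) (D : SparseData N np) (u : ℝ) (hu : 0 < u)
    {σ : ℕ} (hσ : σ ≤ indexQubits N) (hD : D.Fits u p σ) (c : ℝ)
    (x y : BasisState (Fin (indexQubits N))) :
    Core.offEntry hp D σ c x y = -Complex.I * (((2 * c ^ 2 - 1) /
      (Real.sqrt 2 * 2 ^ p * u * 2 ^ σ) : ℝ) : ℂ) * offPart D u x y := by
  rw [Core.offEntry, offPart, Matrix.of_apply]
  split_ifs with hxy
  · simp
  have hr := hD.range x y hxy
  have hsum : ∀ i, ∑ R : BasisState (Fin (p + 1)),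
      sgn (!decide (bitsVal R < Core.offsetVal hp D x y i)) = 2 * (entryInt D x y i : ℂ) := by
    intro i
    have h := offsetVal_eq hp D x y i (hr i)
    rw [sum_sgn_lt]
    · have h' : ((Core.offsetVal hp D x y i : ℤ) : ℂ) = ((entryInt D x y i + 2 ^ p : ℤ) : ℂ) := by
        rw [h]
      push_cast at h'
      rw [h', pow_succ]
      ring
    · have := (hr i).2
      have h2 : (Core.offsetVal hp D x y i : ℤ) ≤ 2 ^ (p + 1) := by
        rw [h, pow_succ]; linarith
      exact_mod_cast h2
  have hdec : decode u (entryBits D x y) =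
      (u : ℂ) * ((entryInt D x y false : ℂ) + Complex.I * (entryInt D x y true : ℂ)) := rfl
  -- A zero entry may sit at a position of either amplitude, since `Fits` locates non-zero entries
  -- only; but then the sign sum vanishes.
  by_cases h0 : decode u (entryBits D x y) = 0
  · rw [h0]
    have h1 : (entryInt D x y false : ℂ) + Complex.I * (entryInt D x y true : ℂ) = 0 := by
      rw [hdec] at h0
      exact (mul_eq_zero.1 h0).resolve_left (by exact_mod_cast hu.ne')
    rw [Finset.sum_add_distrib, ← Finset.mul_sum, hsum, hsum]
    have : 2 * (entryInt D x y false : ℂ) + Complex.I * (2 * (entryInt D x y true : ℂ)) = 0 := by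
      linear_combination 2 * h1
    rw [this]
    simp
  -- Hermitian symmetry makes the mirrored entry non-zero too, so that both positions are below 2^σ.
  · have h0' : decode u (entryBits D y x) ≠ 0 := by
      intro h
      rw [hD.symm, h, star_zero] at h0
      exact h0 rfl
    rw [Core.amp_eq σ hσ, Core.amp_eq σ hσ, if_pos (hD.column y x (Ne.symm hxy) h0'),
      if_pos (hD.column x y hxy h0), Core.sqrt_two_inv_pow, Finset.sum_add_distrib,
      ← Finset.mul_sum, hsum, hsum, hdec]
    have h2 : ((Real.sqrt 2 : ℝ) : ℂ) ≠ 0 := by norm_num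
    have hu' : (u : ℂ) ≠ 0 := by exact_mod_cast hu.ne'
    push_cast
    field_simp
    ring

end Parts

/-! ### Phases from the diagonal part -/

theorem Prog.eval_flatMap_diagonal {N np : ℕ} {Q α : Type} [Fintype Q] [DecidableEq Q]
    (D : SparseData N np) (l : List α) (f : α → Prog N np Q) (φ : α → BasisState Q → ℂ)
    (h : ∀ a ∈ l, (f a).eval D = Matrix.diagonal (φ a)) :
    Prog.eval (l.flatMap f) D = Matrix.diagonal fun s => (l.map fun a => φ a s).prod := by
  induction l with
  | nil => simp
  | cons a l ih =>
    rw [List.flatMap_cons, Prog.eval_append, ih fun b hb => h b (List.mem_cons_of_mem a hb),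
      h a List.mem_cons_self, Matrix.diagonal_mul_diagonal]
    congr 1
    funext s
    rw [List.map_cons, List.prod_cons, mul_comm]

namespace Core

variable {N np p w : ℕ}

/-- Loads the diagonal entry of the current row into the value register. -/
def load : Prog N np (Core N np p w) :=
  copies (Core.x : _ → Core N np p w) (fun i => .s (.y i)) (List.finRange (indexQubits N)) ++ [.queryEntry false eH]

/-- The state with the row index copied. -/
def copyMap (s : BasisState (Core N np p w)) : BasisState (Core N np p w) := fun q =>
  match q with
  | .s (.y i) => (s (.s (.y i))).xor (s (.x i))
  | q => s q

theorem load_performs (D : SparseData N np) :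
    (load : Prog N np (Core N np p w)).Performs D (entMap D ∘ copyMap) := by
  refine Prog.Performs.append (π := copyMap) ?_ (entMap_performs D)
  have hinj : Function.Injective fun i => (Core.s (.y i) : Core N np p w) :=
    fun i j h => by simpa using h
  refine (copies_performs D (Core.x : _ → Core N np p w) ⟨fun i => .s (.y i), hinj⟩
    (fun i j => by simp) _ (List.nodup_finRange _)).congr fun s q => ?_
  revert q
  rw [← funext_iff, eq_overwrite_iff]
  constructor
  · intro q hq
    rcases q with i | i | _ | (i | _ | _ | _ | _ | _ | _ | _ | _ | _) <;> try rfl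
    exact absurd ⟨i, rfl⟩ hq
  · funext i
    rw [if_pos (List.mem_finRange i)]
    rfl

/-- Weight of a bit of the two's complement representation. -/
def bitWeight {np : ℕ} (k : Fin np) : ℝ := if (k : ℕ) + 1 = np then -2 ^ (k : ℕ) else 2 ^ (k : ℕ)

/-- Diagonal phases of the loaded value. -/
def valuePhases (θ : ℝ) : Prog N np (Core N np p w) :=
  (List.finRange np).flatMap fun k =>
    phase₁ (fun a => Complex.exp (Complex.I * ((θ * (bitWeight k * (a.toNat : ℝ)) : ℝ) : ℂ)))
      (.s (.z (false, k)))

/-- Diagonal phases of the product of the loaded value and the time. -/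
def timePhases (θ : ℝ) : Prog N np (Core N np p w) :=
  (List.finRange np).flatMap fun k => (List.finRange w).flatMap fun j : Fin w =>
    phase (fun a b => Complex.exp (Complex.I *
      ((θ * (bitWeight k * (a.toNat : ℝ)) * (2 ^ (j : ℕ) * (b.toNat : ℝ)) : ℝ) : ℂ)))
      (.s (.z (false, k))) (.tm j)

theorem norm_exp_I_mul_real (x : ℝ) : ‖Complex.exp (Complex.I * (x : ℂ))‖ = 1 := by
  rw [mul_comm]; exact Complex.norm_exp_ofReal_mul_I x

theorem prod_exp_finRange (n : ℕ) (f : Fin n → ℝ) :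
    ((List.finRange n).map fun k => Complex.exp (Complex.I * (f k : ℂ))).prod =
      Complex.exp (Complex.I * ((∑ k, f k : ℝ) : ℂ)) := by
  rw [← List.ofFn_eq_map, List.prod_ofFn, ← Complex.exp_sum, ← Finset.mul_sum]
  push_cast
  rfl

theorem sum_bitWeight (f : Fin np → Bool) :
    ∑ k, bitWeight k * ((f k).toNat : ℝ) = (Int.ofBits f : ℝ) := by
  rw [ofBits_eq_sum]
  push_cast
  refine Finset.sum_congr rfl fun k _ => ?_
  rw [bitWeight]

theorem valuePhases_eval (D : SparseData N np) (θ : ℝ) :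
    (valuePhases θ : Prog N np (Core N np p w)).eval D = Matrix.diagonal fun s =>
      Complex.exp (Complex.I *
        ((θ * (Int.ofBits fun k : Fin np => s (.s (.z (false, k)))) : ℝ) : ℂ)) := by
  rw [valuePhases, Prog.eval_flatMap_diagonal D _ _ _ fun k _ => phase₁_eval D _
    (fun _ => norm_exp_I_mul_real _) _]
  congr 1
  funext s
  rw [prod_exp_finRange, ← Finset.mul_sum, sum_bitWeight]

/-- Entry times time is bilinear in the bits, so its phase factors into two-qubit phases, one for
each value bit and time bit. No multiplier is needed; this is the source of the product of `np` and
`w` in the gate count. -/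
theorem timePhases_eval (D : SparseData N np) (θ : ℝ) :
    (timePhases θ : Prog N np (Core N np p w)).eval D = Matrix.diagonal fun s =>
      Complex.exp (Complex.I *
        ((θ * (Int.ofBits fun k : Fin np => s (.s (.z (false, k)))) *
          (bitsVal fun j => s (.tm j) : ℕ) : ℝ) : ℂ)) := by
  rw [timePhases, Prog.eval_flatMap_diagonal D _ _ _ fun k _ =>
    Prog.eval_flatMap_diagonal D _ _ _ fun j _ => phase_eval D _
      (fun _ _ => norm_exp_I_mul_real _) (by simp)]
  congr 1
  funext s
  simp only [prod_exp_finRange]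
  simp only [← Finset.mul_sum, ← Finset.sum_mul]
  rw [sum_bitWeight, bitsVal_eq_sum]
  push_cast
  rfl

/-- Phase evolution under the diagonal part. -/
def evolveDiag (θ : ℝ) : Prog N np (Core N np p w) := load ++ valuePhases θ ++ load.inverse

/-- Phase evolution under the diagonal part, for the time in the time register. -/
def evolveTime (θ : ℝ) : Prog N np (Core N np p w) := load ++ timePhases θ ++ load.inverse

theorem load_clean (D : SparseData N np) (s : BasisState (Core N np p w)) (hs : Clean s)
    (v : ValueWires np) : (entMap D ∘ copyMap) s (.s (.z v)) = entryBits D (xr s) (xr s) v := by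
  have h1 : yr (copyMap s) = xr s := by
    funext i
    have : yr (copyMap s) i = (s (.s (.y i))).xor (s (.x i)) := rfl
    rw [this, hs, Bool.false_xor]
  have h2 : (entMap D ∘ copyMap) s (.s (.z v)) =
      (s (.s (.z v))).xor (entryBits D (xr s) (yr (copyMap s)) v) := rfl
  rw [h2, hs, Bool.false_xor, h1]

theorem evolveDiag_eval (D : SparseData N np) (θ u : ℝ) :
    ∃ φ : BasisState (Core N np p w) → ℂ,
      (evolveDiag (θ * u) : Prog N np (Core N np p w)).eval D = Matrix.diagonal φ ∧
      ∀ s, Clean s → φ s = Complex.exp (Complex.I * ((θ * diagPart D u (xr s) : ℝ) : ℂ)) := by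
  refine ⟨_, Prog.eval_conj_diagonal (load_performs D) (valuePhases_eval D _), ?_⟩
  intro s hs
  simp only [load_clean D s hs, diagPart, entryInt, mul_assoc]

theorem evolveTime_eval (D : SparseData N np) (θ u : ℝ) :
    ∃ φ : BasisState (Core N np p w) → ℂ,
      (evolveTime (θ * u) : Prog N np (Core N np p w)).eval D = Matrix.diagonal φ ∧
      ∀ s, Clean s → φ s = Complex.exp (Complex.I * ((θ * diagPart D u (xr s) *
        (bitsVal fun j => s (.tm j) : ℕ) : ℝ) : ℂ)) := by
  refine ⟨_, Prog.eval_conj_diagonal (load_performs D) (timePhases_eval D _), ?_⟩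
  intro s hs
  simp only [load_clean D s hs, diagPart, entryInt, mul_assoc]
  rfl

variable (hp : p + 1 ≤ np)

/-- The block of the off-diagonal part in the interaction picture. -/
def interaction (σ : ℕ) (c θ : ℝ) : Prog N np (Core N np (p + 1) w) :=
  evolveTime θ ++ offDiag hp σ c ++ (evolveTime θ).inverse

/-- The operator performed by `interaction`. -/
def interactionMat (D : SparseData N np) (u : ℝ) (σ : ℕ) (c θ : ℝ) (w : ℕ) :
    Matrix (BasisState (Fin (indexQubits N) ⊕ Fin w))
      (BasisState (Fin (indexQubits N) ⊕ Fin w)) ℂ :=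
  Matrix.of fun r s => if r ∘ Sum.inr = s ∘ Sum.inr then
    Complex.exp (-(Complex.I * ((θ * diagPart D u (r ∘ Sum.inl) * bitsVal (s ∘ Sum.inr) : ℝ) : ℂ))) *
      offEntry hp D σ c (r ∘ Sum.inl) (s ∘ Sum.inl) *
    Complex.exp (Complex.I * ((θ * diagPart D u (s ∘ Sum.inl) * bitsVal (s ∘ Sum.inr) : ℝ) : ℂ))
    else 0

/-- The conjugating phases need no control: when the control is off, the inner block is the identity
between clean states and the phases cancel. -/
theorem interaction_isBlock (D : SparseData N np) (u : ℝ) (σ : ℕ) (c θ : ℝ) (hc : c ^ 2 ≤ 1) :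
    IsBlock ((interaction hp σ c (θ * u) : Prog N np (Core N np (p + 1) w)).eval D)
      (interactionMat hp D u σ c θ w) := by
  obtain ⟨φ, hφ, hφs⟩ := evolveTime_eval (p := p + 1) (w := w) D θ u
  intro r s hr hs
  rw [interaction, Prog.eval_append, Prog.eval_append, Prog.eval_inverse, hφ,
    Matrix.diagonal_conjTranspose, Matrix.diagonal_mul, Matrix.mul_diagonal,
    offDiag_isBlock hp D σ c hc r s hr hs, Pi.star_apply, hφs r hr, hφs s hs]
  have hstar : ∀ x : ℝ, star (Complex.exp (Complex.I * (x : ℂ))) =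
      Complex.exp (-(Complex.I * (x : ℂ))) := by
    intro x
    rw [RCLike.star_def, ← Complex.exp_conj]
    simp
  rw [hstar]
  have e1 : ∀ q : BasisState (Core N np (p + 1) w), (q ∘ st) ∘ Sum.inl = xr q := fun _ => rfl
  have e2 : ∀ q : BasisState (Core N np (p + 1) w), (q ∘ st) ∘ Sum.inr = fun j => q (.tm j) :=
    fun _ => rfl
  by_cases h1 : r .k = s .k
  swap
  · simp [h1]
  rw [if_pos h1, if_pos h1]
  split_ifs with hk
  · simp only [interactionMat, offMat, Matrix.of_apply, e1, e2]
    split_ifs with h2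
    · rw [h2]; ring
    · simp
  · rw [Matrix.one_apply]
    split_ifs with h2
    · have h3 := (clean_eq_iff hr hs).2 ⟨h1, h2⟩
      rw [h3, one_mul, ← Complex.exp_add]
      simp
    · simp

end Core

/-! ### Projections on sets of basis states -/

section Proj

variable {N np : ℕ} {S T Q : Type} [Fintype S] [DecidableEq S] [Fintype T] [DecidableEq T]
  [Fintype Q] [DecidableEq Q]

open Classical in
/-- The projection on the span of the basis states with property `P`. -/
def proj (P : BasisState Q → Prop) : Matrix (BasisState Q) (BasisState Q) ℂ :=
  Matrix.diagonal fun s => if P s then 1 else 0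

theorem proj_mul (P P' : BasisState Q → Prop) : proj P * proj P' = proj fun s => P s ∧ P' s := by
  rw [proj, proj, proj, Matrix.diagonal_mul_diagonal]
  congr 1
  funext s
  by_cases h : P s <;> by_cases h' : P' s <;> simp [h, h']

theorem proj_congr {P P' : BasisState Q → Prop} (h : ∀ s, P s ↔ P' s) : proj P = proj P' := by
  have : P = P' := funext fun s => propext (h s)
  rw [this]

theorem proj_mul_self (P : BasisState Q → Prop) : proj P * proj P = proj P := by
  rw [proj_mul]; exact proj_congr fun s => and_self_iff

theorem proj_comm (P P' : BasisState Q → Prop) : Commute (proj P) (proj P') := by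
  rw [Commute, SemiconjBy, proj_mul, proj_mul]; exact proj_congr fun s => and_comm

theorem proj_mul_apply (P : BasisState Q → Prop) (X : Matrix (BasisState Q) (BasisState Q) ℂ)
    (r s : BasisState Q) (h : P r) : (proj P * X) r s = X r s := by
  rw [proj, Matrix.diagonal_mul, if_pos h, one_mul]

theorem mul_proj_apply (P : BasisState Q → Prop) (X : Matrix (BasisState Q) (BasisState Q) ℂ)
    (r s : BasisState Q) (h : P s) : (X * proj P) r s = X r s := by
  rw [proj, Matrix.mul_diagonal, if_pos h, mul_one]

theorem proj_commute_embed (e : S ↪ Q) (U : Matrix (BasisState S) (BasisState S) ℂ)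
    {P : BasisState Q → Prop} (h : ∀ r s, AgreeOff e r s → P r → P s) :
    Commute (proj P) (embed e U) := by
  refine diagonal_commute_embed e U _ fun r s hrs => ?_
  classical
  exact if_congr ⟨h r s hrs, h s r hrs.symm⟩ rfl rfl

theorem embed_proj (e : S ↪ Q) (P : BasisState S → Prop) :
    embed e (proj P) = proj fun s => P (s ∘ e) := by
  rw [proj, embed_diagonal, proj]

theorem Prog.Performs.commute_proj {V : Prog N np Q} {D : SparseData N np}
    {π : BasisState Q → BasisState Q} (hV : V.Performs D π) {P : BasisState Q → Prop}
    (h : ∀ s, P (π s) ↔ P s) : Commute (proj P) (V.eval D) := by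
  rw [show V.eval D = mono 1 π from hV, proj, diagonal_eq_mono, Commute, SemiconjBy, mono_mul_mono,
    mono_mul_mono]
  congr 1
  funext s
  simp only [Pi.one_apply, mul_one, one_mul]
  classical
  exact if_congr (h s) rfl rfl

/-- The operator `Y` on the wires `e`, controlled by the wire `k`. -/
def ctl (k : Q) (e : S ↪ Q) (Y : Matrix (BasisState S) (BasisState S) ℂ) :
    Matrix (BasisState Q) (BasisState Q) ℂ :=
  (proj fun s => s k = false) + (proj fun s => s k = true) * embed e Y

theorem proj_false_add_true (k : Q) :
    ((proj fun s : BasisState Q => s k = false) + proj fun s => s k = true) = 1 := by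
  rw [proj, proj, Matrix.diagonal_add, ← Matrix.diagonal_one]
  congr 1
  funext s
  cases s k <;> simp

theorem proj_false_mul_true (k : Q) :
    ((proj fun s : BasisState Q => s k = false) * proj fun s => s k = true) = 0 := by
  rw [proj_mul, proj, ← Matrix.diagonal_zero]
  congr 1
  funext s
  cases s k <;> simp

theorem proj_true_mul_false (k : Q) :
    ((proj fun s : BasisState Q => s k = true) * proj fun s => s k = false) = 0 := by
  rw [(proj_comm _ _).eq, proj_false_mul_true]

theorem ctl_one (k : Q) (e : S ↪ Q) : ctl k e (1 : Matrix (BasisState S) _ ℂ) = 1 := by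
  rw [ctl, embed_one, mul_one, proj_false_add_true]

theorem ctl_mul {k : Q} {e : S ↪ Q} (hk : k ∉ Set.range e)
    (Y Y' : Matrix (BasisState S) (BasisState S) ℂ) : ctl k e Y * ctl k e Y' = ctl k e (Y * Y') := by
  have h0 : ∀ b, Commute (proj fun s : BasisState Q => s k = b) (embed e Y) := fun b =>
    proj_commute_embed e Y fun r s hrs hr => by rw [← hrs k hk]; exact hr
  simp only [ctl, embed_mul]
  rw [add_mul, mul_add, mul_add, proj_mul_self, ← mul_assoc, proj_false_mul_true, zero_mul, add_zero,
    mul_assoc _ (embed e Y), ← (h0 false).eq, ← mul_assoc _ _ (embed e Y), proj_true_mul_false,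
    zero_mul, zero_add, mul_assoc _ (embed e Y), ← mul_assoc (embed e Y) _ (embed e Y'),
    ← (h0 true).eq, ← mul_assoc, ← mul_assoc, proj_mul_self, mul_assoc]

theorem embed_ctl (ι : T ↪ Q) (k : T) (e : S ↪ T) (Y : Matrix (BasisState S) (BasisState S) ℂ) :
    embed ι (ctl k e Y) = ctl (ι k) (e.trans ι) Y := by
  have h := map_add (embedHom ι) (proj fun s : BasisState T => s k = false)
    ((proj fun s => s k = true) * embed e Y)
  simp only [embedHom_apply] at h
  rw [ctl, h, embed_mul, embed_embed, embed_proj, embed_proj]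
  rfl

theorem proj_commute_ctl (k : Q) (e : S ↪ Q) (Y : Matrix (BasisState S) (BasisState S) ℂ)
    {P : BasisState Q → Prop} (h : ∀ r s, AgreeOff e r s → P r → P s) :
    Commute (proj P) (ctl k e Y) :=
  (proj_comm _ _).add_right ((proj_comm _ _).mul_right (proj_commute_embed e Y h))

theorem proj_eq_condOp (a : Q) (b : Bool) : (proj fun s : BasisState Q => s a = b) =
    condOp a fun _ => Matrix.diagonal fun i => if i = b then 1 else 0 := by
  ext r s
  rw [proj, condOp_apply, Matrix.diagonal_apply, Matrix.diagonal_apply]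
  by_cases h : r = s
  · subst h; simp
  · rw [if_neg h]
    split_ifs with h1 h2 h3
    · rw [h2] at h1
      exact absurd (by simpa using h1) h
    · rfl
    · rfl
    · rfl

/-- A controlled Hadamard gate before and after a controlled operator, with the control of the
latter projected on zero, averages the operator with the identity. -/
theorem condGate_had_ctl (k a : Q) (hka : k ≠ a) (e : S ↪ Q) (ha : a ∉ Set.range e)
    (hk : k ∉ Set.range e) (Y : Matrix (BasisState S) (BasisState S) ℂ) :
    (proj fun s => s a = false) * condOp a (fun s => if s k then had else 1) * ctl a e Y *
        condOp a (fun s => if s k then had else 1) * (proj fun s => s a = false) =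
      ctl k e ((1 / 2 : ℂ) • (1 + Y)) * proj fun s => s a = false := by
  set h : Matrix (BasisState Q) (BasisState Q) ℂ := condOp a (fun s => if s k then had else 1)
    with hh
  set p := fun b => (proj fun s : BasisState Q => s a = b) with hp
  have hcomm : Commute h (embed e Y) := by
    have : h = embed (pairEmb k a hka) (condMat fun b => if b then had else 1) :=
      (embed_condOp (pairEmb k a hka) 1 fun s => if s 0 then had else 1).symm
    rw [this]
    refine embed_commute _ _ ?_ _ _
    rintro i j hij
    have : pairEmb k a hka i = k ∨ pairEmb k a hka i = a := by
      fin_cases i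
      exacts [Or.inl rfl, Or.inr rfl]
    rcases this with h' | h'
    · exact hk ⟨j, by rw [← hij, h']⟩
    · exact ha ⟨j, by rw [← hij, h']⟩
  have hpc : ∀ b, Commute (p b) (embed e Y) := fun b =>
    proj_commute_embed e Y fun r s hrs hr => by rw [← hrs a ha]; exact hr
  -- With `k` set, both values of the inner control carry weight 1/2; with `k` clear, only the value
  -- 0 survives.
  have hsand : ∀ b, p false * (h * (p b * (h * p false))) =
      (if b then (1 / 2 : ℂ) • (proj fun s => s k = true) else
        (proj fun s => s k = false) + (1 / 2 : ℂ) • proj fun s => s k = true) * p false := by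
    intro b
    have hupd : ∀ s : BasisState Q, ∀ b', Function.update s a b' k = s k := fun s b' =>
      Function.update_of_ne hka _ _
    simp only [hp, hh, proj_eq_condOp a]
    rw [condOp_mul_condOp _ _ _ (by intro s b'; simp only [hupd]), condOp_mul_condOp _ _ _ fun _ _ => rfl,
      condOp_mul_condOp _ _ _ (by intro s b'; simp only [hupd]), condOp_mul_condOp _ _ _ fun _ _ => rfl]
    have hrhs : (if b then (1 / 2 : ℂ) • (proj fun s => s k = true) else
        (proj fun s => s k = false) + (1 / 2 : ℂ) • proj fun s => s k = true) =
        Matrix.diagonal fun s : BasisState Q => if b then (if s k then 1 / 2 else 0 : ℂ) else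
          (if s k then 1 / 2 else 1) := by
      cases b
      · simp only [Bool.false_eq_true, if_false, proj]
        rw [← Matrix.diagonal_smul, Matrix.diagonal_add]
        congr 1
        funext s
        rcases Bool.eq_false_or_eq_true (s k) with h | h <;> simp [h]
      · simp only [if_true, proj]
        rw [← Matrix.diagonal_smul]
        congr 1
        funext s
        rcases Bool.eq_false_or_eq_true (s k) with h | h <;> simp [h]
    rw [hrhs]
    ext r s
    rw [Matrix.diagonal_mul, condOp_apply, condOp_apply]
    by_cases hrs : r = Function.update s a (r a)
    · have hrk : r k = s k := by rw [hrs, hupd]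
      rw [if_pos hrs, if_pos hrs, hrk]
      simp only [Matrix.mul_apply, Fintype.sum_bool,
        Matrix.diagonal_apply]
      have hsq := sqrt_two_inv_sq
      cases hr : r a <;> cases hs : s a <;> cases hsk : s k <;> cases b <;>
        simp [had] at hsq ⊢ <;> exact hsq
    · rw [if_neg hrs, if_neg hrs, mul_zero]
  have h1 : p false * h * ctl a e Y * h * p false =
      p false * (h * (p false * (h * p false))) + p false * (h * (p true * (h * p false))) *
        embed e Y := by
    have e1 : ctl a e Y = p false + p true * embed e Y := rfl
    have e2 : embed e Y * h * p false = h * p false * embed e Y := by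
      rw [← hcomm.eq, mul_assoc, ← (hpc false).eq, mul_assoc]
    rw [e1]
    calc p false * h * (p false + p true * embed e Y) * h * p false
        = p false * h * p false * h * p false + p false * h * p true * (embed e Y * h * p false) := by
          noncomm_ring
      _ = _ := by rw [e2]; noncomm_ring
  rw [h1, hsand, hsand]
  simp only [if_true, Bool.false_eq_true, if_false]
  have e3 : embed e ((1 / 2 : ℂ) • (1 + Y)) = (1 / 2 : ℂ) • (1 + embed e Y) := by
    have h := map_smul (embedHom e) (1 / 2 : ℂ) (1 + Y)
    rw [map_add, map_one] at h
    exact h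
  have e4 : ∀ X : Matrix (BasisState Q) (BasisState Q) ℂ, X * p false * embed e Y =
      X * embed e Y * p false := by
    intro X
    rw [mul_assoc, (hpc false).eq, mul_assoc]
  rw [e4, ctl, e3, ← add_mul]
  congr 1
  simp only [Algebra.mul_smul_comm, Algebra.smul_mul_assoc, mul_add, mul_one, smul_add]
  rw [add_assoc]

end Proj

namespace Core

variable {N np p w : ℕ}

/-- The entrywise description becomes an identity between projections, which can be transported to
larger wire sets and composed algebraically. -/
theorem IsBlock.proj_eq {U : Matrix (BasisState (Core N np p w)) (BasisState (Core N np p w)) ℂ}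
    {Y : Matrix (BasisState (Fin (indexQubits N) ⊕ Fin w))
      (BasisState (Fin (indexQubits N) ⊕ Fin w)) ℂ} (h : IsBlock U Y) :
    proj Clean * U * proj Clean = ctl .k st Y * proj Clean := by
  have hc : proj Clean * ctl .k st Y * proj Clean = ctl (Core.k : Core N np p w) st Y * proj Clean := by
    rw [(proj_commute_ctl (P := Clean) (Core.k : Core N np p w) st Y ?_).eq, mul_assoc,
      proj_mul_self]
    intro r s hrs hr a
    rw [← hrs _ (by rintro ⟨i | i, h⟩ <;> simp at h)]
    exact hr a
  rw [← hc]
  ext r s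
  simp only [proj, Matrix.mul_diagonal, Matrix.diagonal_mul]
  by_cases hr : Clean r
  swap
  · simp [hr]
  by_cases hs : Clean s
  swap
  · simp [hs]
  simp only [if_pos hr, if_pos hs, one_mul, mul_one]
  rw [h r s hr hs, ctl, Matrix.add_apply, proj, proj, Matrix.diagonal_mul, Matrix.diagonal_apply,
    Matrix.one_apply]
  have h2 := clean_eq_iff hr hs
  have h3 := clean_agreeOff_iff hr hs
  by_cases hk : r .k = s .k
  · rw [embed_apply_of_agreeOff _ (h3.2 hk), if_pos hk, hk]
    simp only [hk, true_and] at h2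
    simp only [h2]
    by_cases h4 : r ∘ st = s ∘ st <;> cases s .k <;> simp [h4]
  · rw [embed_apply_of_not _ (fun h' => hk (h3.1 h')), if_neg hk, mul_zero,
      if_neg (fun h' => hk (h2.1 h').1), add_zero]

end Core

/-! ### Projections on zero wires -/

section ZeroProj

variable {N np : ℕ} {S Q : Type} [Fintype S] [DecidableEq S] [Fintype Q] [DecidableEq Q]

/-- The projection on the states where all wires in `Z` hold `0`. -/
def zeroProj (Z : Set Q) : Matrix (BasisState Q) (BasisState Q) ℂ :=
  proj fun s => ∀ q ∈ Z, s q = false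

theorem zeroProj_mul (Z Z' : Set Q) : zeroProj Z * zeroProj Z' = zeroProj (Z ∪ Z') := by
  rw [zeroProj, zeroProj, proj_mul]
  exact proj_congr fun s => ⟨fun h q hq => hq.elim (h.1 q) (h.2 q),
    fun h => ⟨fun q hq => h q (Or.inl hq), fun q hq => h q (Or.inr hq)⟩⟩

theorem zeroProj_mul_self (Z : Set Q) : zeroProj Z * zeroProj Z = zeroProj Z := proj_mul_self _

theorem zeroProj_comm (Z Z' : Set Q) : Commute (zeroProj Z) (zeroProj Z') := proj_comm _ _

theorem zeroProj_singleton (a : Q) : zeroProj {a} = proj fun s : BasisState Q => s a = false :=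
  proj_congr fun s => by simp

theorem agreeOff_zero {e : S ↪ Q} {Z : Set Q} (h : ∀ i, e i ∉ Z) (r s : BasisState Q)
    (hrs : AgreeOff e r s) (hr : ∀ q ∈ Z, r q = false) (q : Q) (hq : q ∈ Z) : s q = false := by
  rw [← hrs q (by rintro ⟨i, rfl⟩; exact h i hq)]
  exact hr q hq

theorem zeroProj_commute_embed (e : S ↪ Q) (U : Matrix (BasisState S) (BasisState S) ℂ)
    {Z : Set Q} (h : ∀ i, e i ∉ Z) : Commute (zeroProj Z) (embed e U) :=
  proj_commute_embed e U (agreeOff_zero h)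

theorem zeroProj_commute_ctl (k : Q) (e : S ↪ Q) (Y : Matrix (BasisState S) (BasisState S) ℂ)
    {Z : Set Q} (h : ∀ i, e i ∉ Z) : Commute (zeroProj Z) (ctl k e Y) :=
  proj_commute_ctl k e Y (agreeOff_zero h)

theorem zeroProj_commute_performs {V : Prog N np Q} {D : SparseData N np}
    {π : BasisState Q → BasisState Q} (hV : V.Performs D π) {Z : Set Q}
    (h : ∀ s, ∀ q ∈ Z, π s q = s q) : Commute (zeroProj Z) (V.eval D) :=
  hV.commute_proj fun s => forall₂_congr fun q hq => by rw [h s q hq]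

theorem zeroProj_commute_condOp (a : Q) (f : BasisState Q → Matrix Bool Bool ℂ) {Z : Set Q}
    (ha : a ∉ Z) : Commute (zeroProj Z) (condOp a f) := by
  ext r s
  rw [zeroProj, proj, Matrix.diagonal_mul, Matrix.mul_diagonal, condOp_apply]
  by_cases h : r = Function.update s a (r a)
  · rw [if_pos h]
    have : (∀ q ∈ Z, r q = false) ↔ ∀ q ∈ Z, s q = false := by
      refine forall₂_congr fun q hq => ?_
      have hqa : q ≠ a := fun h' => ha (h' ▸ hq)
      rw [h, Function.update_of_ne hqa]
    rw [mul_comm]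
    by_cases h' : ∀ q ∈ Z, s q = false
    · rw [if_pos h', if_pos (this.2 h')]
    · rw [if_neg h', if_neg fun h'' => h' (this.1 h'')]
  · rw [if_neg h, mul_zero, zero_mul]

theorem had_cond_mem (b : Bool) :
    (if b then had else 1 : Matrix Bool Bool ℂ) ∈ Matrix.unitaryGroup Bool ℂ := by
  split_ifs
  exacts [had_mem, one_mem _]

end ZeroProj

/-- Removal of a flagged operation between projections. -/
theorem flag_step {A : Type*} [Ring A] {R f z V F U G C : A}
    (hf : f * f = f) (hR : R * R = R) (hz : z * z = z) (hRf : Commute R f) 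
    (hfz : Commute f z) (hV : Commute f V) (hF : Commute R F) (hUR : Commute R U)
    (hUf : Commute f U) (hflag : R * f * F * (R * f) = R * f * z)
    (hVG : R * V * (R * z) = G * (R * z)) (hUC : z * U * z = C * z) (hCR : Commute R C) (hCf : Commute f C) (hCz : Commute z C) :
    R * f * (V * (F * U)) * (R * f * z) = G * C * (R * f * z) := by
  have h1 : ∀ X, f * (F * (R * (f * X))) = R * (f * (z * X)) := by
    intro X
    have h : R * (f * (F * (R * (f * X)))) = R * (f * (z * X)) := by
      simpa only [mul_assoc] using congrArg (· * X) hflag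
    rw [← h, hRf.left_comm (F * _), hF.left_comm, ← mul_assoc R R, hR]
  have h2 : ∀ X, R * (V * (R * (z * X))) = G * (R * (z * X)) := by
    intro X
    simpa only [mul_assoc] using congrArg (· * X) hVG
  have h3 : z * (U * z) = z * (C * z) := by
    rw [← mul_assoc, hUC, hCz.left_comm, hz]
  have h4 : ∀ X, f * (f * X) = f * X := by
    intro X
    rw [← mul_assoc, hf]
  simp only [mul_assoc]
  rw [← hUR.left_comm, ← hUf.left_comm, ← h4 (V * _), hV.left_comm, h1, h3, hV.left_comm,
    ← hRf.left_comm, h4, hfz.left_comm, h2, hCf.left_comm, hCz.left_comm, hCR.left_comm,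
    ← hfz.left_comm, hz]

/-! ### The nested levels of the truncated series -/

/-- Ancilla wires of the series circuit: time register, scratch, control chain, flags, and the
workspace of the zero test that sets the flags. -/
inductive Anc (N np p w K : ℕ) : Type
  | tm (i : Fin w)
  | s (a : Scratch N np p w)
  | kap (i : Fin (K + 1))
  | fl (o : Bool) (i : Fin K)
  | v (a : Scratch N np p w)
  | c
  deriving DecidableEq, Fintype

/-- The wires of the series circuit. -/
abbrev SerWires (N np p w K : ℕ) : Type := Fin (indexQubits N) ⊕ Anc N np p w K

namespace Series

variable {N np p w K : ℕ}

/-- The wires of an elementary block with control `kap i`. -/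
def core (i : Fin (K + 1)) : Core N np p w ↪ SerWires N np p w K :=
  ⟨fun q => match q with
    | .x j => .inl j
    | .tm j => .inr (.tm j)
    | .k => .inr (.kap i)
    | .s a => .inr (.s a), by
    rintro (_ | _ | _ | _) (_ | _ | _ | _) h <;> simp_all⟩

/-- The system and time registers. -/
def sys : Fin (indexQubits N) ⊕ Fin w ↪ SerWires N np p w K :=
  ⟨Sum.elim .inl fun i => .inr (.tm i), by rintro (i | i) (j | j) h <;> simp_all⟩

theorem st_trans_core (i : Fin (K + 1)) :
    (Core.st.trans (core i) : _ ↪ SerWires N np p w K) = sys := by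
  ext q
  rcases q with q | q <;> rfl

/-- The scratch wires. -/
def scr : Set (SerWires N np p w K) := Set.range fun a => .inr (.s a)

/-- Sets the flag if some scratch wire is non-zero. -/
def flag (o : Bool) (i : Fin K) : Prog N np (SerWires N np p w K) :=
  compare (.inr .c) ((Finset.univ : Finset (Scratch N np p w)).toList.map fun a =>
    (.inr (.s a), .inr (.v a))) (.inr (.fl o i))

theorem flag_performs (D : SparseData N np) (o : Bool) (i : Fin K) :
    (flag o i : Prog N np (SerWires N np p w K)).Performs D fun s =>
      Function.update s (.inr (.fl o i)) ((s (.inr (.fl o i))).xor (carry (s (.inr .c))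
        ((Finset.univ : Finset (Scratch N np p w)).toList.map fun a =>
          (s (.inr (.s a)), s (.inr (.v a)))))) := by
  refine (compare_performs D _ _ _ ?_).congr fun s q => ?_
  · rw [List.nodup_cons, List.nodup_cons, List.mem_cons, mem_pairWires_map, mem_pairWires_map]
    refine ⟨by simp, by simp, nodup_pairWires_map _ (Finset.nodup_toList _) _ _ ?_ ?_ ?_⟩
    · intro a b h; simpa using h
    · intro a b h; simpa using h
    · simp
  · rw [List.map_map]; rfl

/-- The wires that hold `0` before and after the last `i` levels. -/
def rest (i : ℕ) : Set (SerWires N np p w K) := {q | (∃ j : Fin (K + 1), j < i ∧ q = .inr (.kap j)) ∨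
  (∃ b, ∃ j : Fin K, j < i ∧ q = .inr (.fl b j)) ∨ (∃ a, q = .inr (.v a)) ∨ q = .inr .c}

/-- If the flag starts at 0 and is later projected on 0, the test acts as the projection of the
scratch wires onto zero. This replaces an intermediate measurement, at the cost of one qubit for
each test. -/
theorem flag_proj (D : SparseData N np) (o : Bool) (i : Fin K) (Z : Set (SerWires N np p w K))
    (hv : ∀ a, .inr (.v a) ∈ Z) (hc : .inr .c ∈ Z) :
    zeroProj (Z ∪ {.inr (.fl o i)}) * (flag o i : Prog N np (SerWires N np p w K)).eval D *
      zeroProj (Z ∪ {.inr (.fl o i)}) = zeroProj (Z ∪ {.inr (.fl o i)}) * zeroProj scr := by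
  rw [show Prog.eval (flag o i : Prog N np (SerWires N np p w K)) D = _ from flag_performs D o i,
    zeroProj_mul]
  ext r s
  simp only [zeroProj, proj, Matrix.mul_diagonal, Matrix.diagonal_mul, mono_apply]
  by_cases hs : ∀ q ∈ Z ∪ {.inr (.fl o i)}, s q = false
  swap
  · rw [if_neg hs, mul_zero, Matrix.diagonal_apply]
    split_ifs with h1 h2
    · rw [h1] at h2
      exact absurd (fun q hq => h2 q (Or.inl hq)) hs
    · rfl
    · rfl
  have hfl : s (.inr (.fl o i)) = false := hs _ (Or.inr rfl)
  have hcs : s (.inr .c) = false := hs _ (Or.inl hc)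
  have hvs : ∀ a, s (.inr (.v a)) = false := fun a => hs _ (Or.inl (hv a))
  rw [if_pos hs, mul_one]
  simp only [hfl, hcs, hvs, carry_false_right, Bool.false_or, Bool.false_xor]
  by_cases hscr : ∀ a : Scratch N np p w, s (.inr (.s a)) = false
  · have : (Finset.univ : Finset (Scratch N np p w)).toList.any (fun a => s (.inr (.s a))) = false := by
      simp [hscr]
    have hupd : Function.update s (.inr (.fl o i)) false = s := by
      rw [← hfl]
      exact Function.update_eq_self _ _
    rw [this, hupd, Matrix.diagonal_apply]
    by_cases hrs : r = s
    · subst hrs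
      rw [if_pos hs, if_pos rfl, if_pos rfl, if_pos, one_mul, Pi.one_apply]
      rintro q (hq | ⟨a, rfl⟩)
      exacts [hs q hq, hscr a]
    · rw [if_neg hrs, if_neg hrs, mul_zero]
  · have : (Finset.univ : Finset (Scratch N np p w)).toList.any (fun a => s (.inr (.s a))) = true := by
      rw [List.any_eq_true]
      push Not at hscr
      obtain ⟨a, ha⟩ := hscr
      exact ⟨a, by simp, by simpa using ha⟩
    rw [this, Matrix.diagonal_apply]
    have h1 : r = s → ¬ ∀ q ∈ Z ∪ {.inr (.fl o i)} ∪ scr, r q = false := by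
      intro h h'
      exact hscr fun a => by rw [← h]; exact h' _ (Or.inr ⟨a, rfl⟩)
    trans 0
    swap
    · split_ifs with h h'
      exacts [absurd h' (h1 h), rfl, rfl]
    -- Some scratch wire is set, so the test raises the flag and the outer projection kills the
    -- state.
    by_cases hr : r = Function.update s (.inr (.fl o i)) true
    · rw [if_neg, zero_mul]
      intro h
      have := h (.inr (.fl o i)) (Or.inr rfl)
      rw [hr, Function.update_self] at this
      exact Bool.noConfusion this
    · rw [if_neg hr, mul_zero]

end Series

theorem mul_embed_apply {S Q : Type} [Fintype S] [DecidableEq S] [Fintype Q] [DecidableEq Q]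
    (e : S ↪ Q) (U : Matrix (BasisState S) (BasisState S) ℂ)
    (X : Matrix (BasisState Q) (BasisState Q) ℂ) (r s : BasisState Q) :
    (X * embed e U) r s = ∑ v, X r (overwrite e v s) * U v (s ∘ e) := by
  rw [Matrix.mul_apply]
  symm
  refine Fintype.sum_of_injective (fun v => overwrite e v s) (overwrite_injective e s) _ _ ?_ ?_
  · intro k hk
    rw [embed_apply_of_not, mul_zero]
    intro h
    exact hk ⟨k ∘ e, ((eq_overwrite_iff e _ k s).2 ⟨h, rfl⟩).symm⟩
  · intro v
    rw [embed_apply_of_agreeOff U (agreeOff_overwrite e v s), overwrite_comp]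

theorem mono_mul_apply {Q : Type} [Fintype Q] [DecidableEq Q] {π : BasisState Q → BasisState Q}
    (hπ : ∀ s, π (π s) = s) (X : Matrix (BasisState Q) (BasisState Q) ℂ) (r s : BasisState Q) :
    (mono 1 π * X) r s = X (π r) s := by
  rw [Matrix.mul_apply, Finset.sum_eq_single (π r)]
  · rw [mono_apply, hπ, if_pos rfl, Pi.one_apply, one_mul]
  · intro k _ hk
    rw [mono_apply, if_neg, zero_mul]
    intro h
    exact hk (by rw [h, hπ])
  · simp

/-- Conjugation of an operation by an operator that commutes with all but one of the projections. -/
theorem conj_step {A : Type*} [Ring A] {q π z h V G G' : A} (hqπ : Commute q π) (hqh : Commute q h)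
    (hzh : Commute z h) (hzπ : Commute z π) (hV : q * V * (q * z) = G * (q * z))
    (hG : π * h * G * h * π = G' * π) : q * π * (h * (V * h)) * (q * π * z) = G' * (q * π * z) := by
  have h1 : ∀ X, q * (V * (q * (z * X))) = G * (q * (z * X)) := by
    intro X
    simpa only [mul_assoc] using congrArg (· * X) hV
  have h2 : ∀ X, π * (h * (G * (h * (π * X)))) = G' * (π * X) := by
    intro X
    simpa only [mul_assoc] using congrArg (· * X) hG
  simp only [mul_assoc]
  rw [← hzπ.eq, hqπ.left_comm, hqh.left_comm, ← hqh.left_comm (z * π), ← hzh.left_comm, h1, hzh.left_comm,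
    hqh.left_comm, hzπ.eq, hqπ.left_comm, h2]

namespace Series

variable {N np p w K : ℕ}

/-- The last `i` levels of the series circuit, where level `i + 1` performs `P₁ i` and then `P₂ i`. -/
def levels (P₁ P₂ : ℕ → Prog N np (Core N np p w)) : (i : ℕ) → i ≤ K → Prog N np (SerWires N np p w K)
  | 0, _ => []
  | i + 1, h =>
    condGate (fun b => if b then had else 1) (.inr (.kap ⟨i + 1, by omega⟩))
      (.inr (.kap ⟨i, by omega⟩)) ++
    ((P₁ i).map (core ⟨i, by omega⟩) ++ (flag false ⟨i, by omega⟩ ++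
      ((P₂ i).map (core ⟨i, by omega⟩) ++ (flag true ⟨i, by omega⟩ ++
        levels P₁ P₂ i (by omega))))) ++
    condGate (fun b => if b then had else 1) (.inr (.kap ⟨i + 1, by omega⟩))
      (.inr (.kap ⟨i, by omega⟩))

/-- The operator performed by the last `i` levels. -/
def levelMat {T : Type} [Fintype T] [DecidableEq T] (Y₁ Y₂ : ℕ → Matrix T T ℂ) : ℕ → Matrix T T ℂ
  | 0 => 1
  | i + 1 => (1 / 2 : ℂ) • (1 + levelMat Y₁ Y₂ i * (Y₂ i * Y₁ i))

variable (D : SparseData N np) {P₁ P₂ : ℕ → Prog N np (Core N np p w)}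

theorem levels_eval_succ (i : ℕ) (h : i + 1 ≤ K) :
    (levels P₁ P₂ (i + 1) h : Prog N np (SerWires N np p w K)).eval D =
      condOp (.inr (.kap ⟨i, by omega⟩)) (fun s => if s (.inr (.kap ⟨i + 1, by omega⟩)) then had else 1) *
      ((levels P₁ P₂ i (by omega)).eval D * ((flag true ⟨i, by omega⟩ : Prog N np _).eval D *
        embed (core ⟨i, by omega⟩) ((P₂ i).eval D)) *
        ((flag false ⟨i, by omega⟩ : Prog N np _).eval D * embed (core ⟨i, by omega⟩) ((P₁ i).eval D)) *
      condOp (.inr (.kap ⟨i, by omega⟩))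
        (fun s => if s (.inr (.kap ⟨i + 1, by omega⟩)) then had else 1)) := by
  rw [levels, Prog.eval_append, Prog.eval_append, Prog.eval_append, Prog.eval_append,
    Prog.eval_append, Prog.eval_append, condGate_eval D _ had_cond_mem (by simp), Prog.eval_map,
    Prog.eval_map]
  simp only [mul_assoc]

theorem flag_commute (o o' : Bool) (i j : Fin K) (h : (o, i) ≠ (o', j)) :
    Commute (zeroProj {.inr (.fl o i)}) ((flag o' j : Prog N np (SerWires N np p w K)).eval D) := by
  refine zeroProj_commute_performs (flag_performs D o' j) fun s q hq => ?_
  rw [Set.mem_singleton_iff] at hq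
  subst hq
  refine Function.update_of_ne ?_ _ _
  intro h'
  simp at h'
  exact h (Prod.ext h'.1 h'.2)

/-- Inner levels never touch the flags of outer ones. Projections on those flags can therefore be
moved to the place where the flag is set. -/
theorem levels_commute (o : Bool) (j : Fin K) (i : ℕ) (h : i ≤ K) (hij : i ≤ j) :
    Commute (zeroProj {.inr (.fl o j)})
      ((levels P₁ P₂ i h : Prog N np (SerWires N np p w K)).eval D) := by
  induction i with
  | zero => exact Commute.one_right _
  | succ i ih =>
    rw [levels_eval_succ]
    have hc : ∀ X, Commute (zeroProj {.inr (.fl o j)})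
        (embed (core (N := N) (np := np) (p := p) (w := w) (K := K) ⟨i, by omega⟩) X) := fun X =>
      zeroProj_commute_embed _ _ (by rintro (_ | _ | _ | _) h <;> cases h)
    have hf : ∀ o', Commute (zeroProj {.inr (.fl o j)})
        ((flag o' ⟨i, by omega⟩ : Prog N np (SerWires N np p w K)).eval D) := fun o' =>
      flag_commute D o o' j _ (by rintro h; simp [Fin.ext_iff] at h; omega)
    have hh : ∀ f, Commute (zeroProj {.inr (.fl o j)})
        (condOp (.inr (.kap ⟨i, by omega⟩) : SerWires N np p w K) f) := fun f =>
      zeroProj_commute_condOp _ _ (by simp)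
    exact (hh _).mul_right ((((ih _ (by omega)).mul_right ((hf _).mul_right (hc _))).mul_right
      ((hf _).mul_right (hc _))).mul_right (hh _))

theorem rest_succ (i : ℕ) (h : i + 1 ≤ K) : (rest (i + 1) : Set (SerWires N np p w K)) =
    rest i ∪ {.inr (.fl true ⟨i, by omega⟩)} ∪ {.inr (.fl false ⟨i, by omega⟩)} ∪
      {.inr (.kap ⟨i, by omega⟩)} := by
  ext q
  simp only [rest, Set.mem_ofPred_eq, Set.mem_union, Set.mem_singleton_iff]
  constructor
  · rintro (⟨j, hj, rfl⟩ | ⟨o, j, hj, rfl⟩ | h | h)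
    · by_cases hji : (j : ℕ) = i
      · exact Or.inr (by simp [Fin.ext_iff, hji])
      · exact Or.inl (Or.inl (Or.inl (Or.inl ⟨j, by omega, rfl⟩)))
    · by_cases hji : (j : ℕ) = i
      · cases o
        · exact Or.inl (Or.inr (by simp [Fin.ext_iff, hji]))
        · exact Or.inl (Or.inl (Or.inr (by simp [Fin.ext_iff, hji])))
      · exact Or.inl (Or.inl (Or.inl (Or.inr (Or.inl ⟨o, j, by omega, rfl⟩))))
    · exact Or.inl (Or.inl (Or.inl (Or.inr (Or.inr (Or.inl h)))))
    · exact Or.inl (Or.inl (Or.inl (Or.inr (Or.inr (Or.inr h)))))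
  · rintro ((((⟨j, hj, rfl⟩ | ⟨o, j, hj, rfl⟩ | h | h) | rfl) | rfl) | rfl)
    · exact Or.inl ⟨j, by omega, rfl⟩
    · exact Or.inr (Or.inl ⟨o, j, by omega, rfl⟩)
    · exact Or.inr (Or.inr (Or.inl h))
    · exact Or.inr (Or.inr (Or.inr h))
    · exact Or.inr (Or.inl ⟨_, _, Nat.lt_succ_self i, rfl⟩)
    · exact Or.inr (Or.inl ⟨_, _, Nat.lt_succ_self i, rfl⟩)
    · exact Or.inl ⟨_, Nat.lt_succ_self i, rfl⟩

theorem core_proj (i : Fin (K + 1))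
    {U : Matrix (BasisState (Core N np p w)) (BasisState (Core N np p w)) ℂ}
    {Y : Matrix (BasisState (Fin (indexQubits N) ⊕ Fin w))
      (BasisState (Fin (indexQubits N) ⊕ Fin w)) ℂ} (h : Core.IsBlock U Y) :
    zeroProj scr * embed (core (K := K) i) U * zeroProj scr =
      ctl (.inr (.kap i)) sys Y * zeroProj scr := by
  have h1 := congrArg (embed (core (K := K) i)) h.proj_eq
  rw [embed_mul, embed_mul, embed_mul, embed_ctl, st_trans_core, embed_proj] at h1
  have h2 : (proj fun s : BasisState (SerWires N np p w K) => Core.Clean (s ∘ core i)) =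
      zeroProj scr := proj_congr fun s => by
    constructor
    · rintro h _ ⟨a, rfl⟩
      exact h a
    · intro h a
      exact h _ ⟨a, rfl⟩
  rw [h2] at h1
  exact h1

theorem sys_notMem_scr (q : Fin (indexQubits N) ⊕ Fin w) :
    (sys q : SerWires N np p w K) ∉ scr := by
  rintro ⟨a, h⟩
  rcases q with q | q <;> cases h

theorem sys_notMem_rest (i : ℕ) (q : Fin (indexQubits N) ⊕ Fin w) :
    (sys q : SerWires N np p w K) ∉ rest i := by
  rintro (⟨j, hj, h⟩ | ⟨o, j, hj, h⟩ | ⟨a, h⟩ | h) <;> rcases q with q | q <;> cases h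

theorem core_notMem_rest (i : ℕ) (j : Fin (K + 1)) (hij : i ≤ j) (q : Core N np p w) :
    core j q ∉ rest i := by
  rintro (⟨j', hj, h⟩ | ⟨o, j', hj, h⟩ | ⟨a, h⟩ | h) <;> rcases q with q | q | _ | q <;> cases h
  omega

theorem kap_notMem_sys (i : Fin (K + 1)) :
    (.inr (.kap i) : SerWires N np p w K) ∉ Set.range sys := by
  rintro ⟨q | q, h⟩ <;> cases h

/-- The scratch projection appears on the right only: it holds initially and is enforced by flags
after each block, while after the inner levels nothing needs to be assumed about it. This one-sided
form is stable under induction. -/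
theorem levels_proj {Y₁ Y₂ : ℕ → Matrix (BasisState (Fin (indexQubits N) ⊕ Fin w))
      (BasisState (Fin (indexQubits N) ⊕ Fin w)) ℂ}
    (h₁ : ∀ i, Core.IsBlock ((P₁ i).eval D) (Y₁ i)) (h₂ : ∀ i, Core.IsBlock ((P₂ i).eval D) (Y₂ i))
    (i : ℕ) (h : i ≤ K) :
    zeroProj (rest i) * (levels P₁ P₂ i h : Prog N np (SerWires N np p w K)).eval D *
        (zeroProj (rest i) * zeroProj scr) =
      ctl (.inr (.kap ⟨i, by omega⟩)) sys (levelMat Y₁ Y₂ i) *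
        (zeroProj (rest i) * zeroProj scr) := by
  induction i with
  | zero =>
    rw [levels, levelMat, ctl_one, Prog.eval_nil, mul_one, one_mul, ← mul_assoc, zeroProj_mul_self]
  | succ i ih =>
    have h0 := ih (by omega)
    set R := (zeroProj (rest i) : Matrix (BasisState (SerWires N np p w K)) _ ℂ) with hR
    set z := (zeroProj scr : Matrix (BasisState (SerWires N np p w K)) _ ℂ) with hz
    set f := fun o => (zeroProj {.inr (.fl o ⟨i, by omega⟩)} :
      Matrix (BasisState (SerWires N np p w K)) _ ℂ) with hf
    set π := (zeroProj {.inr (.kap ⟨i, by omega⟩)} :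
      Matrix (BasisState (SerWires N np p w K)) _ ℂ) with hπ
    set κ : SerWires N np p w K := .inr (.kap ⟨i, by omega⟩) with hκ
    have hsysfl : ∀ o q, (sys q : SerWires N np p w K) ∉
        ({.inr (.fl o ⟨i, by omega⟩)} : Set (SerWires N np p w K)) := by
      rintro o (q | q) h <;> cases h
    have hcorefl : ∀ o q, (core ⟨i, by omega⟩ q : SerWires N np p w K) ∉
        ({.inr (.fl o ⟨i, by omega⟩)} : Set (SerWires N np p w K)) := by
      rintro o (_ | _ | _ | _) h <;> cases h
    have hflR : ∀ o, Commute R ((flag o ⟨i, by omega⟩ : Prog N np (SerWires N np p w K)).eval D) := by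
      intro o
      refine zeroProj_commute_performs (flag_performs D o _) fun s q hq => ?_
      refine Function.update_of_ne ?_ _ _
      rintro rfl
      rcases hq with ⟨j, hj, h⟩ | ⟨o, j, hj, h⟩ | ⟨a, h⟩ | h <;> cases h
      exact lt_irrefl _ hj
    have hvR : ∀ a, (.inr (.v a) : SerWires N np p w K) ∈ rest i := fun a =>
      Or.inr (Or.inr (Or.inl ⟨a, rfl⟩))
    have hcR : (.inr .c : SerWires N np p w K) ∈ rest i := Or.inr (Or.inr (Or.inr rfl))
    -- The second block and its flag are absorbed first, then the first block and its flag, working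
    -- outward from the inner levels.
    have s1 := flag_step (R := R) (f := f true) (z := z) (zeroProj_mul_self _) (zeroProj_mul_self _)
      (zeroProj_mul_self _) (zeroProj_comm _ _) (zeroProj_comm _ _)
      (levels_commute D true ⟨i, by omega⟩ i (by omega) le_rfl) (hflR true)
      (zeroProj_commute_embed _ _ (core_notMem_rest i ⟨i, by omega⟩ le_rfl))
      (zeroProj_commute_embed _ _ (hcorefl true))
      (by simp only [hR, hf, hz, zeroProj_mul]
          rw [flag_proj D true _ _ hvR hcR, zeroProj_mul])
      h0 (core_proj ⟨i, by omega⟩ (h₂ i))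
      (zeroProj_commute_ctl κ sys (Y₂ i) (sys_notMem_rest i))
      (zeroProj_commute_ctl κ sys (Y₂ i) (hsysfl true))
      (zeroProj_commute_ctl κ sys (Y₂ i) sys_notMem_scr)
    have hlev : Commute (f false) ((levels P₁ P₂ i (by omega) : Prog N np (SerWires N np p w K)).eval D *
        ((flag true ⟨i, by omega⟩ : Prog N np _).eval D *
          embed (core ⟨i, by omega⟩) ((P₂ i).eval D))) :=
      (levels_commute D false ⟨i, by omega⟩ i (by omega) le_rfl).mul_right
        ((flag_commute D false true _ _ (by simp)).mul_right
          (zeroProj_commute_embed _ _ (hcorefl false)))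
    have s2 := flag_step (R := R * f true) (f := f false) (z := z) (zeroProj_mul_self _)
      (by rw [hR, hf, zeroProj_mul, zeroProj_mul_self])
      (zeroProj_mul_self _) (by rw [hR, hf, zeroProj_mul]; exact zeroProj_comm _ _)
      (zeroProj_comm _ _) hlev
      ((hflR false).mul_left (flag_commute D true false _ _ (by simp)))
      ((zeroProj_commute_embed _ _ (core_notMem_rest i ⟨i, by omega⟩ le_rfl)).mul_left
        (zeroProj_commute_embed _ _ (hcorefl true)))
      (zeroProj_commute_embed _ _ (hcorefl false))
      (by simp only [hR, hf, hz, zeroProj_mul]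
          rw [flag_proj D false _ _ (fun a => Or.inl (hvR a)) (Or.inl hcR), zeroProj_mul])
      s1 (core_proj ⟨i, by omega⟩ (h₁ i))
      ((zeroProj_commute_ctl κ sys (Y₁ i) (sys_notMem_rest i)).mul_left
        (zeroProj_commute_ctl κ sys (Y₁ i) (hsysfl true)))
      (zeroProj_commute_ctl κ sys (Y₁ i) (hsysfl false))
      (zeroProj_commute_ctl κ sys (Y₁ i) sys_notMem_scr)
    rw [ctl_mul (kap_notMem_sys _), ctl_mul (kap_notMem_sys _), mul_assoc (levelMat Y₁ Y₂ i)] at s2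
    -- The pair of controlled Hadamard gates averages the accumulated product with the identity and
    -- passes the control to the next link of the chain.
    have hh := condGate_had_ctl (.inr (.kap ⟨i + 1, by omega⟩)) κ (by simp [hκ, Fin.ext_iff]) sys
      (kap_notMem_sys _) (kap_notMem_sys _) (levelMat Y₁ Y₂ i * (Y₂ i * Y₁ i))
    rw [← zeroProj_singleton] at hh
    rw [levels_eval_succ, levelMat, rest_succ i h, ← zeroProj_mul, ← zeroProj_mul, ← zeroProj_mul]
    change R * f true * f false * π * _ * (R * f true * f false * π * z) =
      _ * (R * f true * f false * π * z)
    set q := R * f true * f false with hq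
    set hd := condOp κ (fun s => if s (.inr (.kap ⟨i + 1, by omega⟩)) then had else 1) with hhd
    have hqh : Commute q hd := by
      have hk1 : κ ∉ rest i := by
        rw [hκ]
        rintro (⟨j, hj, h⟩ | ⟨o, j, hj, h⟩ | ⟨a, h⟩ | h) <;> cases h
        exact lt_irrefl _ hj
      exact ((zeroProj_commute_condOp _ _ hk1).mul_left
        (zeroProj_commute_condOp _ _ (by simp [hκ]))).mul_left
          (zeroProj_commute_condOp _ _ (by simp [hκ]))
    have hzh : Commute z hd := zeroProj_commute_condOp _ _ (by rw [hκ]; rintro ⟨a, h⟩; cases h)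
    have hqπ : Commute q π := by
      simp only [hq, hR, hf, zeroProj_mul]; exact zeroProj_comm _ _
    have hzπ : Commute z π := zeroProj_comm _ _
    generalize (levels P₁ P₂ i _).eval D * _ * _ = V at s2 ⊢
    generalize ctl κ sys (levelMat Y₁ Y₂ i * (Y₂ i * Y₁ i)) = G at s2 hh
    exact conj_step hqπ hqh hzh hzπ s2 hh

end Series

namespace Series

variable {N np p w K : ℕ}

/-- The time register. -/
def time : Fin w ↪ SerWires N np p w K := ⟨fun i => .inr (.tm i), fun i j h => by simpa using h⟩

/-- The wire that starts the control chain. -/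
abbrev start : SerWires N np p w K := .inr (.kap (Fin.last K))

/-- The circuit of the truncated series. -/
def series (P₁ P₂ : ℕ → Prog N np (Core N np p w)) : Prog N np (SerWires N np p w K) :=
  rots time (fun _ => had) ++ notGate start ++ levels P₁ P₂ K le_rfl ++ notGate start ++
    rots time (fun _ => had)

/-- The state of system and time registers, with the control chain started. -/
def started (x : BasisState (Fin (indexQubits N))) (t : BasisState (Fin w)) :
    BasisState (SerWires N np p w K) := fun q =>
  match q with
  | .inl i => x i
  | .inr (.tm j) => t j
  | .inr (.kap j) => decide (j = Fin.last K)
  | _ => false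

/-- The outer Hadamard layers prepare and collect a uniform superposition of times; the NOT gates
start the control chain and reset it. -/
theorem series_block (D : SparseData N np) {P₁ P₂ : ℕ → Prog N np (Core N np p w)}
    {Y₁ Y₂ : ℕ → Matrix (BasisState (Fin (indexQubits N) ⊕ Fin w))
      (BasisState (Fin (indexQubits N) ⊕ Fin w)) ℂ}
    (h₁ : ∀ i, Core.IsBlock ((P₁ i).eval D) (Y₁ i)) (h₂ : ∀ i, Core.IsBlock ((P₂ i).eval D) (Y₂ i))
    (r s : BasisState (SerWires N np p w K)) (hr : ∀ a, r (.inr a) = false)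
    (hs : ∀ a, s (.inr a) = false) :
    (series P₁ P₂ : Prog N np (SerWires N np p w K)).eval D r s =
      1 / 2 ^ w * ∑ t' : BasisState (Fin w), ∑ t : BasisState (Fin w),
        levelMat Y₁ Y₂ K (Sum.elim (fun i => r (.inl i)) t') (Sum.elim (fun i => s (.inl i)) t) := by
  have hrt : ∀ i, (r ∘ time) i = false := fun i => hr _
  have hst : ∀ i, (s ∘ time) i = false := fun i => hs _
  have hflip : ∀ s : BasisState (SerWires N np p w K),
      (fun s => Function.update s start (!s start)) ((fun s => Function.update s start (!s start)) s)
        = s := by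
    intro s
    simp
  have hstart : ∀ (s : BasisState (SerWires N np p w K)) (t : BasisState (Fin w)),
      (∀ a, s (.inr a) = false) → Function.update (overwrite time t s) start
        (!(overwrite time t s) start) = started (fun i => s (.inl i)) t := by
    intro s t hs
    have hov : ∀ q : SerWires N np p w K, (∀ i, q ≠ .inr (.tm i)) → overwrite time t s q = s q :=
      fun q hq => overwrite_of_notMem _ _ _ (by rintro ⟨i, rfl⟩; exact hq i rfl)
    funext q
    by_cases hq : q = start
    · subst hq
      rw [Function.update_self, hov _ (by simp), hs]
      simp [started]
    · rw [Function.update_of_ne hq]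
      rcases q with i | (i | a | i | ⟨o, i⟩ | a | _)
      case inl => rw [hov _ (by simp)]; rfl
      case inr.tm => exact overwrite_apply time t s i
      case inr.kap =>
        rw [hov _ (by simp), hs]
        have : i ≠ Fin.last K := fun h => hq (by rw [h])
        simp [started, this]
      all_goals
        rw [hov _ (by simp), hs]
        rfl
  have hlev : ∀ (x y : BasisState (Fin (indexQubits N))) (t' t : BasisState (Fin w)),
      (levels P₁ P₂ K le_rfl : Prog N np (SerWires N np p w K)).eval D (started x t') (started y t) =
        levelMat Y₁ Y₂ K (Sum.elim x t') (Sum.elim y t) := by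
    intro x y t' t
    have hrest : ∀ (x : BasisState (Fin (indexQubits N))) (t : BasisState (Fin w)),
        ∀ q ∈ rest K, (started x t : BasisState (SerWires N np p w K)) q = false := by
      rintro x t q (⟨j, hj, rfl⟩ | ⟨o, j, hj, rfl⟩ | ⟨a, rfl⟩ | rfl)
      · have : j ≠ Fin.last K := by
          rintro rfl
          simp at hj
        simp [started, this]
      all_goals rfl
    have hscr : ∀ (x : BasisState (Fin (indexQubits N))) (t : BasisState (Fin w)),
        ∀ q ∈ scr, (started x t : BasisState (SerWires N np p w K)) q = false := by
      rintro x t q ⟨a, rfl⟩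
      rfl
    have h := congrFun (congrFun (levels_proj (K := K) D h₁ h₂ K le_rfl) (started x t')) (started y t)
    rw [← mul_assoc, ← mul_assoc, zeroProj, zeroProj, mul_proj_apply _ _ _ _ (hscr y t),
      mul_proj_apply _ _ _ _ (hrest y t), mul_proj_apply _ _ _ _ (hscr y t),
      mul_proj_apply _ _ _ _ (hrest y t), proj_mul_apply _ _ _ _ (hrest x t')] at h
    rw [h, ctl, Matrix.add_apply, proj, proj, Matrix.diagonal_mul, Matrix.diagonal_apply]
    have hk : ∀ (x : BasisState (Fin (indexQubits N))) (t : BasisState (Fin w)),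
        (started x t : BasisState (SerWires N np p w K)) (.inr (.kap ⟨K, by omega⟩)) = true := by
      intro x t
      simp [started, Fin.ext_iff]
    have hag : AgreeOff (sys (K := K)) (started x t' : BasisState (SerWires N np p w K))
        (started y t) := by
      intro q hq
      rcases q with i | (i | a | i | ⟨o, i⟩ | a | _) <;> try rfl
      · exact absurd ⟨.inl i, rfl⟩ hq
      · exact absurd ⟨.inr i, rfl⟩ hq
    have hsys : ∀ (x : BasisState (Fin (indexQubits N))) (t : BasisState (Fin w)),
        (started x t : BasisState (SerWires N np p w K)) ∘ sys = Sum.elim x t := by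
      intro x t
      funext q
      rcases q with q | q <;> rfl
    rw [embed_apply_of_agreeOff _ hag, hsys, hsys]
    simp [hk]
  rw [series, Prog.eval_append, Prog.eval_append, Prog.eval_append, Prog.eval_append,
    rots_eval D time _ fun _ => had_mem, notGate_performs, embed_mul_apply]
  simp only [← mul_assoc]
  have hX : ∀ r s : BasisState (SerWires N np p w K),
      (mono 1 (fun s => Function.update s start (!s start)) *
        (levels P₁ P₂ K le_rfl : Prog N np (SerWires N np p w K)).eval D *
        mono 1 (fun s => Function.update s start (!s start)) :
        Matrix (BasisState (SerWires N np p w K)) (BasisState (SerWires N np p w K)) ℂ) r s =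
      (levels P₁ P₂ K le_rfl : Prog N np (SerWires N np p w K)).eval D
        (Function.update r start (!r start)) (Function.update s start (!s start)) := by
    intro r s
    rw [mul_mono_apply, mono_mul_apply hflip, Pi.one_apply, mul_one]
  rw [Finset.mul_sum]
  refine Finset.sum_congr rfl fun t' _ => ?_
  rw [mul_embed_apply, Finset.mul_sum, Finset.mul_sum]
  refine Finset.sum_congr rfl fun t _ => ?_
  rw [hX, hstart r t' hr, hstart s t hs, hlev, Core.tensor_had_left hrt, Core.tensor_had_right hst,
    Fintype.card_fin, ← Core.sqrt_two_inv_pow]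
  ring

end Series

/-! ### Amplitude amplification -/

section Amplify

variable {N np : ℕ} {X A : Type} [Fintype X] [DecidableEq X] [Fintype A] [DecidableEq A]

/-- The isometry that adjoins ancilla wires in the zero state. -/
def adjoin (X A : Type) [DecidableEq X] [DecidableEq A] [Fintype X] [Fintype A] :
    Matrix (BasisState (X ⊕ A)) (BasisState X) ℂ :=
  Matrix.of fun r y => if r = Sum.elim y fun _ => false then 1 else 0

theorem mul_adjoin_apply {M : Type*} (V : Matrix M (BasisState (X ⊕ A)) ℂ) (r : M)
    (y : BasisState X) : (V * adjoin X A) r y = V r (Sum.elim y fun _ => false) := by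
  rw [Matrix.mul_apply, Finset.sum_eq_single (Sum.elim y fun _ => false)]
  · simp [adjoin]
  · intro k _ hk
    simp [adjoin, hk]
  · simp

theorem adjoin_mul_apply {M : Type*} (V : Matrix (BasisState (X ⊕ A)) M ℂ) (r : M)
    (y : BasisState X) : ((adjoin X A).conjTranspose * V) y r = V (Sum.elim y fun _ => false) r := by
  rw [Matrix.mul_apply, Finset.sum_eq_single (Sum.elim y fun _ => false)]
  · simp [adjoin]
  · intro k _ hk
    simp [adjoin, hk]
  · simp

theorem adjoin_isometry : (adjoin X A).conjTranspose * adjoin X A = 1 := by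
  ext x y
  rw [adjoin_mul_apply, adjoin, Matrix.of_apply, Matrix.one_apply]
  by_cases h : x = y
  · simp [h]
  · rw [if_neg h, if_neg]
    intro h'
    exact h (funext fun i => congrFun h' (.inl i))

theorem adjoin_mul_self : adjoin X A * (adjoin X A).conjTranspose =
    proj fun s : BasisState (X ⊕ A) => ∀ a, s (.inr a) = false := by
  ext r s
  rw [Matrix.mul_apply, proj, Matrix.diagonal_apply]
  simp only [Matrix.conjTranspose_apply, adjoin, Matrix.of_apply]
  have helim : ∀ (r : BasisState (X ⊕ A)) (y : BasisState X), r = Sum.elim y (fun _ => false) ↔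
      (y = fun i => r (.inl i)) ∧ ∀ a, r (.inr a) = false := by
    intro r y
    constructor
    · rintro rfl
      exact ⟨rfl, fun _ => rfl⟩
    · rintro ⟨rfl, h⟩
      funext q
      rcases q with q | q
      exacts [rfl, h q]
  simp only [helim]
  rw [Finset.sum_eq_single fun i => s (.inl i)]
  · by_cases hrs : r = s
    · subst hrs
      by_cases h : ∀ a, r (.inr a) = false
      · simp [h]
      · simp [h]
    · rw [if_neg hrs]
      by_cases h : (fun i => s (.inl i)) = (fun i => r (.inl i))
      · by_cases h1 : ∀ a, r (.inr a) = false
        · by_cases h2 : ∀ a, s (.inr a) = false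
          · refine absurd (funext fun q => ?_) hrs
            rcases q with q | q
            · exact (congrFun h q).symm
            · rw [h1, h2]
          · simp [h2]
        · simp [h1]
      · simp [h]
  · intro y _ hy
    simp [hy]
  · simp

end Amplify

/-! ### Leakage and iteration of approximate blocks -/

section Isometry

variable {m n : Type*} [Fintype m] [DecidableEq m] [Fintype n] [DecidableEq n]

/-- An inequality, so that the empty index type is included. -/
theorem norm_one_matrix_le : ‖(1 : Matrix n n ℂ)‖ ≤ 1 := by
  have h := Matrix.l2_opNorm_conjTranspose_mul_self (1 : Matrix n n ℂ)
  rw [Matrix.conjTranspose_one, one_mul] at h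
  nlinarith [norm_nonneg (1 : Matrix n n ℂ)]

theorem norm_le_one_of_isometry {M : Matrix m n ℂ} (h : M.conjTranspose * M = 1) : ‖M‖ ≤ 1 := by
  have h1 := Matrix.l2_opNorm_conjTranspose_mul_self M
  rw [h] at h1
  nlinarith [norm_nonneg M, norm_one_matrix_le (n := n)]

theorem norm_mul_le_of_left {M : Matrix m n ℂ} {l : Type*} [Fintype l] [DecidableEq l]
    {L : Matrix l m ℂ} (h : ‖L‖ ≤ 1) : ‖L * M‖ ≤ ‖M‖ :=
  (Matrix.l2_opNorm_mul L M).trans (mul_le_of_le_one_left (norm_nonneg _) h)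

theorem norm_mul_le_of_right {M : Matrix m n ℂ} {l : Type*} [Fintype l] [DecidableEq l]
    {L : Matrix n l ℂ} (h : ‖L‖ ≤ 1) : ‖M * L‖ ≤ ‖M‖ :=
  (Matrix.l2_opNorm_mul M L).trans (mul_le_of_le_one_right (norm_nonneg _) h)

/-- If the block of a unitary is close to a unitary then there is little leakage. -/
theorem isometry_dist {G : Matrix m m ℂ} {J : Matrix m n ℂ} {U : Matrix n n ℂ} {ε : ℝ}
    (hG : G.conjTranspose * G = 1) (hJ : J.conjTranspose * J = 1) (hU : U.conjTranspose * U = 1)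
    (h : ‖J.conjTranspose * G * J - U‖ ≤ ε) : ‖G * J - J * U‖ ≤ Real.sqrt (2 * ε) := by
  set T := J.conjTranspose * G * J with hT
  have hTc : T.conjTranspose = J.conjTranspose * G.conjTranspose * J := by
    rw [hT, Matrix.conjTranspose_mul, Matrix.conjTranspose_mul, Matrix.conjTranspose_conjTranspose,
      Matrix.mul_assoc]
  -- The two squares are both 1, so only the cross terms remain and the square of the leakage is
  -- linear in T - U.
  have key : (G * J - J * U).conjTranspose * (G * J - J * U) =
      -((T - U).conjTranspose * U + U.conjTranspose * (T - U)) := by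
    have e1 : (G * J).conjTranspose * (G * J) = 1 := by
      rw [Matrix.conjTranspose_mul, Matrix.mul_assoc, ← Matrix.mul_assoc G.conjTranspose, hG,
        Matrix.one_mul, hJ]
    have e2 : (J * U).conjTranspose * (J * U) = 1 := by
      rw [Matrix.conjTranspose_mul, Matrix.mul_assoc, ← Matrix.mul_assoc J.conjTranspose, hJ,
        Matrix.one_mul, hU]
    have e3 : (G * J).conjTranspose * (J * U) = T.conjTranspose * U := by
      rw [hTc, Matrix.conjTranspose_mul]
      simp only [Matrix.mul_assoc]
    have e4 : (J * U).conjTranspose * (G * J) = U.conjTranspose * T := by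
      rw [hT, Matrix.conjTranspose_mul]
      simp only [Matrix.mul_assoc]
    rw [Matrix.conjTranspose_sub, Matrix.sub_mul, Matrix.mul_sub, Matrix.mul_sub, e1, e2, e3, e4,
      Matrix.conjTranspose_sub, Matrix.sub_mul, Matrix.mul_sub, hU]
    abel
  have h1 := Matrix.l2_opNorm_conjTranspose_mul_self (G * J - J * U)
  have hUn := norm_le_one_of_isometry hU
  have h2 : ‖(T - U).conjTranspose * U + U.conjTranspose * (T - U)‖ ≤ 2 * ε := by
    refine (norm_add_le _ _).trans ?_
    have a1 := norm_mul_le_of_right (M := (T - U).conjTranspose) hUn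
    have a2 := norm_mul_le_of_left (L := U.conjTranspose) (M := T - U)
      (by rw [Matrix.l2_opNorm_conjTranspose]; exact hUn)
    rw [Matrix.l2_opNorm_conjTranspose] at a1
    linarith
  rw [key, norm_neg] at h1
  rw [h1] at h2
  exact Real.le_sqrt_of_sq_le (by rw [sq]; exact h2)

/-- The intertwining error telescopes. Leaked amplitude may interfere arbitrarily later, but
contractions cannot enlarge it. -/
theorem pow_dist {G : Matrix m m ℂ} {J : Matrix m n ℂ} {U : Matrix n n ℂ} {η : ℝ}
    (hG : ‖G‖ ≤ 1) (hU : ‖U‖ ≤ 1) (h : ‖G * J - J * U‖ ≤ η) (r : ℕ) :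
    ‖G ^ r * J - J * U ^ r‖ ≤ r * η := by
  induction r with
  | zero => simp
  | succ r ih =>
    have e : G ^ (r + 1) * J - J * U ^ (r + 1) =
        G * (G ^ r * J - J * U ^ r) + (G * J - J * U) * U ^ r := by
      rw [pow_succ', pow_succ', Matrix.mul_sub, Matrix.sub_mul]
      simp only [Matrix.mul_assoc]
      abel
    have hUr : ‖U ^ r‖ ≤ 1 := by
      rcases Nat.eq_zero_or_pos r with rfl | hr
      · rw [pow_zero]; exact norm_one_matrix_le
      · exact (norm_pow_le' U hr).trans (pow_le_one₀ (norm_nonneg _) hU)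
    rw [e]
    refine (norm_add_le _ _).trans ?_
    have a1 := norm_mul_le_of_left (M := G ^ r * J - J * U ^ r) hG
    have a2 := norm_mul_le_of_right (M := G * J - J * U) hUr
    push_cast
    linarith

end Isometry

section Amplify

variable {N np : ℕ} {X A : Type} [Fintype X] [DecidableEq X] [Fintype A] [DecidableEq A]

/-- System, ancilla and workspace wires. -/
abbrev AmpAnc (A : Type) : Type := A ⊕ (A ⊕ Bool)

/-- The system and ancilla wires. -/
def inner (X A : Type) : X ⊕ A ↪ X ⊕ AmpAnc A :=
  ⟨Sum.elim .inl fun a => .inr (.inl a), by rintro (i | i) (j | j) h <;> simp_all⟩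

/-- Tests whether all ancilla wires hold `0`. -/
def zeroTest : Prog N np (X ⊕ AmpAnc A) :=
  compare (.inr (.inr (.inr false))) ((Finset.univ : Finset A).toList.map fun a =>
    (.inr (.inl a), .inr (.inr (.inl a)))) (.inr (.inr (.inr true)))

/-- A phase that depends on whether all ancilla wires hold `0`. -/
def zeroPhase (φ : Bool → ℂ) : Prog N np (X ⊕ AmpAnc A) :=
  zeroTest ++ phase₁ φ (.inr (.inr (.inr true))) ++ zeroTest.inverse

/-- The projection on the workspace in the zero state. -/
def idle (X A : Type) [Fintype X] [DecidableEq X] [Fintype A] [DecidableEq A] :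
    Matrix (BasisState (X ⊕ AmpAnc A)) (BasisState (X ⊕ AmpAnc A)) ℂ :=
  proj fun s => ∀ a, s (.inr (.inr a)) = false

/-- On an idle workspace the test is exact, so the phase is a combination of the identity and the
projection onto zero ancillas, as needed for a reflection. -/
theorem zeroPhase_mul_idle (D : SparseData N np) (φ : Bool → ℂ) (hφ : ∀ i, ‖φ i‖ = 1) :
    (zeroPhase φ : Prog N np (X ⊕ AmpAnc A)).eval D * idle X A =
      (φ true • (1 : Matrix _ _ ℂ) + (φ false - φ true) • (adjoin X (AmpAnc A) *
        (adjoin X (AmpAnc A)).conjTranspose)) * idle X A := by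
  have ht : (zeroTest : Prog N np (X ⊕ AmpAnc A)).Performs D fun s =>
      Function.update s (.inr (.inr (.inr true))) ((s (.inr (.inr (.inr true)))).xor
        (carry (s (.inr (.inr (.inr false)))) ((Finset.univ : Finset A).toList.map fun a =>
          (s (.inr (.inl a)), s (.inr (.inr (.inl a))))))) := by
    refine (compare_performs D _ _ _ ?_).congr fun s q => ?_
    · rw [List.nodup_cons, List.nodup_cons, List.mem_cons, mem_pairWires_map, mem_pairWires_map]
      refine ⟨by simp, by simp, nodup_pairWires_map _ (Finset.nodup_toList _) _ _ ?_ ?_ ?_⟩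
      · intro a b h; simpa using h
      · intro a b h; simpa using h
      · simp
    · rw [List.map_map]; rfl
  rw [zeroPhase, Prog.eval_conj_diagonal ht (phase₁_eval D φ hφ _), adjoin_mul_self]
  ext r s
  simp only [idle, proj, Matrix.mul_diagonal]
  by_cases hs : ∀ a, s (.inr (.inr a)) = false
  swap
  · rw [if_neg hs, mul_zero, mul_zero]
  rw [if_pos hs, mul_one, mul_one, Matrix.add_apply, Matrix.smul_apply, Matrix.smul_apply,
    Matrix.one_apply, Matrix.diagonal_apply, Matrix.diagonal_apply]
  by_cases hrs : r = s
  swap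
  · simp [hrs]
  subst hrs
  rw [if_pos rfl, if_pos rfl, if_pos rfl]
  simp only [Function.update_self, hs, carry_false_right, Bool.false_or, Bool.false_xor]
  by_cases h : ∀ a : A, r (.inr (.inl a)) = false
  · have h1 : (Finset.univ : Finset A).toList.any (fun a => r (.inr (.inl a))) = false := by
      simp [h]
    have h2 : ∀ a, r (.inr a) = false := by
      rintro (a | a)
      exacts [h a, hs a]
    rw [h1, if_pos h2]
    simp
  · have h1 : (Finset.univ : Finset A).toList.any (fun a => r (.inr (.inl a))) = true := by
      rw [List.any_eq_true]
      push Not at h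
      obtain ⟨a, ha⟩ := h
      exact ⟨a, by simp, by simpa using ha⟩
    have h2 : ¬ ∀ a, r (.inr a) = false := fun h' => h fun a => h' _
    rw [h1, if_neg h2]
    simp

/-- One round of oblivious amplitude amplification. -/
def amplify (W : Prog N np (X ⊕ A)) : Prog N np (X ⊕ AmpAnc A) :=
  W.map (inner X A) ++ zeroPhase (fun b => if b then 1 else -1) ++ W.inverse.map (inner X A) ++
    zeroPhase (fun b => if b then -1 else 1) ++ W.map (inner X A)

theorem idle_mul_adjoin : idle X A * adjoin X (AmpAnc A) = adjoin X (AmpAnc A) := by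
  ext r y
  rw [mul_adjoin_apply, idle, proj, Matrix.diagonal_apply, adjoin, Matrix.of_apply]
  by_cases h : r = Sum.elim y fun _ => false
  · rw [if_pos h, if_pos h, h, if_pos]
    intro a
    rfl
  · rw [if_neg h, if_neg h]

/-- With P the projection on zero ancillas, the circuit is w (2P - 1) w† (1 - 2P) w, and J†wJ = T
yields the cubic polynomial. The identity needs only unitarity of w; T need not be proportional to a
unitary. -/
theorem amplify_block (D : SparseData N np) (W : Prog N np (X ⊕ A)) :
    (adjoin X (AmpAnc A)).conjTranspose * (amplify W).eval D * adjoin X (AmpAnc A) =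
      (3 : ℂ) • ((adjoin X A).conjTranspose * W.eval D * adjoin X A) -
      (4 : ℂ) • (((adjoin X A).conjTranspose * W.eval D * adjoin X A) *
        ((adjoin X A).conjTranspose * W.eval D * adjoin X A).conjTranspose *
        ((adjoin X A).conjTranspose * W.eval D * adjoin X A)) := by
  set J := adjoin X (AmpAnc A) with hJ
  set w := embed (inner X A) (W.eval D) with hw
  set E := idle X A with hE
  set T := (adjoin X A).conjTranspose * W.eval D * adjoin X A with hT
  have hJJ : J.conjTranspose * J = 1 := adjoin_isometry
  have hEJ : E * J = J := idle_mul_adjoin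
  have hTw : T = J.conjTranspose * w * J := by
    ext x y
    rw [hT, hJ, mul_adjoin_apply, adjoin_mul_apply, mul_adjoin_apply, adjoin_mul_apply, hw,
      embed_apply_of_agreeOff]
    · congr 1 <;> · funext q; rcases q with q | q <;> rfl
    · rintro (q | q) hq
      · exact absurd ⟨.inl q, rfl⟩ hq
      · rfl
  have hcomm : ∀ U, Commute E (embed (inner X A) U) := by
    intro U
    refine proj_commute_embed _ _ ?_
    intro r s hrs hr a
    rw [← hrs _ (by rintro ⟨q | q, h⟩ <;> cases h)]
    exact hr a
  have hww : w.conjTranspose * w = 1 := by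
    rw [hw, ← embed_conjTranspose, ← embed_mul, Prog.eval_unitary W D, embed_one]
  have hww' : w * w.conjTranspose = 1 := by
    rw [hw, ← embed_conjTranspose, ← embed_mul, Prog.eval_unitary' W D, embed_one]
  have hTc : T.conjTranspose = J.conjTranspose * w.conjTranspose * J := by
    rw [hTw, Matrix.conjTranspose_mul, Matrix.conjTranspose_mul, Matrix.conjTranspose_conjTranspose,
      Matrix.mul_assoc]
  have hR1 := zeroPhase_mul_idle (X := X) (A := A) D (fun b => if b then 1 else -1)
    (by intro i; cases i <;> simp)
  have hR2 := zeroPhase_mul_idle (X := X) (A := A) D (fun b => if b then -1 else 1)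
    (by intro i; cases i <;> simp)
  rw [← hJ, ← hE] at hR1 hR2
  simp only [if_true, Bool.false_eq_true, if_false, one_smul] at hR1 hR2
  have hG : (amplify W).eval D = w * (zeroPhase (fun b => if b then -1 else 1)).eval D *
      w.conjTranspose * (zeroPhase (fun b => if b then 1 else -1)).eval D * w := by
    rw [amplify, Prog.eval_append, Prog.eval_append, Prog.eval_append, Prog.eval_append,
      Prog.eval_map, Prog.eval_map, Prog.eval_inverse, embed_conjTranspose]
    simp only [mul_assoc]
    rfl
  set R₁ := (zeroPhase (fun b => if b then 1 else -1) : Prog N np (X ⊕ AmpAnc A)).eval D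
  set R₂ := (zeroPhase (fun b => if b then -1 else 1) : Prog N np (X ⊕ AmpAnc A)).eval D
  have hEw : E * (w * J) = w * J := by
    rw [← Matrix.mul_assoc, (hcomm _).eq, Matrix.mul_assoc, hEJ]
  have hEw' : E * (w.conjTranspose * J) = w.conjTranspose * J := by
    rw [← Matrix.mul_assoc, hw, ← embed_conjTranspose, (hcomm _).eq, Matrix.mul_assoc, hEJ]
  have s1 : R₁ * (w * J) = w * J - (2 : ℂ) • (J * T) := by
    rw [← hEw, ← Matrix.mul_assoc, hR1, Matrix.mul_assoc, hEw, Matrix.add_mul, Matrix.one_mul,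
      Matrix.smul_mul, Matrix.mul_assoc, hTw, Matrix.mul_assoc J.conjTranspose w J]
    module
  set Y := J - (2 : ℂ) • (w.conjTranspose * J * T) with hY
  have s2 : w.conjTranspose * (R₁ * (w * J)) = Y := by
    rw [s1, Matrix.mul_sub, ← Matrix.mul_assoc, hww, Matrix.one_mul, Matrix.mul_smul,
      ← Matrix.mul_assoc]
  have hEY : E * Y = Y := by
    rw [hY, Matrix.mul_sub, hEJ, Matrix.mul_smul, ← Matrix.mul_assoc, hEw']
  have hJY : J.conjTranspose * Y = 1 - (2 : ℂ) • (T.conjTranspose * T) := by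
    rw [hY, Matrix.mul_sub, hJJ, Matrix.mul_smul, hTc]
    simp only [Matrix.mul_assoc]
  have s3 : R₂ * Y = J + (2 : ℂ) • (w.conjTranspose * J * T) - (4 : ℂ) • (J * (T.conjTranspose * T)) := by
    rw [← hEY, ← Matrix.mul_assoc, hR2, Matrix.mul_assoc, hEY, Matrix.add_mul, Matrix.smul_mul,
      Matrix.smul_mul, Matrix.one_mul, Matrix.mul_assoc, hJY, Matrix.mul_sub, Matrix.mul_one,
      Matrix.mul_smul, hY]
    module
  rw [hG]
  have s4 : J.conjTranspose * (w * R₂ * w.conjTranspose * R₁ * w) * J =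
      J.conjTranspose * (w * (R₂ * (w.conjTranspose * (R₁ * (w * J))))) := by
    simp only [Matrix.mul_assoc]
  rw [s4, s2, s3, Matrix.mul_sub, Matrix.mul_add, Matrix.mul_smul, Matrix.mul_smul,
    Matrix.mul_assoc, ← Matrix.mul_assoc w w.conjTranspose, hww', Matrix.one_mul, Matrix.mul_sub,
    Matrix.mul_add, Matrix.mul_smul, Matrix.mul_smul, ← Matrix.mul_assoc J.conjTranspose J, hJJ,
    Matrix.one_mul, ← Matrix.mul_assoc, ← hTw, ← Matrix.mul_assoc w J, ← Matrix.mul_assoc J.conjTranspose,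
    ← Matrix.mul_assoc J.conjTranspose, ← hTw, Matrix.mul_assoc T]
  module

/-- For S = 2T the polynomial is (3S - SS†S)/2, which fixes every unitary. Replacing the factors one
at a time costs at most 3/2 + (4 + 2 + 1)/2 = 5 times δ. -/
theorem norm_amplify_sub_le {n : Type*} [Fintype n] [DecidableEq n] {T U : Matrix n n ℂ} {δ : ℝ}
    (hT : ‖T‖ ≤ 1) (hU : U.conjTranspose * U = 1) (hU' : U * U.conjTranspose = 1)
    (h : ‖(2 : ℂ) • T - U‖ ≤ δ) :
    ‖(3 : ℂ) • T - (4 : ℂ) • (T * T.conjTranspose * T) - U‖ ≤ 5 * δ := by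
  set S := (2 : ℂ) • T with hS
  set Δ := S - U with hΔ
  have hUn := norm_le_one_of_isometry hU
  have hSn : ‖S‖ ≤ 2 := by
    rw [hS, norm_smul]
    norm_num
    linarith
  have hc : ∀ M : Matrix n n ℂ, ‖M.conjTranspose‖ = ‖M‖ := Matrix.l2_opNorm_conjTranspose
  have e : (3 : ℂ) • T - (4 : ℂ) • (T * T.conjTranspose * T) - U = (3 / 2 : ℂ) • Δ - (1 / 2 : ℂ) •
      (Δ * S.conjTranspose * S + U * Δ.conjTranspose * S + U * U.conjTranspose * Δ) := by
    have e1 : Δ * S.conjTranspose * S + U * Δ.conjTranspose * S + U * U.conjTranspose * Δ =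
        S * S.conjTranspose * S - U := by
      rw [hΔ, Matrix.conjTranspose_sub]
      have : U * U.conjTranspose * U = U := by rw [hU', one_mul]
      calc _ = S * S.conjTranspose * S - U * U.conjTranspose * U := by noncomm_ring
        _ = _ := by rw [this]
    have e2 : S * S.conjTranspose * S = (8 : ℂ) • (T * T.conjTranspose * T) := by
      rw [hS, Matrix.conjTranspose_smul]
      simp only [smul_mul_assoc, mul_smul_comm, smul_smul]
      congr 1
      norm_num
    rw [e1, e2, hΔ, hS]
    module
  have hδ : 0 ≤ δ := (norm_nonneg _).trans h
  have b1 : ‖Δ * S.conjTranspose * S‖ ≤ δ * 2 * 2 := by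
    refine (norm_mul_le _ _).trans (mul_le_mul ((norm_mul_le _ _).trans ?_) hSn (norm_nonneg _)
      (by positivity))
    rw [hc]
    exact mul_le_mul h hSn (norm_nonneg _) hδ
  have b2 : ‖U * Δ.conjTranspose * S‖ ≤ δ * 2 := by
    refine (norm_mul_le _ _).trans (mul_le_mul ((norm_mul_le_of_left hUn).trans ?_) hSn
      (norm_nonneg _) hδ)
    rw [hc]
    exact h
  have b3 : ‖U * U.conjTranspose * Δ‖ ≤ δ := by
    rw [hU', one_mul]
    exact h
  rw [e]
  refine (norm_sub_le _ _).trans ?_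
  rw [norm_smul, norm_smul]
  have b4 := (norm_add_le (Δ * S.conjTranspose * S + U * Δ.conjTranspose * S)
    (U * U.conjTranspose * Δ))
  have b5 := norm_add_le (Δ * S.conjTranspose * S) (U * Δ.conjTranspose * S)
  have n1 : ‖(3 / 2 : ℂ)‖ = 3 / 2 := by norm_num
  have n2 : ‖(1 / 2 : ℂ)‖ = 1 / 2 := by norm_num
  rw [n1, n2]
  linarith

end Amplify

/-! ### The discrete Dyson series -/

section Exp

variable {𝔸 : Type*} [NormedRing 𝔸] [NormOneClass 𝔸] [NormedAlgebra ℂ 𝔸] [CompleteSpace 𝔸]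

theorem norm_exp_sub_one_sub_le {X : 𝔸} (hX : ‖X‖ ≤ 1) :
    ‖NormedSpace.exp X - 1 - X‖ ≤ ‖X‖ ^ 2 := by
  have h1 : HasSum (fun n : ℕ => ((n.factorial : ℂ)⁻¹) • X ^ n) (NormedSpace.exp X) :=
    NormedSpace.exp_series_hasSum_exp' X
  have h2 : HasSum (fun n : ℕ => ((n.factorial : ℝ)⁻¹) • ‖X‖ ^ n) (Real.exp ‖X‖) := by
    rw [Real.exp_eq_exp_ℝ]
    exact NormedSpace.exp_series_hasSum_exp' ‖X‖
  have h1' := (hasSum_nat_add_iff' 2).2 h1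
  have h2' := (hasSum_nat_add_iff' 2).2 h2
  simp only [Finset.sum_range_succ, Finset.sum_range_zero, Nat.factorial, Nat.cast_one, inv_one,
    pow_zero, pow_one, one_smul, zero_add, mul_one] at h1' h2'
  have h3 := tsum_of_norm_bounded h2' (f := fun n : ℕ => (((n + 2).factorial : ℂ)⁻¹) • X ^ (n + 2))
    fun n => by
      rw [norm_smul, smul_eq_mul, norm_inv, Complex.norm_natCast]
      exact mul_le_mul_of_nonneg_left (norm_pow_le _ _) (by positivity)
  have h4 : (∑' n : ℕ, (((n + 2).factorial : ℂ)⁻¹) • X ^ (n + 2)) = NormedSpace.exp X - (1 + X) :=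
    h1'.tsum_eq
  rw [h4] at h3
  have h5 := Real.norm_exp_sub_one_sub_id_le (x := ‖X‖) (by rwa [norm_norm])
  rw [norm_norm] at h5
  have h6 := le_abs_self (Real.exp ‖X‖ - 1 - ‖X‖)
  rw [Real.norm_eq_abs] at h5
  rw [sub_sub]
  linarith

/-- Both sides agree with 1 + Y + Z to first order; every remaining term is quadratic in ρ. -/
theorem norm_exp_mul_sub_le {Y Z : 𝔸} {ρ : ℝ} (h : ‖Y‖ + ‖Z‖ ≤ ρ) (hρ : ρ ≤ 1) :
    ‖NormedSpace.exp Y * (1 + Z) - NormedSpace.exp (Y + Z)‖ ≤ 4 * ρ ^ 2 := by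
  have hyn := norm_nonneg Y
  have hzn := norm_nonneg Z
  have b1 := norm_exp_sub_one_sub_le (X := Y) (by linarith)
  have hYZ := norm_add_le Y Z
  have b2 := norm_exp_sub_one_sub_le (X := Y + Z) (by linarith)
  have e : NormedSpace.exp Y * (1 + Z) - NormedSpace.exp (Y + Z) =
      (NormedSpace.exp Y - 1 - Y) + (NormedSpace.exp Y - 1 - Y) * Z + Y * Z -
        (NormedSpace.exp (Y + Z) - 1 - (Y + Z)) := by noncomm_ring
  have b3 := norm_mul_le (NormedSpace.exp Y - 1 - Y) Z
  have b4 := norm_mul_le Y Z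
  have b5 : ‖NormedSpace.exp Y - 1 - Y‖ * ‖Z‖ ≤ ‖Y‖ ^ 2 * 1 :=
    mul_le_mul b1 (by linarith) hzn (by positivity)
  have b6 : ‖Y + Z‖ ^ 2 ≤ (‖Y‖ + ‖Z‖) ^ 2 := by gcongr
  have b7 : (‖Y‖ + ‖Z‖) ^ 2 ≤ ρ ^ 2 := by gcongr
  rw [e]
  refine (norm_sub_le _ _).trans ?_
  refine (add_le_add_left ((norm_add_le _ _).trans (add_le_add_left (norm_add_le _ _) _)) _).trans ?_
  nlinarith [mul_nonneg hyn hzn]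

/-- The approximating step e^Y (1 + Z) is not a contraction, so the telescoping sum carries powers
of its norm bound. -/
theorem norm_pow_sub_pow_le_mul {G U : 𝔸} {κ q : ℝ} (hU : ‖U‖ ≤ 1) (hG : ‖G‖ ≤ q) (hq : 1 ≤ q)
    (h : ‖G - U‖ ≤ κ) (m : ℕ) : ‖G ^ m - U ^ m‖ ≤ m * κ * q ^ m := by
  have hκ : 0 ≤ κ := (norm_nonneg _).trans h
  induction m with
  | zero => simp
  | succ m ih =>
    have e : G ^ (m + 1) - U ^ (m + 1) = G * (G ^ m - U ^ m) + (G - U) * U ^ m := by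
      rw [pow_succ', pow_succ']; noncomm_ring
    have hUm : ‖U ^ m‖ ≤ 1 := (norm_pow_le _ _).trans (pow_le_one₀ (norm_nonneg _) hU)
    have a1 : ‖G * (G ^ m - U ^ m)‖ ≤ q * (m * κ * q ^ m) :=
      (norm_mul_le _ _).trans (mul_le_mul hG ih (norm_nonneg _) (by linarith))
    have a2 : ‖(G - U) * U ^ m‖ ≤ κ * 1 :=
      (norm_mul_le _ _).trans (mul_le_mul h hUm (norm_nonneg _) hκ)
    have a3 : κ * 1 ≤ κ * q ^ (m + 1) := mul_le_mul_of_nonneg_left (one_le_pow₀ hq) hκ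
    rw [e]
    refine (norm_add_le _ _).trans ?_
    push_cast
    rw [pow_succ] at a3 ⊢
    nlinarith

end Exp

/-! ### Time-ordered sums and their truncation -/

section Dyson

/-- The time-ordered sums of products of `k` of the first `m` operators `f`. -/
def dyson {𝔸 : Type*} [Semiring 𝔸] (f : ℕ → 𝔸) : ℕ → ℕ → 𝔸
  | 0, _ => 1
  | k + 1, m => ∑ j ∈ Finset.range m, f j * dyson f k j

variable {𝔸 : Type*} [NormedRing 𝔸] [NormOneClass 𝔸]

/-- The time-ordered product of the operators `1 + f j`. -/
def orderedProd (f : ℕ → 𝔸) : ℕ → 𝔸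
  | 0 => 1
  | m + 1 => (1 + f m) * orderedProd f m

theorem dyson_succ_succ (f : ℕ → 𝔸) (k m : ℕ) :
    dyson f (k + 1) (m + 1) = dyson f (k + 1) m + f m * dyson f k m := by
  rw [dyson, dyson, Finset.sum_range_succ]

/-- Multiplying out groups the product by the number k of non-trivial factors. Orders k > m are
empty, so any cutoff n ≥ m is exact. -/
theorem orderedProd_eq_sum (f : ℕ → 𝔸) (m n : ℕ) (h : m ≤ n) :
    orderedProd f m = ∑ k ∈ Finset.range (n + 1), dyson f k m := by
  induction m generalizing n with
  | zero =>
    rw [Finset.sum_range_succ', orderedProd, Finset.sum_eq_zero, zero_add, dyson]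
    intro k _
    rw [dyson, Finset.sum_range_zero]
  | succ m ih =>
    obtain ⟨n, rfl⟩ : ∃ n', n = n' + 1 := ⟨n - 1, by omega⟩
    rw [orderedProd, add_mul, one_mul]
    nth_rewrite 1 [ih (n + 1) (by omega)]
    rw [ih n (by omega), Finset.mul_sum, Finset.sum_range_succ' _ (n + 1),
      Finset.sum_range_succ' (fun k => dyson f k (m + 1)) (n + 1)]
    simp only [dyson_succ_succ, Finset.sum_add_distrib]
    simp only [dyson]
    abel

theorem norm_dyson_le {f : ℕ → 𝔸} {η : ℝ} (hη : 0 ≤ η) (hf : ∀ j, ‖f j‖ ≤ η) (k m : ℕ) :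
    ‖dyson f k m‖ ≤ m.choose k * η ^ k := by
  induction k generalizing m with
  | zero => simp [dyson]
  | succ k ih =>
    induction m with
    | zero => simp [dyson]
    | succ m ihm =>
      rw [dyson_succ_succ, Nat.choose_succ_succ]
      refine (norm_add_le _ _).trans ?_
      have h1 : ‖f m * dyson f k m‖ ≤ η * (m.choose k * η ^ k) :=
        (norm_mul_le _ _).trans (mul_le_mul (hf m) (ih m) (norm_nonneg _) hη)
      push_cast
      rw [pow_succ] at *
      linarith

theorem norm_dyson_le_div {f : ℕ → 𝔸} {η : ℝ} (hη : 0 ≤ η) (hf : ∀ j, ‖f j‖ ≤ η) (k m : ℕ) :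
    ‖dyson f k m‖ ≤ (m * η) ^ k / k.factorial := by
  refine (norm_dyson_le hη hf k m).trans ?_
  rw [mul_pow, mul_div_right_comm]
  exact mul_le_mul_of_nonneg_right (Nat.choose_le_pow_div k m) (by positivity)

/-- The highest term is counted twice because the circuit produces it so: the innermost level is not
halved. The surplus is no larger than the bound for the tail. -/
theorem norm_dyson_tail_le {f : ℕ → 𝔸} {η : ℝ} (hη : 0 ≤ η) (hf : ∀ j, ‖f j‖ ≤ η) (m K : ℕ)
    (h : m * η ≤ 1 / 2) :
    ‖∑ k ∈ Finset.range (K + 1), dyson f k m + dyson f K m - orderedProd f m‖ ≤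
      2 * ((m * η) ^ K / K.factorial) := by
  set x := m * η with hx
  have hx0 : 0 ≤ x := by positivity
  have hK := norm_dyson_le_div hη hf K m
  rw [← hx] at hK
  rw [orderedProd_eq_sum f m (K + m) (by omega), show K + m + 1 = K + 1 + m by omega,
    Finset.sum_range_add _ (K + 1)]
  have e : ∀ a b c : 𝔸, a + b - (a + c) = b - c := fun a b c => by abel
  rw [e]
  -- Each further order costs a factor x ≤ 1/2, so the tail is dominated by a geometric series of
  -- sum 1.
  have hb : ∀ j : ℕ, ‖dyson f (K + 1 + j) m‖ ≤ x ^ K / K.factorial * ((1 / 2) * (1 / 2) ^ j) := by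
    intro j
    refine (norm_dyson_le_div hη hf _ m).trans ?_
    rw [← hx, show K + 1 + j = K + (j + 1) by omega, pow_add, ← pow_succ', mul_div_right_comm]
    refine mul_le_mul ?_ (pow_le_pow_left₀ hx0 h _) (by positivity) (by positivity)
    refine div_le_div_of_nonneg_left (by positivity) (by positivity) ?_
    exact_mod_cast Nat.factorial_le (by omega)
  have hs : ‖∑ j ∈ Finset.range m, dyson f (K + 1 + j) m‖ ≤ x ^ K / K.factorial := by
    refine (norm_sum_le _ _).trans ((Finset.sum_le_sum fun j _ => hb j).trans ?_)
    rw [← Finset.mul_sum, ← Finset.mul_sum]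
    refine mul_le_of_le_one_right (by positivity) ?_
    have : ∑ j ∈ Finset.range m, (1 / 2 : ℝ) ^ j = 2 - 2 * (1 / 2) ^ m := by
      rw [geom_sum_eq (by norm_num)]; ring
    rw [this]
    have h2 : (0 : ℝ) ≤ (1 / 2) ^ m := by positivity
    linarith
  refine (norm_sub_le _ _).trans ?_
  linarith

/-- Interaction picture: conjugation by powers of `E`. -/
theorem orderedProd_conj {E F b : 𝔸} (hFE : F * E = 1) (hEF : E * F = 1) (m : ℕ) :
    orderedProd (fun j => F ^ j * b * E ^ j) m = F ^ m * (E * (1 + b)) ^ m := by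
  have hpow : ∀ j, E ^ j * F ^ j = 1 := fun j => by
    have hc : Commute E F := by rw [Commute, SemiconjBy, hEF, hFE]
    rw [← hc.mul_pow, hEF, one_pow]
  induction m with
  | zero => simp [orderedProd]
  | succ m ih =>
    rw [orderedProd, ih, pow_succ' (E * (1 + b)), pow_succ F]
    calc _ = F ^ m * (1 + b * (E ^ m * F ^ m)) * (E * (1 + b)) ^ m := by
            generalize (E * (1 + b)) ^ m = X
            rw [mul_add (F ^ m), mul_one, add_mul, add_mul, one_mul]
            simp only [mul_assoc]
      _ = _ := by
        rw [hpow, mul_one]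
        calc _ = F ^ m * (F * E) * (1 + b) * (E * (1 + b)) ^ m := by rw [hFE, mul_one]
          _ = _ := by simp only [mul_assoc]

end Dyson

/-- Error of the truncated and discretized Dyson series for a short time. -/
theorem dyson_error {𝔸 : Type*} [NormedRing 𝔸] [NormOneClass 𝔸] [NormedAlgebra ℂ 𝔸]
    [CompleteSpace 𝔸] {Y Z : 𝔸} {η ρ : ℝ} {M : ℕ} (K : ℕ)
    (hY1 : ∀ z : ℤ, ‖NormedSpace.exp (z • Y)‖ ≤ 1) (hYZ : ‖NormedSpace.exp (Y + Z)‖ ≤ 1)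
    (hZ : ‖Z‖ ≤ η) (hη : M * η ≤ 1 / 2) (h : ‖Y‖ + ‖Z‖ ≤ ρ) (hρ : ρ ≤ 1) {f : ℕ → 𝔸}
    (hf : ∀ j, f j = NormedSpace.exp ((-(j : ℤ) : ℤ) • Y) * Z * NormedSpace.exp ((j : ℤ) • Y)) :
    ‖∑ k ∈ Finset.range (K + 1), dyson f k M + dyson f K M -
      NormedSpace.exp ((-(M : ℤ) : ℤ) • Y) * NormedSpace.exp (M • (Y + Z))‖ ≤
      2 * ((M * η) ^ K / K.factorial) + 8 * M * ρ ^ 2 := by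
  have hη0 : 0 ≤ η := (norm_nonneg _).trans hZ
  have : NormedAlgebra ℚ 𝔸 := NormedAlgebra.restrictScalars ℚ ℂ 𝔸
  have hE : ∀ j : ℕ, NormedSpace.exp ((j : ℤ) • Y) = NormedSpace.exp Y ^ j := fun j => by
    rw [natCast_zsmul, NormedSpace.exp_nsmul]
  have hF : ∀ j : ℕ, NormedSpace.exp ((-(j : ℤ) : ℤ) • Y) = NormedSpace.exp (-Y) ^ j := fun j => by
    rw [neg_smul, natCast_zsmul, ← smul_neg, NormedSpace.exp_nsmul]
  have hFE : NormedSpace.exp (-Y) * NormedSpace.exp Y = 1 := by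
    rw [← NormedSpace.exp_add_of_commute (Commute.refl Y).neg_left, neg_add_cancel,
      NormedSpace.exp_zero]
  have hEF : NormedSpace.exp Y * NormedSpace.exp (-Y) = 1 := by
    rw [← NormedSpace.exp_add_of_commute (Commute.refl Y).neg_right, add_neg_cancel,
      NormedSpace.exp_zero]
  have hfn : ∀ j, ‖f j‖ ≤ η := fun j => by
    rw [hf]
    refine (norm_mul_le _ _).trans ?_
    have h1 : ‖NormedSpace.exp ((-(j : ℤ) : ℤ) • Y) * Z‖ ≤ 1 * η :=
      (norm_mul_le _ _).trans (mul_le_mul (hY1 _) hZ (norm_nonneg _) (by norm_num))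
    nlinarith [norm_nonneg (NormedSpace.exp ((-(j : ℤ) : ℤ) • Y) * Z), hY1 j,
      norm_nonneg (NormedSpace.exp ((j : ℤ) • Y))]
  have h1 := norm_dyson_tail_le hη0 hfn M K hη
  have hff : f = fun j => NormedSpace.exp (-Y) ^ j * Z * NormedSpace.exp Y ^ j := by
    funext j
    rw [hf, hE, hF]
  -- The whole series is the splitting product seen in the interaction picture; besides truncation
  -- only the splitting error remains.
  have h2 : orderedProd f M = NormedSpace.exp (-Y) ^ M * (NormedSpace.exp Y * (1 + Z)) ^ M := by
    rw [hff]
    exact orderedProd_conj hFE hEF M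
  have hEn : ‖NormedSpace.exp Y‖ ≤ 1 := by simpa using hY1 1
  have hq : ‖NormedSpace.exp Y * (1 + Z)‖ ≤ 1 + η := by
    have h3 : ‖(1 : 𝔸) + Z‖ ≤ 1 + η := by
      have := norm_add_le (1 : 𝔸) Z
      rw [norm_one] at this
      linarith
    refine (norm_mul_le _ _).trans ?_
    nlinarith [norm_nonneg ((1 : 𝔸) + Z), norm_nonneg (NormedSpace.exp Y)]
  have h4 := norm_pow_sub_pow_le_mul hYZ hq (by linarith) (norm_exp_mul_sub_le h hρ) M
  -- Here e^{1/2} ≤ 2 turns M steps of error 4ρ² into a total of 8Mρ².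
  have h5 : (1 + η) ^ M ≤ 2 := by
    have h6 : (1 + η) ^ M ≤ Real.exp (M * η) := by
      rw [Real.exp_nat_mul]
      exact pow_le_pow_left₀ (by linarith) (by rw [add_comm]; exact Real.add_one_le_exp η) M
    have h7 : Real.exp (M * η) ≤ Real.exp (1 / 2) := Real.exp_le_exp.2 hη
    have h8 : Real.exp (1 / 2) ≤ 2 := by
      have h9 : Real.exp (1 / 2) ^ 2 = Real.exp 1 := by
        rw [← Real.exp_nat_mul]; norm_num
      nlinarith [Real.exp_one_lt_d9, Real.exp_pos (1 / 2)]
    linarith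
  have h6 : ‖NormedSpace.exp (-Y) ^ M * ((NormedSpace.exp Y * (1 + Z)) ^ M -
      NormedSpace.exp (Y + Z) ^ M)‖ ≤ 8 * M * ρ ^ 2 := by
    refine (norm_mul_le _ _).trans ?_
    have h7 : ‖NormedSpace.exp (-Y) ^ M‖ ≤ 1 := by rw [← hF]; exact hY1 _
    have h8 : (M : ℝ) * (4 * ρ ^ 2) * (1 + η) ^ M ≤ M * (4 * ρ ^ 2) * 2 :=
      mul_le_mul_of_nonneg_left h5 (by positivity)
    have h9 := mul_le_of_le_one_left (norm_nonneg ((NormedSpace.exp Y * (1 + Z)) ^ M -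
      NormedSpace.exp (Y + Z) ^ M)) h7
    linarith
  rw [hF, NormedSpace.exp_nsmul]
  rw [mul_sub, ← h2] at h6
  have := norm_add_le (∑ k ∈ Finset.range (K + 1), dyson f k M + dyson f K M - orderedProd f M)
    (orderedProd f M - NormedSpace.exp (-Y) ^ M * NormedSpace.exp (Y + Z) ^ M)
  rw [sub_add_sub_cancel] at this
  linarith

/-! ### The series block as a Dyson series -/

section Col

variable {S : Type} [Fintype S] [DecidableEq S] {w : ℕ}

/-- A family of operators indexed by the time, stacked on top of each other. -/
def stack (w : ℕ) (g : ℕ → Matrix (BasisState S) (BasisState S) ℂ) :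
    Matrix (BasisState (S ⊕ Fin w)) (BasisState S) ℂ :=
  Matrix.of fun r y => g (bitsVal (r ∘ Sum.inr)) (r ∘ Sum.inl) y

/-- The sum over all times. -/
def sumTimes : Matrix (BasisState (S ⊕ Fin w)) (BasisState S) ℂ →+
    Matrix (BasisState S) (BasisState S) ℂ where
  toFun G := Matrix.of fun x y => ∑ t, G (Sum.elim x t) y
  map_zero' := by ext; simp
  map_add' G G' := by ext; simp [Finset.sum_add_distrib]

theorem sumTimes_smul (z : ℂ) (G : Matrix (BasisState (S ⊕ Fin w)) (BasisState S) ℂ) :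
    sumTimes (z • G) = z • sumTimes G := by
  ext x y
  simp [sumTimes, Finset.mul_sum]

theorem sumTimes_stack (g : ℕ → Matrix (BasisState S) (BasisState S) ℂ) :
    sumTimes (stack w g) = ∑ m ∈ Finset.range (2 ^ w), g m := by
  ext x y
  rw [Matrix.sum_apply, ← sum_bitsVal w fun m => g m x y]
  rfl

theorem sum_elim_states {M : Type*} [AddCommMonoid M] (F : BasisState (S ⊕ Fin w) → M) :
    ∑ s, F s = ∑ x, ∑ t, F (Sum.elim x t) := by
  rw [← Fintype.sum_prod_type']
  exact Fintype.sum_equiv (Equiv.sumArrowEquivProdArrow S (Fin w) Bool) _ _ fun s => by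
    congr 1
    funext q
    rcases q with q | q <;> rfl

theorem mul_stack_apply (Y : Matrix (BasisState (S ⊕ Fin w)) (BasisState (S ⊕ Fin w)) ℂ)
    (g : ℕ → Matrix (BasisState S) (BasisState S) ℂ) (r : BasisState (S ⊕ Fin w)) (y : BasisState S) :
    (Y * stack w g) r y = ∑ t, ∑ x, Y r (Sum.elim x t) * g (bitsVal t) x y := by
  rw [Matrix.mul_apply, sum_elim_states, Finset.sum_comm]
  rfl

/-- The superposition of all times. -/
def spread (S : Type) [Fintype S] [DecidableEq S] (w : ℕ) :
    Matrix (BasisState (S ⊕ Fin w)) (BasisState S) ℂ := stack w fun _ => 1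

theorem sumTimes_mul_one (Y : Matrix (BasisState (S ⊕ Fin w)) (BasisState (S ⊕ Fin w)) ℂ)
    (x y : BasisState S) :
    sumTimes (Y * spread S w) x y = ∑ t', ∑ t, Y (Sum.elim x t') (Sum.elim y t) := by
  refine Finset.sum_congr rfl fun t' _ => ?_
  rw [spread, mul_stack_apply]
  refine Finset.sum_congr rfl fun t _ => ?_
  rw [Finset.sum_eq_single y]
  · simp
  · intro z _ hz
    simp [hz]
  · simp

end Col

section Levels

variable {N np p w : ℕ}

/-- Jumping to a later time is summation over earlier ones, which is one step of the recursion
defining `dyson`. -/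
theorem timeMat_mul_stack (g : ℕ → Matrix (BasisState (Fin (indexQubits N))) (BasisState _) ℂ) :
    Core.timeMat N w * stack w g =
      stack w fun m => (1 / 2 ^ w : ℂ) • ∑ j ∈ Finset.range m, g j := by
  ext r y
  rw [mul_stack_apply]
  have h1 : ∀ t : BasisState (Fin w), ∑ x, Core.timeMat N w r (Sum.elim x t) * g (bitsVal t) x y =
      if bitsVal t < bitsVal (r ∘ Sum.inr) then 1 / 2 ^ w * g (bitsVal t) (r ∘ Sum.inl) y else 0 := by
    intro t
    rw [Finset.sum_eq_single (r ∘ Sum.inl)]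
    · simp [Core.timeMat]
    · intro x _ hx
      simp [Core.timeMat, hx.symm]
    · simp
  simp only [h1]
  rw [sum_bitsVal w fun m => if m < bitsVal (r ∘ Sum.inr) then 1 / 2 ^ w * g m (r ∘ Sum.inl) y else 0,
    ← Finset.sum_filter]
  have h2 : (Finset.range (2 ^ w)).filter (· < bitsVal (r ∘ Sum.inr)) =
      Finset.range (bitsVal (r ∘ Sum.inr)) := by
    ext m
    have := bitsVal_lt (r ∘ Sum.inr)
    simp only [Finset.mem_filter, Finset.mem_range]
    omega
  rw [h2, stack, Matrix.of_apply, Matrix.smul_apply, Matrix.sum_apply, smul_eq_mul, Finset.mul_sum]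

/-- The diagonal part of the encoded matrix. -/
def diagMat (D : SparseData N np) (u : ℝ) :
    Matrix (BasisState (Fin (indexQubits N))) (BasisState (Fin (indexQubits N))) ℂ :=
  Matrix.diagonal fun x => (diagPart D u x : ℂ)

theorem exp_smul_diagMat (D : SparseData N np) (u : ℝ) (z : ℂ) :
    NormedSpace.exp (z • diagMat D u) = Matrix.diagonal fun x => Complex.exp (z * diagPart D u x) := by
  rw [diagMat, ← Matrix.diagonal_smul, Matrix.exp_diagonal]
  congr 1
  funext x
  rw [Pi.coe_exp, Complex.exp_eq_exp_ℂ]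
  rfl

/-- The block preserves the time, so on stacks it multiplies layer m by the off-diagonal operator
conjugated to time m. -/
theorem interactionMat_mul_stack (hp : p + 1 ≤ np) (D : SparseData N np) (u : ℝ) (σ : ℕ) (c θ : ℝ)
    (g : ℕ → Matrix (BasisState (Fin (indexQubits N))) (BasisState _) ℂ) :
    Core.interactionMat hp D u σ c θ w * stack w g =
      stack w fun m => NormedSpace.exp ((-(m : ℤ) : ℤ) • ((Complex.I * θ) • diagMat D u)) *
        Matrix.of (Core.offEntry hp D σ c) *
        NormedSpace.exp ((m : ℤ) • ((Complex.I * θ) • diagMat D u)) * g m := by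
  ext r y
  rw [mul_stack_apply, Finset.sum_eq_single (r ∘ Sum.inr)]
  · rw [stack, Matrix.of_apply, ← Int.cast_smul_eq_zsmul ℂ, ← Int.cast_smul_eq_zsmul ℂ, smul_smul,
      smul_smul, exp_smul_diagMat, exp_smul_diagMat, Matrix.mul_apply]
    refine Finset.sum_congr rfl fun x _ => ?_
    rw [Matrix.mul_diagonal, Matrix.diagonal_mul, Core.interactionMat, Matrix.of_apply, if_pos (by rfl),
      Matrix.of_apply]
    congr 1
    congr 1
    · congr 1
      congr 1
      rw [show (Sum.elim x (r ∘ Sum.inr) : BasisState (_ ⊕ Fin w)) ∘ Sum.inr = r ∘ Sum.inr from rfl]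
      push_cast
      ring
    · rw [show (Sum.elim x (r ∘ Sum.inr) : BasisState (_ ⊕ Fin w)) ∘ Sum.inr = r ∘ Sum.inr from rfl]
      congr 1
      push_cast
      simp
      ring
  · intro t _ ht
    refine Finset.sum_eq_zero fun x _ => ?_
    rw [Core.interactionMat, Matrix.of_apply, if_neg, zero_mul]
    exact fun h => ht (by rw [h]; rfl)
  · simp

variable {f : ℕ → Matrix (BasisState (Fin (indexQubits N))) (BasisState (Fin (indexQubits N))) ℂ}
  {Y₁ Y₂ : ℕ → Matrix (BasisState (Fin (indexQubits N) ⊕ Fin w)) (BasisState _) ℂ}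

/-- The number k of factors already accumulated is general, so that the induction can enter a level
with a product of k + 1 operators and leave the rest to the inner levels. -/
theorem sumTimes_levelMat
    (h₂ : ∀ i g, Y₂ i * stack w g = stack w fun m => (2 * 2 ^ w : ℂ) • (f m * g m)) (i k : ℕ)
    (h₁ : ∀ j < i, Y₁ j = Core.timeMat N w) :
    sumTimes (Series.levelMat Y₁ Y₂ i *
        (stack w fun m => (2 ^ (k + 1) * 2 ^ w : ℂ) • (f m * dyson f k m))) =
      (2 ^ w : ℂ) • (((2 : ℂ) ^ k • ∑ j ∈ Finset.range i, dyson f (k + 1 + j) (2 ^ w)) +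
        (2 : ℂ) ^ (k + 1) • dyson f (k + 1 + i) (2 ^ w)) := by
  have hv : ∀ k, sumTimes (stack w fun m => (2 ^ (k + 1) * 2 ^ w : ℂ) • (f m * dyson f k m)) =
      (2 ^ (k + 1) * 2 ^ w : ℂ) • dyson f (k + 1) (2 ^ w) := by
    intro k
    rw [sumTimes_stack, dyson, Finset.smul_sum]
  induction i generalizing k with
  | zero => 
    rw [Series.levelMat, Matrix.one_mul, hv, Finset.sum_range_zero, smul_zero, zero_add, smul_smul, add_zero, mul_comm]
  | succ i ih =>
    -- The factor 2^w of the block compensates the 2^{-w} of the time step; the surviving 2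
    -- compensates the averaging at the next level.
    have hstep : Y₂ i * Y₁ i * (stack w fun m => (2 ^ (k + 1) * 2 ^ w : ℂ) • (f m * dyson f k m)) =
        stack w fun m => (2 ^ (k + 1 + 1) * 2 ^ w : ℂ) • (f m * dyson f (k + 1) m) := by
      rw [h₁ i (by omega), Matrix.mul_assoc, timeMat_mul_stack, h₂]
      congr 1
      funext m
      rw [← Finset.smul_sum, ← dyson, smul_smul, mul_smul_comm, smul_smul]
      congr 1
      field_simp
      ring
    rw [Series.levelMat, Matrix.smul_mul, Matrix.add_mul, Matrix.one_mul, Matrix.mul_assoc, hstep, sumTimes_smul,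
      map_add, hv, ih (k + 1) fun j hj => h₁ j (by omega), Finset.sum_range_succ']
    simp only [show ∀ j, k + 1 + 1 + j = k + 1 + (j + 1) from fun j => by omega, add_zero]
    module

/-- The outermost level acts first, on the prepared uniform superposition of times, and so has no
time step. Orders 0 to K receive weight 1/2 and order K + 1 weight 1; doubling gives the sum with
the last term repeated. -/
theorem sumTimes_levelMat_one
    (h₂ : ∀ i g, Y₂ i * stack w g = stack w fun m => (2 * 2 ^ w : ℂ) • (f m * g m)) (K : ℕ)
    (h₁ : ∀ j < K, Y₁ j = Core.timeMat N w) (hK : Y₁ K = 1) :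
    (2 : ℂ) • ((1 / 2 ^ w : ℂ) • sumTimes (Series.levelMat Y₁ Y₂ (K + 1) * spread (Fin (indexQubits N)) w)) =
      ∑ k ∈ Finset.range (K + 1 + 1), dyson f k (2 ^ w) + dyson f (K + 1) (2 ^ w) := by
  have h0 := h₂ K fun _ => 1
  have h0' : (fun m => (2 * 2 ^ w : ℂ) • (f m * (1 : Matrix (BasisState (Fin (indexQubits N))) _ ℂ))) =
      fun m => (2 ^ (0 + 1) * 2 ^ w : ℂ) • (f m * dyson f 0 m) := by
    rw [zero_add, pow_one]
    rfl
  rw [h0', ← spread] at h0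
  have h1 : sumTimes (spread (Fin (indexQubits N)) w) =
      (2 ^ w : ℂ) • dyson f 0 (2 ^ w) := by
    rw [spread, sumTimes_stack, dyson]
    simp [← Nat.cast_smul_eq_nsmul ℂ]
  rw [Series.levelMat, hK, mul_one, Matrix.smul_mul, Matrix.add_mul, Matrix.one_mul, Matrix.mul_assoc, h0,
    sumTimes_smul, map_add, sumTimes_levelMat h₂ K 0 h₁, h1, Finset.sum_range_succ',
    Finset.sum_range_succ]
  simp only [show ∀ j, 0 + 1 + j = j + 1 from fun j => by omega, pow_zero, one_smul]
  have : (2 : ℂ) ^ w ≠ 0 := pow_ne_zero _ two_ne_zero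
  match_scalars <;> field_simp <;> norm_num

end Levels

/-! ### Short time segments -/

section Norms

variable {m n : Type*} [Fintype m] [DecidableEq m] [Fintype n] [DecidableEq n]

theorem norm_submatrix_le (U : Matrix m m ℂ) {ι : n → m} (hι : Function.Injective ι) :
    ‖U.submatrix ι ι‖ ≤ ‖U‖ := by
  set S : Matrix m n ℂ := (1 : Matrix m m ℂ).submatrix id ι with hS
  have e : U.submatrix ι ι = S.conjTranspose * (U * S) := by
    ext x y
    simp [hS, Matrix.mul_apply, Matrix.one_apply]
  have h1 : S.conjTranspose * S = 1 := by
    ext x y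
    simp [hS, Matrix.mul_apply, Matrix.one_apply, hι.eq_iff]
  have h2 := norm_le_one_of_isometry h1
  rw [e]
  refine (norm_mul_le_of_left ?_).trans (norm_mul_le_of_right h2)
  rwa [Matrix.l2_opNorm_conjTranspose]

theorem exp_unitary {X : Matrix n n ℂ} (h : X.conjTranspose = -X) :
    (NormedSpace.exp X).conjTranspose * NormedSpace.exp X = 1 := by
  have : NormedAlgebra ℚ (Matrix n n ℂ) := NormedAlgebra.restrictScalars ℚ ℂ _
  rw [← Matrix.exp_conjTranspose, h,
    ← NormedSpace.exp_add_of_commute (Commute.refl X).neg_left, neg_add_cancel, NormedSpace.exp_zero]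

theorem norm_exp_le_one {X : Matrix n n ℂ} (h : X.conjTranspose = -X) : ‖NormedSpace.exp X‖ ≤ 1 :=
  norm_le_one_of_isometry (exp_unitary h)

theorem conjTranspose_I_smul {H : Matrix n n ℂ} (hH : H.IsHermitian) (τ : ℝ) :
    ((-(Complex.I * τ)) • H).conjTranspose = -((-(Complex.I * τ)) • H) := by
  rw [Matrix.conjTranspose_smul, hH.eq, ← neg_smul]
  simp

end Norms

variable {N np p w : ℕ}

section Block

variable {D : SparseData N np}

/-- With the control set and scratch clean, this matrix is a submatrix of a unitary. Time bits are
irrelevant, hence w = 0, and c = 1 avoids any damping. -/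
theorem norm_offEntry_le (hp : p + 1 ≤ np) (D : SparseData N np) (σ : ℕ) : ‖Matrix.of (Core.offEntry hp D σ 1)‖ ≤ 1 := by
  set ι : BasisState (Fin (indexQubits N)) → BasisState (Core N np (p + 1) 0) := fun y q =>
    match q with
    | .x i => y i
    | .k => true
    | _ => false with hι
  have hinj : Function.Injective ι := fun x y h => funext fun i => congrFun h (.x i)
  have hb := Core.offDiag_isBlock (w := 0) hp D σ 1 (by norm_num)
  have e : Matrix.of (Core.offEntry hp D σ 1) =
      ((Core.offDiag hp σ 1 : Prog N np (Core N np (p + 1) 0)).eval D).submatrix ι ι := by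
    ext x y
    rw [Matrix.submatrix_apply, hb _ _ (fun _ => rfl) (fun _ => rfl), if_pos rfl, if_pos rfl,
      Core.offMat, Matrix.of_apply, Matrix.of_apply, if_pos (Subsingleton.elim _ _)]
    rfl
  rw [e]
  exact (norm_submatrix_le _ hinj).trans (norm_le_one_of_isometry (Prog.eval_unitary _ D))

/-- The normalization of the block encoding of the off-diagonal part. -/
def scale (p σ : ℕ) (u : ℝ) : ℝ := Real.sqrt 2 * 2 ^ p * u * 2 ^ σ

theorem scale_pos {u : ℝ} (hu : 0 < u) (p σ : ℕ) : 0 < scale p σ u := by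
  unfold scale; positivity

variable {u : ℝ} {σ : ℕ}

/-- The block encoding itself proves the bound: divided by its normalization, the matrix is a
contraction. -/
theorem norm_offPart_le (hp : p + 1 ≤ np) (hu : 0 < u) (hσ : σ ≤ indexQubits N) (hD : D.Fits u p σ) : ‖offPart D u‖ ≤ scale p σ u := by
  have h0 := scale_pos hu p σ
  have e : offPart D u = (Complex.I * (scale p σ u : ℂ)) • Matrix.of (Core.offEntry hp D σ 1) := by
    ext x y
    rw [Matrix.smul_apply, Matrix.of_apply, offEntry_eq hp D u hu hσ hD, ← scale, smul_eq_mul]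
    have h1 : (scale p σ u : ℂ) ≠ 0 := by exact_mod_cast h0.ne'
    push_cast
    field_simp
    linear_combination offPart D u x y * Complex.I_sq
  rw [e, norm_smul, norm_mul, Complex.norm_I, one_mul, Complex.norm_real, Real.norm_eq_abs,
    abs_of_pos h0]
  exact mul_le_of_le_one_right h0.le (norm_offEntry_le hp D σ)

theorem offPart_hermitian (hD : D.Fits u p σ) : (offPart D u).IsHermitian := by
  ext x y
  rw [Matrix.conjTranspose_apply, offPart, Matrix.of_apply, Matrix.of_apply]
  by_cases h : x = y
  · rw [if_pos h, if_pos h.symm, star_zero]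
  · rw [if_neg h, if_neg (Ne.symm h), ← hD.symm]

theorem diagMat_hermitian : (diagMat D u).IsHermitian := by
  rw [diagMat, Matrix.IsHermitian, Matrix.diagonal_conjTranspose]
  congr 1
  funext x
  simp

end Block

/-! ### Circuit and error of one segment -/

section Segment

variable (hp : p + 1 ≤ np)

/-- The circuit of the truncated Dyson series in the interaction picture. -/
def seriesCircuit (σ w K : ℕ) (c θ : ℝ) : Prog N np (SerWires N np (p + 1) w (K + 1)) :=
  Series.series (fun i => if i = K then [] else Core.timeStep) fun _ => Core.interaction hp σ c θ

/-- The ancilla wires of a segment. -/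
abbrev SegAnc (N np p w K : ℕ) : Type := AmpAnc (Anc N np (p + 1) w (K + 1))

/-- The isometry that adjoins the ancillas of the series circuit. -/
abbrev serAdjoin (N np p w K : ℕ) : Matrix (BasisState (SerWires N np (p + 1) w (K + 1)))
    (BasisState (Fin (indexQubits N))) ℂ := adjoin (Fin (indexQubits N)) (Anc N np (p + 1) w (K + 1))

/-- The isometry that adjoins the ancillas of a segment. -/
abbrev segAdjoin (N np p w K : ℕ) : Matrix (BasisState (Fin (indexQubits N) ⊕ SegAnc N np p w K))
    (BasisState (Fin (indexQubits N))) ℂ := adjoin (Fin (indexQubits N)) (SegAnc N np p w K)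

/-- Evolution under the diagonal part. -/
def diagCircuit (N np p w K : ℕ) (θ : ℝ) : Prog N np (Fin (indexQubits N) ⊕ SegAnc N np p w K) :=
  (Core.evolveDiag θ).map ((Series.core 0).trans (inner _ _))

/-- The circuit that evolves for the time `τ`. -/
def segment (σ w K : ℕ) (u τ : ℝ) : Prog N np (Fin (indexQubits N) ⊕ SegAnc N np p w K) :=
  amplify (seriesCircuit hp σ w K (Real.sqrt ((1 + 2 * (scale p σ u * τ)) / 2)) (-(τ / 2 ^ w) * u)) ++
    diagCircuit N np p w K (-τ * u)

theorem isBlock_nil (D : SparseData N np) :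
    Core.IsBlock (Prog.eval ([] : Prog N np (Core N np p w)) D) 1 := by
  intro r s hr hs
  rw [Prog.eval_nil, Matrix.one_apply]
  have h := Core.clean_eq_iff hr hs
  rw [ite_self, Matrix.one_apply]
  by_cases h1 : r .k = s .k <;> by_cases h2 : r ∘ Core.st = s ∘ Core.st <;> simp [h, h1, h2]

/-- Loading the diagonal entry, applying phases and unloading is exact and returns all ancillas to
zero, so this part causes no leakage. -/
theorem diagCircuit_adjoin (D : SparseData N np) (u θ : ℝ) (K : ℕ) :
    (diagCircuit N np p w K (θ * u)).eval D * segAdjoin N np p w K =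
      segAdjoin N np p w K * NormedSpace.exp ((Complex.I * θ) • diagMat D u) := by
  obtain ⟨φ, hφ, hφs⟩ := Core.evolveDiag_eval (p := p + 1) (w := w) D θ u
  ext r y
  rw [diagCircuit, Prog.eval_map, mul_adjoin_apply, hφ, exp_smul_diagMat, Matrix.mul_diagonal, segAdjoin,
    adjoin, Matrix.of_apply]
  by_cases h : r = Sum.elim y fun _ => false
  · subst h
    rw [embed_apply_of_agreeOff _ (fun _ _ => rfl), Matrix.diagonal_apply_eq, hφs _ fun _ => rfl,
      if_pos rfl, one_mul]
    congr 1
    push_cast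
    rw [mul_assoc]
    rfl
  · rw [if_neg h, zero_mul, embed]
    rw [Matrix.of_apply]
    split_ifs with h1
    · rw [Matrix.diagonal_apply_ne]
      intro h2
      apply h
      funext q
      by_cases hq : q ∈ Set.range ((Series.core 0).trans (inner _ _) : Core N np (p + 1) w ↪
        Fin (indexQubits N) ⊕ SegAnc N np p w K)
      · obtain ⟨i, rfl⟩ := hq
        exact congrFun h2 i
      · exact h1 q hq
    · rfl

variable {D : SparseData N np} {u : ℝ} {σ : ℕ}

/-- The damping `c` is chosen so that 2c² - 1 = 2βτ. Then the encoded operator is 2·2^w Z with Z =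
-iδB and δ = τ/2^w, and twice the block of the circuit is the truncated series of `dyson_error` with
M = 2^w. -/
theorem series_error (hu : 0 < u) (hσ : σ ≤ indexQubits N) (hD : D.Fits u p σ)
    {τ a : ℝ} (hτ : 0 ≤ τ) (ha : ‖diagMat D u‖ ≤ a) (K : ℕ)
    (h1 : τ * scale p σ u ≤ 1 / 2) (h2 : τ * (a + scale p σ u) ≤ 2 ^ w) :
    ‖(2 : ℂ) • ((serAdjoin N np p w K).conjTranspose * (seriesCircuit hp σ w K
        (Real.sqrt ((1 + 2 * (scale p σ u * τ)) / 2)) (-(τ / 2 ^ w) * u)).eval D * serAdjoin N np p w K) -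
      NormedSpace.exp ((-(Complex.I * ((-τ : ℝ) : ℂ))) • diagMat D u) *
        NormedSpace.exp ((-(Complex.I * τ)) • (diagMat D u + offPart D u))‖ ≤
    2 * ((τ * scale p σ u) ^ (K + 1) / (K + 1).factorial) + 8 * ((τ * (a + scale p σ u)) ^ 2 / 2 ^ w) := by
  have hβ := scale_pos hu p σ
  set β := scale p σ u with hβdef
  set c := Real.sqrt ((1 + 2 * (β * τ)) / 2) with hc
  have hc2 : c ^ 2 = (1 + 2 * (β * τ)) / 2 := Real.sq_sqrt (by positivity)
  have hMpos : (0 : ℝ) < 2 ^ w := by positivity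
  set δ := τ / 2 ^ w with hδ
  have hδ0 : 0 ≤ δ := by positivity
  have hMδ : 2 ^ w * δ = τ := by rw [hδ]; field_simp
  set Y : Matrix (BasisState (Fin (indexQubits N))) (BasisState (Fin (indexQubits N))) ℂ :=
    (-(Complex.I * δ)) • diagMat D u with hY
  set Z : Matrix (BasisState (Fin (indexQubits N))) (BasisState (Fin (indexQubits N))) ℂ :=
    (-(Complex.I * δ)) • offPart D u with hZ
  have hn : ∀ H : Matrix (BasisState (Fin (indexQubits N))) (BasisState (Fin (indexQubits N))) ℂ,
      ‖(-(Complex.I * δ)) • H‖ = δ * ‖H‖ := fun H => by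
    rw [norm_smul, norm_neg, norm_mul, Complex.norm_I, one_mul, Complex.norm_real, Real.norm_eq_abs,
      abs_of_nonneg hδ0]
  set f : ℕ → Matrix (BasisState (Fin (indexQubits N))) (BasisState (Fin (indexQubits N))) ℂ := fun j =>
    NormedSpace.exp ((-(j : ℤ) : ℤ) • Y) * Z * NormedSpace.exp ((j : ℤ) • Y) with hf
  have hB := norm_offPart_le hp hu hσ hD
  have hHh : (diagMat D u + offPart D u).IsHermitian := diagMat_hermitian.add (offPart_hermitian hD)
  have hYZ : Y + Z = (-(Complex.I * δ)) • (diagMat D u + offPart D u) := by rw [smul_add]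
  have hoff : Matrix.of (Core.offEntry hp D σ c) = (2 * 2 ^ w : ℂ) • Z := by
    ext x y
    rw [Matrix.of_apply, offEntry_eq hp D u hu hσ hD, ← scale, ← hβdef, hZ, Matrix.smul_apply,
      Matrix.smul_apply, hc2, smul_eq_mul, smul_eq_mul, ← mul_assoc (2 * 2 ^ w : ℂ)]
    congr 1
    have e : (2 * ((1 + 2 * (β * τ)) / 2) - 1) / β = 2 * (2 ^ w * δ) := by
      rw [hMδ]; field_simp; ring
    rw [e]
    push_cast
    ring
  have hYs : (Complex.I * ((-δ : ℝ) : ℂ)) • diagMat D u = Y := by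
    rw [hY]; congr 1; push_cast; ring
  have hb := Series.series_block (K := K + 1) D (P₁ := fun i => if i = K then [] else Core.timeStep)
    (P₂ := fun _ => Core.interaction hp σ c (-δ * u))
    (Y₁ := fun i => if i = K then 1 else Core.timeMat N w)
    (Y₂ := fun _ => Core.interactionMat hp D u σ c (-δ) w) (fun i => by
      split_ifs
      exacts [isBlock_nil D, Core.timeStep_isBlock D])
    -- The condition τβ ≤ 1/2 is exactly what makes c² ≤ 1.
    (fun i => Core.interaction_isBlock hp D u σ c (-δ) (by rw [hc2]; linarith))
  have hT : (serAdjoin N np p w K).conjTranspose * (seriesCircuit hp σ w K c (-δ * u)).eval D * serAdjoin N np p w K =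
      (1 / 2 ^ w : ℂ) • sumTimes (Series.levelMat (fun i => if i = K then 1 else Core.timeMat N w)
        (fun _ => Core.interactionMat hp D u σ c (-δ) w) (K + 1) * spread (Fin (indexQubits N)) w) := by
    ext x y
    rw [mul_adjoin_apply, adjoin_mul_apply, seriesCircuit, hb _ _ (fun _ => rfl) fun _ => rfl,
      Matrix.smul_apply, sumTimes_mul_one]
    rfl
  rw [hT, sumTimes_levelMat_one (f := f) ?_ K ?_ (if_pos rfl)]
  · have hde := dyson_error (Y := Y) (Z := Z) (η := δ * β) (ρ := δ * (a + β)) (M := 2 ^ w) (K + 1)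
      (fun z => by
        refine norm_exp_le_one ?_
        rw [← Int.cast_smul_eq_zsmul ℂ, Matrix.conjTranspose_smul, hY,
          conjTranspose_I_smul diagMat_hermitian, smul_neg]
        simp)
      (by rw [hYZ]; exact norm_exp_le_one (conjTranspose_I_smul hHh δ))
      (by rw [hZ, hn]; exact mul_le_mul_of_nonneg_left hB hδ0)
      (by push_cast; rw [← mul_assoc, hMδ]; exact h1)
      (by rw [hY, hZ, hn, hn, ← mul_add]; exact mul_le_mul_of_nonneg_left (add_le_add ha hB) hδ0)
      (by rw [hδ, div_mul_eq_mul_div, div_le_one hMpos]; exact h2) (f := f) fun _ => rfl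
    push_cast at hde
    rw [← mul_assoc (2 ^ w), hMδ] at hde
    have e1 : (-(2 ^ w : ℤ)) • Y = (-(Complex.I * ((-τ : ℝ) : ℂ))) • diagMat D u := by
      rw [← Int.cast_smul_eq_zsmul ℂ, hY, smul_smul, ← hMδ]
      congr 1
      push_cast
      ring
    have e2 : 2 ^ w • (Y + Z) = (-(Complex.I * τ)) • (diagMat D u + offPart D u) := by
      rw [← Nat.cast_smul_eq_nsmul ℂ, hYZ, smul_smul, ← hMδ]
      congr 1
      push_cast
      ring
    rw [e1, e2] at hde
    refine hde.trans (le_of_eq ?_)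
    rw [hδ]
    field_simp
  · intro i g
    rw [interactionMat_mul_stack, hYs, hoff]
    congr 1
    funext m
    rw [hf]
    simp only [Matrix.mul_smul, Matrix.smul_mul]
  · intro j hj
    exact if_neg (by omega)

/-- Amplification multiplies the error by 5 and the leakage estimate by a further 2 under the root,
whence 10ε. The final diagonal evolution leaves the interaction picture exactly. -/
theorem segment_dist (hu : 0 < u) (hσ : σ ≤ indexQubits N) (hD : D.Fits u p σ)
    {τ a ε : ℝ} (hτ : 0 ≤ τ) (ha : ‖diagMat D u‖ ≤ a) (K : ℕ)
    (h1 : τ * scale p σ u ≤ 1 / 2) (h2 : τ * (a + scale p σ u) ≤ 2 ^ w)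
    (h3 : 2 * ((τ * scale p σ u) ^ (K + 1) / (K + 1).factorial) +
      8 * ((τ * (a + scale p σ u)) ^ 2 / 2 ^ w) ≤ ε) :
    ‖(segment hp σ w K u τ).eval D * segAdjoin N np p w K - segAdjoin N np p w K *
      NormedSpace.exp ((-(Complex.I * τ)) • (diagMat D u + offPart D u))‖ ≤ Real.sqrt (10 * ε) := by
  have hs := (series_error (w := w) hp hu hσ hD hτ ha K h1 h2).trans h3
  have hHh : (diagMat D u + offPart D u).IsHermitian := diagMat_hermitian.add (offPart_hermitian hD)
  set W := seriesCircuit hp σ w K (Real.sqrt ((1 + 2 * (scale p σ u * τ)) / 2)) (-(τ / 2 ^ w) * u)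
  set U := NormedSpace.exp ((-(Complex.I * τ)) • (diagMat D u + offPart D u)) with hU
  set F := NormedSpace.exp ((-(Complex.I * ((-τ : ℝ) : ℂ))) • diagMat D u) with hF
  set E := NormedSpace.exp ((Complex.I * ((-τ : ℝ) : ℂ)) • diagMat D u) with hE
  have hUU : U.conjTranspose * U = 1 := exp_unitary (conjTranspose_I_smul hHh τ)
  have hFF : F.conjTranspose * F = 1 := exp_unitary (conjTranspose_I_smul diagMat_hermitian (-τ))
  have hEF : E * F = 1 := by
    have : NormedAlgebra ℚ (Matrix (BasisState (Fin (indexQubits N)))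
      (BasisState (Fin (indexQubits N))) ℂ) := NormedAlgebra.restrictScalars ℚ ℂ _
    rw [hE, hF, neg_smul, ← NormedSpace.exp_add_of_commute (Commute.refl _).neg_right,
      add_neg_cancel, NormedSpace.exp_zero]
  have hFU : (F * U).conjTranspose * (F * U) = 1 := by
    rw [Matrix.conjTranspose_mul, Matrix.mul_assoc, ← Matrix.mul_assoc F.conjTranspose, hFF,
      Matrix.one_mul, hUU]
  have hT : ‖(serAdjoin N np p w K).conjTranspose * W.eval D * serAdjoin N np p w K‖ ≤ 1 := by
    have hJ := norm_le_one_of_isometry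
      (adjoin_isometry (X := Fin (indexQubits N)) (A := Anc N np (p + 1) w (K + 1)))
    refine (norm_mul_le_of_right hJ).trans ((norm_mul_le_of_left ?_).trans
      (norm_le_one_of_isometry (Prog.eval_unitary W D)))
    rwa [Matrix.l2_opNorm_conjTranspose]
  have ha := norm_amplify_sub_le hT hFU (mul_eq_one_comm.1 hFU) hs
  rw [← amplify_block] at ha
  have hd := isometry_dist (Prog.eval_unitary (amplify W) D) adjoin_isometry hFU ha
  have e : (segment hp σ w K u τ).eval D * segAdjoin N np p w K - segAdjoin N np p w K * U =
      (diagCircuit N np p w K (-τ * u)).eval D * ((amplify W).eval D * segAdjoin N np p w K - segAdjoin N np p w K * (F * U)) := by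
    rw [segment, Prog.eval_append, Matrix.mul_sub, ← Matrix.mul_assoc (Prog.eval _ D) (segAdjoin N np p w K),
      diagCircuit_adjoin, ← hE, Matrix.mul_assoc (segAdjoin N np p w K) E, ← Matrix.mul_assoc E F, hEF,
      Matrix.one_mul, Matrix.mul_assoc]
  rw [e]
  refine (norm_mul_le_of_left (norm_le_one_of_isometry (Prog.eval_unitary _ D))).trans ?_
  rwa [show (10 : ℝ) * ε = 2 * (5 * ε) by ring]

end Segment

/-! ### The circuit and its error -/

section Circuits

variable {N np : ℕ}

theorem Prog.eval_replicate {Q : Type} [Fintype Q] [DecidableEq Q] (V : Prog N np Q) (r : ℕ)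
    (D : SparseData N np) :
    Prog.eval (List.replicate r V).flatten D = (V.eval D) ^ r := by
  induction r with
  | zero => rfl
  | succ r ih =>
    rw [List.replicate_succ, List.flatten_cons, Prog.eval_append, ih, pow_succ]

theorem Prog.gates_replicate {Q : Type} (V : Prog N np Q) (r : ℕ) :
    Prog.gates (List.replicate r V).flatten = r * V.gates := by
  induction r with
  | zero => simp
  | succ r ih => rw [List.replicate_succ, List.flatten_cons, Prog.gates_append, ih]; ring

theorem Prog.queries_replicate {Q : Type} (V : Prog N np Q) (r : ℕ) :
    Prog.queries (List.replicate r V).flatten = r * V.queries := by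
  induction r with
  | zero => simp
  | succ r ih => rw [List.replicate_succ, List.flatten_cons, Prog.queries_append, ih]; ring

variable {A : Type} [Fintype A] [DecidableEq A]

/-- The numbering of the ancilla wires. -/
def numbering (N : ℕ) (A : Type) [Fintype A] :
    Fin (indexQubits N) ⊕ A ↪ Wires N (Fintype.card A) :=
  (Equiv.sumCongr (Equiv.refl _) (Fintype.equivFin A)).toEmbedding

/-- A list of steps as a circuit. -/
def toCircuit (V : Prog N np (Fin (indexQubits N) ⊕ A)) : Circuit N np (Fintype.card A) :=
  V.map (numbering N A)

theorem toCircuit_block (V : Prog N np (Fin (indexQubits N) ⊕ A)) (D : SparseData N np) :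
    (toCircuit V).block D = ((adjoin (Fin (indexQubits N)) A).conjTranspose * V.eval D *
      adjoin (Fin (indexQubits N)) A).submatrix indexState indexState := by
  ext x y
  rw [Matrix.submatrix_apply, mul_adjoin_apply, adjoin_mul_apply]
  have h : Circuit.eval (toCircuit V) D = Prog.eval (toCircuit V) D := rfl
  rw [Circuit.block, Matrix.of_apply, h, toCircuit, Prog.eval_map, embed_apply_of_agreeOff]
  · congr 1 <;> · funext q; rcases q with q | q <;> rfl
  · intro q hq
    exact absurd ⟨(Equiv.sumCongr (Equiv.refl _) (Fintype.equivFin A)).symm q, Equiv.apply_symm_apply _ _⟩ hq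

end Circuits

/-! ### From register states to the space of valid indices -/

section Transfer

variable {m n : Type*} [Fintype m] [DecidableEq m] [Fintype n] [DecidableEq n]

theorem exp_intertwine {X : Matrix m m ℂ} {S : Matrix m n ℂ} {Y : Matrix n n ℂ} (h : X * S = S * Y) :
    NormedSpace.exp X * S = S * NormedSpace.exp Y := by
  have h1 := (NormedSpace.exp_series_hasSum_exp' (𝕂 := ℂ) X).map
    (AddMonoidHom.mk' (fun M => M * S) fun a b => Matrix.add_mul a b S)
    (continuous_id.matrix_mul continuous_const)
  have h2 := (NormedSpace.exp_series_hasSum_exp' (𝕂 := ℂ) Y).map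
    (AddMonoidHom.mk' (fun M => S * M) fun a b => Matrix.mul_add S a b)
    (continuous_const.matrix_mul continuous_id)
  refine h1.unique ?_
  convert h2 using 1
  swap
  · rfl
  funext k
  simp only [Function.comp_apply, AddMonoidHom.mk'_apply, Matrix.smul_mul, Matrix.mul_smul]
  congr 1
  induction k with
  | zero => simp
  | succ k ih => rw [pow_succ, Matrix.mul_assoc, h, ← Matrix.mul_assoc, ih, pow_succ, Matrix.mul_assoc]

variable {N np : ℕ} {D : SparseData N np} {u : ℝ} {d : ℕ} {H : Matrix (Fin N) (Fin N) ℂ}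

theorem entryInt_re (hD : D.Encodes u d H) (x y : Fin N) (i : Bool) :
    u * (entryInt D (indexState x) (indexState y) i : ℝ) = if i then (H x y).im else (H x y).re := by
  have h : bitsVal (indexState x) < N ∧ bitsVal (indexState y) < N := by
    rw [bitsVal_indexState, bitsVal_indexState]
    exact ⟨x.2, y.2⟩
  have e : entryBits D (indexState x) (indexState y) = D.value x y := by
    rw [entryBits, dif_pos h]
    congr 1 <;> exact Fin.ext (bitsVal_indexState _)
  rw [← hD.1 x y, entryInt, e, decode]
  cases i <;> simp

theorem decode_entryBits (hD : D.Encodes u d H) (x y : Fin N) :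
    decode u (entryBits D (indexState x) (indexState y)) = H x y := by
  have h1 := entryInt_re hD x y false
  have h2 := entryInt_re hD x y true
  rw [← Complex.re_add_im (H x y)]
  simp only [Bool.false_eq_true, if_false, if_true] at h1 h2
  rw [← h1, ← h2, decode]
  simp only [entryInt]
  push_cast
  ring

theorem entryBits_of_not (D : SparseData N np) {x y : BasisState (Fin (indexQubits N))}
    (h : ¬ (bitsVal x < N ∧ bitsVal y < N)) (i : Bool) : entryInt D x y i = 0 := by
  rw [entryInt, entryBits, dif_neg h]
  have h0 : Nat.ofBits (fun _ : Fin np => false) = 0 := by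
    have := bitsVal_eq_sum (fun _ : Fin np => false)
    simpa using this
  simp [Int.ofBits, h0]

theorem decode_of_entryInt (D : SparseData N np) (x y : BasisState (Fin (indexQubits N))) :
    decode u (entryBits D x y) =
      (u : ℂ) * ((entryInt D x y false : ℂ) + Complex.I * (entryInt D x y true : ℂ)) := rfl

/-- The inclusion of the valid basis states. -/
def indexMat (N : ℕ) : Matrix (BasisState (Fin (indexQubits N))) (Fin N) ℂ :=
  Matrix.of fun r x => if r = indexState x then 1 else 0

/-- Entries with an invalid index vanish, so valid states span an invariant subspace on which the
encoded matrix is `H`. Hermiticity makes the diagonal real, so that reading only real parts loses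
nothing. -/
theorem encodedMat_mul (hH : H.IsHermitian) (hD : D.Encodes u d H) :
    (diagMat D u + offPart D u) * indexMat N = indexMat N * H := by
  ext r y
  rw [Matrix.mul_apply, Finset.sum_eq_single (indexState y), indexMat, Matrix.of_apply, if_pos rfl,
    mul_one, Matrix.add_apply, Matrix.mul_apply]
  rotate_left
  · intro s _ hs
    rw [indexMat, Matrix.of_apply, if_neg hs, mul_zero]
  · simp
  by_cases hr : bitsVal r < N
  · obtain ⟨x, rfl⟩ : ∃ x : Fin N, r = indexState x := ⟨⟨_, hr⟩, (indexState_bitsVal r hr).symm⟩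
    rw [Finset.sum_eq_single x, Matrix.of_apply, if_pos rfl, one_mul]
    · rw [diagMat, Matrix.diagonal_apply, offPart, Matrix.of_apply]
      by_cases hxy : x = y
      · subst hxy
        rw [if_pos rfl, if_pos rfl, add_zero, diagPart, entryInt_re hD]
        have := hH.coe_re_apply_self x
        simpa using this
      · rw [if_neg fun h => hxy (indexState_injective h), if_neg fun h => hxy (indexState_injective h),
          zero_add, decode_entryBits hD]
    · intro z _ hz
      rw [Matrix.of_apply, if_neg fun h => hz (indexState_injective h).symm, zero_mul]
    · simp
  · have h1 : ∀ z : Fin N, r ≠ indexState z := by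
      rintro z rfl
      exact hr (by rw [bitsVal_indexState]; exact z.2)
    rw [Finset.sum_eq_zero fun z _ => by rw [Matrix.of_apply, if_neg (h1 z), zero_mul], diagMat,
      Matrix.diagonal_apply_ne _ (h1 y), offPart, Matrix.of_apply, if_neg (h1 y), decode_of_entryInt,
      entryBits_of_not D fun h => hr h.1, entryBits_of_not D fun h => hr h.1]
    simp

theorem exp_encodedMat (hH : H.IsHermitian) (hD : D.Encodes u d H) (z : ℂ) :
    (NormedSpace.exp (z • (diagMat D u + offPart D u))).submatrix indexState indexState =
      NormedSpace.exp (z • H) := by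
  have h := exp_intertwine (X := z • (diagMat D u + offPart D u)) (Y := z • H)
    (S := indexMat N) (by rw [Matrix.smul_mul, encodedMat_mul hH hD, Matrix.mul_smul])
  ext x y
  have h1 := congrFun (congrFun h (indexState x)) y
  simpa [Matrix.mul_apply, indexMat, indexState_injective.eq_iff] using h1

end Transfer

variable {N np p w : ℕ} {D : SparseData N np} {u : ℝ} {d σ : ℕ} {H : Matrix (Fin N) (Fin N) ℂ}

theorem simulation_error (hp : p + 1 ≤ np) (hu : 0 < u) (hσ : σ ≤ indexQubits N) (hF : D.Fits u p σ)
    (hH : H.IsHermitian) (hD : D.Encodes u d H) {t a ε : ℝ} (ht : 0 ≤ t) (ha : ‖diagMat D u‖ ≤ a)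
    (hε : 0 ≤ ε) (K : ℕ) {r : ℕ} (hr : 0 < r) (h1 : t / r * scale p σ u ≤ 1 / 2)
    (h2 : t / r * (a + scale p σ u) ≤ 2 ^ w)
    (h3 : 2 * ((t / r * scale p σ u) ^ (K + 1) / (K + 1).factorial) +
      8 * ((t / r * (a + scale p σ u)) ^ 2 / 2 ^ w) ≤ ε ^ 2 / (10 * r ^ 2)) :
    ‖(toCircuit (List.replicate r (segment hp σ w K u (t / r))).flatten).block D -
      NormedSpace.exp ((-(Complex.I * (t : ℂ))) • H)‖ ≤ ε := by
  have hr0 : (0 : ℝ) < r := by exact_mod_cast hr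
  have hd := segment_dist (w := w) hp hu hσ hF (τ := t / r) (by positivity) ha K h1 h2 h3
  -- The accuracy required of a segment is chosen so that its leakage bound is ε / r.
  have hs : Real.sqrt (10 * (ε ^ 2 / (10 * r ^ 2))) = ε / r := by
    rw [show 10 * (ε ^ 2 / (10 * (r : ℝ) ^ 2)) = (ε / r) ^ 2 by field_simp]
    exact Real.sqrt_sq (by positivity)
  rw [hs] at hd
  have hHh : (diagMat D u + offPart D u).IsHermitian := diagMat_hermitian.add (offPart_hermitian hF)
  have hpow := pow_dist (norm_le_one_of_isometry (Prog.eval_unitary _ D))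
    (norm_exp_le_one (conjTranspose_I_smul hHh _)) hd r
  rw [mul_div_cancel₀ _ hr0.ne'] at hpow
  have : NormedAlgebra ℚ (Matrix (BasisState (Fin (indexQubits N)))
      (BasisState (Fin (indexQubits N))) ℂ) := NormedAlgebra.restrictScalars ℚ ℂ _
  rw [← NormedSpace.exp_nsmul, ← Nat.cast_smul_eq_nsmul ℂ, smul_smul] at hpow
  have e : (r : ℂ) * -(Complex.I * ((t / r : ℝ) : ℂ)) = -(Complex.I * (t : ℂ)) := by
    have : (r : ℂ) ≠ 0 := by exact_mod_cast hr.ne'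
    push_cast
    field_simp
  rw [e] at hpow
  have hJ : (segAdjoin N np p w K).conjTranspose * segAdjoin N np p w K = 1 := adjoin_isometry
  have hJn : ‖(segAdjoin N np p w K).conjTranspose‖ ≤ 1 := by
    rw [Matrix.l2_opNorm_conjTranspose]
    exact norm_le_one_of_isometry hJ
  have hsub := (norm_mul_le_of_left hJn).trans hpow
  rw [Matrix.mul_sub, ← Matrix.mul_assoc _ (segAdjoin N np p w K), hJ, Matrix.one_mul,
    ← Prog.eval_replicate, ← Matrix.mul_assoc] at hsub
  have hn := (norm_submatrix_le _ (indexState_injective (N := N))).trans hsub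
  rw [Matrix.submatrix_sub] at hn
  rw [toCircuit_block, ← exp_encodedMat hH hD]
  exact hn

theorem diag_simulation (hH : H.IsHermitian) (hD : D.Encodes u d H) (h0 : offPart D u = 0) (t : ℝ) :
    (toCircuit (diagCircuit N np 0 0 0 (-t * u))).block D =
      NormedSpace.exp ((-(Complex.I * (t : ℂ))) • H) := by
  have hJ : (segAdjoin N np 0 0 0).conjTranspose * segAdjoin N np 0 0 0 = 1 := adjoin_isometry
  rw [toCircuit_block, ← exp_encodedMat hH hD, h0, add_zero, Matrix.mul_assoc, diagCircuit_adjoin,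
    ← Matrix.mul_assoc, hJ, Matrix.one_mul]
  congr 3
  push_cast
  ring

/-! ### Oracles that encode a sparse matrix -/

variable {N np d : ℕ} {D : SparseData N np} {u a b : ℝ} {A B : Matrix (Fin N) (Fin N) ℂ}

theorem norm_entry_le_of_maxNorm (h : maxNorm B ≤ b) (x y : Fin N) : ‖B x y‖ ≤ b := by
  refine le_trans ?_ h
  unfold maxNorm
  exact (le_ciSup (f := fun y => ‖B x y‖) (Set.finite_range _).bddAbove y).trans
    (le_ciSup (f := fun x => ⨆ y, ‖B x y‖) (Set.finite_range _).bddAbove x)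

theorem norm_diag_le (hA : A.IsDiag) (h : ‖A‖ ≤ a) (x : Fin N) : ‖A x x‖ ≤ a := by
  rw [← hA.diagonal_diag, Matrix.l2_opNorm_diagonal] at h
  exact (norm_le_pi_norm (Matrix.diag A) x).trans h

theorem eq_indexState_or (x : BasisState (Fin (indexQubits N))) :
    (∃ z : Fin N, x = indexState z) ∨ ¬ bitsVal x < N := by
  by_cases h : bitsVal x < N
  exacts [Or.inl ⟨⟨_, h⟩, (indexState_bitsVal x h).symm⟩, Or.inr h]

theorem norm_diagMat_le (ha : 0 ≤ a) (hA : A.IsDiag) (hB : ∀ k, B k k = 0)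
    (hD : D.Encodes u d (A + B)) (h : ‖A‖ ≤ a) : ‖diagMat D u‖ ≤ a := by
  rw [diagMat, Matrix.l2_opNorm_diagonal]
  refine (pi_norm_le_iff_of_nonneg ha).2 fun x => ?_
  rw [Complex.norm_real, diagPart]
  rcases eq_indexState_or x with ⟨z, rfl⟩ | hx
  · rw [entryInt_re hD, Matrix.add_apply, hB, add_zero]
    exact (Complex.abs_re_le_norm _).trans (norm_diag_le hA h z)
  · rw [entryBits_of_not D fun h => hx h.1]
    simpa using ha

theorem abs_entryInt_le (hA : A.IsDiag) (hD : D.Encodes u d (A + B)) (h : maxNorm B ≤ b) (hu : 0 < u)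
    (hb : 0 ≤ b) {x y : BasisState (Fin (indexQubits N))} (hxy : x ≠ y) (i : Bool) :
    u * |(entryInt D x y i : ℝ)| ≤ b := by
  rcases eq_indexState_or x with ⟨x, rfl⟩ | hx
  · rcases eq_indexState_or y with ⟨y, rfl⟩ | hy
    · have h1 := entryInt_re hD x y i
      have h2 : (A + B) x y = B x y := by
        rw [Matrix.add_apply, hA fun h => hxy (by rw [h]), zero_add]
      have h3 := norm_entry_le_of_maxNorm h x y
      rw [← abs_of_pos hu, ← abs_mul, h1, h2]
      cases i
      · exact (Complex.abs_re_le_norm _).trans h3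
      · exact (Complex.abs_im_le_norm _).trans h3
    · rw [entryBits_of_not D fun h => hy h.2]
      simpa using hb
  · rw [entryBits_of_not D fun h => hx h.1]
    simpa using hb

theorem decode_eq_zero_of_not {x y : BasisState (Fin (indexQubits N))}
    (h : ¬ (bitsVal x < N ∧ bitsVal y < N)) : decode u (entryBits D x y) = 0 := by
  rw [decode_of_entryInt, entryBits_of_not D h, entryBits_of_not D h]
  simp

/-- Real and imaginary parts of entries are integer multiples of `u`; below `u` only zero is left.
-/
theorem offPart_eq_zero_of_lt (hA : A.IsDiag) (hD : D.Encodes u d (A + B)) (h : maxNorm B ≤ b)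
    (hu : 0 < u) (hb : 0 ≤ b) (hbu : b < u) : offPart D u = 0 := by
  ext x y
  rw [offPart, Matrix.of_apply, Matrix.zero_apply]
  split_ifs with hxy
  · rfl
  · have h0 : ∀ i, entryInt D x y i = 0 := by
      intro i
      have h1 := abs_entryInt_le hA hD h hu hb hxy i
      by_contra h2
      have h3 : (1 : ℝ) ≤ |(entryInt D x y i : ℝ)| := by
        exact_mod_cast Int.one_le_abs h2
      nlinarith
    rw [decode_of_entryInt, h0, h0]
    simp

theorem offPart_eq_zero_of_sparsity (hD : D.Encodes u 0 (A + B)) : offPart D u = 0 := by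
  ext x y
  rw [offPart, Matrix.of_apply, Matrix.zero_apply]
  split_ifs with hxy
  · rfl
  · by_contra h
    rcases eq_indexState_or x with ⟨x, rfl⟩ | hx
    · rcases eq_indexState_or y with ⟨y, rfl⟩ | hy
      · rw [decode_entryBits hD] at h
        obtain ⟨j, hj, -⟩ := hD.2 x y h
        omega
      · exact h (decode_eq_zero_of_not fun h => hy h.2)
    · exact h (decode_eq_zero_of_not fun h => hx h.1)

theorem ofBits_bounds {n : ℕ} (f : Fin n → Bool) :
    -2 ^ (n - 1) ≤ Int.ofBits f ∧ Int.ofBits f < 2 ^ (n - 1) := by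
  rcases n with _ | n
  · simp
  · have h1 := Nat.ofBits_lt_two_pow f
    rw [Int.ofBits, Nat.add_sub_cancel]
    rw [pow_succ] at h1 ⊢
    have e : ((2 ^ n : ℕ) : ℤ) = 2 ^ n := by push_cast; rfl
    rw [← e]
    clear e
    generalize 2 ^ n = P at *
    split_ifs with h
    · exact ⟨by simp only [Int.ofNat_eq_natCast]; omega, by simp only [Int.ofNat_eq_natCast]; omega⟩
    · rw [Int.subNatNat_eq_coe]
      omega

/-- The number of magnitude bits of the off-diagonal entries. -/
def magnitudeBits (np : ℕ) (u b : ℝ) : ℕ := min (np - 1) (Nat.size ⌊b / u⌋₊)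

/-- The number of bits of the position of a non-zero entry in its row. -/
def positionBits (N d : ℕ) : ℕ := min (Nat.clog 2 d) (indexQubits N)

/-- Off-diagonal integers are bounded both by the width of the value register and by ⌊b/u⌋, so the
smaller bit count suffices. Taking the latter into account ties the normalization to `b` instead of
to the full range of the register, which diagonal entries may exhaust. -/
theorem fits (hA : A.IsDiag) (hH : (A + B).IsHermitian) (hD : D.Encodes u d (A + B))
    (h : maxNorm B ≤ b) (hu : 0 < u) (hb : 0 ≤ b) :
    D.Fits u (magnitudeBits np u b) (positionBits N d) where
  range x y hxy i := by
    have h1 : -2 ^ (np - 1) ≤ entryInt D x y i ∧ entryInt D x y i < 2 ^ (np - 1) := ofBits_bounds _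
    have h2 : |entryInt D x y i| < 2 ^ Nat.size ⌊b / u⌋₊ := by
      have h3 : |entryInt D x y i| ≤ ⌊b / u⌋₊ := by
        rw [Int.natCast_floor_eq_floor (by positivity), Int.le_floor, le_div_iff₀ hu, mul_comm]
        have := abs_entryInt_le hA hD h hu hb hxy i
        push_cast
        exact this
      refine h3.trans_lt ?_
      exact_mod_cast Nat.lt_size_self _
    rw [abs_lt] at h2
    unfold magnitudeBits
    rcases min_choice (np - 1) (Nat.size ⌊b / u⌋₊) with h3 | h3 <;> rw [h3]
    exacts [h1, ⟨h2.1.le, h2.2⟩]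
  symm x y := by
    rcases eq_indexState_or x with ⟨x, rfl⟩ | hx
    · rcases eq_indexState_or y with ⟨y, rfl⟩ | hy
      · rw [decode_entryBits hD, decode_entryBits hD, hH.apply]
      · rw [decode_eq_zero_of_not fun h => hy h.2, decode_eq_zero_of_not fun h => hy h.1, star_zero]
    · rw [decode_eq_zero_of_not fun h => hx h.1, decode_eq_zero_of_not fun h => hx h.2, star_zero]
  column x y hxy hne := by
    rcases eq_indexState_or x with ⟨x, rfl⟩ | hx
    swap
    · exact absurd (decode_eq_zero_of_not fun h => hx h.1) hne
    rcases eq_indexState_or y with ⟨y, rfl⟩ | hy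
    swap
    · exact absurd (decode_eq_zero_of_not fun h => hy h.2) hne
    rw [decode_entryBits hD] at hne
    obtain ⟨j, hj, hjy⟩ := hD.2 x y hne
    have hv : bitsVal (indexState x) < N ∧ bitsVal (indexState y) < N := by
      rw [bitsVal_indexState, bitsVal_indexState]
      exact ⟨x.2, y.2⟩
    have e : columnBits D.inv (indexState x) (indexState y) = indexState j := by
      rw [columnBits, dif_pos hv]
      congr 1
      simp only [SparseData.inv, bitsVal_indexState, Fin.eta]
      rw [Equiv.symm_apply_eq, hjy]
    rw [e]
    unfold positionBits
    rcases min_choice (Nat.clog 2 d) (indexQubits N) with h3 | h3 <;> rw [h3]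
    · rw [bitsVal_indexState]
      exact hj.trans_le (Nat.le_pow_clog (by norm_num) d)
    · exact bitsVal_lt _

theorem positionBits_le (N d : ℕ) : positionBits N d ≤ indexQubits N := min_le_right _ _

theorem magnitudeBits_succ_le (hnp : 0 < np) (u b : ℝ) : magnitudeBits np u b + 1 ≤ np := by
  have := min_le_left (np - 1) (Nat.size ⌊b / u⌋₊)
  unfold magnitudeBits
  omega

/-- Rounding b/u and d up to powers of two costs a factor 2 each, and √2 ≤ 3/2. The assumption u ≤ b
is needed for the first rounding. -/
theorem scale_le (hu : 0 < u) (hb : u ≤ b) (hd : 0 < d) :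
    scale (magnitudeBits np u b) (positionBits N d) u ≤ 6 * (d * b) := by
  have hb0 : 0 < b := hu.trans_le hb
  have h1 : (2 : ℝ) ^ magnitudeBits np u b * u ≤ 2 * b := by
    have h2 : (2 : ℝ) ^ magnitudeBits np u b ≤ 2 ^ Nat.size ⌊b / u⌋₊ :=
      pow_le_pow_right₀ (by norm_num) (min_le_right _ _)
    have hf : 1 ≤ ⌊b / u⌋₊ := by
      rw [Nat.one_le_floor_iff, one_le_div hu]
      exact hb
    have h3 : 2 ^ Nat.size ⌊b / u⌋₊ ≤ 2 * ⌊b / u⌋₊ := by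
      have hs : 0 < Nat.size ⌊b / u⌋₊ := Nat.size_pos.2 hf
      have h4 : 2 ^ (Nat.size ⌊b / u⌋₊ - 1) ≤ ⌊b / u⌋₊ := Nat.lt_size.1 (by omega)
      calc 2 ^ Nat.size ⌊b / u⌋₊ = 2 * 2 ^ (Nat.size ⌊b / u⌋₊ - 1) := by
            rw [← pow_succ']; congr 1; omega
        _ ≤ _ := by omega
    have h5 : (2 : ℝ) ^ Nat.size ⌊b / u⌋₊ ≤ 2 * ⌊b / u⌋₊ := by exact_mod_cast h3
    have h6 : (⌊b / u⌋₊ : ℝ) ≤ b / u := Nat.floor_le (by positivity)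
    calc (2 : ℝ) ^ magnitudeBits np u b * u ≤ 2 * (b / u) * u := by
          refine mul_le_mul_of_nonneg_right ?_ hu.le
          linarith
      _ = 2 * b := by field_simp
  have h2 : (2 : ℝ) ^ positionBits N d ≤ 2 * d := by
    have h3 : (2 : ℝ) ^ positionBits N d ≤ 2 ^ Nat.clog 2 d :=
      pow_le_pow_right₀ (by norm_num) (min_le_left _ _)
    have h4 : 2 ^ Nat.clog 2 d ≤ 2 * d := by
      rcases Nat.lt_or_ge 1 d with h | h
      · have h5 := Nat.pow_pred_clog_lt_self (by norm_num : 1 < 2) h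
        have h6 : 0 < Nat.clog 2 d := Nat.clog_pos (by norm_num) h
        calc 2 ^ Nat.clog 2 d = 2 * 2 ^ (Nat.clog 2 d).pred := by
              rw [← pow_succ']; congr 1; rw [Nat.pred_eq_sub_one]; omega
          _ ≤ _ := by omega
      · obtain rfl : d = 1 := by omega
        simp
    have h5 : (2 : ℝ) ^ Nat.clog 2 d ≤ 2 * d := by exact_mod_cast h4
    linarith
  have h3 : Real.sqrt 2 ≤ 3 / 2 := by
    rw [Real.sqrt_le_left (by norm_num)]
    norm_num
  calc scale (magnitudeBits np u b) (positionBits N d) u =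
        Real.sqrt 2 * (2 ^ magnitudeBits np u b * u) * 2 ^ positionBits N d := by rw [scale]; ring
    _ ≤ 3 / 2 * (2 * b) * (2 * d) := by gcongr
    _ = _ := by ring

/-! ### Resource counts -/

variable {N np p w : ℕ}

theorem card_scratch (N np p w : ℕ) :
    Fintype.card (Scratch N np p w) = indexQubits N + 2 * np + p + w + 6 := by
  let e : Scratch N np p w ≃ (Fin (indexQubits N) ⊕ ValueWires np) ⊕ ((Fin p ⊕ Fin w) ⊕ Fin 6) :=
    { toFun := fun a => match a with
        | .y i => .inl (.inl i)
        | .z k => .inl (.inr k)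
        | .r i => .inr (.inl (.inl i))
        | .t i => .inr (.inl (.inr i))
        | .b => .inr (.inr 0)
        | .rho => .inr (.inr 1)
        | .gre => .inr (.inr 2)
        | .gim => .inr (.inr 3)
        | .g => .inr (.inr 4)
        | .c => .inr (.inr 5)
      invFun := fun a => match a with
        | .inl (.inl i) => .y i
        | .inl (.inr k) => .z k
        | .inr (.inl (.inl i)) => .r i
        | .inr (.inl (.inr i)) => .t i
        | .inr (.inr 0) => .b
        | .inr (.inr 1) => .rho
        | .inr (.inr 2) => .gre
        | .inr (.inr 3) => .gim
        | .inr (.inr 4) => .g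
        | .inr (.inr 5) => .c
      left_inv := by rintro (_ | _ | _ | _ | _ | _ | _ | _ | _ | _) <;> rfl
      right_inv := by
        rintro ((_ | _) | ((_ | _) | i)) <;> try rfl
        fin_cases i <;> rfl }
  rw [Fintype.card_congr e]
  simp
  ring

theorem card_anc (N np p w K : ℕ) :
    Fintype.card (Anc N np p w K) = w + 2 * Fintype.card (Scratch N np p w) + 3 * K + 2 := by
  let e : Anc N np p w K ≃ (Fin w ⊕ Scratch N np p w) ⊕
      ((Fin (K + 1) ⊕ Bool × Fin K) ⊕ (Scratch N np p w ⊕ Unit)) :=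
    { toFun := fun a => match a with
        | .tm i => .inl (.inl i)
        | .s a => .inl (.inr a)
        | .kap i => .inr (.inl (.inl i))
        | .fl o i => .inr (.inl (.inr (o, i)))
        | .v a => .inr (.inr (.inl a))
        | .c => .inr (.inr (.inr ()))
      invFun := fun a => match a with
        | .inl (.inl i) => .tm i
        | .inl (.inr a) => .s a
        | .inr (.inl (.inl i)) => .kap i
        | .inr (.inl (.inr (o, i))) => .fl o i
        | .inr (.inr (.inl a)) => .v a
        | .inr (.inr (.inr ())) => .c
      left_inv := by rintro (_ | _ | _ | _ | _ | _) <;> rfl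
      right_inv := by rintro ((_ | _) | ((_ | ⟨_, _⟩) | (_ | _))) <;> rfl }
  rw [Fintype.card_congr e]
  simp
  ring

namespace Core

theorem gates_timeStep_le : (timeStep : Prog N np (Core N np p w)).gates ≤ 37 * w + 14 := by
  have h1 := gates_rots_le (N := N) (np := np) (eL (N := N) (np := np) (p := p) (w := w)) fun _ => had
  have h2 := gates_ctrlCompare_le (N := N) (np := np) (.k : Core N np p w) (.s .c)
    (regPairs (fun i => .s (.t i)) .tm) (.s .g)
  have h3 := gates_phase_le (N := N) (np := np) cz (.s .b : Core N np p w) .k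
  have h4 := gates_phase_le (N := N) (np := np) cz (.s .b : Core N np p w) (.s .g)
  have h5 := gates_cswaps_le (N := N) (np := np) (.k : Core N np p w)
    (regPairs (fun i => .s (.t i)) .tm)
  simp only [Fintype.card_sum, Fintype.card_fin, Fintype.card_unit] at h1
  simp only [regPairs, List.length_map, List.length_finRange] at h2 h5
  simp only [timeStep, Prog.gates_append, Prog.gates_inverse, regPairs]
  omega

theorem queries_timeStep : (timeStep : Prog N np (Core N np p w)).queries = 0 := by
  simp [timeStep]

variable (hp : p + 1 ≤ np)

theorem gates_judge_le : (judge hp : Prog N np (Core N np (p + 1) w)).gates ≤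
    28 * np + 28 * indexQubits N + 22 := by
  have h1 := fun l g => gates_ctrlCompare_le (N := N) (np := np) (.k : Core N np (p + 1) w) (.s .c) l g
  have a1 := h1 (regPairs (zlow hp false) fun i => .s (.r i)) (.s .gre)
  have a2 := h1 (regPairs (zlow hp true) fun i => .s (.r i)) (.s .gim)
  have a3 := h1 (regPairs .x fun i => .s (.y i)) (.s .g)
  have a4 := h1 (regPairs (fun i => .s (.y i)) .x) (.s .g)
  simp only [regPairs, List.length_map, List.length_finRange] at a1 a2 a3 a4
  simp only [judge, Prog.gates_append, gates_notGate, Prog.gates_cons, Prog.gates_nil, Step.isGate,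
    regPairs, Bool.false_eq_true, if_false]
  omega

theorem queries_judge : (judge hp : Prog N np (Core N np (p + 1) w)).queries = 1 := by
  simp [judge, Step.isGate]

theorem gates_judgePhases_le : (judgePhases : Prog N np (Core N np (p + 1) w)).gates ≤ 5 := by
  have h1 := fun φ a b => gates_phase_le (N := N) (np := np) (Q := Core N np (p + 1) w) φ a b
  have a1 := h1 bitPhase (.s .gre) (.s .gim)
  have a2 := h1 cz (.s .b) .k
  have a3 := h1 cz (.s .b) (.s .g)
  have a4 := h1 cz .k (.s .rho)
  have a5 := gates_phase₁_le (N := N) (np := np) (Q := Core N np (p + 1) w) ctrlPhase .k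
  simp only [judgePhases, Prog.gates_append]
  omega

theorem gates_offDiag_le (σ : ℕ) (c : ℝ) : (offDiag hp σ c : Prog N np (Core N np (p + 1) w)).gates ≤
    65 * indexQubits N + 58 * np + 53 := by
  have h1 := gates_rots_le (N := N) (np := np) (eB (N := N) (np := np) (p := p + 1) (w := w))
    (prepB N (p + 1) σ c)
  have h2 := gates_judge_le (N := N) (w := w) hp
  have h3 := gates_judgePhases_le (N := N) (np := np) (p := p) (w := w)
  have h4 := gates_cswaps_le (N := N) (np := np) (.k : Core N np (p + 1) w)
    (regPairs .x fun i => .s (.y i))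
  simp only [Fintype.card_sum, Fintype.card_fin, Fintype.card_bool] at h1
  simp only [regPairs, List.length_map, List.length_finRange] at h4
  simp only [offDiag, Prog.gates_append, Prog.gates_inverse, Prog.gates_cons, Prog.gates_nil,
    Step.isGate, regPairs, Bool.false_eq_true, if_false]
  omega

/-- A position query and its inverse, and an entry query in the comparison and in its inverse. -/
theorem queries_offDiag (σ : ℕ) (c : ℝ) :
    (offDiag hp σ c : Prog N np (Core N np (p + 1) w)).queries = 4 := by
  simp [offDiag, queries_judge, judgePhases, Step.isGate]

theorem gates_load_le : (load : Prog N np (Core N np p w)).gates ≤ indexQubits N := by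
  have h := gates_copies_le (N := N) (np := np) (Core.x : _ → Core N np p w) (fun i => .s (.y i))
    (List.finRange (indexQubits N))
  rw [List.length_finRange] at h
  simpa [load, Step.isGate] using h

theorem queries_load : (load : Prog N np (Core N np p w)).queries = 1 := by
  simp [load, Step.isGate]

theorem gates_evolveDiag_le (θ : ℝ) : (evolveDiag θ : Prog N np (Core N np p w)).gates ≤
    2 * indexQubits N + np := by
  have h1 := gates_load_le (N := N) (np := np) (p := p) (w := w)
  have h2 : (valuePhases θ : Prog N np (Core N np p w)).gates ≤ np := by
    refine (Prog.gates_flatMap_le _ _ 1 fun k => gates_phase₁_le _ _).trans ?_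
    simp
  simp only [evolveDiag, Prog.gates_append, Prog.gates_inverse]
  omega

theorem queries_evolveDiag (θ : ℝ) : (evolveDiag θ : Prog N np (Core N np p w)).queries = 2 := by
  have h2 : (valuePhases θ : Prog N np (Core N np p w)).queries = 0 := by
    have := Prog.queries_flatMap_le (List.finRange np) (fun k => (phase₁ (fun a => Complex.exp
      (Complex.I * ((θ * (bitWeight k * (a.toNat : ℝ)) : ℝ) : ℂ))) (.s (.z (false, k))) :
        Prog N np (Core N np p w))) 0 fun k => by simp
    simpa [valuePhases] using this
  simp [evolveDiag, queries_load, h2]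

theorem gates_evolveTime_le (θ : ℝ) : (evolveTime θ : Prog N np (Core N np p w)).gates ≤
    2 * indexQubits N + np * w := by
  have h1 := gates_load_le (N := N) (np := np) (p := p) (w := w)
  have h2 : (timePhases θ : Prog N np (Core N np p w)).gates ≤ np * w := by
    refine (Prog.gates_flatMap_le _ _ w fun k => ?_).trans ?_
    · refine (Prog.gates_flatMap_le _ _ 1 fun k => gates_phase_le _ _ _).trans ?_
      simp
    · simp
  simp only [evolveTime, Prog.gates_append, Prog.gates_inverse]
  omega

theorem queries_evolveTime (θ : ℝ) : (evolveTime θ : Prog N np (Core N np p w)).queries = 2 := by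
  have h2 : (timePhases θ : Prog N np (Core N np p w)).queries ≤ 0 := by
    refine (Prog.queries_flatMap_le _ _ 0 fun k => ?_).trans (by simp)
    exact (Prog.queries_flatMap_le _ _ 0 fun j => by simp).trans (by simp)
  simp only [evolveTime, Prog.queries_append, Prog.queries_inverse, queries_load]
  omega

theorem gates_interaction_le (σ : ℕ) (c θ : ℝ) :
    (interaction hp σ c θ : Prog N np (Core N np (p + 1) w)).gates ≤
      69 * indexQubits N + 58 * np + 53 + 2 * (np * w) := by
  have h1 := gates_evolveTime_le (N := N) (np := np) (p := p + 1) (w := w) θ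
  have h2 := gates_offDiag_le (N := N) (w := w) hp σ c
  simp only [interaction, Prog.gates_append, Prog.gates_inverse]
  omega

theorem queries_interaction (σ : ℕ) (c θ : ℝ) :
    (interaction hp σ c θ : Prog N np (Core N np (p + 1) w)).queries = 8 := by
  simp [interaction, queries_evolveTime, queries_offDiag]

end Core

namespace Series

variable {K : ℕ}

theorem gates_flag_le (o : Bool) (i : Fin K) : (flag o i : Prog N np (SerWires N np p w K)).gates ≤
    14 * Fintype.card (Scratch N np p w) + 1 := by
  refine (gates_compare_le _ _ _).trans ?_
  simp

theorem gates_levels_le {P₁ P₂ : ℕ → Prog N np (Core N np p w)} {g₁ g₂ : ℕ}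
    (h₁ : ∀ i, (P₁ i).gates ≤ g₁) (h₂ : ∀ i, (P₂ i).gates ≤ g₂) (i : ℕ) (h : i ≤ K) :
    (levels P₁ P₂ i h : Prog N np (SerWires N np p w K)).gates ≤
      i * (g₁ + g₂ + 28 * Fintype.card (Scratch N np p w) + 4) := by
  induction i with
  | zero => simp [levels]
  | succ i ih =>
    have a1 := gates_condGate_le (N := N) (np := np) (fun b => if b then had else 1)
      (.inr (.kap ⟨i + 1, by omega⟩) : SerWires N np p w K) (.inr (.kap ⟨i, by omega⟩))
    have a2 := gates_flag_le (N := N) (np := np) (p := p) (w := w) false (⟨i, by omega⟩ : Fin K)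
    have a3 := gates_flag_le (N := N) (np := np) (p := p) (w := w) true (⟨i, by omega⟩ : Fin K)
    have a4 := ih (by omega)
    have a5 := h₁ i
    have a6 := h₂ i
    simp only [levels, Prog.gates_append, Prog.gates_map]
    rw [add_mul, one_mul]
    omega

theorem queries_levels_le {P₁ P₂ : ℕ → Prog N np (Core N np p w)} {q : ℕ}
    (h₁ : ∀ i, (P₁ i).queries = 0) (h₂ : ∀ i, (P₂ i).queries ≤ q) (i : ℕ) (h : i ≤ K) :
    (levels P₁ P₂ i h : Prog N np (SerWires N np p w K)).queries ≤ i * q := by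
  induction i with
  | zero => simp [levels]
  | succ i ih =>
    have a4 := ih (by omega)
    have a6 := h₂ i
    simp only [levels, flag, Prog.queries_append, Prog.queries_map, h₁, queries_compare,
      queries_condGate]
    rw [add_mul, one_mul]
    omega

end Series

theorem gates_seriesCircuit_le (hp : p + 1 ≤ np) (σ w K : ℕ) (c θ : ℝ) :
    (seriesCircuit hp σ w K c θ : Prog N np _).gates ≤
      (K + 1) * (97 * indexQubits N + 142 * np + 65 * w + 2 * (np * w) + 239) + 2 * w + 2 := by
  have h1 := Series.gates_levels_le (N := N) (np := np) (p := p + 1) (w := w) (K := K + 1)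
    (P₁ := fun i => if i = K then [] else Core.timeStep)
    (P₂ := fun _ => Core.interaction hp σ c θ) (g₁ := 37 * w + 14) (fun i => by
      split_ifs
      exacts [Nat.zero_le _, Core.gates_timeStep_le]) (fun i => Core.gates_interaction_le hp σ c θ)
      (K + 1) le_rfl
  have h2 := gates_rots_le (N := N) (np := np)
    (Series.time (N := N) (np := np) (p := p + 1) (w := w) (K := K + 1)) fun _ => had
  rw [Fintype.card_fin] at h2
  rw [card_scratch] at h1
  simp only [seriesCircuit, Series.series, Prog.gates_append, gates_notGate]
  have h3 : (K + 1) * (37 * w + 14 + (69 * indexQubits N + 58 * np + 53 + 2 * (np * w)) +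
      28 * (indexQubits N + 2 * np + (p + 1) + w + 6) + 4) ≤
      (K + 1) * (97 * indexQubits N + 142 * np + 65 * w + 2 * (np * w) + 239) :=
    Nat.mul_le_mul_left _ (by omega)
  omega

theorem queries_seriesCircuit_le (hp : p + 1 ≤ np) (σ w K : ℕ) (c θ : ℝ) :
    (seriesCircuit hp σ w K c θ : Prog N np _).queries ≤ (K + 1) * 8 := by
  have h1 := Series.queries_levels_le (N := N) (np := np) (p := p + 1) (w := w) (K := K + 1)
    (P₁ := fun i => if i = K then [] else Core.timeStep)
    (P₂ := fun _ => Core.interaction hp σ c θ) (q := 8) (fun i => by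
      split_ifs
      exacts [rfl, Core.queries_timeStep]) (fun i => (Core.queries_interaction hp σ c θ).le)
      (K + 1) le_rfl
  simpa [seriesCircuit, Series.series] using h1

section Amplify

variable {X A : Type} [Fintype X] [DecidableEq X] [Fintype A] [DecidableEq A]

theorem gates_zeroPhase_le (φ : Bool → ℂ) :
    (zeroPhase φ : Prog N np (X ⊕ AmpAnc A)).gates ≤ 28 * Fintype.card A + 3 := by
  have h1 : (zeroTest : Prog N np (X ⊕ AmpAnc A)).gates ≤ 14 * Fintype.card A + 1 := by
    refine (gates_compare_le _ _ _).trans ?_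
    simp
  have h2 := gates_phase₁_le (N := N) (np := np) φ (.inr (.inr (.inr true)) : X ⊕ AmpAnc A)
  simp only [zeroPhase, Prog.gates_append, Prog.gates_inverse]
  omega

theorem queries_zeroPhase (φ : Bool → ℂ) :
    (zeroPhase φ : Prog N np (X ⊕ AmpAnc A)).queries = 0 := by
  simp [zeroPhase, zeroTest]

theorem gates_amplify_le (W : Prog N np (X ⊕ A)) :
    (amplify W).gates ≤ 3 * W.gates + 56 * Fintype.card A + 6 := by
  have h1 := gates_zeroPhase_le (N := N) (np := np) (X := X) (A := A) fun b => if b then 1 else -1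
  have h2 := gates_zeroPhase_le (N := N) (np := np) (X := X) (A := A) fun b => if b then -1 else 1
  simp only [amplify, Prog.gates_append, Prog.gates_inverse, Prog.gates_map]
  omega

theorem queries_amplify (W : Prog N np (X ⊕ A)) : (amplify W).queries = 3 * W.queries := by
  simp only [amplify, Prog.queries_append, Prog.queries_inverse, Prog.queries_map, queries_zeroPhase]
  omega

end Amplify

theorem gates_diagCircuit_le (N np p w K : ℕ) (θ : ℝ) :
    (diagCircuit N np p w K θ).gates ≤ 2 * indexQubits N + np := by
  rw [diagCircuit, Prog.gates_map]
  exact Core.gates_evolveDiag_le θ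

theorem queries_diagCircuit (N np p w K : ℕ) (θ : ℝ) : (diagCircuit N np p w K θ).queries = 2 := by
  rw [diagCircuit, Prog.queries_map]
  exact Core.queries_evolveDiag θ

theorem card_segAnc_le (hp : p + 1 ≤ np) (w K : ℕ) : Fintype.card (SegAnc N np p w K) ≤
    4 * indexQubits N + 6 * w + 12 * np + 6 * K + 36 := by
  rw [Fintype.card_sum, Fintype.card_sum, card_anc, card_scratch, Fintype.card_bool]
  omega

theorem gates_segment_le (hp : p + 1 ≤ np) (σ w K : ℕ) (u τ : ℝ) :
    (segment hp σ w K u τ : Prog N np _).gates ≤ 3000 * ((K + 1) * (indexQubits N + np * (w + 1))) := by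
  have h1 := gates_seriesCircuit_le (N := N) hp σ w K
    (Real.sqrt ((1 + 2 * (scale p σ u * τ)) / 2)) (-(τ / 2 ^ w) * u)
  have h2 := gates_amplify_le (seriesCircuit (N := N) hp σ w K
    (Real.sqrt ((1 + 2 * (scale p σ u * τ)) / 2)) (-(τ / 2 ^ w) * u))
  have h3 := gates_diagCircuit_le N np p w K (-τ * u)
  rw [card_anc, card_scratch] at h2
  simp only [segment, Prog.gates_append]
  have hn : 1 ≤ np := by omega
  have hw : w ≤ np * w := Nat.le_mul_of_pos_left _ hn
  set X := indexQubits N + np * (w + 1) with hX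
  have hX' : X = indexQubits N + np * w + np := by rw [hX]; ring
  have hXK : X ≤ (K + 1) * X := Nat.le_mul_of_pos_left _ (by omega)
  have hK : K + 1 ≤ (K + 1) * X := Nat.le_mul_of_pos_right _ (by omega)
  -- Since np ≥ 1, constants are absorbed by np and w by np * w; the largest coefficient is 142 +
  -- 239 = 381.
  have h4 : (K + 1) * (97 * indexQubits N + 142 * np + 65 * w + 2 * (np * w) + 239) ≤
      381 * ((K + 1) * X) := by
    rw [mul_left_comm 381]
    exact Nat.mul_le_mul_left _ (by omega)
  omega

/-- Three runs of the series with 8 queries for each of K + 1 levels, and 2 for the diagonal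
evolution. -/
theorem queries_segment_le (hp : p + 1 ≤ np) (σ w K : ℕ) (u τ : ℝ) :
    (segment hp σ w K u τ : Prog N np _).queries ≤ 26 * (K + 1) := by
  have h1 := queries_seriesCircuit_le (N := N) hp σ w K
    (Real.sqrt ((1 + 2 * (scale p σ u * τ)) / 2)) (-(τ / 2 ^ w) * u)
  simp only [segment, Prog.queries_append, queries_amplify, queries_diagCircuit]
  omega

/-! ### Choice of the parameters -/

theorem one_le_logCut (y : ℝ) : 1 ≤ logCut y := by
  rw [logCut, Real.le_log_iff_exp_le (lt_max_of_lt_right (Real.exp_pos _))]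
  exact le_max_right _ _

theorem exp_one_le_log_max (y : ℝ) : Real.exp 1 ≤ Real.log (max y (Real.exp (Real.exp 1))) := by
  rw [Real.le_log_iff_exp_le (lt_max_of_lt_right (Real.exp_pos _))]
  exact le_max_right _ _

theorem one_le_log_log_max (y : ℝ) :
    1 ≤ Real.log (Real.log (max y (Real.exp (Real.exp 1)))) := by
  have h := exp_one_le_log_max y
  rwa [Real.le_log_iff_exp_le ((Real.exp_pos 1).trans_le h)]

theorem one_le_logRatio (y : ℝ) : 1 ≤ logRatio y := by
  have h1 := exp_one_le_log_max y
  have h2 := one_le_log_log_max y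
  rw [logRatio, one_le_div (by linarith)]
  have := Real.log_le_sub_one_of_pos ((Real.exp_pos 1).trans_le h1)
  linarith

/-- The control chain and flags need a number of qubits proportional to K. This inequality lets the
logarithm in the qubit bound pay for them; the 3 stands for e ≤ 3 at the cutoff. -/
theorem logRatio_le_logCut {y q : ℝ} (h : y ≤ q) : logRatio y ≤ 3 * logCut q := by
  have h1 := exp_one_le_log_max y
  have h2 := one_le_log_log_max y
  have h3 := one_le_logCut q
  have h4 : logRatio y ≤ Real.log (max y (Real.exp (Real.exp 1))) :=
    div_le_self (by linarith [Real.exp_pos 1]) h2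
  refine h4.trans ?_
  rcases le_total y (Real.exp (Real.exp 1)) with hy | hy
  · rw [max_eq_right hy, Real.log_exp]
    linarith [Real.exp_one_lt_d9]
  · rw [max_eq_left hy]
    have h5 : Real.log y ≤ logCut q :=
      Real.log_le_log ((Real.exp_pos _).trans_le hy) (h.trans (le_max_left _ _))
    linarith

/-- Taking m = K + 1 of size 10 L / log L with L the cut-off logarithm of y, and m! ≥ (m/e)^m, the
factorial exceeds e^{5L}. Here e^{2L} covers y², and e^{3L} covers the constant because L ≥ e. -/
theorem exists_order (y : ℝ) (hy : 0 ≤ y) :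
    ∃ K : ℕ, 1 ≤ K ∧ 1440 * y ^ 2 ≤ ((K + 1).factorial : ℝ) ∧ (K + 1 : ℝ) ≤ 11 * logRatio y := by
  have h1 := exp_one_le_log_max y
  have h2 := one_le_log_log_max y
  have h3 := one_le_logRatio y
  set Y := max y (Real.exp (Real.exp 1)) with hY
  have hY0 : 0 < Y := lt_max_of_lt_right (Real.exp_pos _)
  set L := Real.log Y with hL
  have hL0 : 0 < L := (Real.exp_pos 1).trans_le h1
  have hΛ : logRatio y = L / Real.log L := rfl
  obtain ⟨m, hm1, hm2⟩ : ∃ m : ℕ, 10 * logRatio y ≤ m ∧ (m : ℝ) ≤ 11 * logRatio y :=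
    ⟨⌈10 * logRatio y⌉₊, Nat.le_ceil _, by
      have := Nat.ceil_lt_add_one (a := 10 * logRatio y) (by linarith)
      linarith⟩
  have hm0 : (10 : ℝ) ≤ m := by linarith
  have hm : 10 ≤ m := by exact_mod_cast hm0
  obtain ⟨K, rfl⟩ : ∃ K, m = K + 1 := ⟨m - 1, by omega⟩
  refine ⟨K, by omega, ?_, by exact_mod_cast hm2⟩
  set m : ℝ := ((K + 1 : ℕ) : ℝ) with hmdef
  -- Of log L - log log L at least half of log L remains, and log 10 supplies the 1 that offsets the
  -- e in (m/e)^m.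
  have hlogm : 1 + Real.log L / 2 ≤ Real.log m := by
    have e1 : Real.log (10 * logRatio y) ≤ Real.log m := Real.log_le_log (by linarith) hm1
    have e2 : Real.log (10 * logRatio y) = Real.log 10 + (Real.log L - Real.log (Real.log L)) := by
      rw [Real.log_mul (by norm_num) (by linarith), hΛ, Real.log_div hL0.ne' (by linarith)]
    have e3 : Real.log (Real.log L) ≤ Real.log L / 2 := by
      have := Real.log_le_sub_one_of_pos (show 0 < Real.log L / 2 by linarith)
      rw [Real.log_div (by linarith) (by norm_num)] at this
      linarith [Real.log_two_lt_d9]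
    have e4 : 1 ≤ Real.log 10 := by
      rw [Real.le_log_iff_exp_le (by norm_num)]
      linarith [Real.exp_one_lt_d9]
    linarith
  have hexp : 5 * L ≤ m * Real.log m - m := by
    have e1 : 10 * L ≤ m * Real.log L := by
      rw [hΛ] at hm1
      have := mul_le_mul_of_nonneg_right hm1 (show 0 ≤ Real.log L by linarith)
      rwa [mul_assoc, div_mul_cancel₀ _ (by linarith)] at this
    nlinarith
  have hfac := Real.pow_div_factorial_le_exp (x := m) (by linarith) (K + 1)
  rw [div_le_iff₀ (by positivity)] at hfac
  have hpow : m ^ (K + 1) = Real.exp (m * Real.log m) := by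
    rw [← Real.rpow_natCast, Real.rpow_def_of_pos (by linarith), mul_comm]
  rw [hpow] at hfac
  have hfac2 : Real.exp (m * Real.log m - m) ≤ (K + 1).factorial := by
    rw [Real.exp_sub, div_le_iff₀ (Real.exp_pos _)]
    linarith
  refine le_trans ?_ ((Real.exp_le_exp.2 hexp).trans hfac2)
  have e5 : Real.exp (5 * L) = Y ^ 2 * Real.exp (3 * L) := by
    have : Y = Real.exp L := (Real.exp_log hY0).symm
    rw [this, ← Real.exp_nat_mul, ← Real.exp_add]
    congr 1
    push_cast
    ring
  have e6 : 1440 ≤ Real.exp (3 * L) := by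
    have : (2 : ℝ) ^ 11 ≤ Real.exp (3 * L) := by
      rw [← Real.exp_log (show (0 : ℝ) < 2 ^ 11 by norm_num), Real.log_pow]
      refine Real.exp_le_exp.2 ?_
      push_cast
      linarith [Real.log_two_lt_d9, Real.exp_one_gt_d9]
    linarith
  have e7 : y ^ 2 ≤ Y ^ 2 := pow_le_pow_left₀ hy (le_max_left _ _) 2
  rw [e5]
  nlinarith [sq_nonneg Y]

theorem exists_timeBits (q : ℝ) (hq : 0 ≤ q) :
    ∃ w : ℕ, 5760 * q ^ 2 ≤ 2 ^ w ∧ (w : ℝ) ≤ 17 * logCut q := by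
  set Q := max q (Real.exp 1) with hQ
  have hQ0 : 0 < Q := lt_max_of_lt_right (Real.exp_pos _)
  have hQ1 : 1 ≤ Q := by
    have := le_max_right q (Real.exp 1)
    linarith [Real.exp_one_gt_d9]
  have hl : logCut q = Real.log Q := rfl
  have h1 := one_le_logCut q
  -- 2^13 exceeds 5760 and 3 log 2 exceeds 2, which gives q²; the upper bound uses 13 + 1 ≤ 14 *
  -- logCut q.
  obtain ⟨w, hw1, hw2⟩ : ∃ w : ℕ, 13 + 3 * logCut q ≤ w ∧ (w : ℝ) ≤ 17 * logCut q :=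
    ⟨⌈13 + 3 * logCut q⌉₊, Nat.le_ceil _, by
      have := Nat.ceil_lt_add_one (a := 13 + 3 * logCut q) (by linarith)
      linarith⟩
  refine ⟨w, ?_, hw2⟩
  have e1 : (2 : ℝ) ^ w = Real.exp (w * Real.log 2) := by
    rw [Real.exp_nat_mul, Real.exp_log (by norm_num)]
  have e2 : 13 * Real.log 2 + 2 * Real.log Q ≤ w * Real.log 2 := by
    have := mul_le_mul_of_nonneg_right hw1 (Real.log_nonneg (by norm_num : (1 : ℝ) ≤ 2))
    rw [hl] at *
    nlinarith [Real.log_two_gt_d9]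
  have e3 : Real.exp (13 * Real.log 2 + 2 * Real.log Q) = 2 ^ 13 * Q ^ 2 := by
    rw [Real.exp_add]
    congr 1
    · rw [show (13 : ℝ) = ((13 : ℕ) : ℝ) by norm_num, Real.exp_nat_mul, Real.exp_log (by norm_num)]
    · rw [show (2 : ℝ) = ((2 : ℕ) : ℝ) by norm_num, Real.exp_nat_mul, Real.exp_log hQ0]
  have e4 : q ^ 2 ≤ Q ^ 2 := pow_le_pow_left₀ hq (le_max_left _ _) 2
  rw [e1]
  refine le_trans ?_ (Real.exp_le_exp.2 e2)
  rw [e3]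
  nlinarith [sq_nonneg Q]

/-- For N ≥ 2 the rounding up costs at most one more log N / log 2, and 2 / log 2 < 3. For N ≤ 1
both sides are 0. -/
theorem indexQubits_le_log (N : ℕ) : (indexQubits N : ℝ) ≤ 3 * Real.log N := by
  rcases Nat.lt_or_ge 1 N with h | h
  · have h1 := Nat.pow_pred_clog_lt_self (by norm_num : 1 < 2) h
    have h2 : 0 < indexQubits N := Nat.clog_pos (by norm_num) h
    have h3 : ((indexQubits N - 1 : ℕ) : ℝ) * Real.log 2 ≤ Real.log N := by
      rw [← Real.log_pow]
      refine Real.log_le_log (by positivity) ?_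
      exact_mod_cast h1.le
    have h4 : Real.log 2 ≤ Real.log N := Real.log_le_log (by norm_num) (by exact_mod_cast h)
    rw [Nat.cast_sub h2] at h3
    push_cast at h3
    have h5 : (0 : ℝ) ≤ indexQubits N := Nat.cast_nonneg _
    nlinarith [Real.log_two_gt_d9]
  · interval_cases N <;> simp [indexQubits]

/-! ### The simulation circuits -/

theorem empty_block {N np m : ℕ} (D : SparseData N np) :
    Circuit.block ([] : Circuit N np m) D = 1 := by
  ext x y
  rw [Circuit.block, Matrix.of_apply, Circuit.eval, List.foldl_nil, Matrix.one_apply, Matrix.one_apply]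
  by_cases h : x = y
  · subst h; simp
  · rw [if_neg h, if_neg fun h' => h (indexState_injective (funext fun i => congrFun h' (.inl i)))]

/-- `V` satisfies the error bound for all encoded matrices with the given parameters. -/
def Simulates {N np m : ℕ} (V : Circuit N np m) (d : ℕ) (u a b t ε : ℝ) : Prop :=
  ∀ (A B : Matrix (Fin N) (Fin N) ℂ) (D : SparseData N np), A.IsDiag → (∀ k, B k k = 0) →
    (A + B).IsHermitian → D.Encodes u d (A + B) → ‖A‖ ≤ a → maxNorm B ≤ b →
    ‖V.block D - NormedSpace.exp ((-(Complex.I * (t : ℂ))) • (A + B))‖ ≤ ε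

variable {N np d : ℕ} {u a b t ε : ℝ}

theorem simulates_nil_of_two_le (hε : 2 ≤ ε) :
    Simulates ([] : Circuit N np 0) d u a b t ε := by
  intro A B D _ _ hH _ _ _
  rw [empty_block]
  refine (norm_sub_le _ _).trans ?_
  have h1 := norm_one_matrix_le (n := Fin N)
  have h2 := norm_exp_le_one (conjTranspose_I_smul hH t)
  linarith

/-- Without value bits every entry decodes to 0, so the evolution is trivial. -/
theorem simulates_nil_of_noBits (hε : 0 ≤ ε) :
    Simulates ([] : Circuit N 0 0) d u a b t ε := by
  intro A B D _ _ _ hD _ _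
  have h : A + B = 0 := by
    ext x y
    rw [← hD.1, decode]
    simp
  rw [empty_block, h, smul_zero, NormedSpace.exp_zero, sub_self, norm_zero]
  exact hε

theorem simulates_diag (hu : 0 < u) (hb : 0 ≤ b) (hε : 0 ≤ ε) (h : d = 0 ∨ b < u) :
    Simulates (toCircuit (diagCircuit N np 0 0 0 (-t * u))) d u a b t ε := by
  intro A B D hA _ hH hD _ hB
  rw [diag_simulation hH hD ?_ t, sub_self, norm_zero]
  · exact hε
  · rcases h with rfl | h
    · exact offPart_eq_zero_of_sparsity hD
    · exact offPart_eq_zero_of_lt hA hD hB hu hb h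

/-- The number of segments. -/
def segmentCount (N np d : ℕ) (u b t : ℝ) : ℕ :=
  ⌈2 * (scale (magnitudeBits np u b) (positionBits N d) u * t)⌉₊ + 1

/-- The simulation circuit. -/
def simulation (hnp : 0 < np) (N d w K : ℕ) (u b t : ℝ) :
    Circuit N np (Fintype.card (SegAnc N np (magnitudeBits np u b) w K)) :=
  toCircuit (List.replicate (segmentCount N np d u b t)
    (segment (magnitudeBits_succ_le hnp u b) (positionBits N d) w K u
      (t / segmentCount N np d u b t))).flatten

/-- The two error terms of a segment are each bounded by ε²/(20 r²). Both are at least quadratic in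
1/r, so r cancels and the conditions on K and w depend only on α_B t/ε and (a + α_B) t/ε. -/
theorem simulates_simulation (hnp : 0 < np) (hd : 0 < d) (hu : 0 < u) (hub : u ≤ b) (ha : 0 ≤ a)
    (ht : 0 ≤ t) (hε : 0 < ε) (hε2 : ε ≤ 2) {w K : ℕ} (hK : 1 ≤ K)
    (hK2 : 1440 * (d * b * t / ε) ^ 2 ≤ ((K + 1).factorial : ℝ))
    (hw : 5760 * (t / ε * (a + d * b)) ^ 2 ≤ 2 ^ w) :
    Simulates (simulation hnp N d w K u b t) d u a b t ε := by
  intro A B D hA hB0 hH hD hAn hB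
  have hb : 0 < b := hu.trans_le hub
  set p := magnitudeBits np u b with hp
  set σ := positionBits N d with hσ
  have hβ := scale_pos hu p σ
  have hβ6 : scale p σ u ≤ 6 * (d * b) := scale_le hu hub hd
  set β := scale p σ u with hβdef
  set r := segmentCount N np d u b t with hr
  have hr1 : (1 : ℝ) ≤ r := by
    rw [hr, segmentCount]; push_cast; linarith [Nat.cast_nonneg (α := ℝ) ⌈2 * (β * t)⌉₊]
  have hr2 : 2 * (β * t) ≤ r := by
    rw [hr, segmentCount]; push_cast; linarith [Nat.le_ceil (2 * (β * t))]
  have hr0 : (0 : ℝ) < r := by linarith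
  have hM : (1 : ℝ) ≤ 2 ^ w := one_le_pow₀ (by norm_num)
  set q := t / ε * (a + d * b) with hq
  have hdb : 0 < d * b := by positivity
  have hq0 : 0 ≤ q := by positivity
  have hqt : q * ε = t * (a + d * b) := by rw [hq]; field_simp
  have hta : t * (a + β) ≤ 6 * (q * ε) := by
    rw [hqt]
    nlinarith [mul_nonneg ht ha, mul_le_mul_of_nonneg_left hβ6 ht]
  have hta0 : 0 ≤ t * (a + β) := by positivity
  set y := d * b * t / ε with hy
  have hyt : y * ε = d * b * t := by rw [hy]; field_simp
  have hy0 : 0 ≤ y := by positivity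
  have htb : β * t ≤ 6 * (y * ε) := by
    rw [hyt]
    nlinarith [mul_le_mul_of_nonneg_right hβ6 ht]
  have e1 : t / r * β = β * t / r := by ring
  have e2 : t / r * (a + β) = t * (a + β) / r := by ring
  refine simulation_error (magnitudeBits_succ_le hnp u b) hu (positionBits_le N d)
    (fits hA hH hD hB hu hb.le) hH hD ht (norm_diagMat_le ha hA hB0 hD hAn) hε.le K
    (Nat.succ_pos _) ?_ ?_ ?_
  · rw [← hr, ← hβdef, e1, div_le_iff₀ hr0]
    linarith
  · rw [← hr, ← hβdef, e2]
    refine (div_le_self hta0 hr1).trans ?_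
    have h1 : q * ε ≤ q * 2 := mul_le_mul_of_nonneg_left hε2 hq0
    -- It remains to bound 12q by 2^w; this follows from 5760 q² ≤ 2^w for large q and from 1 ≤ 2^w
    -- for small q.
    nlinarith [sq_nonneg (q - 1 / 12)]
  · rw [← hr, ← hβdef, e1, e2]
    have hx : β * t / r ≤ 1 := by
      rw [div_le_one hr0]
      nlinarith [mul_nonneg hβ.le ht]
    have hx0 : 0 ≤ β * t / r := by positivity
    have hf : (0 : ℝ) < (K + 1).factorial := by positivity
    -- Only two of the K + 1 powers are used, to produce the factor 1/r²; the smallness comes from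
    -- the factorial. This needs K ≥ 1.
    have b1 : (β * t / r) ^ (K + 1) ≤ (β * t / r) ^ 2 :=
      pow_le_pow_of_le_one hx0 hx (by omega)
    have b2 : (β * t) ^ 2 ≤ (6 * (y * ε)) ^ 2 := pow_le_pow_left₀ (by positivity) htb 2
    have b3 : (t * (a + β)) ^ 2 ≤ (6 * (q * ε)) ^ 2 := pow_le_pow_left₀ hta0 hta 2
    -- The constant is 1440 = 2 · 6² · 20, and below 5760 = 8 · 6² · 20, where 6 comes from
    -- `scale_le`.
    have c1 : 2 * ((β * t / r) ^ (K + 1) / (K + 1).factorial) ≤ ε ^ 2 / (20 * r ^ 2) := by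
      have h1 : (β * t / r) ^ (K + 1) / (K + 1).factorial ≤
          ((6 * (y * ε)) ^ 2 / r ^ 2) / (K + 1).factorial := by
        refine div_le_div_of_nonneg_right (b1.trans ?_) hf.le
        rw [div_pow]
        exact div_le_div_of_nonneg_right b2 (by positivity)
      refine (mul_le_mul_of_nonneg_left h1 (by norm_num)).trans ?_
      rw [div_div, ← mul_div_assoc, div_le_div_iff₀ (by positivity) (by positivity)]
      calc _ = ε ^ 2 * r ^ 2 * (1440 * y ^ 2) := by ring
        _ ≤ ε ^ 2 * r ^ 2 * (K + 1).factorial := mul_le_mul_of_nonneg_left hK2 (by positivity)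
        _ = _ := by ring
    have c2 : 8 * ((t * (a + β) / r) ^ 2 / 2 ^ w) ≤ ε ^ 2 / (20 * r ^ 2) := by
      have h1 : (t * (a + β) / r) ^ 2 / 2 ^ w ≤ ((6 * (q * ε)) ^ 2 / r ^ 2) / 2 ^ w := by
        rw [div_pow]
        exact div_le_div_of_nonneg_right (div_le_div_of_nonneg_right b3 (by positivity))
          (by positivity)
      refine (mul_le_mul_of_nonneg_left h1 (by norm_num)).trans ?_
      rw [div_div, ← mul_div_assoc, div_le_div_iff₀ (by positivity) (by positivity)]
      calc _ = ε ^ 2 * r ^ 2 * (5760 * q ^ 2) := by ring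
        _ ≤ ε ^ 2 * r ^ 2 * 2 ^ w := mul_le_mul_of_nonneg_left hw (by positivity)
        _ = _ := by ring
    have c3 : ε ^ 2 / (20 * (r : ℝ) ^ 2) + ε ^ 2 / (20 * r ^ 2) = ε ^ 2 / (10 * r ^ 2) := by
      field_simp
      norm_num
    linarith

/-- 14 = 2 · 6 + 2, the last 2 for the ceiling and for the extra segment that keeps the count
positive. -/
theorem segmentCount_le (hd : 0 < d) (hu : 0 < u) (hub : u ≤ b) (ht : 0 ≤ t) :
    (segmentCount N np d u b t : ℝ) ≤ 14 * max 1 (d * b * t) := by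
  have h1 : scale (magnitudeBits np u b) (positionBits N d) u ≤ 6 * (d * b) := scale_le hu hub hd
  have h0 := scale_pos hu (magnitudeBits np u b) (positionBits N d)
  have h2 := Nat.ceil_lt_add_one (a := 2 * (scale (magnitudeBits np u b) (positionBits N d) u * t))
    (by positivity)
  have h3 := mul_le_mul_of_nonneg_right h1 ht
  have h4 := le_max_left 1 (d * b * t)
  have h5 := le_max_right 1 (d * b * t)
  rw [segmentCount]
  push_cast
  nlinarith

theorem gateCount_toCircuit {A : Type} [Fintype A] [DecidableEq A]
    (V : Prog N np (Fin (indexQubits N) ⊕ A)) : (toCircuit V).gateCount = V.gates :=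
  Prog.gates_map _ V

theorem queryCount_toCircuit {A : Type} [Fintype A] [DecidableEq A]
    (V : Prog N np (Fin (indexQubits N) ⊕ A)) : (toCircuit V).queryCount = V.queries :=
  Prog.queries_map _ V

/-- The resource bounds, with constant `C`. -/
def Affordable {N np m : ℕ} (V : Circuit N np m) (C : ℝ) (d : ℕ) (a b t ε : ℝ) : Prop :=
  (V.queryCount : ℝ) ≤ C * max 1 (d * b * t) * logRatio (d * b * t / ε) ∧
  (V.qubitCount : ℝ) ≤ C * (np + Real.log N + logCut (t / ε * (a + d * b))) ∧
  (V.gateCount : ℝ) ≤ C * max 1 (d * b * t) *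
    (Real.log N + (np : ℝ) ^ 1 * logCut (t / ε * (a + d * b))) * logRatio (d * b * t / ε)

theorem affordable_nil : Affordable ([] : Circuit N np 0) 10000000 d a b t ε := by
  have h1 := one_le_logRatio (d * b * t / ε)
  have h2 := one_le_logCut (t / ε * (a + d * b))
  have h3 := indexQubits_le_log N
  have h4 : 0 ≤ Real.log N := Real.log_natCast_nonneg N
  have h5 := le_max_left 1 (d * b * t)
  refine ⟨?_, ?_, ?_⟩
  · simp only [Circuit.queryCount, List.countP_nil, Nat.cast_zero]
    positivity
  · simp only [Circuit.qubitCount, add_zero]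
    have : (0 : ℝ) ≤ np := Nat.cast_nonneg _
    nlinarith
  · simp only [Circuit.gateCount, List.countP_nil, Nat.cast_zero]
    positivity

theorem affordable_diag (hnp : 0 < np) (θ : ℝ) :
    Affordable (toCircuit (diagCircuit N np 0 0 0 θ)) 10000000 d a b t ε := by
  have h1 := one_le_logRatio (d * b * t / ε)
  have h2 := one_le_logCut (t / ε * (a + d * b))
  have h3 := indexQubits_le_log N
  have h4 : 0 ≤ Real.log N := Real.log_natCast_nonneg N
  have h5 := le_max_left 1 (d * b * t)
  have hnp1 : (1 : ℝ) ≤ np := by exact_mod_cast hnp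
  set Λ := logRatio (d * b * t / ε)
  set ℓ := logCut (t / ε * (a + d * b))
  set μ := max 1 (d * b * t)
  have hμΛ : 1 ≤ μ * Λ := by nlinarith
  refine ⟨?_, ?_, ?_⟩
  · rw [queryCount_toCircuit, queries_diagCircuit]
    push_cast
    nlinarith
  · have h6 := card_segAnc_le (N := N) (p := 0) hnp 0 0
    have h7 : (Fintype.card (SegAnc N np 0 0 0) : ℝ) ≤ 4 * indexQubits N + 12 * np + 36 := by
      exact_mod_cast h6
    simp only [Circuit.qubitCount]
    push_cast
    nlinarith
  · have h6 := gates_diagCircuit_le N np 0 0 0 θ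
    have h7 : ((diagCircuit N np 0 0 0 θ).gates : ℝ) ≤ 2 * indexQubits N + np := by exact_mod_cast h6
    rw [gateCount_toCircuit, pow_one]
    have h8 : (np : ℝ) ≤ np * ℓ := le_mul_of_one_le_right (by linarith) h2
    have h9 : Real.log N + np * ℓ ≤ μ * Λ * (Real.log N + np * ℓ) :=
      le_mul_of_one_le_left (by linarith) hμΛ
    calc ((diagCircuit N np 0 0 0 θ).gates : ℝ) ≤ 10000000 * (Real.log N + np * ℓ) := by linarith
      _ ≤ 10000000 * (μ * Λ * (Real.log N + np * ℓ)) := by linarith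
      _ = _ := by ring

theorem qubitCount_simulation_le (hnp : 0 < np) (N d w K : ℕ) (u b t : ℝ) :
    (simulation hnp N d w K u b t).qubitCount ≤
      5 * indexQubits N + 6 * w + 12 * np + 6 * K + 36 := by
  refine (Nat.add_le_add_left (card_segAnc_le (N := N) (magnitudeBits_succ_le hnp u b) w K)
    (indexQubits N)).trans ?_
  omega

theorem affordable_simulation (hnp : 0 < np) (hd : 0 < d) (hu : 0 < u) (hub : u ≤ b) (ha : 0 ≤ a)
    (ht : 0 ≤ t) (hε : 0 < ε) {w K : ℕ}
    (hK : (K + 1 : ℝ) ≤ 11 * logRatio (d * b * t / ε))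
    (hw : (w : ℝ) ≤ 17 * logCut (t / ε * (a + d * b))) :
    Affordable (simulation hnp N d w K u b t) 10000000 d a b t ε := by
  have h1 := one_le_logRatio (d * b * t / ε)
  have h2 := one_le_logCut (t / ε * (a + d * b))
  have h3 := indexQubits_le_log N
  have h4 : 0 ≤ Real.log N := Real.log_natCast_nonneg N
  have h5 := le_max_left 1 (d * b * t)
  have hnp1 : (1 : ℝ) ≤ np := by exact_mod_cast hnp
  have hr := segmentCount_le (N := N) (np := np) hd hu hub ht
  have hΛℓ : logRatio (d * b * t / ε) ≤ 3 * logCut (t / ε * (a + d * b)) := by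
    refine logRatio_le_logCut ?_
    have hb : 0 < b := hu.trans_le hub
    rw [mul_div_assoc, mul_comm (d * b : ℝ)]
    exact mul_le_mul_of_nonneg_left (by linarith) (by positivity)
  set Λ := logRatio (d * b * t / ε)
  set ℓ := logCut (t / ε * (a + d * b))
  set μ := max 1 (d * b * t)
  set r := segmentCount N np d u b t with hrdef
  -- Segments times levels is the common factor of query and gate counts. The overall constant is
  -- dominated by the gates: 3000 · 14 · 11 · 18 = 8316000.
  have hrK : (r : ℝ) * (K + 1) ≤ 14 * μ * (11 * Λ) :=
    mul_le_mul hr hK (by positivity) (by positivity)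
  refine ⟨?_, ?_, ?_⟩
  · rw [simulation, queryCount_toCircuit, Prog.queries_replicate]
    have h6 := Nat.mul_le_mul_left r (queries_segment_le (N := N) (magnitudeBits_succ_le hnp u b)
      (positionBits N d) w K u (t / r))
    refine (Nat.cast_le (α := ℝ).2 h6).trans ?_
    push_cast
    calc (r : ℝ) * (26 * (K + 1)) = 26 * (r * (K + 1)) := by ring
      _ ≤ 26 * (14 * μ * (11 * Λ)) := by gcongr
      _ = 4004 * (μ * Λ) := by ring
      _ ≤ 10000000 * (μ * Λ) := mul_le_mul_of_nonneg_right (by norm_num) (by positivity)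
      _ = _ := by ring
  · have h6 := qubitCount_simulation_le hnp N d w K u b t
    have h7 := Nat.cast_le (α := ℝ).2 h6
    push_cast at h7
    refine h7.trans ?_
    clear h6 h7
    linarith
  · rw [simulation, gateCount_toCircuit, Prog.gates_replicate, pow_one]
    have h6 := Nat.mul_le_mul_left r (gates_segment_le (N := N) (magnitudeBits_succ_le hnp u b)
      (positionBits N d) w K u (t / r))
    refine (Nat.cast_le (α := ℝ).2 h6).trans ?_
    push_cast
    have h8 : (np : ℝ) * (w + 1) ≤ np * (18 * ℓ) :=
      mul_le_mul_of_nonneg_left (by linarith) (by linarith)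
    have h9 : 0 ≤ (np : ℝ) * ℓ := by positivity
    have h10 : (indexQubits N : ℝ) + np * (w + 1) ≤ 18 * (Real.log N + np * ℓ) := by linarith
    calc (r : ℝ) * (3000 * ((K + 1) * (indexQubits N + np * (w + 1)))) =
          3000 * ((r * (K + 1)) * (indexQubits N + np * (w + 1))) := by ring
      _ ≤ 3000 * ((14 * μ * (11 * Λ)) * (18 * (Real.log N + np * ℓ))) := by gcongr
      _ = 8316000 * (μ * (Real.log N + np * ℓ) * Λ) := by ring
      _ ≤ 10000000 * (μ * (Real.log N + np * ℓ) * Λ) := by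
        refine mul_le_mul_of_nonneg_right (by norm_num) ?_
        positivity
      _ = _ := by ring

/-- The case distinction uses the given parameters only, so the circuit stays independent of the
oracles. In the generic case ε < 2, at least one value bit, d > 0 and u ≤ b are available, as the
normalization and the error bounds require. -/
theorem exists_circuit (N d np : ℕ) (u a b t ε : ℝ) (hu : 0 < u) (ha : 0 ≤ a) (hb : 0 ≤ b)
    (ht : 0 ≤ t) (hε : 0 < ε) : ∃ (m : ℕ) (V : Circuit N np m),
      Affordable V 10000000 d a b t ε ∧ Simulates V d u a b t ε := by
  rcases le_or_gt 2 ε with h2 | h2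
  · exact ⟨0, [], affordable_nil, simulates_nil_of_two_le h2⟩
  rcases Nat.eq_zero_or_pos np with rfl | hnp
  · exact ⟨0, [], affordable_nil, simulates_nil_of_noBits hε.le⟩
  by_cases hB : d = 0 ∨ b < u
  · exact ⟨_, _, affordable_diag hnp _, simulates_diag hu hb hε.le hB⟩
  push Not at hB
  obtain ⟨hd, hub⟩ := hB
  have hd := Nat.pos_of_ne_zero hd
  obtain ⟨K, hK, hK2, hK3⟩ := exists_order (d * b * t / ε) (by positivity)
  obtain ⟨w, hw, hw2⟩ := exists_timeBits (t / ε * (a + d * b)) (by positivity)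
  exact ⟨_, _, affordable_simulation hnp hd hu hub ha ht hε hK3 hw2,
    simulates_simulation hnp hd hu hub ha ht hε h2.le hK hK2 hw⟩

end SparseSim

end

theorem mainTheorem7 :
    ∃ (C : ℝ) (c : ℕ), 0 < C ∧
      ∀ (N d np : ℕ) (u a b t ε : ℝ), 0 < u → 0 ≤ a → 0 ≤ b → 0 ≤ t → 0 < ε →
        ∃ (m : ℕ) (V : SparseSim.Circuit N np m),
          (V.queryCount : ℝ) ≤ C * max 1 (d * b * t) * SparseSim.logRatio (d * b * t / ε) ∧
          (V.qubitCount : ℝ) ≤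
            C * (np + Real.log N + SparseSim.logCut (t / ε * (a + d * b))) ∧
          (V.gateCount : ℝ) ≤
            C * max 1 (d * b * t) *
              (Real.log N + (np : ℝ) ^ c * SparseSim.logCut (t / ε * (a + d * b))) *
              SparseSim.logRatio (d * b * t / ε) ∧
          ∀ (A B : Matrix (Fin N) (Fin N) ℂ) (D : SparseSim.SparseData N np),
            A.IsDiag → (∀ k, B k k = 0) → (A + B).IsHermitian →
            SparseSim.IsSparse d (A + B) → D.Encodes u d (A + B) →
            ‖A‖ ≤ a → SparseSim.maxNorm B ≤ b →
              ‖V.block D - NormedSpace.exp ((-(Complex.I * (t : ℂ))) • (A + B))‖ ≤ ε := by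
  -- The exponent 1 suffices because comparisons and phases are linear in the number of value bits
  -- and no arithmetic on entries is performed.
  refine ⟨10000000, 1, by norm_num, fun N d np u a b t ε hu ha hb ht hε => ?_⟩
  obtain ⟨m, V, ⟨h1, h2, h3⟩, hV⟩ := SparseSim.exists_circuit N d np u a b t ε hu ha hb ht hε
  exact ⟨m, V, h1, h2, h3, fun A B D hA hB hH _ hD hAn hBn => hV A B D hA hB hH hD hAn hBn⟩
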